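/- **Setting.** Let $\mathcal G$ be a finite-dimensional semisimple ribbon Hopf-$*$-algebra over $\mathbb C$, with coproduct $\Delta$, counit $\epsilon$, antipode $\mathcal S$, universal $R$-matrix $R=\sum r^1_\sigma\otimes r^2_\sigma$, $R'=\sum r^2_\sigma\otimes r^1_\sigma$, and central ribbon element $v$: $v^2=u\mathcal S(u)$ for $u=\sum\mathcal S(r^2_\sigma)r^1_\sigma$, $\mathcal S(v)=v$, $\epsilon(v)=1$, $v^*=v^{-1}$, $\Delta(v)=(R'R)^{-1}(v\otimes v)$. The coproduct is compatible with $(\xi\otimes\eta)^*=\eta^*\otimes\xi^*$. Let $\tau^I$ ($I$ in a finite set of labels, $0$ the label of $\epsilon$) be $*$-representations on finite-dimensional Hilbert spaces $V^I$ which represent all classes of irreducible representations, each once. Let $C^a[IJ|K]:V^I\otimes V^J\to V^K$ be bases of the spaces of intertwiners and $\kappa_I$ complex numbers with $\tau^I(v)=\kappa_I^2$ and $C^a[IJ|K](R')^{IJ}C^b[IJ|L]^*=\delta_{ab}\delta_{KL}\kappa_I\kappa_J/\kappa_K$, where $X^{IJ}=(\tau^I\otimes\tau^J)(X)$, and let $\kappa\in\mathcal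 G$ be the element with $\tau^I(\kappa)=\kappa_I$. With $g=u^{-1}v$ and $\mathrm{tr}_q^I(X)=\mathrm{tr}(X\tau^I(g))$, assume that all quantum dimensions $d_I=\mathrm{tr}_q^I(\mathrm{id})$ are strictly positive and that the matrix $(\mathrm{tr}_q^I\otimes\mathrm{tr}_q^J)(R'R)$ is invertible. For $g,m\ge 0$ the *graph algebra* $\mathcal L_{g,m}$ is the unital associative algebra generated by the matrix elements of $M^I_\nu,A^I_i,B^I_i\in\mathrm{End}(V^I)\otimes\mathcal L_{g,m}$ ($1\le\nu\le m$, $1\le i\le g$) with the following relations, where $X_1,X_2$ are the embeddings of $X$ in the two factors of $\mathrm{End}(V^I)\otimes\mathrm{End}(V^J)$. For each holonomy $X\in\{M_\nu,A_i,B_i\}$: $X^0=1$ and $X^I_1R^{IJ}X^J_2=\sum_{K,a}C^a[IJ|K]^*X^KC^a[IJ|K]$. For each $i$: $(R^{-1})^{IJ}A^I_{i,1}R^{IJ}B^J_{i,2}=B^J_{i,2}(R')^{IJ}A^I_{i,1}R^{IJ}$. Finally $(R^{-1})^{IJ}X^I_1R^{IJ}Y^J_2=Y^J_2(R^{-1})^{IJ}X^I_1R^{IJ}$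 whenever $(X,Y)$ is $(M_\nu,M_\mu)$ with $\nu<\mu$, or $X=M_\nu$ and $Y\in\{A_j,B_j\}$, or $X\in\{A_i,B_i\}$ and $Y\in\{A_j,B_j\}$ with $i<j$. The *semi-direct product* $\mathcal S_{g,m}=\mathcal L_{g,m}\rtimes\mathcal G$ is generated by $\mathcal L_{g,m}$ and $\mathcal G$ with the relations $\mu^J(\xi)X^J=X^J\mu^J(\xi)$, $\mu^J(\xi)=(\tau^J\otimes\mathrm{id})\Delta(\xi)$. Its $*$-operation extends that of $\mathcal G$ by $(X^I)^*=\kappa^{-1}R^I(X^I)^{-1}(R^{-1})^I\kappa$, where $R^I=(\tau^I\otimes\mathrm{id})(R)$, $(R^{-1})^I=(\tau^I\otimes\mathrm{id})(R^{-1})$. Let $\Re=\bigoplus_I\mathrm{End}(V^I)$, and let $\pi$ be a representation of $\mathcal S_{1,0}$ on $\Re$ with a vector $|0\rangle$ that is cyclic for $\mathcal L_{1,0}$ and satisfies $\pi(B^I)|0\rangle=\kappa_I^{-1}|0\rangle$, $\pi(\xi)|0\rangle=\epsilon(\xi)|0\rangle$. On $\Re$ consider the form determined by $\langle\pi(A^I_{ab})|0\rangle,\pi(A^J_{cd})|0\rangle\rangle=\omega((M^I_{ab})^*M^J_{cd})$,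 where $\omega$ is the functional on $\mathcal S_{0,1}$ with $\omega(M^I_{ab}\xi)=\delta_{I,0}\,\epsilon(\xi)$. For labels $I_1,\dots,I_m$ let $\Im_g(I_1,\dots,I_m)=V^{I_1}\otimes\dots\otimes V^{I_m}\otimes\Re^{\otimes g}$. Let $\imath_\nu$ (resp. $\jmath_i$) be the action of $\mathcal G$, through the iterated coproduct, on the tensor factors which precede $V^{I_\nu}$ (resp. the $i$-th copy of $\Re$), and the identity on the other factors; it is $\epsilon$ if there is no preceding factor. Let $\jmath$ be the action of $\mathcal G$ on the whole tensor product. Let $D^{I}(M^J)=\kappa_J^{-1}(R'R)^{JI}$, and let $D^{I_\nu}_\nu$, $\pi_i$ denote $D^{I_\nu}$, $\pi$ acting on $V^{I_\nu}$, respectively on the $i$-th copy of $\Re$. Equip $\Im_g(I_1,\dots,I_m)$ with the form $\langle\cdot,\cdot\rangle$ obtained by adjoining the factors one after the other by the rule $\langle v,w\rangle=(v,(\rho\otimes\rho')(R\eta)w)$, $\eta=\Delta(\kappa)(\kappa^{-1}\otimes\kappa^{-1})$, where $(\cdot,\cdot)$ is the product of the forms on the two factors and $\rho,\rho'$ are the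 actions of $\mathcal G$ on them. **Theorem.** The $*$-operation on every $\mathcal S_{g,m}$ and the functional $\omega$ exist and are unique, a pair $(\pi,|0\rangle)$ exists, and for every such pair the form on $\Re$ exists, is unique and is positive definite. For all $g,m\ge0$ and all labels $I_1,\dots,I_m$, a representation $\Lambda_g^{I_1,\dots,I_m}$ of $\mathcal L_{g,m}$ on $\Im_g(I_1,\dots,I_m)$ is defined by $$\Lambda(M^J_\nu)=(\tau^J\otimes\imath_\nu)(R')\,D^{I_\nu}_\nu(M^J)\,(\tau^J\otimes\imath_\nu)((R')^{-1}),$$ $$\Lambda(A^J_i)=(\tau^J\otimes\jmath_i)(R')\,\pi_i(A^J)\,(\tau^J\otimes\jmath_i)((R')^{-1}),$$ $$\Lambda(B^J_i)=(\tau^J\otimes\jmath_i)(R')\,\pi_i(B^J)\,(\tau^J\otimes\jmath_i)((R')^{-1}).$$ It extends to $\mathcal S_{g,m}$ by $\Lambda(\xi)=\jmath(\xi)$ for $\xi\in\mathcal G$. The form $\langle\cdot,\cdot\rangle$ is positive definite, and with respect to it the extension is a $*$-representation of $\mathcal S_{g,m}$. The family $\{\Lambda_g^{I_1,\dots,I_m}\}_{I_1,\dots,I_m}$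 is faithful on $\mathcal L_{g,m}$: an element that is mapped to $0$ by all of them is $0$. Every $\Lambda_g^{I_1,\dots,I_m}$ is an irreducible representation of $\mathcal L_{g,m}$. -/

import Mathlib

open scoped TensorProduct Kronecker ComplexOrder Matrix

noncomputable section

namespace GraphAlg

universe uG

/-! ### Evaluation of two-legged tensors, finite-dimensional representations -/

/-- `(f ⊗ h)(x)` multiplied out in `A`: on `a ⊗ b` it is `f a * h b`. -/
def pairEval {G A : Type*} [AddCommMonoid G] [Module ℂ G] [Semiring A] [Algebra ℂ A]
    (f h : G →ₗ[ℂ] A) : G ⊗[ℂ] G →ₗ[ℂ] A :=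
  LinearMap.mul' ℂ A ∘ₗ TensorProduct.map f h

/-- The flip `a ⊗ b ↦ b ⊗ a`; in particular `R' = swapLegs R`. -/
def swapLegs (G : Type*) [AddCommMonoid G] [Module ℂ G] : G ⊗[ℂ] G →ₗ[ℂ] G ⊗[ℂ] G :=
  (TensorProduct.comm ℂ G G).toLinearMap

/-- The linear functional `ξ ↦ ρ(ξ)_{ab}`, regarded as having values in the scalars of `A`. -/
def entry {G A : Type*} [Semiring G] [Algebra ℂ G] [Semiring A] [Algebra ℂ A] {n : Type*}
    [Fintype n] [DecidableEq n] (ρ : G →ₐ[ℂ] Matrix n n ℂ) (a b : n) : G →ₗ[ℂ] A where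
  toFun ξ := algebraMap ℂ A (ρ ξ a b)
  map_add' x y := by simp
  map_smul' c x := by
    rw [map_smul, Matrix.smul_apply, smul_eq_mul, map_mul, RingHom.id_apply, Algebra.smul_def]

/-- `(ρ ⊗ f)(x) ∈ End(V) ⊗ A`, written as a matrix over `A`. -/
def evalMat {G A : Type*} [Semiring G] [Algebra ℂ G] [Semiring A] [Algebra ℂ A] {n : Type*}
    [Fintype n] [DecidableEq n] (ρ : G →ₐ[ℂ] Matrix n n ℂ) (f : G →ₗ[ℂ] A) (x : G ⊗[ℂ] G) :
    Matrix n n A :=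
  Matrix.of fun a b => pairEval (entry ρ a b) f x

/-- `(ρ ⊗ σ)(x) ∈ End(V ⊗ W)`, written as a matrix on the product index set. -/
def evalKron {G : Type*} [Semiring G] [Algebra ℂ G] {n k : Type*} [Fintype n] [DecidableEq n]
    [Fintype k] [DecidableEq k] (ρ : G →ₐ[ℂ] Matrix n n ℂ) (σ : G →ₐ[ℂ] Matrix k k ℂ)
    (x : G ⊗[ℂ] G) : Matrix (n × k) (n × k) ℂ :=
  Matrix.of fun p q => pairEval (entry ρ p.1 q.1) (entry σ p.2 q.2) x

/-- A matrix of complex numbers regarded as a matrix over the algebra `A`. -/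
def num {A : Type*} [Semiring A] [Algebra ℂ A] {n k : Type*} (X : Matrix n k ℂ) :
    Matrix n k A := X.map (algebraMap ℂ A)

/-- Irreducibility: the space is nonzero and has no invariant subspaces but the trivial ones. -/
def IsIrreducibleRep {A n : Type*} [Semiring A] [Algebra ℂ A] [Fintype n] [DecidableEq n]
    (ρ : A →ₐ[ℂ] Matrix n n ℂ) : Prop :=
  Nonempty n ∧ ∀ p : Submodule ℂ (n → ℂ), (∀ a, ∀ v ∈ p, ρ a *ᵥ v ∈ p) → p = ⊥ ∨ p = ⊤

/-- Equivalence of representations. -/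
def RepEquivalent {A n k : Type*} [Semiring A] [Algebra ℂ A] [Fintype n] [DecidableEq n]
    [Fintype k] [DecidableEq k] (ρ : A →ₐ[ℂ] Matrix n n ℂ) (σ : A →ₐ[ℂ] Matrix k k ℂ) : Prop :=
  ∃ e : (n → ℂ) ≃ₗ[ℂ] (k → ℂ), ∀ a v, e (ρ a *ᵥ v) = σ a *ᵥ e v

/-! ### The symmetry algebra -/

section Symmetry

variable (G : Type uG) [Ring G] [HopfAlgebra ℂ G] [StarRing G] [StarModule ℂ G]

/-- `x ↦ x ⊗ 1` on the first two of three legs. -/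
def leg12 : G ⊗[ℂ] G →ₐ[ℂ] G ⊗[ℂ] (G ⊗[ℂ] G) :=
  Algebra.TensorProduct.map (AlgHom.id ℂ G) Algebra.TensorProduct.includeLeft

/-- The embedding of `G ⊗ G` in the first and third of three legs. -/
def leg13 : G ⊗[ℂ] G →ₐ[ℂ] G ⊗[ℂ] (G ⊗[ℂ] G) :=
  Algebra.TensorProduct.map (AlgHom.id ℂ G) Algebra.TensorProduct.includeRight

/-- The embedding of `G ⊗ G` in the second and third of three legs. -/
def leg23 : G ⊗[ℂ] G →ₐ[ℂ] G ⊗[ℂ] (G ⊗[ℂ] G) :=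
  Algebra.TensorProduct.includeRight

/-- `Δ ⊗ id`. -/
def comulLeft : G ⊗[ℂ] G →ₗ[ℂ] G ⊗[ℂ] (G ⊗[ℂ] G) :=
  (TensorProduct.assoc ℂ G G G).toLinearMap ∘ₗ
    TensorProduct.map Coalgebra.comul LinearMap.id

/-- `id ⊗ Δ`. -/
def comulRight : G ⊗[ℂ] G →ₗ[ℂ] G ⊗[ℂ] (G ⊗[ℂ] G) :=
  TensorProduct.map LinearMap.id Coalgebra.comul

/-- A ribbon Hopf-*-algebra whose coproduct is compatible with
`(ξ ⊗ η)* = η* ⊗ ξ*` (the `star` of the tensor product below does not reverse the legs,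
so that this operation is `swapLegs ∘ star`). -/
structure RibbonHopfStar where
  /-- the universal `R`-matrix -/
  R : (G ⊗[ℂ] G)ˣ
  /-- the ribbon element -/
  v : Gˣ
  comul_star : ∀ ξ : G, (Coalgebra.comul (R := ℂ) (star ξ) : G ⊗[ℂ] G)
    = swapLegs G (star (Coalgebra.comul (R := ℂ) ξ))
  R_comul : ∀ ξ : G, (R : G ⊗[ℂ] G) * Coalgebra.comul (R := ℂ) ξ
    = swapLegs G (Coalgebra.comul (R := ℂ) ξ) * (R : G ⊗[ℂ] G)
  comulLeft_R : comulLeft G R = leg13 G R * leg23 G R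
  comulRight_R : comulRight G R = leg13 G R * leg12 G R
  v_central : ∀ ξ : G, (v : G) * ξ = ξ * (v : G)
  /-- `v² = u S(u)` with `u = ∑ S(r²) r¹`, where `R = ∑ r¹ ⊗ r²` -/
  v_sq : (v : G) ^ 2 = pairEval (HopfAlgebra.antipode ℂ) LinearMap.id (swapLegs G R)
    * HopfAlgebra.antipode ℂ (pairEval (HopfAlgebra.antipode ℂ) LinearMap.id (swapLegs G R))
  antipode_v : HopfAlgebra.antipode ℂ (v : G) = v
  counit_v : Coalgebra.counit (R := ℂ) (v : G) = 1
  star_v : star (v : G) = ((v⁻¹ : Gˣ) : G)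
  /-- `Δ(v) = (R'R)⁻¹ (v ⊗ v)` -/
  comul_v : swapLegs G R * (R : G ⊗[ℂ] G) * Coalgebra.comul (R := ℂ) (v : G)
    = (v : G) ⊗ₜ[ℂ] (v : G)

variable {G} in
/-- `u = ∑ S(r²) r¹`. -/
def RibbonHopfStar.u (H : RibbonHopfStar G) : G :=
  pairEval (HopfAlgebra.antipode ℂ) LinearMap.id (swapLegs G H.R)

variable {G} in
/-- The grouplike element `g = u⁻¹ v`; `u` is a unit in every quasi-triangular Hopf algebra. -/
def RibbonHopfStar.grp (H : RibbonHopfStar G) : G := Ring.inverse H.u * (H.v : G)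

/-- The symmetry algebra: a finite-dimensional semisimple ribbon Hopf-*-algebra, with
* one irreducible *-representation `τ I` on `ℂ^{δ I}` (an orthonormal basis of `V^I` is chosen)
  for every class of irreducible representations, the trivial one having the label `zero`;
* Clebsch-Gordan maps `C I J K a : V^I ⊗ V^J → V^K`, a basis of the intertwiners;
* square roots `κ I` of the values `τ I (v)` such that the Clebsch-Gordan maps are normalized by
  `C^a[IJ|K] (R')^{IJ} C^b[IJ|L]* = δ_{ab} δ_{KL} κ_I κ_J / κ_K`,
  and the element `kap` of `G` which combines them. -/
structure SymmetryData (ι : Type) extends RibbonHopfStar G where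
  finiteDimensional : FiniteDimensional ℂ G
  semisimple : IsSemisimpleRing G
  /-- the dimensions of the irreducible representations -/
  δ : ι → ℕ
  /-- the irreducible *-representations -/
  τ : ∀ I, G →ₐ[ℂ] Matrix (Fin (δ I)) (Fin (δ I)) ℂ
  τ_star : ∀ I ξ, τ I (star ξ) = (τ I ξ)ᴴ
  τ_irreducible : ∀ I, IsIrreducibleRep (τ I)
  τ_inequivalent : ∀ I J, RepEquivalent (τ I) (τ J) → I = J
  τ_complete : ∀ (k : ℕ) (ρ : G →ₐ[ℂ] Matrix (Fin k) (Fin k) ℂ), IsIrreducibleRep ρ →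
    ∃ I, RepEquivalent ρ (τ I)
  /-- the label of the trivial representation -/
  zero : ι
  δ_zero : δ zero = 1
  τ_zero : ∀ ξ, τ zero ξ = Coalgebra.counit (R := ℂ) ξ • (1 : Matrix _ _ ℂ)
  /-- the fusion rules -/
  N : ι → ι → ι → ℕ
  /-- the Clebsch-Gordan maps -/
  C : ∀ I J K, Fin (N I J K) → Matrix (Fin (δ K)) (Fin (δ I) × Fin (δ J)) ℂ
  C_intertwines : ∀ I J K a ξ,
    C I J K a * evalKron (τ I) (τ J) (Coalgebra.comul ξ) = τ K ξ * C I J K a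
  C_spans : ∀ I J K (T : Matrix (Fin (δ K)) (Fin (δ I) × Fin (δ J)) ℂ),
    (∀ ξ, T * evalKron (τ I) (τ J) (Coalgebra.comul ξ) = τ K ξ * T) →
      T ∈ Submodule.span ℂ (Set.range (C I J K))
  /-- square roots of the values of the ribbon element -/
  κ : ι → ℂ
  κ_sq : ∀ I, τ I v = κ I ^ 2 • (1 : Matrix _ _ ℂ)
  C_norm : ∀ I J K (a b : Fin (N I J K)),
    C I J K a * evalKron (τ I) (τ J) (swapLegs G R) * (C I J K b)ᴴ
      = (if a = b then κ I * κ J / κ K else 0) • (1 : Matrix _ _ ℂ)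
  C_orth : ∀ I J K L (a : Fin (N I J K)) (b : Fin (N I J L)), K ≠ L →
    C I J K a * evalKron (τ I) (τ J) (swapLegs G R) * (C I J L b)ᴴ = 0
  /-- the central element `κ` with `τ^J(κ) = κ_J` -/
  kap : Gˣ
  τ_kap : ∀ I, τ I kap = κ I • (1 : Matrix _ _ ℂ)

variable {G} {ι : Type} (H : SymmetryData G ι)

/-- The quantum dimension `d_I = tr_q^I(e^I) = tr τ^I(g)`. -/
def SymmetryData.qdim (I : ι) : ℂ := (H.τ I H.grp).trace

/-- The matrix `s_{IJ} = (tr_q^I ⊗ tr_q^J)(R'R)`, a nonzero multiple of the matrix `S`. -/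
def SymmetryData.s : Matrix ι ι ℂ := Matrix.of fun I J =>
  (evalKron (H.τ I) (H.τ J) (swapLegs G H.R * (H.R : G ⊗[ℂ] G) * (H.grp ⊗ₜ[ℂ] H.grp))).trace

end Symmetry

/-! ### The graph algebra `L_{g,m}` and its semi-direct product with `G` -/

/-- The `m + 2g` holonomies `M_ν`, `A_i`, `B_i`. -/
inductive Hol (g m : ℕ) : Type
  | M (ν : Fin m) : Hol g m
  | A (i : Fin g) : Hol g m
  | B (i : Fin g) : Hol g m

/-- The pairs `(X, Y)` of holonomies that are subject to the exchange relation
`R⁻¹ X₁ R Y₂ = Y₂ R⁻¹ X₁ R`. -/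
inductive Hol.Before {g m : ℕ} : Hol g m → Hol g m → Prop
  | MM (ν μ : Fin m) : ν < μ → Hol.Before (.M ν) (.M μ)
  | MA (ν : Fin m) (j : Fin g) : Hol.Before (.M ν) (.A j)
  | MB (ν : Fin m) (j : Fin g) : Hol.Before (.M ν) (.B j)
  | AA (i j : Fin g) : i < j → Hol.Before (.A i) (.A j)
  | BB (i j : Fin g) : i < j → Hol.Before (.B i) (.B j)
  | AB (i j : Fin g) : i < j → Hol.Before (.A i) (.B j)
  | BA (i j : Fin g) : i < j → Hol.Before (.B i) (.A j)

section Algebras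

variable {G : Type uG} [Ring G] [HopfAlgebra ℂ G] [StarRing G] [StarModule ℂ G]
variable {ι : Type} [Fintype ι] (H : SymmetryData G ι)

/-- `X₁`: the matrix `X` acting on the first of two tensor factors. -/
def inFirst {A : Type*} [Semiring A] {n : Type*} (k : Type*) [DecidableEq k]
    (X : Matrix n n A) : Matrix (n × k) (n × k) A := X ⊗ₖ (1 : Matrix k k A)

/-- `X₂`: the matrix `X` acting on the second of two tensor factors. -/
def inSecond {A : Type*} [Semiring A] {k : Type*} (n : Type*) [DecidableEq n]
    (X : Matrix k k A) : Matrix (n × k) (n × k) A := (1 : Matrix n n A) ⊗ₖ X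

/-- `R^{IJ}`, over the algebra `A`. -/
def SymmetryData.RM {A : Type*} [Semiring A] [Algebra ℂ A] (I J : ι) :
    Matrix (Fin (H.δ I) × Fin (H.δ J)) (Fin (H.δ I) × Fin (H.δ J)) A :=
  num (evalKron (H.τ I) (H.τ J) H.R)

/-- `(R⁻¹)^{IJ}`, over the algebra `A`. -/
def SymmetryData.RinvM {A : Type*} [Semiring A] [Algebra ℂ A] (I J : ι) :
    Matrix (Fin (H.δ I) × Fin (H.δ J)) (Fin (H.δ I) × Fin (H.δ J)) A :=
  num (evalKron (H.τ I) (H.τ J) ((H.R⁻¹ : (G ⊗[ℂ] G)ˣ) : G ⊗[ℂ] G))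

/-- `(R')^{IJ}`, over the algebra `A`. -/
def SymmetryData.RpM {A : Type*} [Semiring A] [Algebra ℂ A] (I J : ι) :
    Matrix (Fin (H.δ I) × Fin (H.δ J)) (Fin (H.δ I) × Fin (H.δ J)) A :=
  num (evalKron (H.τ I) (H.τ J) (swapLegs G H.R))

/-- `X₁ R^{IJ} Y₂` for `X ∈ End(V^I) ⊗ A` and `Y ∈ End(V^J) ⊗ A`. -/
def productSide {A : Type*} [Ring A] [Algebra ℂ A] {I J : ι}
    (X : Matrix (Fin (H.δ I)) (Fin (H.δ I)) A) (Y : Matrix (Fin (H.δ J)) (Fin (H.δ J)) A) :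
    Matrix (Fin (H.δ I) × Fin (H.δ J)) (Fin (H.δ I) × Fin (H.δ J)) A :=
  inFirst _ X * H.RM I J * inSecond _ Y

/-- `∑_{K,a} C^a[IJ|K]* X^K C^a[IJ|K]`. -/
def fusionSide {A : Type*} [Ring A] [Algebra ℂ A]
    (X : ∀ K : ι, Matrix (Fin (H.δ K)) (Fin (H.δ K)) A) (I J : ι) :
    Matrix (Fin (H.δ I) × Fin (H.δ J)) (Fin (H.δ I) × Fin (H.δ J)) A :=
  ∑ K, ∑ a : Fin (H.N I J K),
    ((num (H.C I J K a).conjTranspose : Matrix (Fin (H.δ I) × Fin (H.δ J)) (Fin (H.δ K)) A)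
      * X K) * num (H.C I J K a)

/-- `(R⁻¹)^{IJ} X₁ R^{IJ} Y₂`. -/
def exchangeLeft {A : Type*} [Ring A] [Algebra ℂ A] {I J : ι}
    (X : Matrix (Fin (H.δ I)) (Fin (H.δ I)) A) (Y : Matrix (Fin (H.δ J)) (Fin (H.δ J)) A) :
    Matrix (Fin (H.δ I) × Fin (H.δ J)) (Fin (H.δ I) × Fin (H.δ J)) A :=
  H.RinvM I J * inFirst _ X * H.RM I J * inSecond _ Y

/-- `Y₂ (R⁻¹)^{IJ} X₁ R^{IJ}`. -/
def exchangeRight {A : Type*} [Ring A] [Algebra ℂ A] {I J : ι}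
    (X : Matrix (Fin (H.δ I)) (Fin (H.δ I)) A) (Y : Matrix (Fin (H.δ J)) (Fin (H.δ J)) A) :
    Matrix (Fin (H.δ I) × Fin (H.δ J)) (Fin (H.δ I) × Fin (H.δ J)) A :=
  inSecond _ Y * H.RinvM I J * inFirst _ X * H.RM I J

/-- `Y₂ (R')^{IJ} X₁ R^{IJ}`. -/
def handleRight {A : Type*} [Ring A] [Algebra ℂ A] {I J : ι}
    (X : Matrix (Fin (H.δ I)) (Fin (H.δ I)) A) (Y : Matrix (Fin (H.δ J)) (Fin (H.δ J)) A) :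
    Matrix (Fin (H.δ I) × Fin (H.δ J)) (Fin (H.δ I) × Fin (H.δ J)) A :=
  inSecond _ Y * H.RpM I J * inFirst _ X * H.RM I J

/-- The defining relations of the graph algebra, imposed entry by entry on matrices
`X h I ∈ End(V^I) ⊗ A`, where `h` runs through the holonomies. -/
inductive GraphRel (g m : ℕ) {A : Type*} [Ring A] [Algebra ℂ A]
    (X : Hol g m → ∀ I : ι, Matrix (Fin (H.δ I)) (Fin (H.δ I)) A) : A → A → Prop
  /-- the holonomy in the trivial representation is the unit -/
  | unit (h : Hol g m) (a b : Fin (H.δ H.zero)) :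
      GraphRel g m X (X h H.zero a b)
        ((1 : Matrix (Fin (H.δ H.zero)) (Fin (H.δ H.zero)) A) a b)
  /-- functoriality -/
  | functoriality (h : Hol g m) (I J : ι) (p q : Fin (H.δ I) × Fin (H.δ J)) :
      GraphRel g m X (productSide H (X h I) (X h J) p q) (fusionSide H (X h) I J p q)
  /-- the relation between `A_i` and `B_i` on every handle -/
  | handle (i : Fin g) (I J : ι) (p q : Fin (H.δ I) × Fin (H.δ J)) :
      GraphRel g m X (exchangeLeft H (X (.A i) I) (X (.B i) J) p q)
        (handleRight H (X (.A i) I) (X (.B i) J) p q)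
  /-- the relations between holonomies which are not on the same puncture or handle -/
  | exchange (h k : Hol g m) (hk : h.Before k) (I J : ι) (p q : Fin (H.δ I) × Fin (H.δ J)) :
      GraphRel g m X (exchangeLeft H (X h I) (X k J) p q) (exchangeRight H (X h I) (X k J) p q)

/-- The labels of the generators: the matrix elements of `M_ν^I`, `A_i^I`, `B_i^I`. -/
abbrev Gen (g m : ℕ) : Type := Hol g m × (Σ I : ι, Fin (H.δ I) × Fin (H.δ I))

/-- The matrices of free generators. -/
def freeHol (g m : ℕ) (h : Hol g m) (I : ι) :
    Matrix (Fin (H.δ I)) (Fin (H.δ I)) (FreeAlgebra ℂ (Gen H g m)) :=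
  Matrix.of fun a b => FreeAlgebra.ι ℂ ((h, ⟨I, (a, b)⟩) : Gen H g m)

/-- The graph algebra `L_{g,m}`. -/
abbrev GraphAlgebra (g m : ℕ) : Type := RingQuot (GraphRel H g m (freeHol H g m))

/-- The holonomy matrices `M_ν^I`, `A_i^I`, `B_i^I` in `End(V^I) ⊗ L_{g,m}`. -/
def hol (g m : ℕ) (h : Hol g m) (I : ι) :
    Matrix (Fin (H.δ I)) (Fin (H.δ I)) (GraphAlgebra H g m) :=
  (freeHol H g m h I).map (RingQuot.mkAlgHom ℂ (GraphRel H g m (freeHol H g m)))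

/-- The relations of the semi-direct product, on the free algebra over the set
`L_{g,m} ⊔ G`: both sets are mapped by algebra homomorphisms, and
`μ^J(ξ) X^J = X^J μ^J(ξ)` for every holonomy `X`, where `μ^J(ξ) = (τ^J ⊗ id)(Δ ξ)`. -/
inductive SemiRel (g m : ℕ) :
    FreeAlgebra ℂ (GraphAlgebra H g m ⊕ G) → FreeAlgebra ℂ (GraphAlgebra H g m ⊕ G) → Prop
  | scalarL (c : ℂ) : SemiRel g m (FreeAlgebra.ι ℂ (.inl (algebraMap ℂ _ c))) (algebraMap ℂ _ c)
  | addL (x y : GraphAlgebra H g m) : SemiRel g m (FreeAlgebra.ι ℂ (.inl (x + y)))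
      (FreeAlgebra.ι ℂ (.inl x) + FreeAlgebra.ι ℂ (.inl y))
  | mulL (x y : GraphAlgebra H g m) : SemiRel g m (FreeAlgebra.ι ℂ (.inl (x * y)))
      (FreeAlgebra.ι ℂ (.inl x) * FreeAlgebra.ι ℂ (.inl y))
  | scalarG (c : ℂ) : SemiRel g m (FreeAlgebra.ι ℂ (.inr (algebraMap ℂ _ c))) (algebraMap ℂ _ c)
  | addG (ξ η : G) : SemiRel g m (FreeAlgebra.ι ℂ (.inr (ξ + η)))
      (FreeAlgebra.ι ℂ (.inr ξ) + FreeAlgebra.ι ℂ (.inr η))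
  | mulG (ξ η : G) : SemiRel g m (FreeAlgebra.ι ℂ (.inr (ξ * η)))
      (FreeAlgebra.ι ℂ (.inr ξ) * FreeAlgebra.ι ℂ (.inr η))
  /-- `∑ τ^J(ξ¹)_{ac} ξ² X^J_{cb} = ∑ X^J_{ac} τ^J(ξ¹)_{cb} ξ²`; the coproduct is written as an
  arbitrary finite sum of simple tensors. -/
  | cross (h : Hol g m) (J : ι) (ξ : G) (n : ℕ) (x y : Fin n → G)
      (hξ : Coalgebra.comul (R := ℂ) ξ = ∑ k, x k ⊗ₜ[ℂ] y k) (a b : Fin (H.δ J)) :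
      SemiRel g m
        (∑ k, ∑ c, H.τ J (x k) a c •
          (FreeAlgebra.ι ℂ (.inr (y k)) * FreeAlgebra.ι ℂ (.inl (hol H g m h J c b))))
        (∑ k, ∑ c, H.τ J (x k) c b •
          (FreeAlgebra.ι ℂ (.inl (hol H g m h J a c)) * FreeAlgebra.ι ℂ (.inr (y k))))

/-- The semi-direct product `S_{g,m}` of `L_{g,m}` and `G`. -/
abbrev SemiDirect (g m : ℕ) : Type uG := RingQuot (SemiRel H g m)

/-- The natural map `L_{g,m} → S_{g,m}`. -/
def ofL (g m : ℕ) : GraphAlgebra H g m →ₐ[ℂ] SemiDirect H g m :=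
  AlgHom.ofLinearMap
    { toFun := fun x => RingQuot.mkAlgHom ℂ (SemiRel H g m) (FreeAlgebra.ι ℂ (.inl x))
      map_add' := fun x y => by
        rw [RingQuot.mkAlgHom_rel ℂ (SemiRel.addL x y), map_add]
      map_smul' := fun c x => by
        rw [Algebra.smul_def, RingQuot.mkAlgHom_rel ℂ (SemiRel.mulL _ x), map_mul,
          RingQuot.mkAlgHom_rel ℂ (SemiRel.scalarL c), AlgHom.commutes, RingHom.id_apply,
          ← Algebra.smul_def] }
    (by
      have h := RingQuot.mkAlgHom_rel ℂ (SemiRel.scalarL (H := H) (g := g) (m := m) 1)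
      simpa using h)
    (fun x y => by
      change RingQuot.mkAlgHom ℂ (SemiRel H g m) _ = RingQuot.mkAlgHom ℂ (SemiRel H g m) _ * RingQuot.mkAlgHom ℂ (SemiRel H g m) _
      rw [RingQuot.mkAlgHom_rel ℂ (SemiRel.mulL x y), map_mul])

/-- The natural map `G → S_{g,m}`. -/
def ofG (g m : ℕ) : G →ₐ[ℂ] SemiDirect H g m :=
  AlgHom.ofLinearMap
    { toFun := fun x => RingQuot.mkAlgHom ℂ (SemiRel H g m) (FreeAlgebra.ι ℂ (.inr x))
      map_add' := fun x y => by
        rw [RingQuot.mkAlgHom_rel ℂ (SemiRel.addG x y), map_add]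
      map_smul' := fun c x => by
        rw [Algebra.smul_def, RingQuot.mkAlgHom_rel ℂ (SemiRel.mulG _ x), map_mul,
          RingQuot.mkAlgHom_rel ℂ (SemiRel.scalarG c), AlgHom.commutes, RingHom.id_apply,
          ← Algebra.smul_def] }
    (by
      have h := RingQuot.mkAlgHom_rel ℂ (SemiRel.scalarG (H := H) (g := g) (m := m) 1)
      simpa using h)
    (fun x y => by
      change RingQuot.mkAlgHom ℂ (SemiRel H g m) _ = RingQuot.mkAlgHom ℂ (SemiRel H g m) _ * RingQuot.mkAlgHom ℂ (SemiRel H g m) _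
      rw [RingQuot.mkAlgHom_rel ℂ (SemiRel.mulG x y), map_mul])

/-- The holonomy matrices in `End(V^I) ⊗ S_{g,m}`. -/
def holS (g m : ℕ) (h : Hol g m) (I : ι) :
    Matrix (Fin (H.δ I)) (Fin (H.δ I)) (SemiDirect H g m) :=
  (hol H g m h I).map (ofL H g m)

/-! ### The `*`-operation and the integral -/

/-- `st` is the `*`-operation of `S_{g,m}`: a conjugate-linear, anti-multiplicative involution
which extends the `*`-operation of `G` and satisfies `(X^I)* = σ_κ(R^I (X^I)⁻¹ (R⁻¹)^I)` for every
holonomy `X`. Here `(X^I)*` has the entries `((X^I)*)_{ab} = (X^I_{ba})*`,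
`R^I = (τ^I ⊗ id)(R)`, and `σ_κ(F) = κ⁻¹ F κ`. -/
structure IsGraphStar (g m : ℕ) (st : SemiDirect H g m → SemiDirect H g m) : Prop where
  add : ∀ x y, st (x + y) = st x + st y
  smul : ∀ (c : ℂ) x, st (c • x) = star c • st x
  mul : ∀ x y, st (x * y) = st y * st x
  invol : ∀ x, st (st x) = x
  onG : ∀ ξ : G, st (ofG H g m ξ) = ofG H g m (star ξ)
  onHol : ∀ (h : Hol g m) (I : ι), ∃ Y : Matrix (Fin (H.δ I)) (Fin (H.δ I)) (SemiDirect H g m),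
    holS H g m h I * Y = 1 ∧ Y * holS H g m h I = 1 ∧
    (holS H g m h I)ᵀ.map st =
      (evalMat (H.τ I) (ofG H g m).toLinearMap H.R * Y *
        evalMat (H.τ I) (ofG H g m).toLinearMap
          ((H.R⁻¹ : (G ⊗[ℂ] G)ˣ) : G ⊗[ℂ] G)).map
        (fun F => ofG H g m ((H.kap⁻¹ : Gˣ) : G) * F * ofG H g m (H.kap : G))

/-- `ω` is the integral of the loop algebra with symmetry, `ω(X^I_{ab} ξ) = δ_{I,0} ε(ξ)`. -/
def IsLoopIntegral [DecidableEq ι] (ω : SemiDirect H 0 1 →ₗ[ℂ] ℂ) : Prop :=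
  ∀ (I : ι) (a b : Fin (H.δ I)) (ξ : G),
    ω (holS H 0 1 (.M 0) I a b * ofG H 0 1 ξ)
      = if I = H.zero then Coalgebra.counit (R := ℂ) ξ else 0

/-! ### The representation of the handle algebra and its scalar product -/

/-- A basis of `ℜ = ⨁_I End(V^I)`: the matrix units. -/
abbrev RegIndex : Type := Σ I : ι, Fin (H.δ I) × Fin (H.δ I)

/-- `π` is the representation of the handle algebra `L_{1,0}`, extended to `S_{1,0}`, on `ℜ` with
the ground state `Ω`: the vector `Ω` is cyclic for `L_{1,0}`, `π(B^I) Ω = Ω κ_I⁻¹`, and `Ω` is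
invariant under `G`. -/
structure IsHandleRep [DecidableEq ι] (π : SemiDirect H 1 0 →ₐ[ℂ] Matrix (RegIndex H) (RegIndex H) ℂ)
    (Ω : RegIndex H → ℂ) : Prop where
  cyclic : ∀ w : RegIndex H → ℂ, ∃ x : GraphAlgebra H 1 0, π (ofL H 1 0 x) *ᵥ Ω = w
  vacuum : ∀ (I : ι) (a b : Fin (H.δ I)),
    π (holS H 1 0 (.B 0) I a b) *ᵥ Ω = (if a = b then (H.κ I)⁻¹ else 0) • Ω
  invariant : ∀ ξ : G, π (ofG H 1 0 ξ) *ᵥ Ω = Coalgebra.counit (R := ℂ) ξ • Ω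

/-- `Q` is the Gram matrix of the form `⟨a₁, a₂⟩ = ω((A₁)* A₂)` on `ℜ`, for `aᵢ = π(Aᵢ) Ω` and
`Aᵢ` in the loop algebra generated by the monodromies `A^I`. This loop algebra is spanned by the
matrix elements of the `A^I`, and `ω` and `*` are those of the loop algebra. -/
def IsHandleForm [DecidableEq ι] (st : SemiDirect H 0 1 → SemiDirect H 0 1)
    (ω : SemiDirect H 0 1 →ₗ[ℂ] ℂ)
    (π : SemiDirect H 1 0 →ₐ[ℂ] Matrix (RegIndex H) (RegIndex H) ℂ)
    (Ω : RegIndex H → ℂ) (Q : Matrix (RegIndex H) (RegIndex H) ℂ) : Prop :=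
  ∀ (I J : ι) (a b : Fin (H.δ I)) (c d : Fin (H.δ J)),
    star (π (holS H 1 0 (.A 0) I a b) *ᵥ Ω) ⬝ᵥ (Q *ᵥ (π (holS H 1 0 (.A 0) J c d) *ᵥ Ω))
      = ω (st (holS H 0 1 (.M 0) I a b) * holS H 0 1 (.M 0) J c d)

end Algebras

/-! ### The representation space `V^{I_1} ⊗ ⋯ ⊗ V^{I_m} ⊗ ℜ^{⊗ g}` -/

section Space

variable {G : Type uG} [Ring G] [HopfAlgebra ℂ G] [StarRing G] [StarModule ℂ G]
variable {ι : Type} [Fintype ι] [DecidableEq ι] (H : SymmetryData G ι)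
variable {g m : ℕ} (lab : Fin m → ι)

/-- Basis of the tensor factor number `k`: of `V^{I_ν}` for `k = inl ν`, and of (the `i`-th copy
of) `ℜ` for `k = inr i`. The vectors of a space with basis `n` are the functions `n → ℂ`. -/
def Factor : Fin m ⊕ Fin g → Type
  | .inl ν => Fin (H.δ (lab ν))
  | .inr _ => RegIndex H

instance factorFintype : ∀ k : Fin m ⊕ Fin g, Fintype (Factor H lab k)
  | .inl ν => inferInstanceAs (Fintype (Fin (H.δ (lab ν))))
  | .inr _ => inferInstanceAs (Fintype (RegIndex H))

instance factorDecidableEq : ∀ k : Fin m ⊕ Fin g, DecidableEq (Factor H lab k)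
  | .inl ν => inferInstanceAs (DecidableEq (Fin (H.δ (lab ν))))
  | .inr _ => inferInstanceAs (DecidableEq (RegIndex H))

variable (g) in
/-- The product basis of `V^{I_1} ⊗ ⋯ ⊗ V^{I_m} ⊗ ℜ ⊗ ⋯ ⊗ ℜ`. -/
abbrev SpaceIndex : Type := ∀ k : Fin m ⊕ Fin g, Factor H lab k

variable (g) in
/-- The linear maps of `V^{I_1} ⊗ ⋯ ⊗ V^{I_m} ⊗ ℜ ⊗ ⋯ ⊗ ℜ`, as matrices. -/
abbrev SpaceMat : Type := Matrix (SpaceIndex H g lab) (SpaceIndex H g lab) ℂ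

/-- `id ⊗ ⋯ ⊗ X ⊗ ⋯ ⊗ id` with `X` on the `k`-th factor. -/
def localOp (k : Fin m ⊕ Fin g) :
    Matrix (Factor H lab k) (Factor H lab k) ℂ →ₗ[ℂ] SpaceMat H g lab where
  toFun X := Matrix.of fun x y => if ∀ l, l ≠ k → x l = y l then X (x k) (y k) else 0
  map_add' X Y := by
    ext x y
    simp only [Matrix.of_apply, Matrix.add_apply]
    split_ifs <;> simp
  map_smul' c X := by
    ext x y
    simp only [Matrix.of_apply, Matrix.smul_apply, RingHom.id_apply]
    split_ifs <;> simp

/-- The representation of `G` on the `k`-th factor: `τ^{I_ν}`, respectively `π`. -/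
def factorRep (π : SemiDirect H 1 0 →ₐ[ℂ] Matrix (RegIndex H) (RegIndex H) ℂ) :
    ∀ k : Fin m ⊕ Fin g, G →ₗ[ℂ] Matrix (Factor H lab k) (Factor H lab k) ℂ
  | .inl ν => (H.τ (lab ν)).toLinearMap
  | .inr _ => (π.comp (ofG H 1 0)).toLinearMap

/-- The action of `G` on the tensor product, through the iterated coproduct, on the factors
in the list (in the order of the list) and by the identity on all others. It is `ε` for the
empty list. -/
def listRep (π : SemiDirect H 1 0 →ₐ[ℂ] Matrix (RegIndex H) (RegIndex H) ℂ) :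
    List (Fin m ⊕ Fin g) → (G →ₗ[ℂ] SpaceMat H g lab)
  | [] => (Algebra.linearMap ℂ (SpaceMat H g lab)) ∘ₗ Coalgebra.counit
  | k :: l => pairEval (localOp H lab k ∘ₗ factorRep H lab π k) (listRep π l) ∘ₗ Coalgebra.comul

/-- All tensor factors in their order. -/
def allFactors (g m : ℕ) : List (Fin m ⊕ Fin g) :=
  (List.finRange m).map .inl ++ (List.finRange g).map .inr

/-- The tensor factors which precede the `k`-th one, in their order. -/
def preceding {g m : ℕ} : Fin m ⊕ Fin g → List (Fin m ⊕ Fin g)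
  | .inl ν => ((List.finRange m).take ν).map .inl
  | .inr i => (List.finRange m).map .inl ++ ((List.finRange g).take i).map .inr

/-- The representation of `G` on the factors preceding the `k`-th one: `ι_ν` for `k = inl ν`
and `ȷ_i` for `k = inr i`. -/
def precRep (π : SemiDirect H 1 0 →ₐ[ℂ] Matrix (RegIndex H) (RegIndex H) ℂ) (k : Fin m ⊕ Fin g) :
    G →ₗ[ℂ] SpaceMat H g lab := listRep H lab π (preceding k)

/-- The natural action `ȷ` of `G` on the whole tensor product. -/
def totalRep (π : SemiDirect H 1 0 →ₐ[ℂ] Matrix (RegIndex H) (RegIndex H) ℂ) :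
    G →ₗ[ℂ] SpaceMat H g lab := listRep H lab π (allFactors g m)

/-- `(τ^J ⊗ f)(R') · X · (τ^J ⊗ f)(R'⁻¹)`. -/
def conjR {A : Type*} [Ring A] [Algebra ℂ A] (f : G →ₗ[ℂ] A) (J : ι)
    (X : Matrix (Fin (H.δ J)) (Fin (H.δ J)) A) : Matrix (Fin (H.δ J)) (Fin (H.δ J)) A :=
  evalMat (H.τ J) f (swapLegs G H.R) * X *
    evalMat (H.τ J) f (swapLegs G ((H.R⁻¹ : (G ⊗[ℂ] G)ˣ) : G ⊗[ℂ] G))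

/-- The loop representation `D^I(M^J) = κ_J⁻¹ (R'R)^{JI}`. -/
def loopRep (I J : ι) :
    Matrix (Fin (H.δ J)) (Fin (H.δ J)) (Matrix (Fin (H.δ I)) (Fin (H.δ I)) ℂ) :=
  (H.κ J)⁻¹ • evalMat (H.τ J) (H.τ I).toLinearMap (swapLegs G H.R * (H.R : G ⊗[ℂ] G))

/-- The operators by which the holonomies act on the tensor product. -/
def holOp (π : SemiDirect H 1 0 →ₐ[ℂ] Matrix (RegIndex H) (RegIndex H) ℂ) (J : ι) :
    Hol g m → Matrix (Fin (H.δ J)) (Fin (H.δ J)) (SpaceMat H g lab)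
  | .M ν => conjR H (precRep H lab π (.inl ν)) J
      ((loopRep H (lab ν) J).map (localOp H lab (.inl ν)))
  | .A i => conjR H (precRep H lab π (.inr i)) J
      ((holS H 1 0 (.A 0) J).map fun x => localOp H lab (.inr i) (π x))
  | .B i => conjR H (precRep H lab π (.inr i)) J
      ((holS H 1 0 (.B 0) J).map fun x => localOp H lab (.inr i) (π x))

/-- Gram matrices of the factors: the standard scalar product on `V^{I_ν}`, and `Q` on `ℜ`. -/
def factorGram (Q : Matrix (RegIndex H) (RegIndex H) ℂ) :
    ∀ k : Fin m ⊕ Fin g, Matrix (Factor H lab k) (Factor H lab k) ℂ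
  | .inl ν => (1 : Matrix (Fin (H.δ (lab ν))) (Fin (H.δ (lab ν))) ℂ)
  | .inr _ => Q

/-- `R η` with `η = Δ(κ) (κ⁻¹ ⊗ κ⁻¹)`. -/
def twist : G ⊗[ℂ] G :=
  (H.R : G ⊗[ℂ] G) * (Coalgebra.comul (R := ℂ) (H.kap : G) *
    (((H.kap⁻¹ : Gˣ) : G) ⊗ₜ[ℂ] ((H.kap⁻¹ : Gˣ) : G)))

/-- The Gram matrix of the scalar product on `V^{I_1} ⊗ ⋯ ⊗ ℜ`, so that
`⟨v, w⟩ = star v ⬝ᵥ (spaceGram *ᵥ w)`. It is the iteration of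
`⟨v, w⟩ = (v, (ρ ⊗ ρ')(R η) w)` for two representations `ρ`, `ρ'`, where `( , )` is the product of
the scalar products on the two factors: the factors are adjoined one after the other, and the
`k`-th one contributes `(ȷ ⊗ ρ_k)(R η)` with `ȷ` the action on the factors before. -/
def spaceGram (π : SemiDirect H 1 0 →ₐ[ℂ] Matrix (RegIndex H) (RegIndex H) ℂ)
    (Q : Matrix (RegIndex H) (RegIndex H) ℂ) : SpaceMat H g lab :=
  (Matrix.of fun x y => ∏ k, factorGram H lab Q k (x k) (y k)) *
    ((allFactors g m).map fun k =>
      pairEval (precRep H lab π k) (localOp H lab k ∘ₗ factorRep H lab π k) (twist H)).prod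

end Space

end GraphAlg

namespace GraphAlg

set_option linter.unusedSectionVars false

local notation "ε" => Coalgebra.counit (R := ℂ)
local notation "Δ" => Coalgebra.comul (R := ℂ)
local notation "𝒮" => HopfAlgebra.antipode ℂ
local notation "𝕄[" H "," I "," A "]" => Matrix (Fin (SymmetryData.δ H I)) (Fin (SymmetryData.δ H I)) A
open LinearMap (mul' mul'_apply mulLeft id_apply rTensor lTensor proj ker mem_ker ker_eq_bot
  range_eq_top toMatrix' mulRight comp_id mulRight_apply)
open TensorProduct (map_tmul add_tmul tmul_add map assoc smul_tmul' sum_tmul comm_tmul lid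
  star_tmul)
open Finset (sum_congr sum_mul mul_sum sum_eq_single sum_comm smul_sum sum_mul_sum sum_eq_zero
  sum_smul prod_eq_zero mem_univ)
open Matrix (mulVec_mulVec mulVec_smul smul_mulVec sum_mulVec mulVec_sum single_apply
  ext_iff_mulVec diagonal_apply conjTranspose_one smul_mul one_apply_eq mul_diagonal diagonal_mul
  of_apply PosDef add_mulVec conjTranspose_mul mulVec_single_one)
open Units (val_mul inv_mul)
open Function (Surjective ne_iff Injective)
open Submodule (smul_mem subset_span span_induction span_le mul_mem_mul finrank_eq_zero mul_le
  mul_induction_on mem_top)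
open Fintype (card sum_prod_type card_fin)
open Algebra (algebraMap_eq_smul_one ofId linearMap smul_def)
open Algebra.TensorProduct (one_def lift_tmul tmul_mul_tmul includeLeft includeRight)
open Coalgebra (coassoc_apply)
open HopfAlgebra (antipode_mul_antidistrib antipode_one)
open AlgHom (ofLinearMap commutes comp_apply comp_assoc toLinearMap_apply mem_range)
open List (map_cons prod_cons mem_cons_self mem_cons finRange cons_append nodup_cons nodup_append
  append_assoc)
open Module (finrank Dual End)
open Pi (evalAlgHom single_eq_of_ne)

variable {G : Type uG} [Ring G] [HopfAlgebra ℂ G]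
variable {A : Type*} [Ring A] [Algebra ℂ A] {B : Type*} [Ring B] [Algebra ℂ B]

/-! ### Evaluation of two-legged tensors at commuting homomorphisms -/

section

/-- The images of two homomorphisms commute elementwise. -/
def Legs {G : Type*} [Ring G] [Algebra ℂ G] {A : Type*} [Ring A] [Algebra ℂ A]
    (f h : G →ₐ[ℂ] A) : Prop := ∀ x y, Commute (f x) (h y)

lemma Legs.symm {f h : G →ₐ[ℂ] A} (hc : Legs f h) : Legs h f := fun x y => (hc y x).symm

/-- `(f ⊗ h)(x)` for two homomorphisms. -/
def Ev (f h : G →ₐ[ℂ] A) : G ⊗[ℂ] G →ₗ[ℂ] A := pairEval f.toLinearMap h.toLinearMap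

@[simp] lemma pairEval_tmul {G A : Type*} [AddCommMonoid G] [Module ℂ G] [Semiring A]
    [Algebra ℂ A] (f h : G →ₗ[ℂ] A) (x y : G) : pairEval f h (x ⊗ₜ y) = f x * h y := by
  simp [pairEval]

@[simp] lemma Ev_tmul (f h : G →ₐ[ℂ] A) (x y : G) : Ev f h (x ⊗ₜ y) = f x * h y := by
  simp [Ev]

@[simp] lemma swapLegs_tmul (x y : G) : swapLegs G (x ⊗ₜ y) = y ⊗ₜ x := by
  simp [swapLegs]

lemma swapLegs_swapLegs (x : G ⊗[ℂ] G) : swapLegs G (swapLegs G x) = x := by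
  induction x with
  | zero => simp
  | tmul a b => simp
  | add a b ha hb => simp [ha, hb]

lemma swapLegs_mul (x y : G ⊗[ℂ] G) :
    swapLegs G (x * y) = swapLegs G x * swapLegs G y := by
  induction x with
  | tmul a b =>
    induction y with
    | tmul c d => simp
    | _ => simp_all [mul_add]
  | _ => simp_all [add_mul]

@[simp] lemma swapLegs_one : swapLegs G 1 = 1 := by
  simp [one_def]

lemma Ev_eq_lift {f h : G →ₐ[ℂ] A} (hc : Legs f h) (x : G ⊗[ℂ] G) :
    Ev f h x = Algebra.TensorProduct.lift f h hc x := by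
  induction x with
  | tmul a b => exact (Ev_tmul f h a b).trans (lift_tmul f h hc a b).symm
  | _ => simp_all

lemma Ev_mul {f h : G →ₐ[ℂ] A} (hc : Legs f h) (x y : G ⊗[ℂ] G) :
    Ev f h (x * y) = Ev f h x * Ev f h y := by
  simp [Ev_eq_lift hc]

@[simp] lemma Ev_one (f h : G →ₐ[ℂ] A) : Ev f h 1 = 1 := by
  simp [one_def]

lemma Ev_swap {f h : G →ₐ[ℂ] A} (hc : Legs f h) (x : G ⊗[ℂ] G) :
    Ev f h (swapLegs G x) = Ev h f x := by
  induction x with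
  | tmul a b => simp [(hc b a).eq]
  | _ => simp_all

lemma map_Ev (θ : A →ₐ[ℂ] B) (f h : G →ₐ[ℂ] A) (x : G ⊗[ℂ] G) :
    θ (Ev f h x) = Ev (θ.comp f) (θ.comp h) x := by
  induction x with
  | tmul a b => simp
  | _ => simp_all

lemma Legs.map {f h : G →ₐ[ℂ] A} (hc : Legs f h) (θ : A →ₐ[ℂ] B) :
    Legs (θ.comp f) (θ.comp h) := fun x y => (hc x y).map θ

lemma Ev_commute {f h : G →ₐ[ℂ] A} {z : A} (hf : ∀ x, Commute z (f x))
    (hh : ∀ x, Commute z (h x)) (x : G ⊗[ℂ] G) : Commute z (Ev f h x) := by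
  induction x with
  | zero => simp
  | add a b ha hb => simpa using ha.add_right hb
  | tmul a b => simpa using (hf a).mul_right (hh b)

/-- `(f ⊗ h) ∘ Δ` as a homomorphism. -/
def conv (f h : G →ₐ[ℂ] A) (hc : Legs f h) : G →ₐ[ℂ] A :=
  (Algebra.TensorProduct.lift f h hc).comp (Bialgebra.comulAlgHom ℂ G)

lemma conv_apply {f h : G →ₐ[ℂ] A} (hc : Legs f h) (x : G) :
    conv f h hc x = Ev f h (Coalgebra.comul x) := by
  simp [conv, Ev_eq_lift hc]

lemma map_conv (θ : A →ₐ[ℂ] B) {f h : G →ₐ[ℂ] A} (hc : Legs f h) :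
    θ.comp (conv f h hc) = conv (θ.comp f) (θ.comp h) (hc.map θ) := by
  ext x
  simp [conv_apply, map_Ev]

lemma conv_commute {f h : G →ₐ[ℂ] A} {hc : Legs f h} {z : A} (hf : ∀ x, Commute z (f x))
    (hh : ∀ x, Commute z (h x)) (x : G) : Commute z (conv f h hc x) := by
  rw [conv_apply]; exact Ev_commute hf hh _

lemma Legs.conv_left {f h k : G →ₐ[ℂ] A} {hc : Legs f h} (hf : Legs f k) (hh : Legs h k) :
    Legs (conv f h hc) k :=
  fun x y => (conv_commute (fun z => (hf z y).symm) (fun z => (hh z y).symm) x).symm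

lemma Legs.conv_right {f h k : G →ₐ[ℂ] A} {hc : Legs f h} (hf : Legs k f) (hh : Legs k h) :
    Legs k (conv f h hc) :=
  (Legs.conv_left hf.symm hh.symm).symm

/-- The counit, with values in the scalars of `A`. -/
def triv (A : Type*) [Ring A] [Algebra ℂ A] : G →ₐ[ℂ] A :=
  (ofId ℂ A).comp (Bialgebra.counitAlgHom ℂ G)

@[simp] lemma triv_apply (x : G) :
    (triv A : G →ₐ[ℂ] A) x = algebraMap ℂ A (Coalgebra.counit x) := rfl

lemma Legs.triv_left (f : G →ₐ[ℂ] A) : Legs (triv A) f :=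
  fun _ _ => Algebra.commute_algebraMap_left _ _

lemma Legs.triv_right (f : G →ₐ[ℂ] A) : Legs f (triv A) := (Legs.triv_left f).symm

lemma conv_triv_left (f : G →ₐ[ℂ] A) : conv (triv A) f (Legs.triv_left f) = f := by
  ext x
  have h := congrArg (mul' ℂ A ∘ₗ map (linearMap ℂ A)
    f.toLinearMap) (Coalgebra.rTensor_counit_comul (R := ℂ) x)
  have h2 : ∀ z : G ⊗[ℂ] G, (mul' ℂ A ∘ₗ map (linearMap ℂ A)
    f.toLinearMap) (Coalgebra.counit.rTensor G z) = Ev (triv A) f z := by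
    intro z
    induction z with
    | tmul a b => simp
    | _ => simp_all
  rw [h2] at h
  simpa [conv_apply] using h

lemma conv_triv_right (f : G →ₐ[ℂ] A) : conv f (triv A) (Legs.triv_right f) = f := by
  ext x
  have h := congrArg (mul' ℂ A ∘ₗ map
    f.toLinearMap (linearMap ℂ A)) (Coalgebra.lTensor_counit_comul (R := ℂ) x)
  have h2 : ∀ z : G ⊗[ℂ] G, (mul' ℂ A ∘ₗ map
    f.toLinearMap (linearMap ℂ A)) (Coalgebra.counit.lTensor G z) = Ev f (triv A) z := by
    intro z
    induction z with
    | tmul a b => simp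
    | _ => simp_all
  rw [h2] at h
  simpa [conv_apply] using h

/-- `(f ⊗ (h ⊗ k))(x)` multiplied out. -/
def Ev3 (f h k : G →ₐ[ℂ] A) (hhk : Legs h k) : G ⊗[ℂ] (G ⊗[ℂ] G) →ₗ[ℂ] A :=
  mul' ℂ A ∘ₗ map f.toLinearMap (Algebra.TensorProduct.lift h k hhk).toLinearMap

@[simp] lemma Ev3_tmul (f h k : G →ₐ[ℂ] A) (hhk : Legs h k) (x : G) (y : G ⊗[ℂ] G) :
    Ev3 f h k hhk (x ⊗ₜ y) = f x * Ev h k y := by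
  simp [Ev3, Ev_eq_lift hhk]

lemma Ev3_mul {f h k : G →ₐ[ℂ] A} (hfh : Legs f h) (hfk : Legs f k) (hhk : Legs h k)
    (x y : G ⊗[ℂ] (G ⊗[ℂ] G)) :
    Ev3 f h k hhk (x * y) = Ev3 f h k hhk x * Ev3 f h k hhk y := by
  induction x with
  | tmul a b =>
    induction y with
    | tmul c d =>
      have hc := Ev_commute (fun x => hfh c x) (fun x => hfk c x) b
      simp only [tmul_mul_tmul, Ev3_tmul, map_mul, Ev_mul hhk, mul_assoc]
      rw [← mul_assoc (f c), hc.eq, mul_assoc]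
    | _ => simp_all [mul_add]
  | _ => simp_all [add_mul]

lemma Ev3_leg12 (f h k : G →ₐ[ℂ] A) (hhk : Legs h k) (x : G ⊗[ℂ] G) :
    Ev3 f h k hhk (leg12 G x) = Ev f h x := by
  induction x with
  | tmul a b => simp [leg12]
  | _ => simp_all

lemma Ev3_leg13 (f h k : G →ₐ[ℂ] A) (hhk : Legs h k) (x : G ⊗[ℂ] G) :
    Ev3 f h k hhk (leg13 G x) = Ev f k x := by
  induction x with
  | tmul a b => simp [leg13]
  | _ => simp_all

lemma Ev3_leg23 (f h k : G →ₐ[ℂ] A) (hhk : Legs h k) (x : G ⊗[ℂ] G) :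
    Ev3 f h k hhk (leg23 G x) = Ev h k x := by
  simp [leg23]

lemma Ev3_comulLeft {f h k : G →ₐ[ℂ] A} (hfh : Legs f h) (hhk : Legs h k) (x : G ⊗[ℂ] G) :
    Ev3 f h k hhk (comulLeft G x) = Ev (conv f h hfh) k x := by
  induction x with
  | tmul a b =>
    simp only [comulLeft, LinearMap.comp_apply, map_tmul, id_apply, Ev_tmul, conv_apply]
    generalize (Δ a) = z
    induction z with
    | tmul c d => simp [mul_assoc]
    | _ => simp_all [add_tmul, add_mul]
  | _ => simp_all

lemma Ev3_comulRight {f h k : G →ₐ[ℂ] A} (hhk : Legs h k) (x : G ⊗[ℂ] G) :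
    Ev3 f h k hhk (comulRight G x) = Ev f (conv h k hhk) x := by
  induction x with
  | tmul a b => simp [comulRight, conv_apply]
  | _ => simp_all

variable [StarRing G] [StarModule ℂ G]

namespace RibbonHopfStar

variable (H : RibbonHopfStar G)

/-- `(f ⊗ h)(R)`. -/
def Rv (f h : G →ₐ[ℂ] A) : A := Ev f h (H.R : G ⊗[ℂ] G)

/-- `(f ⊗ h)(R⁻¹)`. -/
def Ri (f h : G →ₐ[ℂ] A) : A := Ev f h ↑H.R⁻¹

/-- `(f ⊗ h)(R'R)`. -/
def Qv (f h : G →ₐ[ℂ] A) : A := Ev f h (swapLegs G H.R * (H.R : G ⊗[ℂ] G))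

variable {f h k : G →ₐ[ℂ] A}

lemma Rv_mul_Ri (hc : Legs f h) : H.Rv f h * H.Ri f h = 1 := by
  rw [Rv, Ri, ← Ev_mul hc]; simp

lemma Ri_mul_Rv (hc : Legs f h) : H.Ri f h * H.Rv f h = 1 := by
  rw [Rv, Ri, ← Ev_mul hc]; simp

/-- `(f ⊗ h)(R)` as a unit. -/
def Ru (hc : Legs f h) : Aˣ := ⟨H.Rv f h, H.Ri f h, H.Rv_mul_Ri hc, H.Ri_mul_Rv hc⟩

@[simp] lemma val_Ru (hc : Legs f h) : (H.Ru hc : A) = H.Rv f h := rfl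

@[simp] lemma val_inv_Ru (hc : Legs f h) : ((H.Ru hc)⁻¹ : Aˣ) = H.Ri f h := rfl

lemma Qv_eq (hc : Legs f h) : H.Qv f h = H.Rv h f * H.Rv f h := by
  rw [Qv, Ev_mul hc, Ev_swap hc]; rfl

lemma Ev_swap_R (hc : Legs f h) : Ev f h (swapLegs G H.R) = H.Rv h f := Ev_swap hc _

lemma Ev_swap_Ri (hc : Legs f h) :
    Ev f h (swapLegs G ↑H.R⁻¹) = H.Ri h f := Ev_swap hc _

lemma map_Rv (θ : A →ₐ[ℂ] B) (f h : G →ₐ[ℂ] A) :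
    θ (H.Rv f h) = H.Rv (θ.comp f) (θ.comp h) := map_Ev θ f h _

lemma map_Ri (θ : A →ₐ[ℂ] B) (f h : G →ₐ[ℂ] A) :
    θ (H.Ri f h) = H.Ri (θ.comp f) (θ.comp h) := map_Ev θ f h _

lemma map_Qv (θ : A →ₐ[ℂ] B) (f h : G →ₐ[ℂ] A) :
    θ (H.Qv f h) = H.Qv (θ.comp f) (θ.comp h) := map_Ev θ f h _

lemma Rv_conv (hc : Legs f h) (x : G) :
    H.Rv f h * conv f h hc x = conv h f hc.symm x * H.Rv f h := by
  rw [conv_apply, conv_apply, Rv, ← Ev_mul hc, R_comul, Ev_mul hc, Ev_swap hc]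

lemma Rv_conv_left (hfh : Legs f h) (hfk : Legs f k) (hhk : Legs h k) :
    H.Rv (conv f h hfh) k = H.Rv f k * H.Rv h k := by
  rw [Rv, ← Ev3_comulLeft hfh hhk, comulLeft_R, Ev3_mul hfh hfk hhk, Ev3_leg13, Ev3_leg23]; rfl

lemma Rv_conv_right (hfh : Legs f h) (hfk : Legs f k) (hhk : Legs h k) :
    H.Rv f (conv h k hhk) = H.Rv f k * H.Rv f h := by
  rw [Rv, ← Ev3_comulRight hhk, comulRight_R, Ev3_mul hfh hfk hhk, Ev3_leg13, Ev3_leg12]; rfl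

/-- A homomorphism applied to one leg: `R(f,h)` intertwines for a third leg. -/
lemma Rv_Ev_left (hfh : Legs f h) (hfk : Legs f k) (hhk : Legs h k) (x : G ⊗[ℂ] G) :
    H.Rv f h * Ev (conv f h hfh) k x = Ev (conv h f hfh.symm) k x * H.Rv f h := by
  induction x with
  | tmul a b =>
    have := Ev_commute (fun x => (hfk x b).symm) (fun x => (hhk x b).symm) (H.R : G ⊗[ℂ] G)
    rw [Ev_tmul, Ev_tmul, ← mul_assoc, Rv_conv, mul_assoc, mul_assoc]
    congr 1; exact this.symm.eq
  | _ => simp_all [mul_add, add_mul]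

lemma yang_baxter (hfh : Legs f h) (hfk : Legs f k) (hhk : Legs h k) :
    H.Rv f h * H.Rv f k * H.Rv h k = H.Rv h k * H.Rv f k * H.Rv f h := by
  have := H.Rv_Ev_left hfh hfk hhk H.R
  change H.Rv f h * H.Rv (conv f h hfh) k = H.Rv (conv h f hfh.symm) k * H.Rv f h at this
  rwa [Rv_conv_left H hfh hfk hhk, Rv_conv_left H hfh.symm hhk hfk, ← mul_assoc] at this

lemma Rv_commute {z : A} (hf : ∀ x, Commute z (f x)) (hh : ∀ x, Commute z (h x)) :
    Commute z (H.Rv f h) := Ev_commute hf hh _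

lemma Ri_commute {z : A} (hf : ∀ x, Commute z (f x)) (hh : ∀ x, Commute z (h x)) :
    Commute z (H.Ri f h) := Ev_commute hf hh _

lemma Qv_commute {z : A} (hf : ∀ x, Commute z (f x)) (hh : ∀ x, Commute z (h x)) :
    Commute z (H.Qv f h) := Ev_commute hf hh _

/-- `R'R` commutes with the coproduct. -/
lemma Qv_commute_conv (hc : Legs f h) (x : G) : Commute (H.Qv f h) (conv f h hc x) := by
  rw [Qv_eq _ hc, Commute, SemiconjBy, mul_assoc, Rv_conv, ← mul_assoc, Rv_conv, mul_assoc]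

lemma Rv_triv_right (f : G →ₐ[ℂ] A) : H.Rv f (triv A) = 1 := by
  have hc := Legs.triv_right f
  have ht := Legs.triv_right (G := G) (triv A)
  have h1 := H.Rv_conv_right hc hc ht
  rw [conv_triv_right] at h1
  have h2 := congrArg (· * H.Ri f (triv A)) h1
  simpa [mul_assoc, H.Rv_mul_Ri hc] using h2.symm

lemma Rv_triv_left (f : G →ₐ[ℂ] A) : H.Rv (triv A) f = 1 := by
  have hc := Legs.triv_left f
  have ht := Legs.triv_right (G := G) (triv A)
  have h1 := H.Rv_conv_left ht hc hc
  rw [conv_triv_right] at h1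
  have h2 := congrArg (· * H.Ri (triv A) f) h1
  simpa [mul_assoc, H.Rv_mul_Ri hc] using h2.symm

lemma Ri_triv_right (f : G →ₐ[ℂ] A) : H.Ri f (triv A) = 1 := by
  simpa [H.Rv_triv_right] using H.Rv_mul_Ri (Legs.triv_right f)

lemma Ri_triv_left (f : G →ₐ[ℂ] A) : H.Ri (triv A) f = 1 := by
  simpa [H.Rv_triv_left] using H.Rv_mul_Ri (Legs.triv_left f)

end RibbonHopfStar

end

/-! ### The antipode and the `R`-matrix -/

section

open HopfAlgebra

lemma pairEval_antipode_comul (x : G) :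
    pairEval 𝒮 LinearMap.id (Δ x) = algebraMap ℂ G (Coalgebra.counit x) := by
  simpa [pairEval, rTensor] using mul_antipode_rTensor_comul_apply (R := ℂ) x

lemma pairEval_comul_antipode (x : G) :
    pairEval LinearMap.id 𝒮 (Δ x) = algebraMap ℂ G (Coalgebra.counit x) := by
  simpa [pairEval, lTensor] using mul_antipode_lTensor_comul_apply (R := ℂ) x

/-- `x ⊗ (y ⊗ z) ↦ x ⊗ φ (y ⊗ z)`. -/
def onLast (φ : G ⊗[ℂ] G →ₗ[ℂ] G) : G ⊗[ℂ] (G ⊗[ℂ] G) →ₗ[ℂ] G ⊗[ℂ] G :=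
  map LinearMap.id φ

/-- `x ⊗ (y ⊗ z) ↦ φ (x ⊗ y) ⊗ z`. -/
def onFirst (φ : G ⊗[ℂ] G →ₗ[ℂ] G) : G ⊗[ℂ] (G ⊗[ℂ] G) →ₗ[ℂ] G ⊗[ℂ] G :=
  map φ LinearMap.id ∘ₗ (assoc ℂ G G G).symm.toLinearMap

@[simp] lemma onLast_tmul (φ : G ⊗[ℂ] G →ₗ[ℂ] G) (x : G) (y : G ⊗[ℂ] G) :
    onLast φ (x ⊗ₜ y) = x ⊗ₜ φ y := by simp [onLast]

@[simp] lemma onFirst_tmul (φ : G ⊗[ℂ] G →ₗ[ℂ] G) (x y z : G) :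
    onFirst φ (x ⊗ₜ (y ⊗ₜ z)) = φ (x ⊗ₜ y) ⊗ₜ z := by simp [onFirst]

lemma onLast_comulRight {φ : G ⊗[ℂ] G →ₗ[ℂ] G}
    (hφ : ∀ x, φ (Δ x) = algebraMap ℂ G (Coalgebra.counit x))
    (x : G ⊗[ℂ] G) :
    onLast φ (comulRight G x) = (Ev (AlgHom.id ℂ G) (triv G) x) ⊗ₜ 1 := by
  induction x with
  | tmul a b =>
    simp [comulRight, hφ, algebraMap_eq_smul_one, smul_tmul']
  | _ => simp_all [add_tmul]

lemma onFirst_comulLeft {φ : G ⊗[ℂ] G →ₗ[ℂ] G}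
    (hφ : ∀ x, φ (Δ x) = algebraMap ℂ G (Coalgebra.counit x))
    (x : G ⊗[ℂ] G) :
    onFirst φ (comulLeft G x) = 1 ⊗ₜ (Ev (triv G) (AlgHom.id ℂ G) x) := by
  induction x with
  | tmul a b =>
    simp [comulLeft, onFirst, hφ, algebraMap_eq_smul_one, smul_tmul']
  | _ => simp_all [tmul_add]

/-- A finite expansion in simple tensors. -/
lemma exists_sum_tmul {M N : Type*} [AddCommGroup M]
    [Module ℂ M] [AddCommGroup N] [Module ℂ N] (z : M ⊗[ℂ] N) : ∃ (n : ℕ) (x : Fin n → M) (y : Fin n → N), z = ∑ i, x i ⊗ₜ y i := by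
  obtain ⟨s, hs⟩ := TensorProduct.exists_finset z
  refine ⟨s.card, fun i => (s.equivFin.symm i).1.1, fun i => (s.equivFin.symm i).1.2, ?_⟩
  rw [hs, ← Finset.sum_coe_sort]
  exact (Equiv.sum_comp s.equivFin.symm (fun i : s => i.1.1 ⊗ₜ[ℂ] i.1.2)).symm

/-- `x ⊗ (y ⊗ z) ↦ S²(z) S(y) t x`. -/
def tripleS (t : G) : G ⊗[ℂ] (G ⊗[ℂ] G) →ₗ[ℂ] G :=
  mul' ℂ G ∘ₗ (TensorProduct.comm ℂ G G).toLinearMap ∘ₗ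
    map (mulLeft ℂ t) (mul' ℂ G ∘ₗ (TensorProduct.comm ℂ G G).toLinearMap ∘ₗ
        map 𝒮 (𝒮 ∘ₗ 𝒮))

@[simp] lemma tripleS_tmul (t x y z : G) : tripleS t (x ⊗ₜ (y ⊗ₜ z))
    = 𝒮 (𝒮 z) * 𝒮 y * (t * x) := by simp [tripleS]

lemma tripleS_comulRight (t : G) (w : G ⊗[ℂ] G) :
    tripleS t (comulRight G w) = t * Ev (AlgHom.id ℂ G) (triv G) w := by
  induction w with
  | tmul a b =>
    have h : ∀ d : G ⊗[ℂ] G, tripleS t (a ⊗ₜ d) = 𝒮 (pairEval LinearMap.id 𝒮 d) * (t * a) := by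
      intro d
      induction d with
      | tmul c d => simp [antipode_mul_antidistrib]
      | _ => simp_all [tmul_add, add_mul]
    simp [comulRight, h, pairEval_comul_antipode, algebraMap_eq_smul_one]
  | _ => simp_all [mul_add]

variable [StarRing G] [StarModule ℂ G]

namespace RibbonHopfStar

variable (H : RibbonHopfStar G)

/-- The number of terms in a chosen expansion `R = ∑ r¹ ⊗ r²`. -/
def rn : ℕ := (exists_sum_tmul (H.R : G ⊗[ℂ] G)).choose

/-- The left factors in a chosen expansion `R = ∑ r¹ ⊗ r²`. -/
def rl : Fin H.rn → G := (exists_sum_tmul (H.R : G ⊗[ℂ] G)).choose_spec.choose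

/-- The right factors in a chosen expansion `R = ∑ r¹ ⊗ r²`. -/
def rr : Fin H.rn → G := (exists_sum_tmul (H.R : G ⊗[ℂ] G)).choose_spec.choose_spec.choose

lemma R_eq : (H.R : G ⊗[ℂ] G) = ∑ i, H.rl i ⊗ₜ H.rr i :=
  (exists_sum_tmul (H.R : G ⊗[ℂ] G)).choose_spec.choose_spec.choose_spec

lemma Rv_eq_sum (f h : G →ₐ[ℂ] A) : H.Rv f h = ∑ i, f (H.rl i) * h (H.rr i) := by
  simp [Rv, H.R_eq]

lemma u_eq_sum : H.u = ∑ i, 𝒮 (H.rr i) * H.rl i := by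
  rw [u, H.R_eq]; simp

lemma Ev_id_triv_R : Ev (AlgHom.id ℂ G) (triv G) (H.R : G ⊗[ℂ] G) = 1 :=
  H.Rv_triv_right (AlgHom.id ℂ G)

lemma Ev_triv_id_R : Ev (triv G) (AlgHom.id ℂ G) (H.R : G ⊗[ℂ] G) = 1 :=
  H.Rv_triv_left (AlgHom.id ℂ G)

lemma comulRight_R_sum :
    comulRight G H.R = ∑ i, ∑ j, (H.rl i * H.rl j) ⊗ₜ (H.rr j ⊗ₜ H.rr i) := by
  rw [comulRight_R, H.R_eq]
  simp [leg13, leg12, sum_mul_sum]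

lemma comulLeft_R_sum :
    comulLeft G H.R = ∑ i, ∑ j, H.rl i ⊗ₜ (H.rl j ⊗ₜ (H.rr i * H.rr j)) := by
  rw [comulLeft_R, H.R_eq]
  simp [leg13, leg23, sum_mul_sum]

/-- `∑ s¹ r¹ ⊗ S(r²) s² = 1`. -/
lemma sum_mul_tmul_antipode_mul :
    ∑ i, ∑ j, (H.rl i * H.rl j) ⊗ₜ[ℂ] (𝒮 (H.rr j) * H.rr i) = 1 := by
  have h := onLast_comulRight pairEval_antipode_comul (H.R : G ⊗[ℂ] G)
  rw [comulRight_R_sum, Ev_id_triv_R] at h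
  simpa [one_def] using h

/-- `∑ S(r¹) s¹ ⊗ r² s² = 1`. -/
lemma sum_antipode_mul_tmul_mul :
    ∑ i, ∑ j, (𝒮 (H.rl i) * H.rl j) ⊗ₜ[ℂ] (H.rr i * H.rr j) = 1 := by
  have h := onFirst_comulLeft pairEval_antipode_comul (H.R : G ⊗[ℂ] G)
  rw [comulLeft_R_sum, Ev_triv_id_R] at h
  simpa [one_def] using h

/-- `R⁻¹ = (S ⊗ id)(R)`. -/
lemma inv_R_eq : ((H.R⁻¹ : (G ⊗[ℂ] G)ˣ) : G ⊗[ℂ] G) = ∑ i, 𝒮 (H.rl i) ⊗ₜ H.rr i := by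
  symm
  rw [← Units.mul_eq_one_iff_eq_inv]
  have h := H.sum_antipode_mul_tmul_mul
  conv_lhs => rw [H.R_eq]
  simpa [sum_mul_sum] using h

lemma Ri_eq_sum (f h : G →ₐ[ℂ] A) :
    H.Ri f h = ∑ i, f (𝒮 (H.rl i)) * h (H.rr i) := by
  simp [Ri, H.inv_R_eq]

/-- `(S ⊗ S)(R) = R`. -/
lemma antipode_antipode_R :
    map 𝒮 𝒮 (H.R : G ⊗[ℂ] G) = H.R := by
  have h := congrArg (map 𝒮 LinearMap.id) H.sum_mul_tmul_antipode_mul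
  have h1 : map 𝒮 (LinearMap.id : G →ₗ[ℂ] G) (1 : G ⊗[ℂ] G) = 1 := by
    simp [one_def]
  rw [h1] at h
  have h2 : map 𝒮 𝒮 (H.R : G ⊗[ℂ] G) * ((H.R⁻¹ : (G ⊗[ℂ] G)ˣ) : G ⊗[ℂ] G) = 1 := by
    rw [← h, inv_R_eq, H.R_eq]
    simp only [map_sum, map_tmul, antipode_mul_antidistrib, id_apply, sum_mul_sum, tmul_mul_tmul]
    exact sum_comm
  rwa [Units.mul_inv_eq_one] at h2

/-- `∑ S(t¹) r¹ ⊗ r² t² = 1` for `R⁻¹ = ∑ t¹ ⊗ t² = ∑ r¹ ⊗ r²`. -/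
lemma sum_inv_cancel :
    ∑ i, ∑ j, (𝒮 (𝒮 (H.rl j)) * 𝒮 (H.rl i)) ⊗ₜ[ℂ] (H.rr i * H.rr j) = 1 := by
  have h : (H.R : G ⊗[ℂ] G) * ((H.R⁻¹ : (G ⊗[ℂ] G)ˣ) : G ⊗[ℂ] G) = 1 := by simp
  rw [inv_R_eq, H.R_eq] at h
  have h1 := congrArg (map 𝒮 LinearMap.id) h
  simpa [sum_mul_sum, one_def, antipode_mul_antidistrib] using h1

/-- The factor `R` between two elements can be removed. -/
lemma cancel_Rv {a b : G →ₐ[ℂ] A} (hab : Legs a b) {P Q : A} (hP : ∀ x, Commute P (b x))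
    (hQ : ∀ x, Commute Q (a x)) :
    ∑ j, b (𝒮 (H.rr j)) * (P * H.Rv a b * Q) * a (H.rl j) = P * Q := by
  have h := congrArg (fun z => P * Ev a b z * Q) H.sum_mul_tmul_antipode_mul
  simp only [Ev_one, mul_one] at h
  rw [← h, sum_comm]
  simp only [map_sum, mul_sum, sum_mul, Ev_tmul, Rv_eq_sum]
  refine sum_congr rfl fun j _ => sum_congr rfl fun i _ => ?_
  rw [map_mul, map_mul]
  calc b (𝒮 (H.rr j)) * (P * (a (H.rl i) * b (H.rr i)) * Q) * a (H.rl j)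
      = (b (𝒮 (H.rr j)) * P) * (a (H.rl i) * b (H.rr i)) * (Q * a (H.rl j)) := by
        simp only [mul_assoc]
    _ = P * (b (𝒮 (H.rr j)) * a (H.rl i)) * (b (H.rr i) * a (H.rl j)) * Q := by
        rw [← (hP _).eq, (hQ _).eq]; simp only [mul_assoc]
    _ = P * (a (H.rl i) * a (H.rl j) * (b (𝒮 (H.rr j)) * b (H.rr i))) * Q := by
        rw [← (hab _ _).eq, ← (hab _ _).eq]
        simp only [mul_assoc]
        rw [← mul_assoc (b _) (a _), ← (hab _ _).eq]
        simp only [mul_assoc]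

/-- The factor `R⁻¹` between two elements can be removed. -/
lemma cancel_Ri {a b : G →ₐ[ℂ] A} {P Q : A} (hP : ∀ x, Commute P (a x))
    (hQ : ∀ x, Commute Q (b x)) :
    ∑ j, a (𝒮 (𝒮 (H.rl j))) * (P * H.Ri a b * Q) * b (H.rr j) = P * Q := by
  have h := congrArg (fun z => P * Ev a b z * Q) H.sum_inv_cancel
  simp only [Ev_one, mul_one] at h
  rw [← h, sum_comm]
  simp only [map_sum, mul_sum, sum_mul, Ev_tmul, Ri_eq_sum]
  refine sum_congr rfl fun j _ => sum_congr rfl fun i _ => ?_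
  rw [map_mul, map_mul]
  generalize 𝒮 (H.rl i) = s, 𝒮 (𝒮 (H.rl j)) = t
  calc a t * (P * (a s * b (H.rr i)) * Q) * b (H.rr j)
      = (a t * P) * (a s * b (H.rr i)) * (Q * b (H.rr j)) := by simp only [mul_assoc]
    _ = P * a t * (a s * b (H.rr i)) * (b (H.rr j) * Q) := by rw [← (hP _).eq, (hQ _).eq]
    _ = _ := by simp only [mul_assoc]

end RibbonHopfStar

namespace RibbonHopfStar

variable (H : RibbonHopfStar G)

lemma tripleS_leg12_R (w : G ⊗[ℂ] (G ⊗[ℂ] G)) :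
    tripleS 1 (leg12 G H.R * w) = tripleS H.u w := by
  induction w with
  | tmul x w =>
    induction w with
    | tmul y z =>
      rw [u_eq_sum, R_eq]
      simp [leg12, sum_mul, mul_sum, antipode_mul_antidistrib, mul_assoc]
    | _ => simp_all [mul_add, tmul_add]
  | _ => simp_all [mul_add]

lemma tripleS_leg12_comulLeft (w : G ⊗[ℂ] G) :
    tripleS 1 (leg12 G H.R * comulLeft G w) = 𝒮 (𝒮 (Ev (triv G) (AlgHom.id ℂ G) w)) * H.u := by
  induction w with
  | tmul a b =>
    have h1 : ∀ z d : G ⊗[ℂ] G, leg12 G z * assoc ℂ G G G (d ⊗ₜ b)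
        = assoc ℂ G G G ((z * d) ⊗ₜ b) := by
      intro z d
      induction z with
      | tmul p q =>
        induction d with
        | tmul r s => simp [leg12]
        | _ => simp_all [mul_add, add_tmul]
      | _ => simp_all [add_mul, add_tmul]
    have h2 : ∀ d : G ⊗[ℂ] G, tripleS 1 (assoc ℂ G G G ((swapLegs G d * (H.R : G ⊗[ℂ] G)) ⊗ₜ b))
        = 𝒮 (𝒮 b) * ∑ i, 𝒮 (H.rr i) * pairEval 𝒮 LinearMap.id d * H.rl i := by
      intro d
      induction d with
      | tmul r s =>
        rw [R_eq]
        simp [mul_sum, sum_tmul, antipode_mul_antidistrib, mul_assoc]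
      | _ => simp_all [add_mul, mul_add, add_tmul, Finset.sum_add_distrib]
    simp only [comulLeft, LinearMap.comp_apply, map_tmul, id_apply]
    erw [h1, R_comul, h2]
    simp [pairEval_antipode_comul, algebraMap_eq_smul_one, u_eq_sum, ← smul_sum]
  | _ => simp_all [mul_add, add_mul]

/-- The square of the antipode is implemented by `u`. -/
lemma antipode_antipode_mul_u (x : G) : 𝒮 (𝒮 x) * H.u = H.u * x := by
  have h1 : comulLeft G (Δ x) = comulRight G (Δ x) :=
    coassoc_apply x
  have h2 := H.tripleS_leg12_comulLeft (Δ x)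
  rw [h1, tripleS_leg12_R, tripleS_comulRight, ← conv_apply (Legs.triv_right _),
    ← conv_apply (Legs.triv_left _), conv_triv_left, conv_triv_right] at h2
  exact h2.symm

/-- `∑ s² u s¹ = 1`. -/
lemma sum_rr_u_rl : ∑ i, H.rr i * H.u * H.rl i = 1 := by
  have h := onLast_comulRight pairEval_comul_antipode (H.R : G ⊗[ℂ] G)
  rw [comulRight_R_sum, Ev_id_triv_R] at h
  have h3 := congrArg (mul' ℂ G ∘ₗ (TensorProduct.comm ℂ G G).toLinearMap) h
  simp only [map_sum, onLast_tmul, pairEval_tmul, id_apply, LinearMap.comp_apply,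
    LinearEquiv.coe_coe, comm_tmul, mul'_apply, mul_one] at h3
  rw [← h3, u_eq_sum]
  simp only [mul_sum, sum_mul]
  rw [sum_comm]
  simp [mul_assoc]

variable [FiniteDimensional ℂ G]

lemma isUnit_u : IsUnit H.u := by
  have h : H.u * (𝒮 H.u * ((H.v⁻¹ ^ 2 : Gˣ) : G)) = 1 := by
    rw [← mul_assoc]
    have := H.v_sq
    change (H.v : G) ^ 2 = H.u * 𝒮 H.u at this
    rw [← this, ← Units.val_pow_eq_pow_val, ← val_mul, inv_pow, mul_inv_cancel, Units.val_one]
  have : IsNoetherianRing G := isNoetherian_of_tower ℂ inferInstance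
  exact IsUnit.of_mul_eq_one _ h

/-- The element `u` as a unit. -/
def uU : Gˣ := H.isUnit_u.unit

lemma val_uU : (H.uU : G) = H.u := rfl

/-- The element `g = u⁻¹ v` as a unit. -/
def gU : Gˣ := H.uU⁻¹ * H.v

lemma val_gU : (H.gU : G) = H.grp := by
  rw [gU, grp, ← H.val_uU, Ring.inverse_unit]; rfl

lemma antipode_antipode (x : G) :
    𝒮 (𝒮 x) = H.uU * x * ↑H.uU⁻¹ := by
  rw [val_uU, ← antipode_antipode_mul_u, mul_assoc, ← H.val_uU, Units.mul_inv, mul_one]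

/-- `x g = g S²(x)`. -/
lemma mul_g (x : G) : x * H.gU = H.gU * 𝒮 (𝒮 x) := by
  rw [H.antipode_antipode, gU, val_mul]
  have h1 := H.v_central (H.uU * x * ↑H.uU⁻¹)
  rw [mul_assoc, h1]
  simp only [← mul_assoc, inv_mul, one_mul]

lemma antipode_surjective (H : RibbonHopfStar G) : Surjective (𝒮 : G →ₗ[ℂ] G) := by
  intro y
  refine ⟨𝒮 (↑H.uU⁻¹ * y * H.uU), ?_⟩
  rw [H.antipode_antipode]
  simp [← mul_assoc]

lemma gU_inv : H.gU⁻¹ = H.v⁻¹ * H.uU := by simp [gU]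

/-- `∑ s² g⁻¹ s¹ = v⁻¹`. -/
lemma sum_rr_g_inv_rl : ∑ i, H.rr i * ((H.gU⁻¹ : Gˣ) : G) * H.rl i = ((H.v⁻¹ : Gˣ) : G) := by
  have hv : ∀ x : G, ((H.v⁻¹ : Gˣ) : G) * x = x * ((H.v⁻¹ : Gˣ) : G) := fun x => by
    rw [Units.inv_mul_eq_iff_eq_mul, ← mul_assoc, H.v_central, mul_assoc, Units.mul_inv, mul_one]
  have h := congrArg (((H.v⁻¹ : Gˣ) : G) * ·) H.sum_rr_u_rl
  simp only [mul_one, mul_sum] at h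
  rw [← h, gU_inv]
  refine sum_congr rfl fun i _ => ?_
  rw [val_mul, H.val_uU, ← mul_assoc, ← hv]
  simp only [mul_assoc]

end RibbonHopfStar
end

variable [StarRing G] [StarModule ℂ G]

/-! ### The symmetry algebra as a product of matrix algebras -/

section

lemma isIrreducibleRep_of_surjective {A n : Type*} [Semiring A] [Algebra ℂ A] [Fintype n]
    [DecidableEq n] [Nonempty n] {ρ : A →ₐ[ℂ] Matrix n n ℂ} (hρ : Surjective ρ) :
    IsIrreducibleRep ρ := by
  refine ⟨inferInstance, fun p hp => or_iff_not_imp_left.2 fun hne => ?_⟩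
  obtain ⟨v, hv, hv0⟩ := p.ne_bot_iff.1 hne
  obtain ⟨k, hk⟩ := ne_iff.1 hv0
  have key : ∀ a, Pi.single a (1 : ℂ) ∈ p := by
    intro a
    obtain ⟨x, hx⟩ := hρ (Matrix.single a k (v k)⁻¹)
    have := hp x v hv
    rw [hx] at this
    convert this using 1
    ext b
    simp only [Pi.zero_apply] at hk
    by_cases hb : b = a
    · subst hb
      simp [Matrix.mulVec, dotProduct, single_apply, hk]
    · simp [hb, Matrix.single_mulVec]
  refine eq_top_iff.2 fun w _ => ?_
  rw [pi_eq_sum_univ' w]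
  exact p.sum_mem fun i _ => p.smul_mem _ (by simpa [Pi.single_apply, eq_comm] using key i)

lemma RepEquivalent.symm {A n k : Type*} [Semiring A] [Algebra ℂ A] [Fintype n] [DecidableEq n]
    [Fintype k] [DecidableEq k] {ρ : A →ₐ[ℂ] Matrix n n ℂ} {σ : A →ₐ[ℂ] Matrix k k ℂ}
    (h : RepEquivalent ρ σ) : RepEquivalent σ ρ := by
  obtain ⟨e, he⟩ := h
  exact ⟨e.symm, fun a v => by rw [e.symm_apply_eq, he, e.apply_symm_apply]⟩

lemma RepEquivalent.trans {A n k l : Type*} [Semiring A] [Algebra ℂ A] [Fintype n]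
    [DecidableEq n] [Fintype k] [DecidableEq k] [Fintype l] [DecidableEq l]
    {ρ : A →ₐ[ℂ] Matrix n n ℂ} {σ : A →ₐ[ℂ] Matrix k k ℂ} {π : A →ₐ[ℂ] Matrix l l ℂ}
    (h : RepEquivalent ρ σ) (h' : RepEquivalent σ π) : RepEquivalent ρ π := by
  obtain ⟨e, he⟩ := h
  obtain ⟨e', he'⟩ := h'
  exact ⟨e.trans e', fun a v => by simp [he, he']⟩

/-- Every irreducible representation of a product of matrix algebras is one of the
projections. -/
lemma exists_repEquivalent_projection {n : ℕ} {d : Fin n → ℕ}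
    (e : A ≃ₐ[ℂ] ∀ i, Matrix (Fin (d i)) (Fin (d i)) ℂ) {m : Type*} [Fintype m] [DecidableEq m]
    {ρ : A →ₐ[ℂ] Matrix m m ℂ} (hρ : IsIrreducibleRep ρ) :
    ∃ i, RepEquivalent ((evalAlgHom ℂ _ i).comp e.toAlgHom) ρ := by
  obtain ⟨hm, hirr⟩ := hρ
  obtain ⟨j0⟩ := hm
  let F : ∀ i, Fin (d i) → Fin (d i) → A := fun i k l =>
    e.symm (Pi.single i (Matrix.single k l 1))
  have hF : ∑ i, ∑ k, F i k k = 1 := by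
    apply e.injective
    simp only [F, map_sum, AlgEquiv.apply_symm_apply, map_one]
    funext i
    simp only [Finset.sum_apply]
    rw [sum_eq_single i]
    · simp only [Pi.single_eq_same]
      ext a b
      simp [Matrix.sum_apply, Matrix.one_apply, single_apply,
        Finset.filter_and, Finset.filter_eq']
      by_cases h : a = b <;> simp [h]
    · intro j _ hj
      exact sum_eq_zero fun k _ => by rw [single_eq_of_ne hj.symm]
    · simp
  have hex : ∃ i k, ρ (F i k k) ≠ 0 := by
    by_contra! h
    have := congrArg ρ hF
    simp only [map_sum, h, Finset.sum_const_zero, map_one] at this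
    have := congrFun (congrFun this j0) j0
    simp at this
  obtain ⟨i, k, hik⟩ := hex
  obtain ⟨w0, hw0⟩ : ∃ w0, ρ (F i k k) *ᵥ w0 ≠ 0 := by
    by_contra! h
    exact hik (ext_iff_mulVec.2 fun v => by simp [h])
  set w := ρ (F i k k) *ᵥ w0 with hw
  set L : (Fin (d i) → ℂ) →ₗ[ℂ] (m → ℂ) :=
    ∑ l, (proj l).smulRight (ρ (F i l k) *ᵥ w) with hL
  have hLa : ∀ x, L x = ∑ l, x l • (ρ (F i l k) *ᵥ w) := fun x => by simp [hL]
  have hmul : ∀ a l, a * F i l k = ∑ q, e a i q l • F i q k := by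
    intro a l
    apply e.injective
    simp only [F, map_mul, map_sum, map_smul, AlgEquiv.apply_symm_apply]
    funext j
    by_cases hj : j = i
    · subst hj
      ext b c
      simp only [Pi.mul_apply, Pi.single_eq_same, Finset.sum_apply, Pi.smul_apply,
        Matrix.sum_apply, Matrix.smul_apply]
      by_cases hc : c = k
      · subst hc; simp [single_apply]
      · simp [hc, Ne.symm hc]
    · simp [single_eq_of_ne hj]
  have hint : ∀ a x, L (e a i *ᵥ x) = ρ a *ᵥ L x := by
    intro a x
    have h1 : ∀ l, ρ a *ᵥ (ρ (F i l k) *ᵥ w) = ∑ q, e a i q l • (ρ (F i q k) *ᵥ w) := by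
      intro l
      rw [mulVec_mulVec, ← map_mul, hmul]
      simp [sum_mulVec, smul_mulVec]
    simp only [hLa, mulVec_sum, mulVec_smul, h1, Matrix.mulVec, dotProduct,
      smul_sum, sum_smul, smul_smul]
    rw [sum_comm]
    simp only [mul_comm]
  have hLk : L (Pi.single k 1) = w := by
    have : ρ (F i k k) *ᵥ w = w := by
      rw [hw, mulVec_mulVec, ← map_mul, hmul]
      simp [F, single_apply, Finset.sum_ite_eq]
    simp [hLa, Pi.single_apply, this]
  have : Nonempty (Fin (d i)) := ⟨k⟩
  have hsurj : Surjective ((evalAlgHom ℂ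
      (fun i => Matrix (Fin (d i)) (Fin (d i)) ℂ) i).comp e.toAlgHom) := fun y =>
    ⟨e.symm (Pi.single i y), by simp⟩
  have hker : ker L = ⊥ := by
    refine ((isIrreducibleRep_of_surjective hsurj).2 (ker L) fun a v hv => ?_).resolve_right
      fun h => hw0 ?_
    · rw [mem_ker] at hv ⊢
      exact (hint a v).trans (by rw [hv, Matrix.mulVec_zero])
    · rw [← hLk, ← mem_ker, h]; trivial
  have hrange : LinearMap.range L = ⊤ := by
    refine (hirr (LinearMap.range L) ?_).resolve_left fun h => hw0 ?_
    · rintro a _ ⟨v, rfl⟩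
      exact ⟨_, hint a v⟩
    · rw [← hLk, ← Submodule.mem_bot ℂ, ← h]; exact ⟨_, rfl⟩
  exact ⟨i, LinearEquiv.ofBijective L ⟨ker_eq_bot.1 hker, range_eq_top.1 hrange⟩,
    fun a v => hint a v⟩

variable {ι : Type} (H : SymmetryData G ι)

namespace SymmetryData

lemma exists_wedderburn (H : SymmetryData G ι) : ∃ (n : ℕ) (d : Fin n → ℕ), (∀ i, NeZero (d i)) ∧
    Nonempty (G ≃ₐ[ℂ] ∀ i, Matrix (Fin (d i)) (Fin (d i)) ℂ) := by
  have := H.semisimple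
  have := H.finiteDimensional
  exact IsSemisimpleRing.exists_algEquiv_pi_matrix_of_isAlgClosed ℂ G

lemma eq_zero_of_τ {x : G} (hx : ∀ I, H.τ I x = 0) : x = 0 := by
  obtain ⟨n, d, hd, ⟨e⟩⟩ := H.exists_wedderburn
  apply e.injective
  rw [map_zero]
  funext i
  have hsurj : Surjective ((evalAlgHom ℂ
      (fun i => Matrix (Fin (d i)) (Fin (d i)) ℂ) i).comp e.toAlgHom) := fun y =>
    ⟨e.symm (Pi.single i y), by simp⟩
  have : Nonempty (Fin (d i)) := ⟨0⟩
  obtain ⟨I, f, hf⟩ := H.τ_complete _ _ (isIrreducibleRep_of_surjective hsurj)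
  refine ext_iff_mulVec.2 fun v => f.injective ?_
  have := hf x v
  rw [hx] at this
  simpa using this

lemma ext_τ {x y : G} (h : ∀ I, H.τ I x = H.τ I y) : x = y :=
  sub_eq_zero.1 (H.eq_zero_of_τ fun I => by rw [map_sub, h, sub_self])

lemma exists_τ_eq (I : ι) (Y : 𝕄[H, I, ℂ]) :
    ∃ x, H.τ I x = Y ∧ ∀ J, J ≠ I → H.τ J x = 0 := by
  obtain ⟨n, d, hd, ⟨e⟩⟩ := H.exists_wedderburn
  obtain ⟨i, E, hE⟩ := exists_repEquivalent_projection e (H.τ_irreducible I)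
  refine ⟨e.symm (Pi.single i (toMatrix' (E.symm.toLinearMap ∘ₗ Y.mulVecLin ∘ₗ
    E.toLinearMap))), ?_, ?_⟩
  · refine ext_iff_mulVec.2 fun v => ?_
    obtain ⟨w, rfl⟩ := E.surjective v
    rw [← hE]
    simp [← Matrix.toLin'_apply (toMatrix' _)]
  · intro J hJ
    obtain ⟨j, F, hF⟩ := exists_repEquivalent_projection e (H.τ_irreducible J)
    refine ext_iff_mulVec.2 fun v => ?_
    obtain ⟨w, rfl⟩ := F.surjective v
    have hij : j ≠ i := by
      rintro rfl
      exact hJ (H.τ_inequivalent J I ((RepEquivalent.symm ⟨F, hF⟩).trans ⟨E, hE⟩))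
    rw [← hF]
    simp [single_eq_of_ne hij]

/-- The matrix units of `G`. -/
def mu (I : ι) (a b : Fin (H.δ I)) : G := (H.exists_τ_eq I (Matrix.single a b 1)).choose

@[simp] lemma τ_mu_self (I : ι) (a b : Fin (H.δ I)) :
    H.τ I (H.mu I a b) = Matrix.single a b 1 :=
  (H.exists_τ_eq I (Matrix.single a b 1)).choose_spec.1

lemma τ_mu_of_ne {I J : ι} (h : J ≠ I) (a b : Fin (H.δ I)) : H.τ J (H.mu I a b) = 0 :=
  (H.exists_τ_eq I (Matrix.single a b 1)).choose_spec.2 J h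

variable [Fintype ι]

lemma eq_sum_mu (x : G) : x = ∑ I, ∑ a, ∑ b, H.τ I x a b • H.mu I a b := by
  refine H.ext_τ fun J => ?_
  simp only [map_sum, map_smul]
  rw [sum_eq_single J]
  · simp only [τ_mu_self]
    conv_lhs => rw [Matrix.matrix_eq_sum_single (H.τ J x)]
    simp [Matrix.smul_single]
  · intro I _ hI
    simp [H.τ_mu_of_ne hI.symm]
  · simp

variable {M : Type*} [AddCommGroup M] [Module ℂ M]

/-- The functional `ξ ↦ τ^I(ξ)_{ab}` applied to the first leg. -/
def coef (I : ι) (a b : Fin (H.δ I)) : G ⊗[ℂ] M →ₗ[ℂ] M :=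
  (lid ℂ M).toLinearMap ∘ₗ rTensor M (entry (A := ℂ) (H.τ I) a b)

@[simp] lemma coef_tmul (I : ι) (a b : Fin (H.δ I)) (x : G) (m : M) :
    H.coef I a b (x ⊗ₜ[ℂ] m) = H.τ I x a b • m := by
  simp [coef, entry]

lemma eq_sum_coef (z : G ⊗[ℂ] M) : z = ∑ I, ∑ a, ∑ b, H.mu I a b ⊗ₜ H.coef I a b z := by
  induction z with
  | zero => simp
  | add x y hx hy =>
    simp only [map_add, tmul_add, Finset.sum_add_distrib]
    rw [← hx, ← hy]
  | tmul x m =>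
    conv_lhs => rw [H.eq_sum_mu x]
    simp [sum_tmul, TensorProduct.smul_tmul]

lemma ext_coef {z w : G ⊗[ℂ] M} (h : ∀ I a b, H.coef I a b z = H.coef I a b w) : z = w := by
  rw [H.eq_sum_coef z, H.eq_sum_coef w]
  simp [h]

lemma linearIndependent_mu : LinearIndependent ℂ
    fun p : (Σ I : ι, Fin (H.δ I) × Fin (H.δ I)) => H.mu p.1 p.2.1 p.2.2 := by
  classical
  rw [Fintype.linearIndependent_iff]
  intro c hc ⟨I, a, b⟩
  have h := congrArg (fun x => H.τ I x a b) hc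
  simp only [map_sum, map_smul, map_zero, Matrix.zero_apply, Matrix.sum_apply,
    Matrix.smul_apply] at h
  rw [sum_eq_single ⟨I, a, b⟩] at h
  · simpa using h
  · rintro ⟨J, c, d⟩ _ hne
    by_cases hJ : J = I
    · subst hJ
      have : ¬ (c = a ∧ d = b) := by rintro ⟨rfl, rfl⟩; exact hne rfl
      simp [this]
    · simp [H.τ_mu_of_ne (Ne.symm hJ)]
  · simp

/-- The basis of matrix units. -/
def muBasis : Module.Basis (Σ I : ι, Fin (H.δ I) × Fin (H.δ I)) ℂ G :=
  Module.Basis.mk H.linearIndependent_mu (by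
    intro x _
    rw [H.eq_sum_mu x]
    exact Submodule.sum_mem _ fun I _ => Submodule.sum_mem _ fun a _ => Submodule.sum_mem _
      fun b _ => smul_mem _ _ (subset_span ⟨⟨I, a, b⟩, rfl⟩))

lemma finrank_eq_card :
    finrank ℂ G = card (Σ I : ι, Fin (H.δ I) × Fin (H.δ I)) :=
  Module.finrank_eq_card_basis H.muBasis

/-- Schur's lemma. -/
lemma schur_ne {I J : ι} (h : I ≠ J) {X : Matrix (Fin (H.δ I)) (Fin (H.δ J)) ℂ}
    (hX : ∀ x, H.τ I x * X = X * H.τ J x) : X = 0 := by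
  obtain ⟨x, hx, hx'⟩ := H.exists_τ_eq I 1
  have := hX x
  rwa [hx, hx' J h.symm, Matrix.one_mul, Matrix.mul_zero] at this

/-- Schur's lemma. -/
lemma schur_self {I : ι} {X : 𝕄[H, I, ℂ]}
    (hX : ∀ x, H.τ I x * X = X * H.τ I x) : ∃ c : ℂ, X = c • 1 := by
  have h : X ∈ Set.range (Matrix.scalar (Fin (H.δ I))) := by
    rw [Matrix.mem_range_scalar_iff_commute_single']
    intro a b
    have := hX (H.mu I a b)
    rwa [τ_mu_self] at this
  obtain ⟨c, hc⟩ := h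
  exact ⟨c, by rw [← hc, Matrix.scalar_apply, Matrix.smul_one_eq_diagonal]⟩

lemma δ_pos (I : ι) : 0 < H.δ I := Fin.pos_iff_nonempty.2 (H.τ_irreducible I).1

end SymmetryData
end

/-! ### Homomorphisms into matrices over an algebra -/

section

variable {n : Type*} [Fintype n] [DecidableEq n] {k : Type*} [Fintype k] [DecidableEq k]
variable {l : Type*} [Fintype l]

/-- Complex matrices as matrices over `A`. -/
def numAlg (A : Type*) [Ring A] [Algebra ℂ A] (n : Type*) [Fintype n] [DecidableEq n] :
    Matrix n n ℂ →ₐ[ℂ] Matrix n n A := (ofId ℂ A).mapMatrix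

lemma numAlg_apply (X : Matrix n n ℂ) : numAlg A n X = num X := rfl

lemma num_mul (X : Matrix n k ℂ) (Y : Matrix k l ℂ) :
    (num (X * Y) : Matrix n l A) = (num X : Matrix n k A) * (num Y : Matrix k l A) := Matrix.map_mul

/-- The elements of `A` as scalar matrices. -/
def scal (A : Type*) [Ring A] [Algebra ℂ A] (n : Type*) [Fintype n] [DecidableEq n] :
    A →ₐ[ℂ] Matrix n n A := Matrix.scalarAlgHom n ℂ

lemma scal_apply (x : A) : scal A n x = Matrix.diagonal fun _ => x := rfl

/-- `X ↦ X ⊗ 1`. -/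
def inFirstHom (A : Type*) [Ring A] [Algebra ℂ A] (n k : Type*) [Fintype n] [DecidableEq n]
    [Fintype k] [DecidableEq k] : Matrix n n A →ₐ[ℂ] Matrix (n × k) (n × k) A :=
  ofLinearMap
    { toFun := fun X => inFirst k X
      map_add' := fun X Y => by ext; simp [inFirst, add_mul]
      map_smul' := fun c X => by ext; simp [inFirst] }
    (by ext ⟨a, b⟩ ⟨c, d⟩; by_cases h1 : a = c <;> by_cases h2 : b = d <;>
      simp [inFirst, Matrix.one_apply, h1, h2])
    (fun X Y => by
      ext ⟨a, b⟩ ⟨c, d⟩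
      simp [inFirst, Matrix.mul_apply, sum_prod_type, Matrix.one_apply])

/-- `X ↦ 1 ⊗ X`. -/
def inSecondHom (A : Type*) [Ring A] [Algebra ℂ A] (n k : Type*) [Fintype n] [DecidableEq n]
    [Fintype k] [DecidableEq k] : Matrix k k A →ₐ[ℂ] Matrix (n × k) (n × k) A :=
  ofLinearMap
    { toFun := fun X => inSecond n X
      map_add' := fun X Y => by ext; simp [inSecond, mul_add]
      map_smul' := fun c X => by ext; simp [inSecond] }
    (by ext ⟨a, b⟩ ⟨c, d⟩; by_cases h1 : a = c <;> by_cases h2 : b = d <;>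
      simp [inSecond, Matrix.one_apply, h1, h2])
    (fun X Y => by
      ext ⟨a, b⟩ ⟨c, d⟩
      simp [inSecond, Matrix.mul_apply, sum_prod_type, Matrix.one_apply])

lemma inFirstHom_apply (X : Matrix n n A) : inFirstHom A n k X = inFirst k X := rfl

lemma inSecondHom_apply (X : Matrix k k A) : inSecondHom A n k X = inSecond n X := rfl

lemma inFirstHom_scal (x : A) : inFirstHom A n k (scal A n x) = scal A (n × k) x := by
  ext ⟨a, b⟩ ⟨c, d⟩
  by_cases h1 : a = c <;> by_cases h2 : b = d <;>
    simp [inFirstHom_apply, inFirst, scal_apply, h1, h2]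

lemma inSecondHom_scal (x : A) : inSecondHom A n k (scal A k x) = scal A (n × k) x := by
  ext ⟨a, b⟩ ⟨c, d⟩
  by_cases h1 : a = c <;> by_cases h2 : b = d <;>
    simp [inSecondHom_apply, inSecond, scal_apply, h1, h2]

lemma num_mul_scal (X : Matrix n k ℂ) (x : A) :
    (num X : Matrix n k A) * scal A k x = scal A n x * (num X : Matrix n k A) := by
  ext a b
  simpa [scal_apply, num] using Algebra.commutes _ _

lemma num_commute_scal (X : Matrix n n ℂ) (x : A) : Commute (numAlg A n X) (scal A n x) :=
  num_mul_scal X x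

lemma inFirst_commute_inSecond_num (X : Matrix n n A) (Y : Matrix k k ℂ) :
    Commute (inFirstHom A n k X) (inSecondHom A n k (numAlg A k Y)) := by
  ext ⟨a, b⟩ ⟨c, d⟩
  simp [inFirstHom_apply, inSecondHom_apply, inFirst, inSecond, Matrix.mul_apply, numAlg_apply,
    sum_prod_type, Matrix.one_apply, num, Algebra.commutes]

lemma inFirst_num_commute_inSecond (X : Matrix n n ℂ) (Y : Matrix k k A) :
    Commute (inFirstHom A n k (numAlg A n X)) (inSecondHom A n k Y) := by
  ext ⟨a, b⟩ ⟨c, d⟩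
  simp [inFirstHom_apply, inSecondHom_apply, inFirst, inSecond, Matrix.mul_apply, numAlg_apply,
    sum_prod_type, Matrix.one_apply, num, Algebra.commutes]

/-- A matrix representation, with values in the matrices over `A`. -/
def numHom (A : Type*) [Ring A] [Algebra ℂ A] (ρ : G →ₐ[ℂ] Matrix n n ℂ) :
    G →ₐ[ℂ] Matrix n n A := (numAlg A n).comp ρ

lemma legs_numHom_scal (ρ : G →ₐ[ℂ] Matrix n n ℂ) (φ : G →ₐ[ℂ] A) :
    Legs (numHom A ρ) ((scal A n).comp φ) := fun _ _ => num_commute_scal _ _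

lemma evalMat_eq_Ev (ρ : G →ₐ[ℂ] Matrix n n ℂ) (φ : G →ₐ[ℂ] A) (x : G ⊗[ℂ] G) :
    evalMat ρ φ.toLinearMap x = Ev (numHom A ρ) ((scal A n).comp φ) x := by
  ext a b
  induction x with
  | zero => simp [evalMat]
  | add x y hx hy =>
    rw [map_add, Matrix.add_apply, ← hx, ← hy]
    simp [evalMat]
  | tmul x y => simp [evalMat, entry, numHom, numAlg_apply, num, scal_apply]

/-- A representation on the first of two factors. -/
def legFst (A : Type*) [Ring A] [Algebra ℂ A] (k : Type*) [Fintype k] [DecidableEq k]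
    (ρ : G →ₐ[ℂ] Matrix n n ℂ) : G →ₐ[ℂ] Matrix (n × k) (n × k) A :=
  (inFirstHom A n k).comp (numHom A ρ)

/-- A representation on the second of two factors. -/
def legSnd (A : Type*) [Ring A] [Algebra ℂ A] (n : Type*) [Fintype n] [DecidableEq n]
    (σ : G →ₐ[ℂ] Matrix k k ℂ) : G →ₐ[ℂ] Matrix (n × k) (n × k) A :=
  (inSecondHom A n k).comp (numHom A σ)

lemma legs_fst_snd (ρ : G →ₐ[ℂ] Matrix n n ℂ) (σ : G →ₐ[ℂ] Matrix k k ℂ) :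
    Legs (legFst A k ρ) (legSnd A n σ) := fun _ _ => inFirst_commute_inSecond_num _ _

lemma legs_fst_scal (ρ : G →ₐ[ℂ] Matrix n n ℂ) (φ : G →ₐ[ℂ] A) :
    Legs (legFst A k ρ) ((scal A (n × k)).comp φ) := fun x y => by
  have := (num_commute_scal (ρ x) (φ y)).map (inFirstHom A n k)
  rwa [inFirstHom_scal] at this

lemma legs_snd_scal (σ : G →ₐ[ℂ] Matrix k k ℂ) (φ : G →ₐ[ℂ] A) :
    Legs (legSnd A n σ) ((scal A (n × k)).comp φ) := fun x y => by
  have := (num_commute_scal (σ x) (φ y)).map (inSecondHom A n k)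
  rwa [inSecondHom_scal] at this

lemma num_evalKron (ρ : G →ₐ[ℂ] Matrix n n ℂ) (σ : G →ₐ[ℂ] Matrix k k ℂ) (x : G ⊗[ℂ] G) :
    (num (evalKron ρ σ x) : Matrix (n × k) (n × k) A) = Ev (legFst A k ρ) (legSnd A n σ) x := by
  ext ⟨a, b⟩ ⟨c, d⟩
  induction x with
  | zero => simp [evalKron, num]
  | add x y hx hy =>
    rw [map_add, Matrix.add_apply, ← hx, ← hy]
    simp [evalKron, num]
  | tmul x y =>
    simp [evalKron, entry, legFst, legSnd, numHom, numAlg_apply, num, inFirstHom_apply,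
      inSecondHom_apply, inFirst, inSecond, Matrix.mul_apply, sum_prod_type,
      Matrix.one_apply]

lemma evalKron_eq_Ev (ρ : G →ₐ[ℂ] Matrix n n ℂ) (σ : G →ₐ[ℂ] Matrix k k ℂ) (x : G ⊗[ℂ] G) :
    evalKron ρ σ x = Ev (legFst ℂ k ρ) (legSnd ℂ n σ) x := by
  rw [← num_evalKron]; ext; simp [num]

lemma evalKron_mul (ρ : G →ₐ[ℂ] Matrix n n ℂ) (σ : G →ₐ[ℂ] Matrix k k ℂ) (x y : G ⊗[ℂ] G) :
    evalKron ρ σ (x * y) = evalKron ρ σ x * evalKron ρ σ y := by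
  simp only [evalKron_eq_Ev]; exact Ev_mul (legs_fst_snd ρ σ) x y

@[simp] lemma evalKron_one (ρ : G →ₐ[ℂ] Matrix n n ℂ) (σ : G →ₐ[ℂ] Matrix k k ℂ) :
    evalKron ρ σ 1 = 1 := by
  rw [evalKron_eq_Ev]; exact Ev_one _ _

lemma evalKron_tmul (ρ : G →ₐ[ℂ] Matrix n n ℂ) (σ : G →ₐ[ℂ] Matrix k k ℂ) (x y : G) :
    evalKron ρ σ (x ⊗ₜ y) = ρ x ⊗ₖ σ y := by
  ext ⟨a, b⟩ ⟨c, d⟩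
  simp [evalKron, entry]

/-- `evalKron` as a linear map. -/
def evalKronLin (ρ : G →ₐ[ℂ] Matrix n n ℂ) (σ : G →ₐ[ℂ] Matrix k k ℂ) :
    G ⊗[ℂ] G →ₗ[ℂ] Matrix (n × k) (n × k) ℂ := Ev (legFst ℂ k ρ) (legSnd ℂ n σ)

lemma evalKronLin_apply (ρ : G →ₐ[ℂ] Matrix n n ℂ) (σ : G →ₐ[ℂ] Matrix k k ℂ)
    (x : G ⊗[ℂ] G) : evalKronLin ρ σ x = evalKron ρ σ x := (evalKron_eq_Ev ρ σ x).symm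

end

section

variable {ι : Type} [Fintype ι] (H : SymmetryData G ι)

namespace SymmetryData

/-- `τ^I` on the first of two factors. -/
abbrev lA (A : Type*) [Ring A] [Algebra ℂ A] (I J : ι) :
    G →ₐ[ℂ] Matrix (Fin (H.δ I) × Fin (H.δ J)) (Fin (H.δ I) × Fin (H.δ J)) A :=
  legFst A (Fin (H.δ J)) (H.τ I)

/-- `τ^J` on the second of two factors. -/
abbrev lB (A : Type*) [Ring A] [Algebra ℂ A] (I J : ι) :
    G →ₐ[ℂ] Matrix (Fin (H.δ I) × Fin (H.δ J)) (Fin (H.δ I) × Fin (H.δ J)) A :=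
  legSnd A (Fin (H.δ I)) (H.τ J)

lemma legs_AB (I J : ι) : Legs (H.lA A I J) (H.lB A I J) := legs_fst_snd _ _

lemma num_C_mul_conv (I J K : ι) (a : Fin (H.N I J K)) (x : G) :
    (num (H.C I J K a) : Matrix (Fin (H.δ K)) (Fin (H.δ I) × Fin (H.δ J)) A) * conv (H.lA A I J) (H.lB A I J) (H.legs_AB I J) x
      = numHom A (H.τ K) x * (num (H.C I J K a) : Matrix (Fin (H.δ K)) (Fin (H.δ I) × Fin (H.δ J)) A) := by
  rw [conv_apply, ← num_evalKron, ← num_mul, C_intertwines, num_mul]; rfl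

lemma num_C_mul_Ev (I J K : ι) (a : Fin (H.N I J K)) (φ : G →ₐ[ℂ] A) (x : G ⊗[ℂ] G) :
    (num (H.C I J K a) : Matrix (Fin (H.δ K)) (Fin (H.δ I) × Fin (H.δ J)) A)
        * Ev (conv (H.lA A I J) (H.lB A I J) (H.legs_AB I J)) ((scal A _).comp φ) x
      = Ev (numHom A (H.τ K)) ((scal A _).comp φ) x
        * (num (H.C I J K a) : Matrix (Fin (H.δ K)) (Fin (H.δ I) × Fin (H.δ J)) A) := by
  induction x with
  | tmul x y =>
    rw [Ev_tmul, Ev_tmul, ← Matrix.mul_assoc, num_C_mul_conv, Matrix.mul_assoc, Matrix.mul_assoc]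
    congr 1
    exact num_mul_scal _ _
  | _ => simp_all [Matrix.mul_add, Matrix.add_mul]

lemma RM_eq (I J : ι) : H.RM (A := A) I J = H.Rv (H.lA A I J) (H.lB A I J) := num_evalKron _ _ _

lemma RinvM_eq (I J : ι) : H.RinvM (A := A) I J = H.Ri (H.lA A I J) (H.lB A I J) :=
  num_evalKron _ _ _

lemma RpM_eq (I J : ι) : H.RpM (A := A) I J = H.Rv (H.lB A I J) (H.lA A I J) :=
  (num_evalKron _ _ _).trans (H.Ev_swap_R (H.legs_AB I J))

lemma kap_central (x : G) : (H.kap : G) * x = x * H.kap :=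
  H.ext_τ fun I => by simp [H.τ_kap]

lemma kap_inv_central (x : G) : ↑H.kap⁻¹ * x = x * ↑H.kap⁻¹ := by
  rw [Units.inv_mul_eq_iff_eq_mul, ← mul_assoc, H.kap_central, mul_assoc, Units.mul_inv, mul_one]

lemma one_ne_zero_mat (I : ι) : (1 : 𝕄[H, I, ℂ]) ≠ 0 := by
  have : NeZero (H.δ I) := ⟨(H.δ_pos I).ne'⟩
  exact one_ne_zero

lemma κ_ne_zero (I : ι) : H.κ I ≠ 0 := by
  intro h
  have h1 := congrArg (H.τ I) H.kap.mul_inv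
  rw [map_mul, H.τ_kap, h, zero_smul, zero_mul, map_one] at h1
  exact H.one_ne_zero_mat I h1.symm

lemma τ_kap_inv (I : ι) : H.τ I ↑H.kap⁻¹ = (H.κ I)⁻¹ • 1 := by
  have h1 := congrArg (H.τ I) H.kap.mul_inv
  rw [map_mul, H.τ_kap, map_one, smul_mul_assoc, one_mul] at h1
  rw [← h1, smul_smul, inv_mul_cancel₀ (H.κ_ne_zero I), one_smul]

lemma kap_sq : (H.kap : G) ^ 2 = H.v :=
  H.ext_τ fun I => by rw [map_pow, H.τ_kap, H.κ_sq, smul_pow, one_pow]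

lemma star_κ_mul (I : ι) : star (H.κ I) * H.κ I = 1 := by
  have h1 : H.τ I (star (H.v : G)) * H.τ I (H.v : G) = 1 := by
    rw [H.star_v, ← map_mul, inv_mul, map_one]
  rw [H.τ_star, H.κ_sq, Matrix.conjTranspose_smul, conjTranspose_one, smul_mul_smul_comm,
    one_mul] at h1
  have h2 : star (H.κ I ^ 2) * H.κ I ^ 2 = 1 := by
    by_contra h
    have h3 : (star (H.κ I ^ 2) * H.κ I ^ 2 - 1) • (1 : 𝕄[H, I, ℂ]) = 0 := by
      rw [sub_smul, h1, one_smul, sub_self]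
    rcases smul_eq_zero.1 h3 with h4 | h4
    · exact h (sub_eq_zero.1 h4)
    · exact H.one_ne_zero_mat I h4
  simp only [Complex.star_def, map_pow] at h2 ⊢
  rw [← mul_pow, ← Complex.normSq_eq_conj_mul_self] at h2
  rw [← Complex.normSq_eq_conj_mul_self]
  have h5 : Complex.normSq (H.κ I) ^ 2 = 1 := by exact_mod_cast h2
  have h6 := (pow_eq_one_iff_of_nonneg (Complex.normSq_nonneg (H.κ I)) two_ne_zero).1 h5
  rw [h6]; simp

lemma star_kap : star (H.kap : G) = ↑H.kap⁻¹ :=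
  H.ext_τ fun I => by
    rw [H.τ_star, H.τ_kap, H.τ_kap_inv, Matrix.conjTranspose_smul, conjTranspose_one,
      eq_inv_of_mul_eq_one_left (H.star_κ_mul I)]

lemma κ_zero_sq : H.κ H.zero ^ 2 = 1 := by
  have h := H.κ_sq H.zero
  rw [H.τ_zero, H.counit_v] at h
  by_contra h'
  have h3 : (1 - H.κ H.zero ^ 2) • (1 : Matrix (Fin (H.δ H.zero)) (Fin (H.δ H.zero)) ℂ) = 0 := by
    rw [sub_smul, h, sub_self]
  rcases smul_eq_zero.1 h3 with h4 | h4
  · exact h' (sub_eq_zero.1 h4).symm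
  · exact H.one_ne_zero_mat _ h4

end SymmetryData
end

variable {ι : Type} [Fintype ι] [DecidableEq ι] (H : SymmetryData G ι)

/-! ### Completeness of the Clebsch-Gordan maps -/

section

namespace SymmetryData

/-- The quantum dimensions are positive and the matrix `s` is invertible. -/
structure IsModular : Prop where
  qdim_pos : ∀ I, 0 < H.qdim I
  isUnit_s : IsUnit H.s

lemma mu_mul (K : ι) (q p : Fin (H.δ K)) (x : G) :
    H.mu K q p * x = ∑ r, H.τ K x p r • H.mu K q r := by
  refine H.ext_τ fun L => ?_
  simp only [map_mul, map_sum, map_smul]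
  by_cases h : L = K
  · subst h
    simp only [τ_mu_self]
    ext a b
    simp [Matrix.sum_apply, single_apply, Matrix.mul_apply, ite_and]
  · simp [H.τ_mu_of_ne h]

lemma mul_mu (K : ι) (q p : Fin (H.δ K)) (x : G) :
    x * H.mu K q p = ∑ r, H.τ K x r q • H.mu K r p := by
  refine H.ext_τ fun L => ?_
  simp only [map_mul, map_sum, map_smul]
  by_cases h : L = K
  · subst h
    simp only [τ_mu_self]
    ext a b
    simp [Matrix.sum_apply, single_apply, Matrix.mul_apply, ite_and]
  · simp [H.τ_mu_of_ne h]

lemma coef_coef (I J : ι) (a b : Fin (H.δ I)) (c d : Fin (H.δ J)) (z : G ⊗[ℂ] G) :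
    H.τ J (H.coef I a b z) c d = evalKron (H.τ I) (H.τ J) z (a, c) (b, d) := by
  induction z with
  | zero => simp [evalKron]
  | add x y hx hy =>
    simp only [map_add, Matrix.add_apply, hx, hy]
    simp [evalKron]
  | tmul x y => simp [evalKron, entry]

lemma ext_evalKron {z w : G ⊗[ℂ] G}
    (h : ∀ I J, evalKron (H.τ I) (H.τ J) z = evalKron (H.τ I) (H.τ J) w) : z = w := by
  refine H.ext_coef fun I a b => H.ext_τ fun J => ?_
  ext c d
  rw [coef_coef, coef_coef, h]

lemma exists_evalKron_eq
    (y : ∀ I J, Matrix (Fin (H.δ I) × Fin (H.δ J)) (Fin (H.δ I) × Fin (H.δ J)) ℂ) :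
    ∃ x : G ⊗[ℂ] G, ∀ I J, evalKron (H.τ I) (H.τ J) x = y I J := by
  refine ⟨∑ I, ∑ J, ∑ a, ∑ b, ∑ c, ∑ d, y I J (a, c) (b, d) • (H.mu I a b ⊗ₜ H.mu J c d),
    fun I J => ?_⟩
  simp only [← evalKronLin_apply, map_sum, map_smul]
  simp only [evalKronLin_apply, evalKron_tmul]
  rw [sum_eq_single I, sum_eq_single J]
  · simp only [τ_mu_self]
    ext ⟨a, c⟩ ⟨b, d⟩
    simp [Matrix.sum_apply, single_apply, ite_and]
  · intro K _ hK
    simp [H.τ_mu_of_ne hK.symm]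
  · simp
  · intro K _ hK
    simp [H.τ_mu_of_ne hK.symm]
  · simp

/-- `(τ^I ⊗ τ^J) ∘ Δ` as a homomorphism. -/
def rep2 (I J : ι) : G →ₐ[ℂ] Matrix (Fin (H.δ I) × Fin (H.δ J)) (Fin (H.δ I) × Fin (H.δ J)) ℂ :=
  conv (H.lA ℂ I J) (H.lB ℂ I J) (H.legs_AB I J)

lemma rep2_apply (I J : ι) (x : G) :
    H.rep2 I J x = evalKron (H.τ I) (H.τ J) (Coalgebra.comul x) := by
  rw [rep2, conv_apply, ← evalKron_eq_Ev]

lemma eq_zero_of_intertwiner_mul (I J : ι)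
    {Z : Matrix (Fin (H.δ I) × Fin (H.δ J)) (Fin (H.δ I) × Fin (H.δ J)) ℂ}
    (hZ : ∀ K a, H.C I J K a * Z = 0) : Z = 0 := by
  have h1 : ∀ K (T : Matrix (Fin (H.δ K)) (Fin (H.δ I) × Fin (H.δ J)) ℂ),
      (∀ ξ, T * H.rep2 I J ξ = H.τ K ξ * T) → T * Z = 0 := by
    intro K T hT
    have h := H.C_spans I J K T fun ξ => by rw [← rep2_apply]; exact hT ξ
    clear hT
    induction h using span_induction with
    | mem x hx => obtain ⟨a, rfl⟩ := hx; exact hZ K a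
    | zero => simp
    | add x y _ _ hx hy =>
      exact (Matrix.add_mul x y Z).trans (by rw [hx, hy, add_zero])
    | smul c x _ hx => exact (smul_mul c x Z).trans (by rw [hx, smul_zero])
  have h2 : ∀ y : G, H.rep2 I J y * Z = 0 := by
    intro y
    rw [H.eq_sum_mu y]
    simp only [map_sum, map_smul, sum_mul, smul_mul_assoc]
    refine sum_eq_zero fun K _ => sum_eq_zero fun q _ => sum_eq_zero
      fun p _ => ?_
    have : H.rep2 I J (H.mu K q p) * Z = 0 := by
      ext i j
      have h3 := h1 K (Matrix.of fun p l => H.rep2 I J (H.mu K q p) i l) (by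
        intro ξ
        ext p l
        have h4 := congrArg (fun x => H.rep2 I J x i l) (H.mu_mul K q p ξ)
        simp only [map_mul, map_sum, map_smul, Matrix.sum_apply, Matrix.smul_apply] at h4
        simpa [Matrix.mul_apply] using h4)
      have h5 := congrFun (congrFun h3 p) j
      simpa [Matrix.mul_apply] using h5
    rw [this, smul_zero]
  simpa using h2 1

lemma completeness (I J : ι) :
    evalKron (H.τ I) (H.τ J) (swapLegs G H.R) *
      ∑ K, ∑ a : Fin (H.N I J K), (H.κ K / (H.κ I * H.κ J)) • ((H.C I J K a)ᴴ * H.C I J K a) = 1 := by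
  rw [← sub_eq_zero]
  refine H.eq_zero_of_intertwiner_mul I J fun L b => ?_
  rw [Matrix.mul_sub, Matrix.mul_one, ← Matrix.mul_assoc, Matrix.mul_sum, sub_eq_zero]
  rw [sum_eq_single L]
  · rw [Matrix.mul_sum, sum_eq_single b]
    · rw [Matrix.mul_smul, ← Matrix.mul_assoc, H.C_norm, if_pos rfl, smul_mul,
        Matrix.one_mul, smul_smul, div_mul_div_comm, mul_comm (H.κ L)]
      rw [div_self, one_smul]
      exact mul_ne_zero (mul_ne_zero (H.κ_ne_zero I) (H.κ_ne_zero J)) (H.κ_ne_zero L)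
    · intro a _ ha
      rw [Matrix.mul_smul, ← Matrix.mul_assoc, H.C_norm, if_neg ha.symm]
      simp
    · simp
  · intro K _ hK
    rw [Matrix.mul_sum]
    refine sum_eq_zero fun a _ => ?_
    rw [Matrix.mul_smul, ← Matrix.mul_assoc, H.C_orth I J L K b a hK.symm]
    simp
  · simp

lemma kap_tmul_kap_central (z : G ⊗[ℂ] G) :
    ((H.kap : G) ⊗ₜ[ℂ] (H.kap : G)) * z = z * ((H.kap : G) ⊗ₜ[ℂ] (H.kap : G)) := by
  induction z with
  | tmul x y => simp [H.kap_central]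
  | _ => simp_all [mul_add, add_mul]

lemma kap_inv_tmul_central (z : G ⊗[ℂ] G) : (((H.kap⁻¹ : Gˣ) : G) ⊗ₜ[ℂ] ((H.kap⁻¹ : Gˣ) : G)) * z
      = z * (((H.kap⁻¹ : Gˣ) : G) ⊗ₜ[ℂ] ((H.kap⁻¹ : Gˣ) : G)) := by
  induction z with
  | tmul x y => simp [H.kap_inv_central]
  | _ => simp_all [mul_add, add_mul]

lemma kap_tmul_mul_inv : ((H.kap : G) ⊗ₜ[ℂ] (H.kap : G))
      * (((H.kap⁻¹ : Gˣ) : G) ⊗ₜ[ℂ] ((H.kap⁻¹ : Gˣ) : G)) = 1 := by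
  simp [one_def]

lemma swap_R_mul_R_mul_comul_kap :
    swapLegs G H.R * (H.R : G ⊗[ℂ] G) * Δ (H.kap : G) * Δ (H.kap : G)
      = ((H.kap : G) ⊗ₜ[ℂ] (H.kap : G)) * ((H.kap : G) ⊗ₜ[ℂ] (H.kap : G)) := by
  have h := H.comul_v
  rw [← H.kap_sq, sq, Bialgebra.comul_mul, ← mul_assoc] at h
  rw [h]; simp

/-- `R' (Rη) Δ(κ) = κ ⊗ κ`. -/
lemma swap_R_mul_twist_mul :
    swapLegs G H.R * twist H * Δ (H.kap : G) = (H.kap : G) ⊗ₜ[ℂ] (H.kap : G) := by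
  have h := H.swap_R_mul_R_mul_comul_kap
  rw [twist, ← kap_inv_tmul_central]
  calc _ = swapLegs G H.R * ((H.R : G ⊗[ℂ] G) * (((H.kap⁻¹ : Gˣ) : G) ⊗ₜ[ℂ] ((H.kap⁻¹ : Gˣ) : G)))
        * Δ (H.kap : G) * Δ (H.kap : G) := by
          simp only [mul_assoc]
    _ = (((H.kap⁻¹ : Gˣ) : G) ⊗ₜ[ℂ] ((H.kap⁻¹ : Gˣ) : G)) * (swapLegs G H.R * (H.R : G ⊗[ℂ] G)
        * Δ (H.kap : G) * Δ (H.kap : G)) := by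
          rw [← kap_inv_tmul_central, ← mul_assoc, ← kap_inv_tmul_central]
          simp only [mul_assoc]
    _ = _ := by
      rw [h, kap_inv_tmul_central, mul_assoc, kap_tmul_mul_inv, mul_one]

lemma isUnit_swap_R : IsUnit (swapLegs G (H.R : G ⊗[ℂ] G)) :=
  ⟨⟨swapLegs G H.R, swapLegs G ↑H.R⁻¹,
    by rw [← swapLegs_mul]; simp, by rw [← swapLegs_mul]; simp⟩, rfl⟩

lemma isUnit_comul {x : G} (hx : IsUnit x) :
    IsUnit (Δ x : G ⊗[ℂ] G) :=
  hx.map (Bialgebra.comulAlgHom ℂ G)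

lemma isUnit_twist : IsUnit (twist H) := by
  refine H.R.isUnit.mul ((isUnit_comul H.kap.isUnit).mul ?_)
  exact ⟨⟨_, (H.kap : G) ⊗ₜ[ℂ] (H.kap : G),
    by rw [← kap_tmul_kap_central, kap_tmul_mul_inv], H.kap_tmul_mul_inv⟩, rfl⟩

lemma isUnit_evalKron {z : G ⊗[ℂ] G} (hz : IsUnit z) (I J : ι) :
    IsUnit (evalKron (H.τ I) (H.τ J) z) := by
  obtain ⟨u, rfl⟩ := hz
  exact ⟨⟨evalKron (H.τ I) (H.τ J) u, evalKron (H.τ I) (H.τ J) (u⁻¹ : (G ⊗[ℂ] G)ˣ),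
    by rw [← evalKron_mul]; simp, by rw [← evalKron_mul]; simp⟩, rfl⟩

/-- The sum of the projections on the irreducible constituents is `Rη`. -/
lemma evalKron_twist (I J : ι) :
    evalKron (H.τ I) (H.τ J) (twist H)
      = ∑ K, ∑ a : Fin (H.N I J K), (H.C I J K a)ᴴ * H.C I J K a := by
  have h1 := congrArg (evalKron (H.τ I) (H.τ J)) H.swap_R_mul_twist_mul
  rw [evalKron_mul, evalKron_mul, evalKron_tmul, H.τ_kap, H.τ_kap, Matrix.smul_kronecker,
    Matrix.kronecker_smul, Matrix.one_kronecker_one, smul_smul] at h1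
  have h2 : (evalKron (H.τ I) (H.τ J) (swapLegs G H.R)
      * ∑ K, ∑ a : Fin (H.N I J K), (H.C I J K a)ᴴ * H.C I J K a)
      * evalKron (H.τ I) (H.τ J) (Δ (H.kap : G))
      = (H.κ I * H.κ J) • 1 := by
    rw [← H.completeness I J, Matrix.mul_assoc, sum_mul, ← Matrix.mul_smul, smul_sum]
    refine congrArg _ (sum_congr rfl fun K _ => ?_)
    rw [sum_mul, smul_sum]
    refine sum_congr rfl fun a _ => ?_
    rw [Matrix.mul_assoc, C_intertwines, H.τ_kap, smul_mul, Matrix.one_mul,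
      Matrix.mul_smul, smul_smul, mul_div_cancel₀]
    exact mul_ne_zero (H.κ_ne_zero I) (H.κ_ne_zero J)
  rw [← h2] at h1
  have h3 := H.isUnit_evalKron H.isUnit_swap_R I J
  have h4 := H.isUnit_evalKron (isUnit_comul H.kap.isUnit) I J
  exact h3.mul_left_cancel (h4.mul_right_cancel h1)

lemma evalKron_star (I J : ι) (z : G ⊗[ℂ] G) :
    evalKron (H.τ I) (H.τ J) (star z) = (evalKron (H.τ I) (H.τ J) z)ᴴ := by
  simp only [← evalKronLin_apply]
  induction z with
  | zero => simp
  | add x y hx hy => rw [star_add, map_add, map_add, hx, hy, Matrix.conjTranspose_add]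
  | tmul x y =>
    rw [star_tmul, evalKronLin_apply, evalKronLin_apply, evalKron_tmul,
      evalKron_tmul, H.τ_star, H.τ_star, Matrix.conjTranspose_kronecker]

lemma star_twist : star (twist H) = twist H :=
  H.ext_evalKron fun I J => by
    rw [evalKron_star, evalKron_twist]
    simp [Matrix.conjTranspose_sum]

lemma posDef_evalKron_twist (I J : ι) : (evalKron (H.τ I) (H.τ J) (twist H)).PosDef := by
  refine ((Matrix.PosSemidef.posDef_iff_isUnit ?_).2 (H.isUnit_evalKron H.isUnit_twist I J))
  rw [evalKron_twist]
  exact Matrix.posSemidef_sum _ fun K _ => Matrix.posSemidef_sum _ fun a _ =>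
    Matrix.posSemidef_conjTranspose_mul_self _

/-- `Rη` is positive in `G ⊗ G`. -/
lemma exists_twist_eq : ∃ x : G ⊗[ℂ] G, IsUnit x ∧ twist H = star x * x := by
  have h : ∀ I J, ∃ y : Matrix (Fin (H.δ I) × Fin (H.δ J)) (Fin (H.δ I) × Fin (H.δ J)) ℂ,
      evalKron (H.τ I) (H.τ J) (twist H) = yᴴ * y := by
    intro I J
    open scoped MatrixOrder in
    exact CStarAlgebra.nonneg_iff_eq_star_mul_self.1 (H.posDef_evalKron_twist I J).posSemidef.nonneg
  choose y hy using h
  obtain ⟨x, hx⟩ := H.exists_evalKron_eq y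
  have hT : twist H = star x * x := H.ext_evalKron fun I J => by
    rw [hy, evalKron_mul, evalKron_star, hx]
  refine ⟨x, ?_, hT⟩
  have := H.finiteDimensional
  have : IsNoetherianRing (G ⊗[ℂ] G) := isNoetherian_of_tower ℂ inferInstance
  obtain ⟨u, hu⟩ := H.isUnit_twist
  refine IsUnit.of_mul_eq_one_right (↑u⁻¹ * star x) ?_
  rw [mul_assoc, ← hT, ← hu, inv_mul]

lemma star_comul_kap : star (Δ (H.kap : G)) = swapLegs G (Δ ↑H.kap⁻¹) := by
  rw [← H.star_kap, H.comul_star, swapLegs_swapLegs]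

/-- `(* ⊗ *)(R) = (R')⁻¹`. -/
lemma star_R : star (H.R : G ⊗[ℂ] G) = swapLegs G ((H.R⁻¹ : (G ⊗[ℂ] G)ˣ) : G ⊗[ℂ] G) := by
  have h := H.star_twist
  rw [twist, star_mul, star_mul, star_tmul, star_comul_kap] at h
  have h0 : star ((H.kap⁻¹ : Gˣ) : G) = H.kap := by rw [← H.star_kap, star_star]
  rw [h0] at h
  set D := (Δ (H.kap : G) : G ⊗[ℂ] G) with hD
  set D' := (Δ ((H.kap⁻¹ : Gˣ) : G) : G ⊗[ℂ] G) with hD'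
  have hDD : D * D' = 1 := by rw [hD, hD', ← Bialgebra.comul_mul]; simp
  set k := (H.kap : G) ⊗ₜ[ℂ] (H.kap : G) with hk
  set k' := ((H.kap⁻¹ : Gˣ) : G) ⊗ₜ[ℂ] ((H.kap⁻¹ : Gˣ) : G) with hk'
  have hkk : k * k' = 1 := H.kap_tmul_mul_inv
  have hkz : ∀ z, k * z = z * k := H.kap_tmul_kap_central
  have hkz' : ∀ z, k' * z = z * k' := H.kap_inv_tmul_central
  have hkl : ∀ z w, z * (k' * w) = k' * (z * w) := fun z w => by
    rw [← mul_assoc, ← hkz', mul_assoc]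
  have hsw : swapLegs G D * swapLegs G D' = 1 := by rw [← swapLegs_mul, hDD, swapLegs_one]
  have hRD : (H.R : G ⊗[ℂ] G) * D = swapLegs G D * H.R := H.R_comul _
  have h2 := H.swap_R_mul_R_mul_comul_kap
  rw [← hD, ← hk] at h2
  -- `star R = k' Δ'(κ) R Δ(κ) k' = k' k' R Δ(κ)²`
  have h3 : star (H.R : G ⊗[ℂ] G) = k' * k' * ((H.R : G ⊗[ℂ] G) * D * D) := by
    have h4 : star (H.R : G ⊗[ℂ] G)
        = swapLegs G D * (k' * ((k * swapLegs G D') * star (H.R : G ⊗[ℂ] G))) := by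
      rw [← mul_assoc k', ← mul_assoc k', hkz', hkk, one_mul, ← mul_assoc, hsw, one_mul]
    have h5 : swapLegs G D * ((H.R : G ⊗[ℂ] G) * D) = (H.R : G ⊗[ℂ] G) * D * D := by
      rw [← mul_assoc, ← hRD]
    rw [h4, h, ← mul_assoc (H.R : G ⊗[ℂ] G) D k', ← hkz', hkl, hkl, h5]
    simp only [mul_assoc]
  have h5 : swapLegs G (H.R : G ⊗[ℂ] G) * star (H.R : G ⊗[ℂ] G) = 1 := by
    rw [h3, mul_assoc k', hkl, hkl, ← mul_assoc, ← mul_assoc (swapLegs G (H.R : G ⊗[ℂ] G)),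
      ← mul_assoc (swapLegs G (H.R : G ⊗[ℂ] G)), h2, ← mul_assoc, mul_assoc k', ← hkz k', hkk,
      mul_one, ← hkz, hkk]
  have h6 : swapLegs G ((H.R⁻¹ : (G ⊗[ℂ] G)ˣ) : G ⊗[ℂ] G) * swapLegs G (H.R : G ⊗[ℂ] G) = 1 := by
    rw [← swapLegs_mul]; simp
  exact (left_inv_eq_right_inv h6 h5).symm

/-- The operators `κ⁻¹ R'R` of a holonomy which is given by a homomorphism. -/
def hv (a f : G →ₐ[ℂ] A) : A := a ↑H.kap⁻¹ * H.Qv a f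

variable {a b f : G →ₐ[ℂ] A}

lemma commute_kap_inv (hab : Legs a b) (y : G ⊗[ℂ] G) :
    Commute (a ↑H.kap⁻¹) (Ev a b y) :=
  Ev_commute (fun x => by rw [Commute, SemiconjBy, ← map_mul, kap_inv_central, map_mul])
    (fun x => hab _ x) y

lemma commute_kap (hab : Legs a b) (y : G ⊗[ℂ] G) :
    Commute (a (H.kap : G)) (Ev a b y) :=
  Ev_commute (fun x => by rw [Commute, SemiconjBy, ← map_mul, kap_central, map_mul])
    (fun x => hab _ x) y

/-- The universal form of functoriality. -/
lemma hv_mul_R_mul_hv (hab : Legs a b) (haf : Legs a f) (hbf : Legs b f) :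
    H.hv a f * H.Rv a b * H.hv b f = Ev a b (twist H) * H.hv (conv a b hab) f := by
  have hcf := Legs.conv_left haf hbf (hc := hab)
  have e1 : Ev a b (twist H) * conv a b hab ((H.kap⁻¹ : Gˣ) : G)
      = a ((H.kap⁻¹ : Gˣ) : G) * b ((H.kap⁻¹ : Gˣ) : G) * H.Rv a b := by
    rw [conv_apply, ← Ev_mul hab, ← Ev_tmul, RibbonHopfStar.Rv, ← Ev_mul hab, twist]
    rw [mul_assoc, mul_assoc, H.kap_inv_tmul_central, ← mul_assoc (Coalgebra.comul _),
      ← Bialgebra.comul_mul, Units.mul_inv, Bialgebra.comul_one, one_mul,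
      H.kap_inv_tmul_central]
  rw [hv, hv, hv, H.Qv_eq hcf, ← mul_assoc (Ev a b (twist H)), e1, H.Qv_eq haf, H.Qv_eq hbf,
    H.Rv_conv_right haf.symm hbf.symm hab, H.Rv_conv_left hab haf hbf]
  have y1 := H.yang_baxter haf.symm hbf.symm hab
  have y2 := H.yang_baxter haf hab hbf.symm
  have c1 : Commute (b ((H.kap⁻¹ : Gˣ) : G)) (H.Rv f a * H.Rv a f) :=
    (H.Rv_commute (fun x => hbf _ _) (fun x => (hab _ _).symm)).mul_right
      (H.Rv_commute (fun x => (hab _ _).symm) (fun x => hbf _ _))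
  have c2 : Commute (b ((H.kap⁻¹ : Gˣ) : G)) (H.Rv a b) :=
    H.Rv_commute (fun x => (hab _ _).symm)
      (fun x => by rw [Commute, SemiconjBy, ← map_mul, kap_inv_central, map_mul])
  generalize b ((H.kap⁻¹ : Gˣ) : G) = kb at *
  generalize a ((H.kap⁻¹ : Gˣ) : G) = ka at *
  calc ka * (H.Rv f a * H.Rv a f) * H.Rv a b * (kb * (H.Rv f b * H.Rv b f))
      = ka * ((H.Rv f a * H.Rv a f) * (H.Rv a b * kb)) * (H.Rv f b * H.Rv b f) := by
        simp only [mul_assoc]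
    _ = ka * kb * (H.Rv f a * (H.Rv a f * H.Rv a b * H.Rv f b) * H.Rv b f) := by
        rw [← c2.eq, ← mul_assoc _ kb, ← c1.eq]; simp only [mul_assoc]
    _ = ka * kb * ((H.Rv f a * H.Rv f b * H.Rv a b) * H.Rv a f * H.Rv b f) := by
        rw [y2]; simp only [mul_assoc]
    _ = _ := by rw [y1]; simp only [mul_assoc]

end SymmetryData
end

/-! ### Factorizability -/

section

open HopfAlgebra

/-- `x ⊗ y ↦ k(x) y`. -/
def legL {M : Type*} [AddCommGroup M] [Module ℂ M] (k : G →ₗ[ℂ] ℂ) : G ⊗[ℂ] M →ₗ[ℂ] M :=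
  (lid ℂ M).toLinearMap ∘ₗ rTensor M k

@[simp] lemma legL_tmul {M : Type*} [AddCommGroup M] [Module ℂ M] (k : G →ₗ[ℂ] ℂ) (x : G)
    (y : M) : legL k (x ⊗ₜ[ℂ] y) = k x • y := by simp [legL]

lemma sum_antipode_mul_conv {f h : G →ₐ[ℂ] A} (hc : Legs f h) (x : G) :
    mul' ℂ A (map (f.toLinearMap ∘ₗ 𝒮) (conv f h hc).toLinearMap (Δ x)) = h x := by
  let Ψ : G ⊗[ℂ] (G ⊗[ℂ] G) →ₗ[ℂ] A :=
    mul' ℂ A ∘ₗ map (f.toLinearMap ∘ₗ 𝒮) (Ev f h)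
  have h1 : ∀ z, mul' ℂ A (map (f.toLinearMap ∘ₗ 𝒮)
      (conv f h hc).toLinearMap z) = Ψ (comulRight G z) := by
    intro z
    induction z with
    | tmul a b => simp [Ψ, comulRight, conv_apply]
    | _ => simp_all
  have h2 : ∀ z, Ψ (comulLeft G z) = Ev (triv A) h z := by
    intro z
    induction z with
    | tmul a b =>
      have h3 : ∀ d : G ⊗[ℂ] G, Ψ (assoc ℂ G G G (d ⊗ₜ b))
          = f (pairEval 𝒮 LinearMap.id d) * h b := by
        intro d
        induction d with
        | tmul r s => simp [Ψ, mul_assoc]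
        | _ => simp_all [add_tmul, add_mul]
      simp [comulLeft, h3, pairEval_antipode_comul]
    | _ => simp_all
  rw [h1]
  have h4 : comulLeft G (Δ x) = comulRight G (Δ x) :=
    coassoc_apply x
  rw [← h4, h2, ← conv_apply (Legs.triv_left h), conv_triv_left]

/-- For an invariant element, the second leg acts as the antipode of the first. -/
lemma mul_of_invariant {f h : G →ₐ[ℂ] A} (hc : Legs f h) {Y : A}
    (hY : ∀ x, conv f h hc x * Y = ε x • Y) (x : G) :
    h x * Y = f (𝒮 x) * Y := by
  rw [← sum_antipode_mul_conv hc x]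
  have h1 : ∀ z, mul' ℂ A (map (f.toLinearMap ∘ₗ 𝒮) (conv f h hc).toLinearMap z) * Y
        = f (𝒮 (Ev (AlgHom.id ℂ G) (triv G) z)) * Y := by
    intro z
    induction z with
    | tmul a b => simp [mul_assoc, hY, algebraMap_eq_smul_one]
    | _ => simp_all [add_mul]
  rw [h1, ← conv_apply (Legs.triv_right _), conv_triv_right]; rfl

/-- The image of an element that commutes with `(f ⊗ h)Δ` under a trace on the first leg is
central. -/
lemma central_of_trace {f h : G →ₐ[ℂ] A} (hc : Legs f h) {X : A}
    (hX : ∀ x, Commute X (conv f h hc x)) (T : A →ₗ[ℂ] G)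
    (hl : ∀ x Y, T (h x * Y) = x * T Y) (hr : ∀ x Y, T (Y * h x) = T Y * x)
    (ht : ∀ x Y, T (f (𝒮 (𝒮 x)) * Y) = T (Y * f x)) (x : G) :
    x * T X = T X * x := by
  let Ψ : G ⊗[ℂ] (G ⊗[ℂ] G) →ₗ[ℂ] G :=
    mul' ℂ G ∘ₗ map (T ∘ₗ mulRight ℂ X ∘ₗ f.toLinearMap ∘ₗ
      𝒮 ∘ₗ pairEval LinearMap.id 𝒮) LinearMap.id ∘ₗ
      (assoc ℂ G G G).symm.toLinearMap
  have h1 : ∀ a (w : G ⊗[ℂ] G), Ψ (a ⊗ₜ w) = T (f (𝒮 a) * (X * Ev f h w)) := by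
    intro a w
    induction w with
    | tmul b c =>
      have e1 : f (𝒮 a) * (X * Ev f h (b ⊗ₜ c)) = (f (𝒮 a) * X) * f b * h c := by simp [mul_assoc]
      rw [e1, hr, ← ht]
      simp [Ψ, antipode_mul_antidistrib, mul_assoc]
    | _ => simp_all [tmul_add, mul_add]
  have h2 : ∀ z, T (mul' ℂ A (map (f.toLinearMap ∘ₗ 𝒮)
      (conv f h hc).toLinearMap z) * X) = Ψ (comulRight G z) := by
    intro z
    induction z with
    | tmul a b =>
      have : comulRight G (a ⊗ₜ b) = a ⊗ₜ Δ b := by simp [comulRight]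
      rw [this, h1, ← conv_apply hc, (hX b).eq]
      simp [mul_assoc]
    | _ => simp_all [add_mul]
  have h3 : ∀ z, Ψ (comulLeft G z) = T X * Ev (triv G) (AlgHom.id ℂ G) z := by
    intro z
    induction z with
    | tmul a b =>
      simp [comulLeft, Ψ, pairEval_comul_antipode, algebraMap_eq_smul_one]
    | _ => simp_all [mul_add]
  have h4 : comulLeft G (Δ x) = comulRight G (Δ x) :=
    coassoc_apply x
  rw [← hl, ← sum_antipode_mul_conv hc x, h2, ← h4, h3, ← conv_apply (Legs.triv_left _),
    conv_triv_left]; rfl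

lemma legs_include : Legs (includeLeft : G →ₐ[ℂ] G ⊗[ℂ] G)
    includeRight := fun x y => by
  simp [Commute, SemiconjBy]

lemma Ev_include (z : G ⊗[ℂ] G) : Ev (includeLeft : G →ₐ[ℂ] G ⊗[ℂ] G)
    includeRight z = z := by
  induction z with
  | tmul a b => simp
  | _ => simp_all

namespace SymmetryData

/-- The element `R'R`. -/
def RR : G ⊗[ℂ] G := swapLegs G H.R * (H.R : G ⊗[ℂ] G)

/-- The image of the Drinfeld map. -/
def drinfeldRange : Submodule ℂ G :=
  Submodule.span ℂ (Set.range fun p : RegIndex H => H.coef p.1 p.2.1 p.2.2 H.RR)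

lemma legL_RR_mem (k : G →ₗ[ℂ] ℂ) : legL k H.RR ∈ H.drinfeldRange := by
  rw [H.eq_sum_coef H.RR]
  simp only [map_sum, legL_tmul]
  exact Submodule.sum_mem _ fun I _ => Submodule.sum_mem _ fun a _ => Submodule.sum_mem _
    fun b _ => smul_mem _ _ (subset_span ⟨⟨I, a, b⟩, rfl⟩)

/-- The quantum trace functional. -/
def qtr (J : ι) : G →ₗ[ℂ] ℂ :=
  Matrix.traceLinearMap _ ℂ ℂ ∘ₗ (H.τ J).toLinearMap ∘ₗ mulRight ℂ H.grp

lemma qtr_apply (J : ι) (x : G) : H.qtr J x = (H.τ J (x * H.grp)).trace := rfl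

lemma qtr_mul (J : ι) (x y : G) :
    H.qtr J (𝒮 (𝒮 x) * y) = H.qtr J (y * x) := by
  have := H.finiteDimensional
  rw [qtr_apply, qtr_apply, mul_assoc, map_mul, Matrix.trace_mul_comm, ← map_mul, mul_assoc,
    mul_assoc, ← H.val_gU, ← H.mul_g]

lemma legL_mul_left (k : G →ₗ[ℂ] ℂ) (x : G) (z : G ⊗[ℂ] G) :
    legL k ((1 ⊗ₜ x) * z) = x * legL k z := by
  induction z with
  | tmul a b => simp
  | _ => simp_all [mul_add]

lemma legL_mul_right (k : G →ₗ[ℂ] ℂ) (x : G) (z : G ⊗[ℂ] G) :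
    legL k (z * (1 ⊗ₜ x)) = legL k z * x := by
  induction z with
  | tmul a b => simp
  | _ => simp_all [add_mul]

lemma legL_mul_tmul_one (k : G →ₗ[ℂ] ℂ) (x : G) (z : G ⊗[ℂ] G) :
    legL k ((x ⊗ₜ 1) * z) = legL (k ∘ₗ mulLeft ℂ x) z := by
  induction z with
  | tmul a b => simp
  | _ => simp_all [mul_add]

lemma RR_commute (x : G) : Commute H.RR (conv _ _ (legs_include (G := G)) x) := by
  have := H.Qv_commute_conv (legs_include (G := G)) x
  rwa [RibbonHopfStar.Qv, Ev_include] at this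

lemma central_legL_qtr (J : ι) (x : G) :
    x * legL (H.qtr J) H.RR = legL (H.qtr J) H.RR * x := by
  refine central_of_trace legs_include H.RR_commute _ (fun x Y => legL_mul_left _ x Y)
    (fun x Y => legL_mul_right _ x Y) (fun x Y => ?_) x
  induction Y with
  | tmul a b => simp [H.qtr_mul]
  | _ => simp_all [mul_add, add_mul]

/-- The invariant projection. -/
def e0 : G := H.mu H.zero ⟨0, by rw [H.δ_zero]; exact one_pos⟩ ⟨0, by rw [H.δ_zero]; exact one_pos⟩

lemma τ_e0 (I : ι) : H.τ I H.e0 = if I = H.zero then 1 else 0 := by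
  split_ifs with h
  · subst h
    rw [e0, τ_mu_self]
    have : Subsingleton (Fin (H.δ H.zero)) := by rw [H.δ_zero]; infer_instance
    ext a b
    rw [Subsingleton.elim a ⟨0, by rw [H.δ_zero]; exact one_pos⟩,
      Subsingleton.elim b ⟨0, by rw [H.δ_zero]; exact one_pos⟩]
    simp
  · exact H.τ_mu_of_ne h _ _

lemma mul_e0 (x : G) : x * H.e0 = ε x • H.e0 :=
  H.ext_τ fun I => by
    rw [map_mul, map_smul, τ_e0]
    split_ifs with h
    · subst h; rw [mul_one, H.τ_zero]
    · simp

lemma e0_mul (x : G) : H.e0 * x = ε x • H.e0 :=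
  H.ext_τ fun I => by
    rw [map_mul, map_smul, τ_e0]
    split_ifs with h
    · subst h; rw [one_mul, H.τ_zero]
    · simp

lemma smul_one_inj {I : ι} {c d : ℂ} (h : c • (1 : 𝕄[H, I, ℂ]) = d • 1) : c = d := by
  have : NeZero (H.δ I) := ⟨(H.δ_pos I).ne'⟩
  simpa using congrFun (congrFun h 0) 0

lemma counit_e0 : ε H.e0 = 1 := by
  have h := H.τ_e0 H.zero
  rw [if_pos rfl, H.τ_zero] at h
  exact H.smul_one_inj (h.trans (one_smul ℂ _).symm)

lemma s_apply (J I : ι) : H.s J I = H.qtr I (legL (H.qtr J) H.RR) := by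
  have : ∀ z : G ⊗[ℂ] G,
      (evalKron (H.τ J) (H.τ I) (z * (H.grp ⊗ₜ[ℂ] H.grp))).trace = H.qtr I (legL (H.qtr J) z) := by
    intro z
    induction z with
    | zero => rw [zero_mul, ← evalKronLin_apply]; simp
    | add a b ha hb =>
      rw [map_add, map_add, ← ha, ← hb, ← Matrix.trace_add]
      congr 1
      simp only [add_mul, ← evalKronLin_apply, map_add]
    | tmul a b =>
      rw [tmul_mul_tmul, evalKron_tmul, Matrix.trace_kronecker]
      simp [qtr_apply]
  exact this H.RR

lemma e0_mem_drinfeldRange (hm : H.IsModular) :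
    H.e0 ∈ H.drinfeldRange := by
  have hc : ∀ I J, ∃ c : ℂ, H.τ I (legL (H.qtr J) H.RR) = c • 1 := fun I J =>
    H.schur_self fun x => by rw [← map_mul, ← map_mul, central_legL_qtr]
  choose c hc using hc
  have hsc : ∀ J I, H.s J I = c I J * H.qdim I := by
    intro J I
    rw [s_apply, qtr_apply, map_mul, hc, smul_mul_assoc, one_mul, Matrix.trace_smul]; rfl
  obtain ⟨s, hs⟩ := hm.2
  have h1 : ∀ I, ∑ J, (s⁻¹ : (Matrix ι ι ℂ)ˣ) H.zero J * H.s J I = if H.zero = I then 1 else 0 := by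
    intro I
    have := congrFun (congrFun s.inv_mul H.zero) I
    rwa [hs, Matrix.mul_apply, Matrix.one_apply] at this
  have h2 : H.e0 = H.qdim H.zero • ∑ J, (s⁻¹ : (Matrix ι ι ℂ)ˣ) H.zero J • legL (H.qtr J) H.RR := by
    refine H.ext_τ fun I => ?_
    simp only [map_smul, map_sum, hc, τ_e0, smul_smul, ← sum_smul]
    have h3 := h1 I
    simp only [hsc, ← mul_assoc, ← sum_mul] at h3
    rw [eq_div_of_mul_eq (hm.1 I).ne' h3]
    by_cases h : I = H.zero
    · subst h; simp [(hm.1 H.zero).ne']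
    · simp [h, Ne.symm h]
  rw [h2]
  exact smul_mem _ _ (Submodule.sum_mem _ fun J _ =>
    smul_mem _ _ (H.legL_RR_mem _))

lemma legL_comul_mem {w : G} (hw : w ∈ H.drinfeldRange) (k : G →ₗ[ℂ] ℂ) :
    legL k (Δ w) ∈ H.drinfeldRange := by
  -- the three legs of `G ⊗ (G ⊗ G)`
  let a : G →ₐ[ℂ] G ⊗[ℂ] (G ⊗[ℂ] G) := includeLeft
  let b : G →ₐ[ℂ] G ⊗[ℂ] (G ⊗[ℂ] G) :=
    includeRight.comp includeLeft
  let c : G →ₐ[ℂ] G ⊗[ℂ] (G ⊗[ℂ] G) :=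
    includeRight.comp includeRight
  have hab : Legs a b := fun x y => by simp [a, b, Commute, SemiconjBy]
  have hac : Legs a c := fun x y => by simp [a, c, Commute, SemiconjBy]
  have hbc : Legs b c := fun x y => by simp [b, c, Commute, SemiconjBy]
  have key : Ev a (conv b c hbc) H.RR = H.Rv b a * Ev a c H.RR * H.Rv a b := by
    have h1 : Ev a (conv b c hbc) H.RR = H.Qv a (conv b c hbc) := rfl
    have h2 : Ev a c H.RR = H.Qv a c := rfl
    rw [h1, h2, H.Qv_eq (Legs.conv_right hab hac), H.Qv_eq hac, H.Rv_conv_left hbc hab.symm hac.symm,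
      H.Rv_conv_right hab hac hbc]
    simp only [mul_assoc]
  have hcr : ∀ z, Ev a (conv b c hbc) z = comulRight G z := by
    intro z
    induction z with
    | tmul p q =>
      have : conv b c hbc q = 1 ⊗ₜ Δ q := by
        rw [conv_apply]
        generalize (Δ q) = w
        induction w with
        | tmul r s => simp [b, c]
        | _ => simp_all [tmul_add]
      simp [a, this, comulRight]
    | _ => simp_all
  induction hw using span_induction with
  | zero => simp
  | add x y _ _ hx hy => simpa using Submodule.add_mem _ hx hy
  | smul t x _ hx => simpa using smul_mem _ t hx
  | mem x hx =>
    obtain ⟨⟨I, p, q⟩, rfl⟩ := hx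
    let φ : G →ₗ[ℂ] ℂ := entry (A := ℂ) (H.τ I) p q
    have e1 : legL k (Δ (H.coef I p q H.RR)) = legL k (legL φ (comulRight G H.RR)) := by
      congr 1
      generalize H.RR = z
      induction z with
      | tmul r s => simp [comulRight, φ, entry]
      | _ => simp_all
    change legL k (Δ (H.coef I p q H.RR)) ∈ _
    rw [e1, ← hcr, key, H.Rv_eq_sum, H.Rv_eq_sum]
    simp only [sum_mul, mul_sum, map_sum]
    refine Submodule.sum_mem _ fun j _ => Submodule.sum_mem _ fun i _ => ?_
    have e2 : ∀ z, legL k (legL φ (b (H.rl i) * a (H.rr i) * Ev a c z * (a (H.rl j) * b (H.rr j))))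
        = legL (k (H.rl i * H.rr j) • (φ ∘ₗ mulLeft ℂ (H.rr i) ∘ₗ
            mulRight ℂ (H.rl j))) z := by
      intro z
      induction z with
      | tmul r s => simp [a, b, c, mul_assoc, smul_smul, mul_comm]
      | _ => simp_all [mul_add, add_mul]
    rw [e2]
    exact H.legL_RR_mem _

lemma mul_legL_comul_e0 (k : G →ₗ[ℂ] ℂ) (x : G) :
    x * legL k (Δ H.e0) = legL (k ∘ₗ mulLeft ℂ (𝒮 x)) (Δ H.e0) := by
  rw [← legL_mul_left, ← legL_mul_tmul_one]
  have hcomul : ∀ y : G, conv _ _ (legs_include (G := G)) y = Δ y :=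
    fun y => by rw [conv_apply, Ev_include]
  have := mul_of_invariant (legs_include (G := G)) (Y := Δ H.e0)
    (fun y => by rw [hcomul, ← Bialgebra.comul_mul, mul_e0, map_smul]) x
  exact congrArg (legL k) this

/-- The Drinfeld map is surjective. -/
lemma drinfeldRange_eq_top (hm : H.IsModular) :
    H.drinfeldRange = ⊤ := by
  have h0 := H.e0_mem_drinfeldRange hm
  refine eq_top_iff.2 fun x _ => ?_
  have h1 : x = ∑ I, ∑ a, ∑ b, x * (𝒮 (H.mu I a b) * H.coef I a b (Δ H.e0)) := by
    have h2 := pairEval_antipode_comul (H.e0 : G)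
    rw [H.counit_e0, map_one, H.eq_sum_coef (Δ H.e0)] at h2
    simp only [map_sum, pairEval_tmul, id_apply] at h2
    simp only [← mul_sum, h2, mul_one]
  rw [h1]
  refine Submodule.sum_mem _ fun I _ => Submodule.sum_mem _ fun a _ => Submodule.sum_mem _
    fun b _ => ?_
  have h3 := H.mul_legL_comul_e0 (entry (A := ℂ) (H.τ I) a b) (x * 𝒮 (H.mu I a b))
  rw [← mul_assoc]
  change _ * legL (entry (A := ℂ) (H.τ I) a b) _ ∈ _
  rw [h3]
  exact H.legL_comul_mem h0 _

end SymmetryData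
end

/-! ### The relations of the graph algebra as matrix equations -/

section

lemma num_map {n k : Type*} (θ : A →ₐ[ℂ] B) (X : Matrix n k ℂ) :
    (num X : Matrix n k A).map θ = num X := by ext; simp [num]

lemma inFirst_map {n k : Type*} [DecidableEq k] (θ : A →ₐ[ℂ] B) (X : Matrix n n A) :
    (inFirst k X).map θ = inFirst k (X.map θ) := by
  ext ⟨a, b⟩ ⟨c, d⟩; by_cases h : b = d <;> simp [inFirst, h]

lemma inSecond_map {n k : Type*} [DecidableEq n] (θ : A →ₐ[ℂ] B) (X : Matrix k k A) :
    (inSecond n X).map θ = inSecond n (X.map θ) := by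
  ext ⟨a, b⟩ ⟨c, d⟩; by_cases h : a = c <;> simp [inSecond, h]

lemma map_mul_alg {n k l : Type*} [Fintype k] (θ : A →ₐ[ℂ] B) (X : Matrix n k A)
    (Y : Matrix k l A) : (X * Y).map θ = X.map θ * Y.map θ := Matrix.map_mul

variable {I J : ι} (X : 𝕄[H, I, A]) (Y : 𝕄[H, J, A])

lemma productSide_map (θ : A →ₐ[ℂ] B) :
    (productSide H X Y).map θ = productSide H (X.map θ) (Y.map θ) := by
  simp only [productSide, map_mul_alg, inFirst_map, inSecond_map, SymmetryData.RM, num_map]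

lemma exchangeLeft_map (θ : A →ₐ[ℂ] B) :
    (exchangeLeft H X Y).map θ = exchangeLeft H (X.map θ) (Y.map θ) := by
  simp only [exchangeLeft, map_mul_alg, inFirst_map, inSecond_map, SymmetryData.RM,
    SymmetryData.RinvM, num_map]

lemma exchangeRight_map (θ : A →ₐ[ℂ] B) :
    (exchangeRight H X Y).map θ = exchangeRight H (X.map θ) (Y.map θ) := by
  simp only [exchangeRight, map_mul_alg, inFirst_map, inSecond_map, SymmetryData.RM,
    SymmetryData.RinvM, num_map]

lemma handleRight_map (θ : A →ₐ[ℂ] B) :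
    (handleRight H X Y).map θ = handleRight H (X.map θ) (Y.map θ) := by
  simp only [handleRight, map_mul_alg, inFirst_map, inSecond_map, SymmetryData.RM,
    SymmetryData.RpM, num_map]

lemma fusionSide_eq (X : ∀ K : ι, 𝕄[H, K, A]) (I J : ι) :
    fusionSide H X I J = ∑ K, ∑ a : Fin (H.N I J K),
      (num (H.C I J K a)ᴴ : Matrix (Fin (H.δ I) × Fin (H.δ J)) (Fin (H.δ K)) A)
        * (X K * (num (H.C I J K a) : Matrix (Fin (H.δ K)) (Fin (H.δ I) × Fin (H.δ J)) A)) := by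
  unfold fusionSide
  refine sum_congr rfl fun K _ => sum_congr rfl fun a _ => ?_
  exact Matrix.mul_assoc (num (H.C I J K a)ᴴ :
    Matrix (Fin (H.δ I) × Fin (H.δ J)) (Fin (H.δ K)) A) (X K) (num (H.C I J K a))

lemma fusionSide_map (θ : A →ₐ[ℂ] B) (X : ∀ K : ι, 𝕄[H, K, A])
    (I J : ι) : (fusionSide H X I J).map θ = fusionSide H (fun K => (X K).map θ) I J := by
  rw [fusionSide_eq, fusionSide_eq]
  ext p q
  simp only [Matrix.map_apply, Matrix.sum_apply, map_sum]
  refine sum_congr rfl fun K _ => sum_congr rfl fun a _ => ?_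
  rw [← num_map θ, ← num_map θ (H.C I J K a), ← map_mul_alg, ← map_mul_alg]
  rfl

/-- The relations of the graph algebra, for matrices over an algebra. -/
structure IsHolFamily (g m : ℕ) (X : Hol g m → ∀ I : ι, 𝕄[H, I, A]) :
    Prop where
  unit : ∀ h, X h H.zero = 1
  functoriality : ∀ h I J, productSide H (X h I) (X h J) = fusionSide H (X h) I J
  handle : ∀ i I J, exchangeLeft H (X (.A i) I) (X (.B i) J)
    = handleRight H (X (.A i) I) (X (.B i) J)
  exchange : ∀ h k, Hol.Before h k → ∀ I J,
    exchangeLeft H (X h I) (X k J) = exchangeRight H (X h I) (X k J)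

variable {H} {g m : ℕ}

lemma IsHolFamily.map {X : Hol g m → ∀ I : ι, 𝕄[H, I, A]}
    (hX : IsHolFamily H g m X) (θ : A →ₐ[ℂ] B) : IsHolFamily H g m fun h I => (X h I).map θ where
  unit h := by simp [hX.unit]
  functoriality h I J := by
    rw [← productSide_map, hX.functoriality, fusionSide_map]
  handle i I J := by rw [← exchangeLeft_map, hX.handle, handleRight_map]
  exchange h k hk I J := by rw [← exchangeLeft_map, hX.exchange h k hk, exchangeRight_map]

variable (H g m) in
lemma isHolFamily_hol : IsHolFamily H g m (hol H g m) where
  unit h := by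
    ext a b
    have := RingQuot.mkAlgHom_rel ℂ (GraphRel.unit (H := H) (X := freeHol H g m) h a b)
    rw [hol, Matrix.map_apply, this]
    simp [Matrix.one_apply]
  functoriality h I J := by
    unfold hol
    rw [← productSide_map, ← fusionSide_map]
    ext p q
    exact RingQuot.mkAlgHom_rel ℂ (GraphRel.functoriality h I J p q)
  handle i I J := by
    unfold hol
    rw [← exchangeLeft_map, ← handleRight_map]
    ext p q
    exact RingQuot.mkAlgHom_rel ℂ (GraphRel.handle i I J p q)
  exchange h k hk I J := by
    unfold hol
    rw [← exchangeLeft_map, ← exchangeRight_map]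
    ext p q
    exact RingQuot.mkAlgHom_rel ℂ (GraphRel.exchange h k hk I J p q)

/-- The homomorphism on the free algebra. -/
def freeLift (X : Hol g m → ∀ I : ι, 𝕄[H, I, A]) :
    FreeAlgebra ℂ (Gen H g m) →ₐ[ℂ] A :=
  FreeAlgebra.lift ℂ fun p => X p.1 p.2.1 p.2.2.1 p.2.2.2

lemma freeHol_map (X : Hol g m → ∀ I : ι, 𝕄[H, I, A]) (h : Hol g m)
    (I : ι) : (freeHol H g m h I).map (freeLift X) = X h I := by
  ext a b; simp [freeHol, freeLift]

lemma IsHolFamily.freeLift_rel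
    {X : Hol g m → ∀ I : ι, 𝕄[H, I, A]} (hX : IsHolFamily H g m X)
    {x y : FreeAlgebra ℂ (Gen H g m)} (hxy : GraphRel H g m (freeHol H g m) x y) :
    freeLift X x = freeLift X y := by
  cases hxy with
  | unit h a b =>
    have e : (freeHol H g m h H.zero).map (freeLift X)
        = (1 : Matrix _ _ (FreeAlgebra ℂ (Gen H g m))).map (freeLift X) := by
      rw [freeHol_map, hX.unit]; simp
    exact congrFun (congrFun e a) b
  | functoriality h I J p q =>
    have e : (productSide H (freeHol H g m h I) (freeHol H g m h J)).map (freeLift X)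
        = (fusionSide H (freeHol H g m h) I J).map (freeLift X) := by
      rw [productSide_map, fusionSide_map]; simp only [freeHol_map, hX.functoriality]
    exact congrFun (congrFun e p) q
  | handle i I J p q =>
    have e : (exchangeLeft H (freeHol H g m (.A i) I) (freeHol H g m (.B i) J)).map (freeLift X)
        = (handleRight H (freeHol H g m (.A i) I) (freeHol H g m (.B i) J)).map (freeLift X) := by
      rw [exchangeLeft_map, handleRight_map]; simp only [freeHol_map, hX.handle]
    exact congrFun (congrFun e p) q
  | exchange h k hk I J p q =>
    have e : (exchangeLeft H (freeHol H g m h I) (freeHol H g m k J)).map (freeLift X)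
        = (exchangeRight H (freeHol H g m h I) (freeHol H g m k J)).map (freeLift X) := by
      rw [exchangeLeft_map, exchangeRight_map]; simp only [freeHol_map, hX.exchange h k hk]
    exact congrFun (congrFun e p) q

/-- The homomorphism from the graph algebra given by a family of holonomies. -/
def IsHolFamily.lift {X : Hol g m → ∀ I : ι, 𝕄[H, I, A]}
    (hX : IsHolFamily H g m X) : GraphAlgebra H g m →ₐ[ℂ] A :=
  RingQuot.liftAlgHom ℂ ⟨freeLift X, fun _ _ => hX.freeLift_rel⟩

lemma IsHolFamily.hol_map_lift
    {X : Hol g m → ∀ I : ι, 𝕄[H, I, A]}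
    (hX : IsHolFamily H g m X) (h : Hol g m) (I : ι) : (hol H g m h I).map hX.lift = X h I := by
  ext a b
  simp only [hol, Matrix.map_apply, IsHolFamily.lift, RingQuot.liftAlgHom_mkAlgHom_apply]
  exact congrFun (congrFun (freeHol_map X h I) a) b

lemma graphAlgebra_algHom_ext {θ η : GraphAlgebra H g m →ₐ[ℂ] A}
    (h : ∀ k I, (hol H g m k I).map θ = (hol H g m k I).map η) : θ = η := by
  apply RingQuot.ringQuot_ext'
  apply FreeAlgebra.hom_ext
  funext ⟨k, I, a, b⟩
  exact congrFun (congrFun (h k I) a) b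

/-- The graph algebra is generated by the entries of the holonomies. -/
lemma graphAlgebra_induction {p : GraphAlgebra H g m → Prop}
    (scalar : ∀ c, p (algebraMap ℂ _ c)) (gen : ∀ h I a b, p (hol H g m h I a b))
    (add : ∀ x y, p x → p y → p (x + y)) (mul : ∀ x y, p x → p y → p (x * y)) (x) : p x := by
  obtain ⟨y, rfl⟩ := RingQuot.mkAlgHom_surjective ℂ (GraphRel H g m (freeHol H g m)) x
  induction y using FreeAlgebra.induction with
  | grade0 c => rw [commutes]; exact scalar c
  | grade1 q => exact gen q.1 q.2.1 q.2.2.1 q.2.2.2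
  | add a b ha hb => rw [map_add]; exact add _ _ ha hb
  | mul a b ha hb => rw [map_mul]; exact mul _ _ ha hb

end

section

lemma numHom_map {n : Type*} [Fintype n] [DecidableEq n] (θ : A →ₐ[ℂ] B)
    (ρ : G →ₐ[ℂ] Matrix n n ℂ) : θ.mapMatrix.comp (numHom A ρ) = numHom B ρ := by
  ext x : 1; exact num_map θ (ρ x)

lemma scal_map {n : Type*} [Fintype n] [DecidableEq n] (θ : A →ₐ[ℂ] B) (φ : G →ₐ[ℂ] A) :
    θ.mapMatrix.comp ((scal A n).comp φ) = (scal B n).comp (θ.comp φ) := by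
  ext x a b
  by_cases h : a = b <;> simp [scal_apply, h]

namespace SymmetryData

/-- The holonomy matrices given by a homomorphism `φ : G → A`. -/
def holMat (φ : G →ₐ[ℂ] A) (I : ι) : 𝕄[H, I, A] :=
  H.hv (numHom A (H.τ I)) ((scal A _).comp φ)

lemma holMat_eq (φ : G →ₐ[ℂ] A) (I : ι) :
    H.holMat φ I = (H.κ I)⁻¹ • evalMat (H.τ I) φ.toLinearMap H.RR := by
  rw [holMat, hv, evalMat_eq_Ev]
  have : numHom A (H.τ I) ↑H.kap⁻¹ = (H.κ I)⁻¹ • 1 := by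
    rw [numHom, comp_apply, H.τ_kap_inv, map_smul, map_one]
  rw [this, smul_mul_assoc, one_mul]; rfl

lemma holMat_apply (φ : G →ₐ[ℂ] A) (I : ι) (a b : Fin (H.δ I)) :
    H.holMat φ I a b = (H.κ I)⁻¹ • φ (H.coef I a b H.RR) := by
  rw [holMat_eq, Matrix.smul_apply]
  congr 1
  generalize H.RR = z
  induction z with
  | zero => simp [evalMat]
  | add x y hx hy => rw [map_add, map_add, ← hx, ← hy]; simp [evalMat]
  | tmul x y => simp [evalMat, entry, smul_def]

lemma map_hv (θ : A →ₐ[ℂ] B) (a f : G →ₐ[ℂ] A) :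
    θ (H.hv a f) = H.hv (θ.comp a) (θ.comp f) := by
  rw [hv, hv, map_mul, H.map_Qv]; rfl

lemma holMat_map (θ : A →ₐ[ℂ] B) (φ : G →ₐ[ℂ] A) (I : ι) :
    (H.holMat φ I).map θ = H.holMat (θ.comp φ) I := by
  change θ.mapMatrix (H.hv _ _) = _
  rw [map_hv, numHom_map, scal_map]; rfl

lemma inFirst_holMat (φ : G →ₐ[ℂ] A) (I J : ι) :
    inFirst (Fin (H.δ J)) (H.holMat φ I) = H.hv (H.lA A I J) ((scal A _).comp φ) := by
  rw [← inFirstHom_apply, holMat, map_hv]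
  congr 1
  ext x : 1
  exact inFirstHom_scal _

lemma inSecond_holMat (φ : G →ₐ[ℂ] A) (I J : ι) :
    inSecond (Fin (H.δ I)) (H.holMat φ J) = H.hv (H.lB A I J) ((scal A _).comp φ) := by
  rw [← inSecondHom_apply, holMat, map_hv]
  congr 1
  ext x : 1
  exact inSecondHom_scal _

lemma hv_triv (f : G →ₐ[ℂ] A) : H.hv (triv A) f
    = algebraMap ℂ A (Coalgebra.counit ((H.kap⁻¹ : Gˣ) : G)) := by
  rw [hv, H.Qv_eq (Legs.triv_left f), H.Rv_triv_left, H.Rv_triv_right]; simp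

lemma numHom_zero : numHom A (H.τ H.zero) = triv _ := by
  ext x a b
  simp [numHom, H.τ_zero, numAlg_apply, num, triv, Algebra.ofId_apply, Matrix.algebraMap_matrix_apply,
    Matrix.one_apply, algebraMap_eq_smul_one]

lemma counit_kap : ε (H.kap : G) = H.κ H.zero := by
  refine H.smul_one_inj (I := H.zero) ?_
  rw [← H.τ_zero, H.τ_kap]

lemma comp_triv (θ : A →ₐ[ℂ] B) : θ.comp (triv A) = (triv B : G →ₐ[ℂ] B) := by
  ext x; simp

lemma κ_zero : H.κ H.zero = 1 := by
  have h1 := H.posDef_evalKron_twist H.zero H.zero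
  have hA : H.lA ℂ H.zero H.zero = triv _ := by rw [lA, legFst, numHom_zero, comp_triv]
  have hB : H.lB ℂ H.zero H.zero = triv _ := by rw [lB, legSnd, numHom_zero, comp_triv]
  have hc := H.legs_AB (A := ℂ) H.zero H.zero
  have h2 : evalKron (H.τ H.zero) (H.τ H.zero) (twist H)
      * evalKron (H.τ H.zero) (H.τ H.zero) ((H.kap : G) ⊗ₜ (H.kap : G)) = H.κ H.zero • 1 := by
    rw [twist, ← evalKron_mul, mul_assoc, mul_assoc, ← kap_tmul_kap_central, kap_tmul_mul_inv,
      mul_one, evalKron_eq_Ev, Ev_mul hc, ← conv_apply hc]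
    change H.Rv (H.lA ℂ H.zero H.zero) (H.lB ℂ H.zero H.zero) * _ = _
    rw [conv_apply]
    rw [show Ev (legFst ℂ (Fin (H.δ H.zero)) (H.τ H.zero)) (legSnd ℂ (Fin (H.δ H.zero)) (H.τ H.zero))
      = Ev (triv _) (triv _) from congrArg₂ Ev hA hB, hA, hB, H.Rv_triv_right, one_mul,
      ← conv_apply (Legs.triv_right _), conv_triv_right, triv_apply, counit_kap,
      algebraMap_eq_smul_one]
  rw [evalKron_tmul, H.τ_kap, Matrix.smul_kronecker, Matrix.kronecker_smul,
    Matrix.one_kronecker_one, smul_smul, ← sq, κ_zero_sq, one_smul, mul_one] at h2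
  rw [h2] at h1
  let i : Fin (H.δ H.zero) := ⟨0, H.δ_pos _⟩
  have h3 : 0 < H.κ H.zero := by
    have := h1.diag_pos (i := (i, i))
    simpa using this
  rcases sq_eq_one_iff.1 H.κ_zero_sq with h | h
  · exact h
  · rw [h] at h3
    exact absurd h3 (by simp [Complex.lt_def])

lemma holMat_unit (φ : G →ₐ[ℂ] A) : H.holMat φ H.zero = 1 := by
  rw [holMat, numHom_zero, hv_triv]
  have h : ε ((H.kap⁻¹ : Gˣ) : G) = 1 := by
    refine H.smul_one_inj (I := H.zero) ?_
    rw [← H.τ_zero, H.τ_kap_inv, κ_zero, inv_one]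
  rw [h, map_one]

lemma holMat_functoriality (φ : G →ₐ[ℂ] A) (I J : ι) :
    productSide H (H.holMat φ I) (H.holMat φ J) = fusionSide H (H.holMat φ) I J := by
  rw [productSide, inFirst_holMat, inSecond_holMat, RM_eq,
    H.hv_mul_R_mul_hv (H.legs_AB I J) (legs_fst_scal _ _) (legs_snd_scal _ _), ← num_evalKron,
    evalKron_twist, fusionSide_eq]
  have h1 : ∀ K (a : Fin (H.N I J K)),
      (num (H.C I J K a) : Matrix (Fin (H.δ K)) (Fin (H.δ I) × Fin (H.δ J)) A) *
        H.hv (conv (H.lA A I J) (H.lB A I J) (H.legs_AB I J)) ((scal A _).comp φ)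
      = H.holMat φ K * (num (H.C I J K a) : Matrix (Fin (H.δ K)) (Fin (H.δ I) × Fin (H.δ J)) A) := by
    intro K a
    rw [hv, ← Matrix.mul_assoc, num_C_mul_conv, Matrix.mul_assoc]
    rw [RibbonHopfStar.Qv, num_C_mul_Ev, ← Matrix.mul_assoc]; rfl
  simp only [← h1, ← Matrix.mul_assoc, ← num_mul]
  have h2 : ∀ Z : Matrix (Fin (H.δ I) × Fin (H.δ J)) (Fin (H.δ I) × Fin (H.δ J)) ℂ,
    (num Z : Matrix _ _ A) = numAlg A _ Z := fun _ => rfl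
  simp only [h2, map_sum, sum_mul]

lemma handle_iff (φ ψ : G →ₐ[ℂ] A) (I J : ι) :
    exchangeLeft H (H.holMat φ I) (H.holMat ψ J) = handleRight H (H.holMat φ I) (H.holMat ψ J) ↔
    H.Ri (H.lA A I J) (H.lB A I J) * H.hv (H.lA A I J) ((scal A _).comp φ)
      * H.Rv (H.lA A I J) (H.lB A I J) * H.hv (H.lB A I J) ((scal A _).comp ψ)
    = H.hv (H.lB A I J) ((scal A _).comp ψ) * H.Rv (H.lB A I J) (H.lA A I J)
      * H.hv (H.lA A I J) ((scal A _).comp φ) * H.Rv (H.lA A I J) (H.lB A I J) := by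
  rw [exchangeLeft, handleRight, inFirst_holMat, inSecond_holMat, RM_eq, RinvM_eq, RpM_eq]

end SymmetryData
end

/-! ### Subspaces spanned by matrix entries -/

section

variable {n k : Type*} [Fintype n] [DecidableEq n] [Fintype k] [DecidableEq k]

/-- All entries of a matrix belong to the subspace `V`. -/
def EntriesIn (V : Submodule ℂ A) (M : Matrix n n A) : Prop := ∀ i j, M i j ∈ V

variable {V : Submodule ℂ A}

lemma EntriesIn.num_mul {M : Matrix n n A} (hM : EntriesIn V M) (X : Matrix n n ℂ) :
    EntriesIn V (numAlg A n X * M) := fun i j => by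
  rw [Matrix.mul_apply]
  refine Submodule.sum_mem _ fun l _ => ?_
  rw [numAlg_apply, num, Matrix.map_apply, ← smul_def]
  exact V.smul_mem _ (hM _ _)

lemma EntriesIn.mul_num {M : Matrix n n A} (hM : EntriesIn V M) (X : Matrix n n ℂ) :
    EntriesIn V (M * numAlg A n X) := fun i j => by
  rw [Matrix.mul_apply]
  refine Submodule.sum_mem _ fun l _ => ?_
  rw [numAlg_apply, num, Matrix.map_apply, ← Algebra.commutes, ← smul_def]
  exact V.smul_mem _ (hM _ _)

lemma EntriesIn.sum {ι : Type*} {s : Finset ι} {M : ι → Matrix n n A}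
    (hM : ∀ i ∈ s, EntriesIn V (M i)) : EntriesIn V (∑ i ∈ s, M i) := fun a b => by
  rw [Matrix.sum_apply]
  exact Submodule.sum_mem _ fun i hi => hM i hi a b

lemma inFirst_num (X : Matrix n n ℂ) :
    inFirstHom A n k (numAlg A n X) = numAlg A (n × k) (inFirst k X) :=
  (inFirst_map (ofId ℂ A) X).symm

lemma inSecond_num (X : Matrix k k ℂ) :
    inSecondHom A n k (numAlg A k X) = numAlg A (n × k) (inSecond n X) :=
  (inSecond_map (ofId ℂ A) X).symm

lemma inFirst_mul_inSecond_apply (X : Matrix n n A) (Y : Matrix k k A) (i j : n) (p q : k) :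
    (inFirst k X * inSecond n Y) (i, p) (j, q) = X i j * Y p q := by
  simp [inFirst, inSecond, Matrix.mul_apply, sum_prod_type, Matrix.one_apply]

lemma inSecond_mul_inFirst_apply (X : Matrix n n A) (Y : Matrix k k A) (i j : n) (p q : k) :
    (inSecond n Y * inFirst k X) (i, p) (j, q) = Y p q * X i j := by
  simp [inFirst, inSecond, Matrix.mul_apply, sum_prod_type, Matrix.one_apply]

end

section

lemma EntriesIn.legFst_mul {V : Submodule ℂ A} {I J : ι}
    {M : Matrix (Fin (H.δ I) × Fin (H.δ J)) (Fin (H.δ I) × Fin (H.δ J)) A} (hM : EntriesIn V M)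
    (x : G) : EntriesIn V (H.lA A I J x * M) := by
  change EntriesIn V (inFirstHom A _ _ (numAlg A _ (H.τ I x)) * M)
  rw [inFirst_num]; exact hM.num_mul _

lemma EntriesIn.mul_legFst {V : Submodule ℂ A} {I J : ι}
    {M : Matrix (Fin (H.δ I) × Fin (H.δ J)) (Fin (H.δ I) × Fin (H.δ J)) A} (hM : EntriesIn V M)
    (x : G) : EntriesIn V (M * H.lA A I J x) := by
  change EntriesIn V (M * inFirstHom A _ _ (numAlg A _ (H.τ I x)))
  rw [inFirst_num]; exact hM.mul_num _

lemma EntriesIn.legSnd_mul {V : Submodule ℂ A} {I J : ι}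
    {M : Matrix (Fin (H.δ I) × Fin (H.δ J)) (Fin (H.δ I) × Fin (H.δ J)) A} (hM : EntriesIn V M)
    (x : G) : EntriesIn V (H.lB A I J x * M) := by
  change EntriesIn V (inSecondHom A _ _ (numAlg A _ (H.τ J x)) * M)
  rw [inSecond_num]; exact hM.num_mul _

lemma EntriesIn.mul_legSnd {V : Submodule ℂ A} {I J : ι}
    {M : Matrix (Fin (H.δ I) × Fin (H.δ J)) (Fin (H.δ I) × Fin (H.δ J)) A} (hM : EntriesIn V M)
    (x : G) : EntriesIn V (M * H.lB A I J x) := by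
  change EntriesIn V (M * inSecondHom A _ _ (numAlg A _ (H.τ J x)))
  rw [inSecond_num]; exact hM.mul_num _

variable {I J : ι} {X : 𝕄[H, I, A]}
  {Y : 𝕄[H, J, A]}

lemma entriesIn_of_productSide {V : Submodule ℂ A} (h : EntriesIn V (productSide H X Y))
    (i j : Fin (H.δ I)) (p q : Fin (H.δ J)) : X i j * Y p q ∈ V := by
  rw [← inFirst_mul_inSecond_apply]
  have := H.cancel_Rv (H.legs_AB (A := A) I J) (P := inFirst _ X) (Q := inSecond _ Y)
    (fun x => inFirst_commute_inSecond_num _ _)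
    (fun x => (inFirst_num_commute_inSecond _ _).symm)
  rw [← this]
  rw [productSide, SymmetryData.RM_eq] at h
  exact EntriesIn.sum (fun j _ => (h.legSnd_mul H _).mul_legFst H _) _ _

lemma entriesIn_of_mul_RinvM {V : Submodule ℂ A}
    (h : EntriesIn V (inSecond _ Y * H.RinvM I J * inFirst _ X))
    (i j : Fin (H.δ I)) (p q : Fin (H.δ J)) : Y p q * X i j ∈ V := by
  rw [← inSecond_mul_inFirst_apply]
  have := H.cancel_Ri (a := H.lA A I J) (b := H.lB A I J) (P := inSecond _ Y) (Q := inFirst _ X)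
    (fun x => (inFirst_num_commute_inSecond _ _).symm)
    (fun x => inFirst_commute_inSecond_num _ _)
  rw [← this]
  rw [SymmetryData.RinvM_eq] at h
  exact EntriesIn.sum (fun j _ => (h.legFst_mul H _).mul_legSnd H _) _ _

lemma entriesIn_of_mul_RpM {V : Submodule ℂ A}
    (h : EntriesIn V (inSecond _ Y * H.RpM I J * inFirst _ X))
    (i j : Fin (H.δ I)) (p q : Fin (H.δ J)) : Y p q * X i j ∈ V := by
  rw [← inSecond_mul_inFirst_apply]
  have := H.cancel_Rv (H.legs_AB (A := A) I J).symm (P := inSecond _ Y) (Q := inFirst _ X)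
    (fun x => (inFirst_num_commute_inSecond _ _).symm)
    (fun x => inFirst_commute_inSecond_num _ _)
  rw [← this]
  rw [SymmetryData.RpM_eq] at h
  exact EntriesIn.sum (fun j _ => (h.legFst_mul H _).mul_legSnd H _) _ _

/-- The subspace spanned by the entries of the matrices `X^I`. -/
def entrySpan (X : ∀ I : ι, 𝕄[H, I, A]) : Submodule ℂ A :=
  Submodule.span ℂ (Set.range fun p : RegIndex H => X p.1 p.2.1 p.2.2)

variable {H}

lemma mem_entrySpan (X : ∀ I : ι, 𝕄[H, I, A]) (I : ι)
    (i j : Fin (H.δ I)) : X I i j ∈ entrySpan H X := subset_span ⟨⟨I, i, j⟩, rfl⟩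

lemma one_mem_entrySpan {X : ∀ I : ι, 𝕄[H, I, A]} (hX : X H.zero = 1) : 1 ∈ entrySpan H X := by
  have := mem_entrySpan X H.zero ⟨0, H.δ_pos _⟩ ⟨0, H.δ_pos _⟩
  rwa [hX, one_apply_eq] at this

lemma entrySpan_mul_le {X Y : ∀ I : ι, 𝕄[H, I, A]}
    {V : Submodule ℂ A} (h : ∀ I J i j p q, X I i j * Y J p q ∈ V) :
    entrySpan H X * entrySpan H Y ≤ V := by
  rw [entrySpan, entrySpan, Submodule.span_mul_span, span_le]
  rintro _ ⟨_, ⟨p, rfl⟩, _, ⟨q, rfl⟩, rfl⟩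
  exact h _ _ _ _ _ _

lemma entrySpan_mul_self_le {X : ∀ I : ι, 𝕄[H, I, A]}
    (hX : ∀ I J, productSide H (X I) (X J) = fusionSide H X I J) :
    entrySpan H X * entrySpan H X ≤ entrySpan H X := by
  refine entrySpan_mul_le fun I J i j p q => entriesIn_of_productSide H ?_ i j p q
  rw [hX, fusionSide_eq]
  refine EntriesIn.sum fun K _ => EntriesIn.sum fun a _ => fun r s => ?_
  rw [Matrix.mul_apply]
  refine Submodule.sum_mem _ fun c _ => ?_
  rw [Matrix.mul_apply, num, Matrix.map_apply, ← smul_def]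
  refine smul_mem _ _ (Submodule.sum_mem _ fun d _ => ?_)
  rw [num, Matrix.map_apply, ← Algebra.commutes, ← smul_def]
  exact smul_mem _ _ (mem_entrySpan X K c d)

lemma entriesIn_mul_mul {X Y : ∀ I : ι, 𝕄[H, I, A]} (I J : ι)
    (U V W : Matrix (Fin (H.δ I) × Fin (H.δ J)) (Fin (H.δ I) × Fin (H.δ J)) ℂ) :
    EntriesIn (entrySpan H X * entrySpan H Y)
      (numAlg A _ U * inFirst _ (X I) * numAlg A _ V * inSecond _ (Y J) * numAlg A _ W) := by
  have h1 : EntriesIn (entrySpan H X) (numAlg A _ U * inFirst (Fin (H.δ J)) (X I) * numAlg A _ V) := by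
    refine EntriesIn.mul_num (EntriesIn.num_mul (fun ⟨a, b⟩ ⟨c, d⟩ => ?_) _) _
    by_cases h : b = d
    · simpa [inFirst, h] using mem_entrySpan X I a c
    · simp [inFirst, h]
  refine EntriesIn.mul_num (fun i j => ?_) _
  rw [Matrix.mul_apply]
  refine Submodule.sum_mem _ fun ⟨c, d⟩ _ => mul_mem_mul (h1 _ _) ?_
  by_cases h : c = j.1
  · simpa [inSecond, h] using mem_entrySpan Y J d j.2
  · simp [inSecond, h]

lemma entrySpan_mul_le_of_exchange {X Y : ∀ I : ι, 𝕄[H, I, A]}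
    (h : ∀ I J, exchangeLeft H (X I) (Y J) = exchangeRight H (X I) (Y J)) :
    entrySpan H Y * entrySpan H X ≤ entrySpan H X * entrySpan H Y := by
  refine entrySpan_mul_le fun J I p q i j => entriesIn_of_mul_RinvM H ?_ i j p q
  have h1 := congrArg (· * H.RinvM I J) (h I J)
  simp only [exchangeRight, exchangeLeft, mul_assoc] at h1
  have h2 : (H.RM I J : Matrix _ _ A) * H.RinvM I J = 1 := by
    rw [SymmetryData.RM_eq, SymmetryData.RinvM_eq]; exact H.Rv_mul_Ri (H.legs_AB I J)
  rw [h2, mul_one, ← mul_assoc] at h1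
  rw [mul_assoc, ← h1]
  have := entriesIn_mul_mul (X := X) (Y := Y) I J (evalKron (H.τ I) (H.τ J) ↑H.R⁻¹)
    (evalKron (H.τ I) (H.τ J) H.R)
    (evalKron (H.τ I) (H.τ J) ↑H.R⁻¹)
  simp only [mul_assoc] at this ⊢
  exact this

lemma entrySpan_mul_le_of_handle {X Y : ∀ I : ι, 𝕄[H, I, A]}
    (h : ∀ I J, exchangeLeft H (X I) (Y J) = handleRight H (X I) (Y J)) :
    entrySpan H Y * entrySpan H X ≤ entrySpan H X * entrySpan H Y := by
  refine entrySpan_mul_le fun J I p q i j => entriesIn_of_mul_RpM H ?_ i j p q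
  have h1 := congrArg (· * H.RinvM I J) (h I J)
  simp only [handleRight, exchangeLeft, mul_assoc] at h1
  have h2 : (H.RM I J : Matrix _ _ A) * H.RinvM I J = 1 := by
    rw [SymmetryData.RM_eq, SymmetryData.RinvM_eq]; exact H.Rv_mul_Ri (H.legs_AB I J)
  rw [h2, mul_one, ← mul_assoc] at h1
  rw [mul_assoc, ← h1]
  have := entriesIn_mul_mul (X := X) (Y := Y) I J (evalKron (H.τ I) (H.τ J) ↑H.R⁻¹)
    (evalKron (H.τ I) (H.τ J) H.R)
    (evalKron (H.τ I) (H.τ J) ↑H.R⁻¹)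
  simp only [mul_assoc] at this ⊢
  exact this

end

/-! ### The loop algebra -/

section

lemma isHolFamily_single {X : ∀ I : ι, 𝕄[H, I, A]}
    (h0 : X H.zero = 1) (hX : ∀ I J, productSide H (X I) (X J) = fusionSide H X I J) :
    IsHolFamily H 0 1 fun _ => X where
  unit _ := h0
  functoriality _ := hX
  handle i := i.elim0
  exchange h k hk := by
    cases hk with
    | MM ν μ h => exact absurd h (by rw [Subsingleton.elim ν μ]; exact lt_irrefl _)
    | MA _ j => exact j.elim0
    | MB _ j => exact j.elim0
    | AA _ j => exact j.elim0
    | BB _ j => exact j.elim0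
    | AB _ j => exact j.elim0
    | BA _ j => exact j.elim0

lemma hol_loop_eq (h : Hol 0 1) : h = .M 0 := by
  cases h with
  | M ν => rw [Subsingleton.elim ν 0]
  | A i => exact i.elim0
  | B i => exact i.elim0

lemma entrySpan_hol_loop : entrySpan H (hol H 0 1 (.M 0)) = ⊤ := by
  refine eq_top_iff.2 fun x _ => ?_
  have h := isHolFamily_hol H 0 1
  have h1 := one_mem_entrySpan (h.unit (.M 0))
  refine graphAlgebra_induction (fun c => ?_) (fun k I a b => ?_) (fun _ _ => Submodule.add_mem _)
    (fun x y hx hy => entrySpan_mul_self_le (h.functoriality (.M 0)) (mul_mem_mul hx hy)) x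
  · rw [algebraMap_eq_smul_one]; exact smul_mem _ _ h1
  · rw [hol_loop_eq k]; exact mem_entrySpan _ _ _ _

/-- The homomorphism from the loop algebra to the symmetry algebra. -/
def loopHom : GraphAlgebra H 0 1 →ₐ[ℂ] G :=
  (isHolFamily_single H (H.holMat_unit (AlgHom.id ℂ G))
    (H.holMat_functoriality (AlgHom.id ℂ G))).lift

lemma hol_map_loopHom (I : ι) : (hol H 0 1 (.M 0) I).map (loopHom H) = H.holMat (AlgHom.id ℂ G) I :=
  IsHolFamily.hol_map_lift _ _ _

lemma loopHom_surjective (hm : H.IsModular) : Surjective (loopHom H) := by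
  intro x
  have hx : x ∈ H.drinfeldRange := by rw [H.drinfeldRange_eq_top hm]; trivial
  have : H.drinfeldRange ≤ LinearMap.range (loopHom H).toLinearMap := by
    rw [SymmetryData.drinfeldRange, span_le]
    rintro _ ⟨⟨I, a, b⟩, rfl⟩
    refine ⟨H.κ I • hol H 0 1 (.M 0) I a b, ?_⟩
    have h := congrFun (congrFun (hol_map_loopHom H I) a) b
    rw [SymmetryData.holMat_apply] at h
    rw [map_smul]
    have h' : loopHom H (hol H 0 1 (.M 0) I a b) = (H.κ I)⁻¹ • H.coef I a b H.RR := h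
    refine (congrArg (H.κ I • ·) h').trans ?_
    rw [smul_smul, mul_inv_cancel₀ (H.κ_ne_zero I), one_smul]
  exact this hx

lemma loopHom_bijective (hm : H.IsModular) : Function.Bijective (loopHom H) := by
  refine ⟨?_, loopHom_surjective H hm⟩
  have := H.finiteDimensional
  have h1 : Module.Finite ℂ (GraphAlgebra H 0 1) :=
    ⟨by rw [← entrySpan_hol_loop]; exact Submodule.fg_span (Set.finite_range _)⟩
  have h2 : finrank ℂ (GraphAlgebra H 0 1) ≤ finrank ℂ G := by
    rw [H.finrank_eq_card, ← finrank_top, ← entrySpan_hol_loop]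
    exact finrank_range_le_card _
  have h3 := LinearMap.finrank_range_add_finrank_ker (loopHom H).toLinearMap
  have h4 : LinearMap.range (loopHom H).toLinearMap = ⊤ :=
    range_eq_top.2 (loopHom_surjective H hm)
  rw [h4, finrank_top] at h3
  have h5 : finrank ℂ (ker (loopHom H).toLinearMap) = 0 := by omega
  exact ker_eq_bot.1 (finrank_eq_zero.1 h5)

/-- Every holonomy is given by a homomorphism from the symmetry algebra. -/
lemma exists_holMat_eq (hm : H.IsModular)
    {X : ∀ I : ι, 𝕄[H, I, A]}
    (h0 : X H.zero = 1) (hX : ∀ I J, productSide H (X I) (X J) = fusionSide H X I J) :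
    ∃ φ : G →ₐ[ℂ] A, ∀ I, X I = H.holMat φ I := by
  let e : GraphAlgebra H 0 1 ≃ₐ[ℂ] G := AlgEquiv.ofBijective (loopHom H) (loopHom_bijective H hm)
  let L := (isHolFamily_single H h0 hX).lift
  refine ⟨L.comp e.symm.toAlgHom, fun I => ?_⟩
  rw [← (isHolFamily_single H h0 hX).hol_map_lift (.M 0) I]
  ext a b
  have h := congrFun (congrFun (hol_map_loopHom H I) a) b
  rw [SymmetryData.holMat_apply] at h ⊢
  rw [Matrix.map_apply, comp_apply, ← map_smul]
  change L _ = _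
  rw [← map_smul]
  congr 1
  refine e.injective (h.trans ?_)
  exact (e.apply_symm_apply _).symm

end

/-! ### From matrix identities to identities for arbitrary commuting homomorphisms -/

section

/-- The homomorphism `x ⊗ (y ⊗ z) ↦ a(x) b(y) θ(z)`. -/
def triHom {a b : G →ₐ[ℂ] B} {θ : A →ₐ[ℂ] B} (hab : Legs a b)
    (ha : ∀ x z, Commute (a x) (θ z)) (hb : ∀ y z, Commute (b y) (θ z)) :
    G ⊗[ℂ] (G ⊗[ℂ] A) →ₐ[ℂ] B :=
  Algebra.TensorProduct.lift a (Algebra.TensorProduct.lift b θ hb) fun x z => by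
    induction z with
    | zero => simp
    | add p q hp hq => simpa using hp.add_right hq
    | tmul y z => simpa using (hab x y).mul_right (ha x z)

lemma triHom_tmul {a b : G →ₐ[ℂ] B} {θ : A →ₐ[ℂ] B} (hab : Legs a b)
    (ha : ∀ x z, Commute (a x) (θ z)) (hb : ∀ y z, Commute (b y) (θ z)) (x y : G) (z : A) :
    triHom hab ha hb (x ⊗ₜ (y ⊗ₜ z)) = a x * (b y * θ z) := by simp [triHom]

/-- The first leg of the universal algebra. -/
def uA (A : Type*) [Ring A] [Algebra ℂ A] : G →ₐ[ℂ] G ⊗[ℂ] (G ⊗[ℂ] A) :=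
  includeLeft

/-- The second leg of the universal algebra. -/
def uB (A : Type*) [Ring A] [Algebra ℂ A] : G →ₐ[ℂ] G ⊗[ℂ] (G ⊗[ℂ] A) :=
  includeRight.comp includeLeft

/-- The third factor of the universal algebra. -/
def uT (G : Type uG) [Ring G] [HopfAlgebra ℂ G] (A : Type*) [Ring A] [Algebra ℂ A] :
    A →ₐ[ℂ] G ⊗[ℂ] (G ⊗[ℂ] A) :=
  includeRight.comp includeRight

lemma triHom_uA {a b : G →ₐ[ℂ] B} {θ : A →ₐ[ℂ] B} (hab : Legs a b)
    (ha : ∀ x z, Commute (a x) (θ z)) (hb : ∀ y z, Commute (b y) (θ z)) :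
    (triHom hab ha hb).comp (uA A) = a := by ext x; simp [triHom, uA]

lemma triHom_uB {a b : G →ₐ[ℂ] B} {θ : A →ₐ[ℂ] B} (hab : Legs a b)
    (ha : ∀ x z, Commute (a x) (θ z)) (hb : ∀ y z, Commute (b y) (θ z)) :
    (triHom hab ha hb).comp (uB A) = b := by ext x; simp [triHom, uB]

lemma triHom_uT {a b : G →ₐ[ℂ] B} {θ : A →ₐ[ℂ] B} (hab : Legs a b)
    (ha : ∀ x z, Commute (a x) (θ z)) (hb : ∀ y z, Commute (b y) (θ z)) :
    (triHom hab ha hb).comp (uT G A) = θ := by ext x; simp [triHom, uT]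

lemma lA_commute_scal (I J : ι) (x : G) (z : A) : Commute (H.lA A I J x) (scal A _ z) := by
  have := (num_commute_scal (H.τ I x) z).map (inFirstHom A _ (Fin (H.δ J)))
  rwa [inFirstHom_scal] at this

lemma lB_commute_scal (I J : ι) (x : G) (z : A) : Commute (H.lB A I J x) (scal A _ z) := by
  have := (num_commute_scal (H.τ J x) z).map (inSecondHom A (Fin (H.δ I)) _)
  rwa [inSecondHom_scal] at this

/-- The evaluation at `τ^I ⊗ τ^J`. -/
def matHom (A : Type*) [Ring A] [Algebra ℂ A] (I J : ι) :
    G ⊗[ℂ] (G ⊗[ℂ] A) →ₐ[ℂ] Matrix (Fin (H.δ I) × Fin (H.δ J)) (Fin (H.δ I) × Fin (H.δ J)) A :=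
  triHom (H.legs_AB I J) (lA_commute_scal H I J) (lB_commute_scal H I J)

lemma matHom_tmul (I J : ι) (x y : G) (z : A) : matHom H A I J (x ⊗ₜ (y ⊗ₜ z))
    = H.lA A I J x * (H.lB A I J y * scal A _ z) := triHom_tmul _ _ _ _ _ _

lemma matHom_uA (I J : ι) : (matHom H A I J).comp (uA A) = H.lA A I J := triHom_uA _ _ _

lemma matHom_uB (I J : ι) : (matHom H A I J).comp (uB A) = H.lB A I J := triHom_uB _ _ _

lemma matHom_uT (I J : ι) : (matHom H A I J).comp (uT G A) = scal A _ := triHom_uT _ _ _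

lemma coef_coef_matHom (I J : ι) (a b : Fin (H.δ I)) (c d : Fin (H.δ J))
    (z : G ⊗[ℂ] (G ⊗[ℂ] A)) : H.coef J c d (H.coef I a b z) = matHom H A I J z (a, c) (b, d) := by
  induction z with
  | tmul x w =>
    induction w with
    | tmul y z =>
      rw [matHom_tmul, ← mul_assoc, scal_apply, mul_diagonal]
      have : (H.lA A I J x * H.lB A I J y) (a, c) (b, d)
          = algebraMap ℂ A (H.τ I x a b) * algebraMap ℂ A (H.τ J y c d) :=
        inFirst_mul_inSecond_apply _ _ a b c d
      rw [this, ← map_mul, ← smul_def]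
      simp [smul_smul]
    | _ => simp_all [tmul_add, Matrix.add_apply]
  | _ => simp_all [Matrix.add_apply]

lemma ext_matHom {z w : G ⊗[ℂ] (G ⊗[ℂ] A)} (h : ∀ I J, matHom H A I J z = matHom H A I J w) :
    z = w :=
  H.ext_coef fun I a b => H.ext_coef fun J c d => by rw [coef_coef_matHom, coef_coef_matHom, h]

variable {H}

lemma handle_universal {φ ψ : G →ₐ[ℂ] A} (h : ∀ I J, exchangeLeft H (H.holMat φ I) (H.holMat ψ J)
      = handleRight H (H.holMat φ I) (H.holMat ψ J))
    {a b : G →ₐ[ℂ] B} {θ : A →ₐ[ℂ] B} (hab : Legs a b)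
    (ha : ∀ x z, Commute (a x) (θ z)) (hb : ∀ y z, Commute (b y) (θ z)) :
    H.Ri a b * H.hv a (θ.comp φ) * H.Rv a b * H.hv b (θ.comp ψ)
      = H.hv b (θ.comp ψ) * H.Rv b a * H.hv a (θ.comp φ) * H.Rv a b := by
  have key : H.Ri (uA A) (uB A) * H.hv (uA A) ((uT G A).comp φ) * H.Rv (uA A) (uB A)
        * H.hv (uB A) ((uT G A).comp ψ)
      = H.hv (uB A) ((uT G A).comp ψ) * H.Rv (uB A) (uA A) * H.hv (uA A) ((uT G A).comp φ)
        * H.Rv (uA A) (uB A) := by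
    refine ext_matHom H fun I J => ?_
    have h1 := (H.handle_iff φ ψ I J).1 (h I J)
    simp only [map_mul, H.map_Ri, H.map_Rv, H.map_hv, ← comp_assoc, matHom_uA, matHom_uB, matHom_uT]
    exact h1
  have := congrArg (triHom hab ha hb) key
  simp only [map_mul, H.map_Ri, H.map_Rv, H.map_hv, ← comp_assoc, triHom_uA, triHom_uB,
    triHom_uT] at this
  exact this

end

/-! ### Ordered monomials -/

section

/-- The subspace `U` has a spanning set with at most `N` elements. -/
def SpannedBy (N : ℕ) (U : Submodule ℂ A) : Prop :=
  ∃ s : Finset A, s.card ≤ N ∧ U = Submodule.span ℂ s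

lemma SpannedBy.mul {N M : ℕ} {U V : Submodule ℂ A} (hU : SpannedBy N U)
    (hV : SpannedBy M V) : SpannedBy (N * M) (U * V) := by
  classical
  obtain ⟨s, hs, rfl⟩ := hU
  obtain ⟨t, ht, rfl⟩ := hV
  open scoped Pointwise in
  exact ⟨s * t, Finset.card_mul_le.trans (Nat.mul_le_mul hs ht), by
    rw [Submodule.span_mul_span, Finset.coe_mul]⟩

lemma spannedBy_span_range {κ : Type*} [Fintype κ] (f : κ → A) :
    SpannedBy (card κ) (Submodule.span ℂ (Set.range f)) := by
  classical
  exact ⟨Finset.univ.image f, Finset.card_image_le, by simp⟩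

lemma SpannedBy.finite {N : ℕ} (h : SpannedBy N (⊤ : Submodule ℂ A)) : Module.Finite ℂ A := by
  obtain ⟨s, _, hs⟩ := h
  exact ⟨s, hs.symm⟩

lemma SpannedBy.finrank_le {N : ℕ} (h : SpannedBy N (⊤ : Submodule ℂ A)) :
    finrank ℂ A ≤ N := by
  obtain ⟨s, hs, h⟩ := h
  rw [← finrank_top ℂ A, h]
  exact (finrank_span_finset_le_card s).trans hs

lemma spannedBy_list_prod {σ : Type*} {N : ℕ} {V : σ → Submodule ℂ A}
    (hV : ∀ h, SpannedBy N (V h)) (l : List σ) : SpannedBy (N ^ l.length) (l.map V).prod := by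
  induction l with
  | nil => exact ⟨{1}, by simp, by simp [Submodule.one_eq_span]⟩
  | cons k t ih =>
    rw [map_cons, prod_cons, List.length_cons, pow_succ']
    exact (hV k).mul ih

variable {σ : Type*} {V : σ → Submodule ℂ A}

lemma list_prod_mul_le {h : σ} {t : List σ} (ht : ∀ k ∈ t, V k * V h ≤ V h * V k) :
    (t.map V).prod * V h ≤ V h * (t.map V).prod := by
  induction t with
  | nil => simp
  | cons k t ih =>
    rw [map_cons, prod_cons]
    calc V k * (t.map V).prod * V h = V k * ((t.map V).prod * V h) := mul_assoc _ _ _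
      _ ≤ V k * (V h * (t.map V).prod) :=
        mul_le_mul_right (ih fun j hj => ht j (List.mem_cons_of_mem _ hj)) _
      _ = (V k * V h) * (t.map V).prod := (mul_assoc _ _ _).symm
      _ ≤ (V h * V k) * (t.map V).prod := mul_le_mul_left (ht k mem_cons_self) _
      _ = _ := mul_assoc _ _ _

lemma list_prod_mul_self_le (hs : ∀ h, V h * V h ≤ V h) {l : List σ}
    (hl : l.Pairwise fun h k => V k * V h ≤ V h * V k) {h : σ} (hh : h ∈ l) :
    (l.map V).prod * V h ≤ (l.map V).prod := by
  induction l with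
  | nil => simp at hh
  | cons k t ih =>
    rw [List.pairwise_cons] at hl
    rw [map_cons, prod_cons, mul_assoc]
    rcases mem_cons.1 hh with rfl | hh
    · calc V h * ((t.map V).prod * V h) ≤ V h * (V h * (t.map V).prod) :=
            mul_le_mul_right (list_prod_mul_le hl.1) _
        _ = (V h * V h) * (t.map V).prod := (mul_assoc _ _ _).symm
        _ ≤ _ := mul_le_mul_left (hs h) _
    · exact mul_le_mul_right (ih hl.2 hh) _

lemma one_mem_list_prod (h1 : ∀ h, 1 ∈ V h) (l : List σ) : (1 : A) ∈ (l.map V).prod := by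
  induction l with
  | nil => exact Submodule.one_le.1 le_rfl
  | cons k t ih =>
    rw [map_cons, prod_cons, ← mul_one (1 : A)]
    exact mul_mem_mul (h1 k) ih

end

/-- All holonomies in their order. -/
def holList (g m : ℕ) : List (Hol g m) :=
  (finRange m).map .M ++ (finRange g).flatMap fun i => [.A i, .B i]

lemma length_holList (g m : ℕ) : (holList g m).length = m + 2 * g := by
  simp [holList, List.length_flatMap, mul_comm]

lemma mem_holList {g m : ℕ} (h : Hol g m) : h ∈ holList g m := by
  cases h <;> simp [holList]

lemma pairwise_holList {g m : ℕ} {r : Hol g m → Hol g m → Prop}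
    (hb : ∀ h k, Hol.Before h k → r h k) (hh : ∀ i, r (.A i) (.B i)) :
    (holList g m).Pairwise r := by
  rw [holList, List.pairwise_append]
  refine ⟨?_, ?_, ?_⟩
  · rw [List.pairwise_map]
    exact (List.pairwise_lt_finRange m).imp fun h => hb _ _ (.MM _ _ h)
  · rw [List.pairwise_flatMap]
    refine ⟨fun i _ => by simpa using hh i, (List.pairwise_lt_finRange g).imp fun {i j} h => ?_⟩
    simp only [mem_cons, List.not_mem_nil, or_false, forall_eq_or_imp, forall_eq]
    exact ⟨⟨hb _ _ (.AA _ _ h), hb _ _ (.AB _ _ h)⟩, hb _ _ (.BA _ _ h), hb _ _ (.BB _ _ h)⟩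
  · simp only [List.mem_map, List.mem_finRange, true_and, List.mem_flatMap, mem_cons,
      List.not_mem_nil, or_false]
    rintro _ ⟨ν, rfl⟩ _ ⟨i, rfl | rfl⟩
    · exact hb _ _ (.MA _ _)
    · exact hb _ _ (.MB _ _)

section

variable (g m : ℕ)

lemma list_prod_entrySpan_hol :
    ((holList g m).map fun h => entrySpan H (hol H g m h)).prod = ⊤ := by
  have hX := isHolFamily_hol H g m
  have h1 : (1 : GraphAlgebra H g m) ∈ ((holList g m).map fun h => entrySpan H (hol H g m h)).prod :=
    one_mem_list_prod (fun h => one_mem_entrySpan (hX.unit h)) _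
  have h2 : ∀ h, ((holList g m).map fun h => entrySpan H (hol H g m h)).prod
      * entrySpan H (hol H g m h) ≤ ((holList g m).map fun h => entrySpan H (hol H g m h)).prod :=
    fun h => list_prod_mul_self_le (V := fun h => entrySpan H (hol H g m h))
      (fun k => entrySpan_mul_self_le (hX.functoriality k))
      (pairwise_holList (fun k l hkl => entrySpan_mul_le_of_exchange (hX.exchange k l hkl))
        fun i => entrySpan_mul_le_of_handle (hX.handle i)) (mem_holList h)
  have h3 : ∀ x y, y ∈ ((holList g m).map fun h => entrySpan H (hol H g m h)).prod →
      y * x ∈ ((holList g m).map fun h => entrySpan H (hol H g m h)).prod := by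
    intro x
    induction x using graphAlgebra_induction with
    | scalar c =>
      intro y hy
      rw [← Algebra.commutes, ← smul_def]; exact smul_mem _ _ hy
    | gen h I a b => exact fun y hy => h2 h (mul_mem_mul hy (mem_entrySpan _ _ _ _))
    | add x y hx hy =>
      intro z hz
      rw [mul_add]; exact Submodule.add_mem _ (hx z hz) (hy z hz)
    | mul x y hx hy =>
      intro z hz
      rw [← mul_assoc]; exact hy _ (hx _ hz)
  exact eq_top_iff.2 fun x _ => by simpa using h3 x 1 h1

lemma spannedBy_graphAlgebra :
    SpannedBy (card (RegIndex H) ^ (m + 2 * g)) (⊤ : Submodule ℂ (GraphAlgebra H g m)) := by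
  rw [← list_prod_entrySpan_hol, ← length_holList g m]
  exact spannedBy_list_prod (fun h => spannedBy_span_range _) _

end

/-! ### The semi-direct product -/

section

variable {H} {g m : ℕ}

lemma ofL_apply (x : GraphAlgebra H g m) : ofL H g m x
    = RingQuot.mkAlgHom ℂ (SemiRel H g m) (FreeAlgebra.ι ℂ (.inl x)) := rfl

lemma ofG_apply (ξ : G) : ofG H g m ξ
    = RingQuot.mkAlgHom ℂ (SemiRel H g m) (FreeAlgebra.ι ℂ (.inr ξ)) := rfl

lemma semi_induction {p : SemiDirect H g m → Prop}
    (scalar : ∀ c, p (algebraMap ℂ _ c)) (inl : ∀ x, p (ofL H g m x)) (inr : ∀ ξ, p (ofG H g m ξ))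
    (add : ∀ x y, p x → p y → p (x + y)) (mul : ∀ x y, p x → p y → p (x * y)) (x) : p x := by
  obtain ⟨y, rfl⟩ := RingQuot.mkAlgHom_surjective ℂ (SemiRel H g m) x
  induction y using FreeAlgebra.induction with
  | grade0 c => rw [commutes]; exact scalar c
  | grade1 q =>
    cases q with
    | inl x => exact inl x
    | inr ξ => exact inr ξ
  | add a b ha hb => rw [map_add]; exact add _ _ ha hb
  | mul a b ha hb => rw [map_mul]; exact mul _ _ ha hb

/-- The action of `ξ` on the matrix index and in the algebra, `μ^J(ξ)`. -/
abbrev muMat (H : SymmetryData G ι) (J : ι) (j : G →ₐ[ℂ] A) :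
    G →ₐ[ℂ] 𝕄[H, J, A] :=
  conv (numHom A (H.τ J)) ((scal A _).comp j) (legs_numHom_scal _ _)

lemma muMat_eq_sum (J : ι) (j : G →ₐ[ℂ] A) (ξ : G) {n : ℕ} {x y : Fin n → G}
    (hξ : Δ ξ = ∑ k, x k ⊗ₜ[ℂ] y k) (a b : Fin (H.δ J)) :
    muMat H J j ξ a b = ∑ k, H.τ J (x k) a b • j (y k) := by
  rw [conv_apply, hξ, map_sum, Matrix.sum_apply]
  refine sum_congr rfl fun k _ => ?_
  rw [Ev_tmul, comp_apply, scal_apply, mul_diagonal]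
  simp [numHom, numAlg_apply, num, smul_def]

lemma muMat_mul_eq_sum (J : ι) (j : G →ₐ[ℂ] A) (ξ : G) {n : ℕ} {x y : Fin n → G}
    (hξ : Δ ξ = ∑ k, x k ⊗ₜ[ℂ] y k)
    (X : 𝕄[H, J, A]) (a b : Fin (H.δ J)) :
    (muMat H J j ξ * X) a b = ∑ k, ∑ c, H.τ J (x k) a c • (j (y k) * X c b) := by
  rw [Matrix.mul_apply, sum_comm]
  simp only [muMat_eq_sum J j ξ hξ, sum_mul, smul_mul_assoc]

lemma mul_muMat_eq_sum (J : ι) (j : G →ₐ[ℂ] A) (ξ : G) {n : ℕ} {x y : Fin n → G}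
    (hξ : Δ ξ = ∑ k, x k ⊗ₜ[ℂ] y k)
    (X : 𝕄[H, J, A]) (a b : Fin (H.δ J)) :
    (X * muMat H J j ξ) a b = ∑ k, ∑ c, H.τ J (x k) c b • (X a c * j (y k)) := by
  rw [Matrix.mul_apply, sum_comm]
  simp only [muMat_eq_sum J j ξ hξ, mul_sum, mul_smul_comm]

lemma muMat_commute_holS (h : Hol g m) (J : ι) (ξ : G) :
    Commute (muMat H J (ofG H g m) ξ) (holS H g m h J) := by
  obtain ⟨n, x, y, hξ⟩ := exists_sum_tmul (Δ ξ)
  ext a b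
  rw [muMat_mul_eq_sum J _ ξ hξ, mul_muMat_eq_sum J _ ξ hξ]
  have := RingQuot.mkAlgHom_rel ℂ (SemiRel.cross h J ξ n x y hξ a b)
  simp only [map_sum, map_smul, map_mul] at this
  exact this

/-- The homomorphism from the semi-direct product given by homomorphisms on the two factors. -/
def semiLift (θ : GraphAlgebra H g m →ₐ[ℂ] A) (j : G →ₐ[ℂ] A)
    (hc : ∀ h J ξ, Commute (muMat H J j ξ) ((hol H g m h J).map θ)) : SemiDirect H g m →ₐ[ℂ] A :=
  RingQuot.liftAlgHom ℂ ⟨FreeAlgebra.lift ℂ (Sum.elim θ j), fun {x y} hxy => by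
    cases hxy with
    | scalarL c => simp
    | addL x y => simp
    | mulL x y => simp
    | scalarG c => simp
    | addG x y => simp
    | mulG x y => simp
    | cross h J ξ n x y hξ a b =>
      have h1 := congrFun (congrFun (hc h J ξ).eq a) b
      rw [muMat_mul_eq_sum J _ ξ hξ, mul_muMat_eq_sum J _ ξ hξ] at h1
      simpa using h1⟩

lemma semiLift_ofL (θ : GraphAlgebra H g m →ₐ[ℂ] A) (j : G →ₐ[ℂ] A)
    (hc : ∀ h J ξ, Commute (muMat H J j ξ) ((hol H g m h J).map θ)) (x) :
    semiLift θ j hc (ofL H g m x) = θ x := by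
  rw [ofL_apply, semiLift, RingQuot.liftAlgHom_mkAlgHom_apply]; simp

lemma semiLift_ofG (θ : GraphAlgebra H g m →ₐ[ℂ] A) (j : G →ₐ[ℂ] A)
    (hc : ∀ h J ξ, Commute (muMat H J j ξ) ((hol H g m h J).map θ)) (x) :
    semiLift θ j hc (ofG H g m x) = j x := by
  rw [ofG_apply, semiLift, RingQuot.liftAlgHom_mkAlgHom_apply]; simp

lemma legs_comp {a : G →ₐ[ℂ] B} {θ : A →ₐ[ℂ] B} (ha : ∀ x z, Commute (a x) (θ z))
    (j : G →ₐ[ℂ] A) : Legs a (θ.comp j) := fun x y => ha x (j y)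

/-- The universal form of the relation between a holonomy and the symmetry. -/
lemma commute_conv_hv {j φ : G →ₐ[ℂ] A}
    (h : ∀ J ξ, Commute (muMat H J j ξ) (H.holMat φ J)) {a : G →ₐ[ℂ] B} {θ : A →ₐ[ℂ] B}
    (ha : ∀ x z, Commute (a x) (θ z)) (ξ : G) :
    Commute (conv a (θ.comp j) (legs_comp ha j) ξ) (H.hv a (θ.comp φ)) := by
  let a0 : G →ₐ[ℂ] G ⊗[ℂ] A := includeLeft
  let θ0 : A →ₐ[ℂ] G ⊗[ℂ] A := includeRight
  have h0 : ∀ x z, Commute (a0 x) (θ0 z) := fun x z => by simp [a0, θ0, Commute, SemiconjBy]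
  have key : Commute (conv a0 (θ0.comp j) (legs_comp h0 j) ξ) (H.hv a0 (θ0.comp φ)) := by
    have hm : ∀ J x z, Commute (numHom A (H.τ J) x) (scal A _ z) :=
      fun J x z => num_commute_scal _ _
    have hcoef : ∀ J a b (z : G ⊗[ℂ] A),
        H.coef J a b z = Algebra.TensorProduct.lift _ _ (hm J) z a b := by
      intro J a b z
      induction z with
      | tmul x y =>
        rw [lift_tmul, scal_apply, mul_diagonal]
        simp [numHom, numAlg_apply, num, smul_def]
      | _ => simp_all [Matrix.add_apply]
    refine H.ext_coef fun J p q => ?_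
    rw [hcoef, hcoef]
    have e1 : (Algebra.TensorProduct.lift _ _ (hm J)).comp a0 = numHom A (H.τ J) := by
      ext x; simp [a0]
    have e2 : (Algebra.TensorProduct.lift _ _ (hm J)).comp θ0 = scal A _ := by
      ext x; simp [θ0]
    have e3 := h J ξ
    have e4 : Algebra.TensorProduct.lift _ _ (hm J) (conv a0 (θ0.comp j) (legs_comp h0 j) ξ)
        = muMat H J j ξ := by
      rw [← comp_apply, map_conv, conv_apply, conv_apply]
      simp only [← comp_assoc, e1, e2]
    have e5 : Algebra.TensorProduct.lift _ _ (hm J) (H.hv a0 (θ0.comp φ)) = H.holMat φ J := by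
      rw [H.map_hv]
      simp only [← comp_assoc, e1, e2]; rfl
    rw [map_mul, map_mul, e4, e5, e3.eq]
  have h1 := key.map (Algebra.TensorProduct.lift a θ ha)
  have e1 : (Algebra.TensorProduct.lift a θ ha).comp a0 = a := by ext x; simp [a0]
  have e2 : (Algebra.TensorProduct.lift a θ ha).comp θ0 = θ := by ext x; simp [θ0]
  rw [← comp_apply, map_conv, H.map_hv, conv_apply] at h1
  rw [conv_apply]
  simpa only [← comp_assoc, e1, e2] using h1

lemma range_ofG_mul_entrySpan_le (h : Hol g m) :
    LinearMap.range (ofG H g m).toLinearMap * entrySpan H (holS H g m h)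
      ≤ entrySpan H (holS H g m h) * LinearMap.range (ofG H g m).toLinearMap := by
  rw [mul_le]
  rintro _ ⟨ξ, rfl⟩ y hy
  change ofG H g m ξ * y ∈ _
  induction hy using span_induction with
  | zero => simp
  | add x y _ _ hx hy => rw [mul_add]; exact Submodule.add_mem _ hx hy
  | smul c x _ hx => rw [mul_smul_comm]; exact smul_mem _ _ hx
  | mem x hx =>
    obtain ⟨⟨J, p, q⟩, rfl⟩ := hx
    have hc := legs_numHom_scal (H.τ J) (ofG H g m)
    have h1 := congrArg (fun M => (M * holS H g m h J) p q) (sum_antipode_mul_conv hc ξ)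
    have h2 : (((scal (SemiDirect H g m) (Fin (H.δ J))).comp (ofG H g m)) ξ * holS H g m h J) p q
        = ofG H g m ξ * holS H g m h J p q := by
      rw [comp_apply, scal_apply, diagonal_mul]
    change _ = (((scal (SemiDirect H g m) (Fin (H.δ J))).comp (ofG H g m)) ξ * holS H g m h J) p q at h1
    rw [h2] at h1
    change ofG H g m ξ * holS H g m h J p q ∈ _
    rw [← h1]
    generalize (Δ ξ) = z
    clear h1 h2
    induction z with
    | zero => simp
    | add x y hx hy => simp only [map_add, add_mul, Matrix.add_apply]; exact Submodule.add_mem _ hx hy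
    | tmul x y =>
      rw [map_tmul, mul'_apply, mul_assoc]
      change ((numHom (SemiDirect H g m) (H.τ J) (𝒮 x) *
        (muMat H J (ofG H g m) y * holS H g m h J) :
          𝕄[H, J, SemiDirect H g m])) p q ∈ _
      rw [(muMat_commute_holS h J y).eq, ← mul_assoc, Matrix.mul_apply]
      refine Submodule.sum_mem _ fun c _ => mul_mem_mul ?_ ?_
      · exact EntriesIn.num_mul (fun i j => mem_entrySpan _ _ _ _) _ _ _
      · obtain ⟨n, x', y', hξ⟩ := exists_sum_tmul (Δ y)
        rw [muMat_eq_sum J _ y hξ]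
        exact Submodule.sum_mem _ fun k _ => smul_mem _ _ ⟨_, rfl⟩

lemma range_ofL_mul_range_ofG : LinearMap.range (ofL H g m).toLinearMap
    * LinearMap.range (ofG H g m).toLinearMap = ⊤ := by
  set L := LinearMap.range (ofL H g m).toLinearMap with hL
  set K := LinearMap.range (ofG H g m).toLinearMap with hK
  have hLL : L * L ≤ L := by
    rw [mul_le]
    rintro _ ⟨x, rfl⟩ _ ⟨y, rfl⟩
    exact ⟨x * y, map_mul (ofL H g m) x y⟩
  have hKK : K * K ≤ K := by
    rw [mul_le]
    rintro _ ⟨x, rfl⟩ _ ⟨y, rfl⟩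
    exact ⟨x * y, map_mul (ofG H g m) x y⟩
  have hVL : ∀ h, entrySpan H (holS H g m h) ≤ L := by
    intro h
    rw [entrySpan, span_le]
    rintro _ ⟨p, rfl⟩
    exact ⟨_, rfl⟩
  have hKL : ∀ x, ∀ k ∈ K, k * ofL H g m x ∈ L * K := by
    intro x
    induction x using graphAlgebra_induction with
    | scalar c =>
      intro k hk
      rw [commutes, ← Algebra.commutes, ← commutes (ofL H g m)]
      exact mul_mem_mul ⟨_, rfl⟩ hk
    | gen h I a b =>
      intro k hk
      exact (mul_le_mul_left (hVL h) K) (range_ofG_mul_entrySpan_le h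
        (mul_mem_mul hk (mem_entrySpan _ _ _ _)))
    | add x y hx hy =>
      intro z hz
      rw [map_add, mul_add]; exact Submodule.add_mem _ (hx z hz) (hy z hz)
    | mul x y hx hy =>
      intro z hz
      rw [map_mul, ← mul_assoc]
      have h1 := hx z hz
      revert h1
      generalize z * ofL H g m x = w
      intro h1
      refine mul_induction_on h1 (fun p hp q hq => ?_) (fun p q hp hq => ?_)
      · rw [mul_assoc]
        have h2 := mul_mem_mul hp (hy q hq)
        rw [← mul_assoc] at h2
        exact (mul_le_mul_left hLL K) h2
      · rw [add_mul]; exact Submodule.add_mem _ hp hq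
  have h1 : (1 : SemiDirect H g m) ∈ L * K := by
    rw [← mul_one (1 : SemiDirect H g m)]
    exact mul_mem_mul ⟨1, map_one (ofL H g m)⟩ ⟨1, map_one (ofG H g m)⟩
  have h3 : ∀ x y, y ∈ L * K → y * x ∈ L * K := by
    intro x
    induction x using semi_induction with
    | scalar c =>
      intro y hy
      rw [← Algebra.commutes, ← smul_def]; exact smul_mem _ _ hy
    | inl x =>
      intro y hy
      refine mul_induction_on hy (fun p hp q hq => ?_) (fun p q hp hq => ?_)
      · rw [mul_assoc]
        have h2 := mul_mem_mul hp (hKL x q hq)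
        rw [← mul_assoc] at h2
        exact (mul_le_mul_left hLL K) h2
      · rw [add_mul]; exact Submodule.add_mem _ hp hq
    | inr ξ =>
      intro y hy
      have h0 : ofG H g m ξ ∈ K := ⟨ξ, rfl⟩
      have h2 := mul_mem_mul hy h0
      rw [mul_assoc] at h2
      exact (mul_le_mul_right hKK L) h2
    | add x y hx hy =>
      intro z hz
      rw [mul_add]; exact Submodule.add_mem _ (hx z hz) (hy z hz)
    | mul x y hx hy =>
      intro z hz
      rw [← mul_assoc]; exact hy _ (hx _ hz)
  exact eq_top_iff.2 fun x _ => by simpa using h3 x 1 h1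

lemma spannedBy_map {N : ℕ} (θ : A →ₐ[ℂ] B) (h : SpannedBy N (⊤ : Submodule ℂ A)) :
    SpannedBy N (LinearMap.range θ.toLinearMap) := by
  classical
  obtain ⟨s, hs, h⟩ := h
  refine ⟨s.image θ, Finset.card_image_le.trans hs, ?_⟩
  rw [LinearMap.range_eq_map, h, Submodule.map_span, Finset.coe_image]; rfl

variable (H g m) in
lemma spannedBy_semiDirect :
    SpannedBy (card (RegIndex H) ^ (m + 2 * g) * card (RegIndex H))
      (⊤ : Submodule ℂ (SemiDirect H g m)) := by
  rw [← range_ofL_mul_range_ofG]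
  refine (spannedBy_map _ (spannedBy_graphAlgebra H g m)).mul (spannedBy_map _ ?_)
  have := spannedBy_span_range H.muBasis
  rwa [H.muBasis.span_eq] at this

end

/-! ### Iterated convolution -/

section

lemma conv_assoc {f h k : G →ₐ[ℂ] A} (hfh : Legs f h) (hfk : Legs f k) (hhk : Legs h k) :
    conv (conv f h hfh) k (Legs.conv_left hfk hhk)
      = conv f (conv h k hhk) (Legs.conv_right hfh hfk) := by
  ext x
  rw [conv_apply, conv_apply, ← Ev3_comulLeft hfh hhk, ← Ev3_comulRight hhk]
  exact congrArg _ (coassoc_apply x)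

open Classical in
/-- The convolution of two homomorphisms, with a dummy value if they do not commute. -/
def cv (f h : G →ₐ[ℂ] A) : G →ₐ[ℂ] A := if hc : Legs f h then conv f h hc else triv A

lemma cv_eq {f h : G →ₐ[ℂ] A} (hc : Legs f h) : cv f h = conv f h hc := dif_pos hc

lemma cv_commute {f h : G →ₐ[ℂ] A} {z : A} (hf : ∀ x, Commute z (f x))
    (hh : ∀ x, Commute z (h x)) (x : G) : Commute z (cv f h x) := by
  unfold cv
  split_ifs with hc
  · exact conv_commute hf hh x
  · exact (Algebra.commute_algebraMap_left _ _).symm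

/-- The iterated convolution along a list. -/
def listHom {σ : Type*} (F : σ → (G →ₐ[ℂ] A)) : List σ → (G →ₐ[ℂ] A)
  | [] => triv A
  | k :: l => cv (F k) (listHom F l)

variable {σ : Type*} {F : σ → (G →ₐ[ℂ] A)}

lemma listHom_commute {z : A} {l : List σ} (h : ∀ k ∈ l, ∀ x, Commute z (F k x)) (x : G) :
    Commute z (listHom F l x) := by
  induction l generalizing x with
  | nil => exact (Algebra.commute_algebraMap_left _ _).symm
  | cons k l ih =>
    exact cv_commute (h k mem_cons_self)
      (fun x => ih (fun j hj => h j (List.mem_cons_of_mem _ hj)) x) x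

lemma legs_listHom {h : G →ₐ[ℂ] A} {l : List σ} (hl : ∀ k ∈ l, Legs h (F k)) :
    Legs h (listHom F l) := fun x y => listHom_commute (fun k hk y => hl k hk x y) y

lemma legs_listHom_listHom (hF : ∀ k l, k ≠ l → Legs (F k) (F l)) {l₁ l₂ : List σ}
    (hd : List.Disjoint l₁ l₂) : Legs (listHom F l₁) (listHom F l₂) :=
  legs_listHom fun k hk => Legs.symm (legs_listHom fun j hj => hF k j fun h => hd hj (h ▸ hk))

lemma listHom_cons (hF : ∀ k l, k ≠ l → Legs (F k) (F l)) {k : σ} {l : List σ} (hk : k ∉ l) :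
    listHom F (k :: l) = conv (F k) (listHom F l)
      (legs_listHom fun j hj => hF k j fun h => hk (h ▸ hj)) := cv_eq _

lemma listHom_append (hF : ∀ k l, k ≠ l → Legs (F k) (F l)) {l₁ l₂ : List σ}
    (hd : (l₁ ++ l₂).Nodup) :
    listHom F (l₁ ++ l₂) = conv (listHom F l₁) (listHom F l₂)
      (legs_listHom_listHom hF (List.disjoint_of_nodup_append hd)) := by
  induction l₁ with
  | nil => exact (conv_triv_left _).symm
  | cons k l ih =>
    rw [cons_append, nodup_cons] at hd
    have h1 := listHom_cons hF (k := k) (l := l ++ l₂) hd.1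
    have h2 := listHom_cons hF (k := k) (l := l) fun h => hd.1 (List.mem_append_left _ h)
    rw [cons_append, h1]
    simp only [ih hd.2, h2]
    exact (conv_assoc _ (legs_listHom fun j hj => hF k j fun h =>
      hd.1 (h ▸ List.mem_append_right _ hj)) _).symm

lemma listHom_singleton (k : σ) : listHom F [k] = F k := by
  change cv (F k) (triv A) = _
  rw [cv_eq (Legs.triv_right _), conv_triv_right]

lemma map_cv (θ : A →ₐ[ℂ] B) {f h : G →ₐ[ℂ] A} (hc : Legs f h) :
    θ.comp (cv f h) = cv (θ.comp f) (θ.comp h) := by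
  rw [cv_eq hc, cv_eq (hc.map θ), map_conv]

lemma map_listHom (θ : A →ₐ[ℂ] B) (hF : ∀ k l, k ≠ l → Legs (F k) (F l)) {l : List σ}
    (hl : l.Nodup) : θ.comp (listHom F l) = listHom (fun k => θ.comp (F k)) l := by
  induction l with
  | nil => ext x; simp [listHom]
  | cons k l ih =>
    rw [nodup_cons] at hl
    change θ.comp (cv (F k) (listHom F l)) = cv (θ.comp (F k)) _
    rw [← ih hl.2]
    exact map_cv θ (legs_listHom fun j hj => hF k j fun h => hl.1 (h ▸ hj))

end

/-! ### Star operations -/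

section

/-- A conjugate-linear anti-multiplicative involution. -/
structure IsStarOp {A : Type*} [Ring A] [Algebra ℂ A] (σ : A → A) : Prop where
  add : ∀ x y, σ (x + y) = σ x + σ y
  smul : ∀ (c : ℂ) x, σ (c • x) = star c • σ x
  mul : ∀ x y, σ (x * y) = σ y * σ x
  invol : ∀ x, σ (σ x) = x

variable {σ : A → A}

lemma isStarOp_star [StarRing A] [StarModule ℂ A] : IsStarOp (star : A → A) where
  add := star_add
  smul := star_smul
  mul := star_mul
  invol := star_star

namespace IsStarOp

lemma map_zero (hσ : IsStarOp σ) : σ 0 = 0 := by simpa using hσ.smul 0 0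

lemma map_one (hσ : IsStarOp σ) : σ 1 = 1 := by
  have := hσ.mul (σ 1) 1
  rwa [mul_one, hσ.invol, mul_one, eq_comm] at this

lemma map_sum (hσ : IsStarOp σ) {κ : Type*} (s : Finset κ) (f : κ → A) :
    σ (∑ i ∈ s, f i) = ∑ i ∈ s, σ (f i) := by
  classical
  induction s using Finset.induction_on with
  | empty => simpa using hσ.map_zero
  | insert i s hi ih => rw [Finset.sum_insert hi, Finset.sum_insert hi, hσ.add, ih]

lemma algebraMap (hσ : IsStarOp σ) (c : ℂ) :
    σ (algebraMap ℂ A c) = algebraMap ℂ A (star c) := by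
  rw [algebraMap_eq_smul_one, hσ.smul, hσ.map_one, algebraMap_eq_smul_one]

/-- The star operation of a form that is changed by a selfadjoint unit. -/
lemma twisted (hσ : IsStarOp σ) (T : Aˣ) (hT : σ T = T) :
    IsStarOp fun x => ↑T⁻¹ * σ x * T where
  add x y := by rw [hσ.add, mul_add, add_mul]
  smul c x := by rw [hσ.smul, mul_smul_comm, smul_mul_assoc]
  mul x y := by rw [hσ.mul]; simp [mul_assoc]
  invol x := by
    have h1 : σ ↑T⁻¹ = ↑T⁻¹ := by
      refine Units.eq_inv_of_mul_eq_one_right ?_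
      have h2 := hσ.mul (T : A) ↑T⁻¹
      rwa [Units.mul_inv, hσ.map_one, hT, eq_comm] at h2
    rw [hσ.mul, hσ.mul, hσ.invol, hT, h1]
    simp [mul_assoc]

/-- The star operation on the matrices over `A`. -/
lemma matrix {n : Type*} [Fintype n] [DecidableEq n] (hσ : IsStarOp σ) :
    IsStarOp fun M : Matrix n n A => Mᵀ.map σ where
  add X Y := by ext; simp [hσ.add]
  smul c X := by ext; simp [hσ.smul]
  mul X Y := by ext; simp [Matrix.mul_apply, hσ.map_sum, hσ.mul]
  invol X := by ext; simp [hσ.invol]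

end IsStarOp

/-- A homomorphism that respects the star operations. -/
def IsStarHom (σ : A → A) (f : G →ₐ[ℂ] A) : Prop := ∀ x, σ (f x) = f (star x)

lemma IsStarHom.ev (hσ : IsStarOp σ) {f h : G →ₐ[ℂ] A} (hf : IsStarHom σ f)
    (hh : IsStarHom σ h) (hc : Legs f h) (z : G ⊗[ℂ] G) : σ (Ev f h z) = Ev f h (star z) := by
  induction z with
  | zero => simp [hσ.map_zero]
  | add x y hx hy => rw [map_add, hσ.add, hx, hy, star_add, map_add]
  | tmul x y =>
    rw [Ev_tmul, hσ.mul, hf, hh, star_tmul, Ev_tmul, (hc _ _).eq]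

lemma IsStarHom.rv (hσ : IsStarOp σ) {f h : G →ₐ[ℂ] A} (hf : IsStarHom σ f)
    (hh : IsStarHom σ h) (hc : Legs f h) : σ (H.Rv f h) = H.Ri h f := by
  rw [RibbonHopfStar.Rv, hf.ev hσ hh hc, H.star_R, Ev_swap hc]; rfl

lemma IsStarHom.ri (hσ : IsStarOp σ) {f h : G →ₐ[ℂ] A} (hf : IsStarHom σ f)
    (hh : IsStarHom σ h) (hc : Legs f h) : σ (H.Ri f h) = H.Rv h f := by
  rw [← hσ.invol (H.Rv h f), hh.rv H hσ hf hc.symm]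

lemma IsStarHom.ev_twist (hσ : IsStarOp σ) {f h : G →ₐ[ℂ] A} (hf : IsStarHom σ f)
    (hh : IsStarHom σ h) (hc : Legs f h) : σ (Ev f h (twist H)) = Ev f h (twist H) := by
  rw [hf.ev hσ hh hc, H.star_twist]

lemma star_kap_inv : star ((H.kap⁻¹ : Gˣ) : G) = H.kap := by rw [← H.star_kap, star_star]

/-- The value of the element `κ`, as a unit. -/
def kU (f : G →ₐ[ℂ] A) : Aˣ := Units.map (f : G →* A) H.kap

lemma val_kU (f : G →ₐ[ℂ] A) : (kU H f : A) = f H.kap := rfl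

lemma kU_commute_Ev {f h : G →ₐ[ℂ] A} (hc : Legs f h) (z : G ⊗[ℂ] G) :
    Commute (kU H f : A) (Ev f h z) := H.commute_kap hc z

lemma kU_commute_Ev' {f h : G →ₐ[ℂ] A} (hc : Legs f h) (z : G ⊗[ℂ] G) :
    Commute (kU H h : A) (Ev f h z) := by
  have := H.commute_kap hc.symm (swapLegs G z)
  rwa [Ev_swap hc.symm] at this

/-- `(f ⊗ h)(Rη)` as a unit. -/
def tU {f h : G →ₐ[ℂ] A} (hc : Legs f h) : Aˣ :=
  H.Ru hc * kU H (conv f h hc) * ((kU H f)⁻¹ * (kU H h)⁻¹)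

lemma val_tU {f h : G →ₐ[ℂ] A} (hc : Legs f h) : (tU H hc : A) = Ev f h (twist H) := by
  rw [twist, Ev_mul hc, Ev_mul hc, Ev_tmul, ← conv_apply hc, ← mul_assoc]; rfl

lemma conj_eq_of_commute {u v w : Aˣ} {Y : A} (h : u = v * w) (hw : Commute (w : A) Y) :
    (u : A) * Y * ↑u⁻¹ = v * Y * ↑v⁻¹ := by
  have h1 : (w : A) * Y * ↑w⁻¹ = Y := by rw [hw.eq, mul_assoc, Units.mul_inv, mul_one]
  rw [h, mul_inv_rev, val_mul, val_mul]
  calc (v : A) * w * Y * (↑w⁻¹ * ↑v⁻¹)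
      = v * ((w : A) * Y * ↑w⁻¹) * ↑v⁻¹ := by simp only [mul_assoc]
    _ = _ := by rw [h1]

/-- The star operation of a holonomy matrix in the presence of the action `j`. -/
def StarWord (σ : A → A) (a j : G →ₐ[ℂ] A) (X : A) : Prop :=
  ∃ Y, X * Y = 1 ∧ Y * X = 1 ∧
    σ X = j ↑H.kap⁻¹ * (H.Rv a j * Y * H.Ri a j) * j (H.kap : G)

section

variable {a f h : G →ₐ[ℂ] A} (hc : Legs f h)

lemma isStarHom_conv (hσ : IsStarOp σ) (hf : IsStarHom σ f) (hh : IsStarHom σ h) :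
    IsStarHom (fun x => ↑(tU H hc)⁻¹ * σ x * tU H hc) (conv f h hc) := by
  intro ξ
  have h1 : σ (conv f h hc ξ) = conv h f hc.symm (star ξ) := by
    rw [conv_apply, hf.ev hσ hh hc, conv_apply, ← Ev_swap hc, H.comul_star, swapLegs_swapLegs]
  have h2 := H.Rv_conv hc (star ξ)
  have h4 : (tU H hc : A) * conv f h hc (star ξ) = conv h f hc.symm (star ξ) * tU H hc := by
    have e1 : Commute (conv f h hc (star ξ)) (conv f h hc (H.kap : G)) := by
      rw [Commute, SemiconjBy, ← map_mul, ← map_mul, H.kap_central]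
    have e2 : Commute (conv f h hc (star ξ)) ↑(kU H f)⁻¹ := by
      rw [conv_apply]; exact (kU_commute_Ev H hc _).symm.units_inv_right
    have e3 : Commute (conv f h hc (star ξ)) ↑(kU H h)⁻¹ := by
      rw [conv_apply]; exact (kU_commute_Ev' H hc _).symm.units_inv_right
    have e4 := e1.mul_right (e2.mul_right e3)
    have e5 : (tU H hc : A) = H.Rv f h * (conv f h hc (H.kap : G) *
        (↑(kU H f)⁻¹ * ↑(kU H h)⁻¹)) := by
      simp only [tU, val_mul, mul_assoc]; rfl
    rw [e5, mul_assoc, ← e4.eq, ← mul_assoc, h2, mul_assoc]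
  change ↑(tU H hc)⁻¹ * σ (conv f h hc ξ) * tU H hc = _
  rw [h1, mul_assoc, ← h4, ← mul_assoc, inv_mul, one_mul]

/-- The star operation of a holonomy of the first factor. -/
lemma StarWord.first (haf : Legs a f) (hah : Legs a h) {X : A}
    (hX : StarWord H σ a f X) (hXh : ∀ x, Commute X (h x))
    (hXf : ∀ x, Commute X (conv a f haf x)) :
    StarWord H (fun x => ↑(tU H hc)⁻¹ * σ x * tU H hc) a (conv f h hc) X := by
  obtain ⟨Y, hXY, hYX, hs⟩ := hX
  refine ⟨Y, hXY, hYX, ?_⟩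
  have hac := Legs.conv_right (hc := hc) haf hah
  -- everything that commutes with `X` commutes with `Y`
  have hY : ∀ z, Commute X z → Commute z Y := fun z hz => by
    have : Commute z X := hz.symm
    calc z * Y = Y * X * (z * Y) := by rw [hYX, one_mul]
      _ = Y * (X * z) * Y := by simp only [mul_assoc]
      _ = Y * (z * X) * Y := by rw [hz.eq]
      _ = Y * z := by rw [mul_assoc, mul_assoc, hXY, mul_one]
  set u : Aˣ := (tU H hc)⁻¹ * ((kU H f)⁻¹ * H.Ru haf) with hu
  set v : Aˣ := (kU H (conv f h hc))⁻¹ * H.Ru hac with hv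
  have e1 : ↑(tU H hc)⁻¹ * σ X * tU H hc = (u : A) * Y * ↑u⁻¹ := by
    rw [hs, hu]
    simp only [mul_inv_rev, inv_inv, val_mul, mul_assoc]
    rfl
  have e2 : conv f h hc ↑H.kap⁻¹ * (H.Rv a (conv f h hc) * Y * H.Ri a (conv f h hc))
      * conv f h hc (H.kap : G) = (v : A) * Y * ↑v⁻¹ := by
    rw [hv]
    simp only [mul_inv_rev, inv_inv, val_mul, mul_assoc]
    rfl
  change ↑(tU H hc)⁻¹ * σ X * tU H hc = _
  rw [e1, e2]
  refine conj_eq_of_commute (w := (H.Ru hah * H.Ru hc)⁻¹ * kU H h) ?_ ?_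
  · have y1 : H.Ru haf * H.Ru hah * H.Ru hc = H.Ru hc * H.Ru hah * H.Ru haf :=
      Units.ext (H.yang_baxter haf hah hc)
    have y2 : H.Ru hac = H.Ru hah * H.Ru haf := Units.ext (H.Rv_conv_right haf hah hc)
    have c1 : Commute (kU H f) (H.Ru hc) := Units.ext (kU_commute_Ev H hc _)
    have c2 : Commute (kU H f) (kU H (conv f h hc)) := Units.ext (by
      rw [val_mul, val_mul, val_kU H (conv f h hc), conv_apply]
      exact kU_commute_Ev H hc _)
    have c3 : Commute (kU H h) (H.Ru hc) := Units.ext (kU_commute_Ev' H hc _)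
    have c4 : Commute (kU H h) (kU H (conv f h hc)) := Units.ext (by
      rw [val_mul, val_mul, val_kU H (conv f h hc), conv_apply]
      exact kU_commute_Ev' H hc _)
    have c5 : Commute (kU H h) (kU H f) := Units.ext (hc _ _).symm
    have c6 : Commute (kU H h) (H.Ru haf) :=
      Units.ext (H.Rv_commute (fun x => (hah _ _).symm) (fun x => (hc _ _).symm))
    rw [hu, hv, y2, tU]
    generalize H.Ru haf = raf at *
    generalize H.Ru hah = rah at *
    generalize H.Ru hc = r at *
    generalize kU H f = kf at *
    generalize kU H h = kh at *
    generalize kU H (conv f h hc) = kc at *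
    have g1 : r⁻¹ * raf = rah * raf * (rah * r)⁻¹ := by
      rw [eq_mul_inv_iff_mul_eq, mul_assoc, inv_mul_eq_iff_eq_mul, ← mul_assoc, ← mul_assoc, y1]
    calc (r * kc * (kf⁻¹ * kh⁻¹))⁻¹ * (kf⁻¹ * raf)
        = kh * kf * kc⁻¹ * r⁻¹ * kf⁻¹ * raf := by group
      _ = kh * (kf * (kc⁻¹ * r⁻¹)) * kf⁻¹ * raf := by group
      _ = kh * ((kc⁻¹ * r⁻¹) * kf) * kf⁻¹ * raf := by
        rw [(c2.inv_right.mul_right c1.inv_right).eq]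
      _ = kh * (kc⁻¹ * (r⁻¹ * raf)) := by group
      _ = (kc⁻¹ * (r⁻¹ * raf)) * kh := (c4.inv_right.mul_right (c3.inv_right.mul_right c6)).eq
      _ = _ := by rw [g1]; group
  · have d1 : Commute X ((H.Ru hah * H.Ru hc : Aˣ) : A) := by
      have := H.Rv_commute (f := conv a f haf) (h := h) hXf hXh
      rwa [H.Rv_conv_left haf hah hc] at this
    have d2 : Commute X ↑(H.Ru hah * H.Ru hc)⁻¹ := d1.units_inv_right
    rw [val_mul]
    exact hY _ (d2.mul_right (hXh _))

/-- The star operation of a holonomy of the second factor. -/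
lemma StarWord.second (hσ : IsStarOp σ) (ha : IsStarHom σ a) (hf : IsStarHom σ f)
    (haf : Legs a f) (hah : Legs a h) {X : A}
    (hX : StarWord H σ a h X) (hXf : ∀ x, Commute X (f x))
    (hXh : ∀ x, Commute X (conv a h hah x)) :
    StarWord H (fun x => ↑(tU H hc)⁻¹ * σ x * tU H hc) a (conv f h hc)
      (H.Rv f a * X * H.Ri f a) := by
  obtain ⟨Y, hXY, hYX, hs⟩ := hX
  have i1 := H.Rv_mul_Ri haf.symm
  have i2 := H.Ri_mul_Rv haf.symm
  refine ⟨H.Rv f a * Y * H.Ri f a, ?_, ?_, ?_⟩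
  · calc _ = H.Rv f a * X * (H.Ri f a * H.Rv f a) * Y * H.Ri f a := by simp only [mul_assoc]
      _ = 1 := by rw [i2, mul_one, mul_assoc (H.Rv f a), hXY, mul_one, i1]
  · calc _ = H.Rv f a * Y * (H.Ri f a * H.Rv f a) * X * H.Ri f a := by simp only [mul_assoc]
      _ = 1 := by rw [i2, mul_one, mul_assoc (H.Rv f a), hYX, mul_one, i1]
  have hac := Legs.conv_right (hc := hc) haf hah
  have hY : ∀ z, Commute X z → Commute z Y := fun z hz => by
    calc z * Y = Y * X * (z * Y) := by rw [hYX, one_mul]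
      _ = Y * (X * z) * Y := by simp only [mul_assoc]
      _ = Y * (z * X) * Y := by rw [hz.eq]
      _ = Y * z := by rw [mul_assoc, mul_assoc, hXY, mul_one]
  set u : Aˣ := (tU H hc)⁻¹ * (H.Ru haf * ((kU H h)⁻¹ * H.Ru hah)) with hu
  set v : Aˣ := (kU H (conv f h hc))⁻¹ * (H.Ru hac * H.Ru haf.symm) with hv
  have e1 : ↑(tU H hc)⁻¹ * σ (H.Rv f a * X * H.Ri f a) * tU H hc = (u : A) * Y * ↑u⁻¹ := by
    rw [hσ.mul, hσ.mul, hf.rv H hσ ha haf.symm, hf.ri H hσ ha haf.symm, hs, hu]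
    simp only [mul_inv_rev, inv_inv, val_mul, mul_assoc]
    rfl
  have e2 : conv f h hc ↑H.kap⁻¹ * (H.Rv a (conv f h hc) *
      (H.Rv f a * Y * H.Ri f a) * H.Ri a (conv f h hc))
      * conv f h hc (H.kap : G) = (v : A) * Y * ↑v⁻¹ := by
    rw [hv]
    simp only [mul_inv_rev, inv_inv, val_mul, mul_assoc]
    rfl
  change ↑(tU H hc)⁻¹ * σ (H.Rv f a * X * H.Ri f a) * tU H hc = _
  rw [e1, e2]
  refine conj_eq_of_commute (w := (H.Ru hc * H.Ru haf.symm)⁻¹ * kU H f) ?_ ?_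
  · have y1 : H.Ru haf * H.Ru hah * H.Ru hc = H.Ru hc * H.Ru hah * H.Ru haf :=
      Units.ext (H.yang_baxter haf hah hc)
    have y2 : H.Ru hac = H.Ru hah * H.Ru haf := Units.ext (H.Rv_conv_right haf hah hc)
    have c1 : Commute (kU H f) (H.Ru hc) := Units.ext (kU_commute_Ev H hc _)
    have c2 : Commute (kU H f) (kU H (conv f h hc)) := Units.ext (by
      rw [val_mul, val_mul, val_kU H (conv f h hc), conv_apply]
      exact kU_commute_Ev H hc _)
    have c3 : Commute (kU H h) (H.Ru hc) := Units.ext (kU_commute_Ev' H hc _)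
    have c4 : Commute (kU H h) (kU H (conv f h hc)) := Units.ext (by
      rw [val_mul, val_mul, val_kU H (conv f h hc), conv_apply]
      exact kU_commute_Ev' H hc _)
    have c5 : Commute (kU H f) (kU H h) := Units.ext (hc _ _)
    have c6 : Commute (kU H h) (H.Ru haf) :=
      Units.ext (H.Rv_commute (fun x => (hah _ _).symm) (fun x => (hc _ _).symm))
    have c7 : Commute (kU H f) (H.Ru haf) := Units.ext (kU_commute_Ev' H haf _)
    have c8 : Commute (kU H f) (H.Ru hah) :=
      Units.ext (H.Rv_commute (fun x => (haf _ _).symm) (fun x => hc _ _))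
    rw [hu, hv, y2, tU]
    generalize H.Ru haf.symm = rfa at *
    generalize H.Ru haf = raf at *
    generalize H.Ru hah = rah at *
    generalize H.Ru hc = r at *
    generalize kU H f = kf at *
    generalize kU H h = kh at *
    generalize kU H (conv f h hc) = kc at *
    have g1 : r⁻¹ * (raf * rah) = rah * raf * r⁻¹ := by
      rw [eq_mul_inv_iff_mul_eq, mul_assoc, inv_mul_eq_iff_eq_mul, y1, mul_assoc]
    calc (r * kc * (kf⁻¹ * kh⁻¹))⁻¹ * (raf * (kh⁻¹ * rah))
        = kh * (kf * (kc⁻¹ * (r⁻¹ * raf))) * kh⁻¹ * rah := by group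
      _ = (kf * (kc⁻¹ * (r⁻¹ * raf))) * kh * kh⁻¹ * rah := by
        rw [(c5.symm.mul_right (c4.inv_right.mul_right (c3.inv_right.mul_right c6))).eq]
      _ = kf * (kc⁻¹ * (r⁻¹ * (raf * rah))) := by group
      _ = (kc⁻¹ * (r⁻¹ * (raf * rah))) * kf :=
        (c2.inv_right.mul_right (c1.inv_right.mul_right (c7.mul_right c8))).eq
      _ = _ := by rw [g1]; group
  · have d1 : Commute X ((H.Ru hc * H.Ru haf.symm : Aˣ) : A) := by
      have := H.Rv_commute (f := f) (h := conv a h hah) hXf hXh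
      rwa [H.Rv_conv_right haf.symm hc hah] at this
    have d2 : Commute X ↑(H.Ru hc * H.Ru haf.symm)⁻¹ := d1.units_inv_right
    rw [val_mul]
    exact hY _ (d2.mul_right (hXf _))

end

/-- The star operation of the holonomy `κ⁻¹ R'R`. -/
lemma starWord_hv {a f : G →ₐ[ℂ] A} (hσ : IsStarOp σ) (ha : IsStarHom σ a) (hf : IsStarHom σ f)
    (haf : Legs a f) : StarWord H σ a f (H.hv a f) := by
  set X : Aˣ := (kU H a)⁻¹ * (H.Ru haf.symm * H.Ru haf) with hX
  have h1 : H.hv a f = X := by rw [SymmetryData.hv, H.Qv_eq haf]; rfl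
  refine ⟨↑X⁻¹, by rw [h1, Units.mul_inv], by rw [h1, inv_mul], ?_⟩
  rw [SymmetryData.hv, H.Qv_eq haf, hσ.mul, hσ.mul, ha.rv H hσ hf haf, hf.rv H hσ ha haf.symm, ha,
    star_kap_inv]
  have c1 : Commute (kU H a) (H.Ru haf) := Units.ext (kU_commute_Ev H haf _)
  have c2 : Commute (kU H f) (H.Ru haf) := Units.ext (kU_commute_Ev' H haf _)
  have c3 : Commute (kU H f) (H.Ru haf.symm) := Units.ext (kU_commute_Ev H haf.symm _)
  have c4 : Commute (kU H f) (kU H a) := Units.ext (haf _ _).symm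
  have : (H.Ru haf.symm)⁻¹ * (H.Ru haf)⁻¹ * kU H a
      = (kU H f)⁻¹ * (H.Ru haf * X⁻¹ * (H.Ru haf)⁻¹) * kU H f := by
    rw [hX]
    generalize H.Ru haf.symm = rfa at *
    generalize H.Ru haf = raf at *
    generalize kU H f = kf at *
    generalize kU H a = ka at *
    have e : raf * (ka⁻¹ * (rfa * raf))⁻¹ * raf⁻¹ = rfa⁻¹ * raf⁻¹ * ka := by
      calc raf * (ka⁻¹ * (rfa * raf))⁻¹ * raf⁻¹ = rfa⁻¹ * (ka * raf⁻¹) := by group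
        _ = rfa⁻¹ * (raf⁻¹ * ka) := by rw [c1.inv_right.eq]
        _ = _ := by group
    have e' := ((c3.inv_right.mul_right c2.inv_right).mul_right c4).eq
    rw [e, mul_assoc (kf⁻¹), ← e', ← mul_assoc, inv_mul_cancel, one_mul]
  exact congrArg Units.val this

end

/-! ### Holonomies conjugated by the action on other tensor factors -/

section

namespace RibbonHopfStar

variable (H : RibbonHopfStar G) {a b j f r : G →ₐ[ℂ] A} {X Y : A}

/-- `R_{ja} X R_{ja}⁻¹`, where `R_{ja} = (j ⊗ a)(R)`. -/
def dress (j a : G →ₐ[ℂ] A) (X : A) : A := H.Rv j a * X * H.Ri j a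

lemma map_dress (θ : A →ₐ[ℂ] B) (j a : G →ₐ[ℂ] A) (X : A) :
    θ (H.dress j a X) = H.dress (θ.comp j) (θ.comp a) (θ X) := by
  simp only [dress, map_mul, map_Rv, map_Ri]

lemma dress_commute {z : A} (hj : ∀ x, Commute z (j x)) (ha : ∀ x, Commute z (a x))
    (hX : Commute z X) : Commute z (H.dress j a X) :=
  ((H.Rv_commute hj ha).mul_right hX).mul_right (H.Ri_commute hj ha)

lemma Ri_Rv_Rv (hja : Legs j a) (hjb : Legs j b) (hab : Legs a b) :
    H.Ri j a * (H.Rv a b * H.Rv j b) = H.Rv j b * H.Rv a b * H.Ri j a := by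
  have y : H.Ru hja * H.Ru hjb * H.Ru hab = H.Ru hab * H.Ru hjb * H.Ru hja :=
    Units.ext (H.yang_baxter hja hjb hab)
  have : (H.Ru hja)⁻¹ * (H.Ru hab * H.Ru hjb) = H.Ru hjb * H.Ru hab * (H.Ru hja)⁻¹ := by
    rw [inv_mul_eq_iff_eq_mul, ← mul_assoc, eq_mul_inv_iff_mul_eq, ← y, mul_assoc]
  exact congrArg Units.val this

lemma Ri_Rv_Rv' (hja : Legs j a) (hjb : Legs j b) (hab : Legs a b) :
    H.Ri a b * (H.Rv j a * H.Rv j b) = H.Rv j b * H.Rv j a * H.Ri a b := by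
  have y : H.Ru hja * H.Ru hjb * H.Ru hab = H.Ru hab * H.Ru hjb * H.Ru hja :=
    Units.ext (H.yang_baxter hja hjb hab)
  have : (H.Ru hab)⁻¹ * (H.Ru hja * H.Ru hjb) = H.Ru hjb * H.Ru hja * (H.Ru hab)⁻¹ := by
    rw [inv_mul_eq_iff_eq_mul, ← mul_assoc, eq_mul_inv_iff_mul_eq, y, mul_assoc]
  exact congrArg Units.val this

lemma Ri_Ri_Rv (hja : Legs j a) (hjb : Legs j b) (hab : Legs a b) :
    H.Ri j b * H.Ri j a * H.Rv a b = H.Rv a b * (H.Ri j a * H.Ri j b) := by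
  have y : H.Ru hja * H.Ru hjb * H.Ru hab = H.Ru hab * H.Ru hjb * H.Ru hja :=
    Units.ext (H.yang_baxter hja hjb hab)
  have : (H.Ru hjb)⁻¹ * (H.Ru hja)⁻¹ * H.Ru hab = H.Ru hab * ((H.Ru hja)⁻¹ * (H.Ru hjb)⁻¹) := by
    rw [← mul_inv_rev, ← mul_inv_rev, inv_mul_eq_iff_eq_mul, ← mul_assoc, eq_mul_inv_iff_mul_eq,
      y, mul_assoc]
  exact congrArg Units.val this

lemma dress_Rv_dress (hja : Legs j a) (hjb : Legs j b) (hab : Legs a b)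
    (hXj : ∀ x, Commute X (j x)) (hXb : ∀ x, Commute X (b x)) (hYj : ∀ x, Commute Y (j x))
    (hYa : ∀ x, Commute Y (a x)) :
    H.dress j a X * H.Rv a b * H.dress j b Y
      = H.Rv j a * H.Rv j b * (X * H.Rv a b * Y) * (H.Ri j a * H.Ri j b) := by
  have h1 := H.Ri_Rv_Rv hja hjb hab
  have h2 := (H.Rv_commute hXj hXb).eq
  have h3 := (H.Ri_commute hYj hYa).eq
  calc H.dress j a X * H.Rv a b * H.dress j b Y
      = H.Rv j a * X * (H.Ri j a * (H.Rv a b * H.Rv j b)) * Y * H.Ri j b := by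
        simp only [dress, mul_assoc]
    _ = H.Rv j a * (X * H.Rv j b) * H.Rv a b * (H.Ri j a * Y) * H.Ri j b := by
        rw [h1]; simp only [mul_assoc]
    _ = _ := by rw [h2, ← h3]; simp only [mul_assoc]

lemma commute_dress (hab : Legs a b) (hja : Legs j a) (hjb : Legs j b) (hjf : Legs j f)
    (hjr : Legs j r) (haf : Legs a f) (har : Legs a r) (hbf : Legs b f) (hbr : Legs b r)
    (hfr : Legs f r)
    (hXj : ∀ x, Commute X (j x)) (hXb : ∀ x, Commute X (b x)) (hXr : ∀ x, Commute X (r x))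
    (hXf : ∀ x, Commute X (conv a f haf x)) (hXY : Commute X Y)
    (hYj : ∀ x, Commute Y (j x)) (hYa : ∀ x, Commute Y (a x)) :
    Commute (H.Ri a b * H.dress j a X * H.Rv a b)
      (H.dress (conv j (conv f r hfr) (Legs.conv_right hjf hjr)) b Y) := by
  have hfrb : Legs (conv f r hfr) b := Legs.conv_left hbf.symm hbr.symm
  have hJb : Legs (conv j (conv f r hfr) (Legs.conv_right hjf hjr)) b := Legs.conv_left hjb hfrb
  set u := (H.Ru hab)⁻¹ * H.Ru hja with hu
  set v := H.Ru hJb with hv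
  have hv' : v = H.Ru hjb * (H.Ru hbf.symm * H.Ru hbr.symm) := by
    refine Units.ext ?_
    change H.Rv _ b = H.Rv j b * (H.Rv f b * H.Rv r b)
    rw [H.Rv_conv_left _ hjb hfrb, H.Rv_conv_left hfr hbf.symm hbr.symm]
  have e1 : H.Ri a b * H.dress j a X * H.Rv a b = (u : A) * X * ↑u⁻¹ := by
    rw [hu, mul_inv_rev, inv_inv, val_mul, val_mul]
    simp only [dress, mul_assoc]; rfl
  have e2 : (v : A) * Y * ↑v⁻¹
      = H.dress (conv j (conv f r hfr) (Legs.conv_right hjf hjr)) b Y := rfl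
  rw [e1, ← e2]
  have e3 : v⁻¹ * u = H.Ru hja * ((H.Ru hbr.symm)⁻¹ * (H.Ru hab * H.Ru hbf.symm)⁻¹
      * (H.Ru hjb)⁻¹) := by
    have y : (H.Ru hja)⁻¹ * (H.Ru hab * H.Ru hjb) = H.Ru hjb * H.Ru hab * (H.Ru hja)⁻¹ :=
      Units.ext (H.Ri_Rv_Rv hja hjb hab)
    have c1 : Commute (H.Ru hja) (H.Ru hbf.symm * H.Ru hbr.symm) := by
      refine Units.ext ?_
      have : ∀ x, Commute (H.Rv j a) (b x) := fun x =>
        (H.Rv_commute (fun y => (hjb y x).symm) fun y => (hab y x).symm).symm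
      exact (H.Rv_commute (fun x => (H.Rv_commute (fun y => (hjf y x).symm)
        fun y => (haf y x).symm).symm) this).mul_right (H.Rv_commute (fun x =>
          (H.Rv_commute (fun y => (hjr y x).symm) fun y => (har y x).symm).symm) this)
    rw [hv', hu]
    generalize H.Ru hja = ja at *
    generalize H.Ru hjb = jb at *
    generalize H.Ru hab = ab at *
    generalize H.Ru hbf.symm = fb at *
    generalize H.Ru hbr.symm = rb at *
    have : ja⁻¹ * (ab * jb) * (fb * rb) = jb * (ab * fb) * rb * ja⁻¹ := by
      rw [y, mul_assoc _ (ja⁻¹), c1.inv_left.eq]; group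
    calc (jb * (fb * rb))⁻¹ * (ab⁻¹ * ja) = (ja⁻¹ * (ab * jb) * (fb * rb))⁻¹ := by group
      _ = _ := by rw [this]; group
  have e4 : ((v⁻¹ * u : Aˣ) : A) * X * ↑(v⁻¹ * u)⁻¹ = H.dress j a X := by
    refine conj_eq_of_commute e3 ?_
    rw [val_mul, val_mul]
    have d1 : Commute X (H.Ru hbr.symm : A) := H.Rv_commute hXr hXb
    have d2 : Commute X (H.Ru hjb : A) := H.Rv_commute hXj hXb
    have d3 : Commute X ((H.Ru hab * H.Ru hbf.symm : Aˣ) : A) := by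
      have := H.Rv_commute (f := conv a f haf) (h := b) hXf hXb
      rwa [H.Rv_conv_left haf hab hbf.symm] at this
    exact ((d1.units_inv_right.mul_right d3.units_inv_right).mul_right d2.units_inv_right).symm
  have e5 : Commute (H.dress j a X) Y := (H.dress_commute hYj hYa hXY.symm).symm
  rw [← e4] at e5
  have e6 : ∀ w : Aˣ, ∀ x y : A, Commute x y →
      Commute ((w : A) * x * ↑w⁻¹) ((w : A) * y * ↑w⁻¹) := fun w x y h => by
    simp only [Commute, SemiconjBy, mul_assoc, Units.inv_mul_cancel_left]
    rw [← mul_assoc x, h.eq, mul_assoc]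
  have := e6 v _ _ e5
  simp only [mul_inv_rev, inv_inv, val_mul, mul_assoc, Units.mul_inv_cancel_left,
    Units.mul_inv, mul_one] at this
  simpa only [mul_assoc] using this

lemma commute_conv_dress (hja : Legs j a) (hjr : Legs j r) (har : Legs a r)
    (hXj : ∀ x, Commute X (j x)) (hXr : ∀ x, Commute X (conv a r har x)) (x : G) :
    Commute (conv a (conv j r hjr) (Legs.conv_right hja.symm har) x) (H.dress j a X) := by
  have h1 : ∀ x, conv a (conv j r hjr) (Legs.conv_right hja.symm har) x * H.Rv j a
      = H.Rv j a * conv j (conv a r har) (Legs.conv_right hja hjr) x := by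
    intro x
    rw [← conv_assoc hja.symm har hjr, ← conv_assoc hja hjr har, conv_apply, conv_apply]
    exact (H.Rv_Ev_left hja hjr har _).symm
  have h2 : Commute (conv j (conv a r har) (Legs.conv_right hja hjr) x) X :=
    (conv_commute hXj hXr x).symm
  have h3 := congrArg (fun z => H.Ri j a * z * H.Ri j a) (h1 x)
  simp only [← mul_assoc, H.Ri_mul_Rv hja, one_mul] at h3
  rw [mul_assoc, mul_assoc, H.Rv_mul_Ri hja, mul_one] at h3
  rw [Commute, SemiconjBy, dress, ← mul_assoc, ← mul_assoc, h1, mul_assoc (H.Rv j a), h2.eq]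
  simp only [mul_assoc]
  rw [h3]

end RibbonHopfStar

namespace SymmetryData

lemma dress_fusion {a b j ψ : G →ₐ[ℂ] A} (hja : Legs j a) (hjb : Legs j b) (hab : Legs a b)
    (haψ : Legs a ψ) (hbψ : Legs b ψ) (hjψ : Legs j ψ) :
    H.dress j a (H.hv a ψ) * H.Rv a b * H.dress j b (H.hv b ψ)
      = Ev a b (twist H) * H.dress j (conv a b hab) (H.hv (conv a b hab) ψ) := by
  have hv_comm : ∀ {a z : G →ₐ[ℂ] A}, Legs z a → Legs z ψ → ∀ x, Commute (H.hv a ψ) (z x) :=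
    fun h1 h2 x => ((h1 _ _).mul_right (H.Qv_commute (fun y => h1 x y) (fun y => h2 x y))).symm
  rw [H.dress_Rv_dress hja hjb hab (hv_comm hja hjψ) (hv_comm hab.symm hbψ) (hv_comm hjb hjψ)
    (hv_comm hab haψ), H.hv_mul_R_mul_hv hab haψ hbψ]
  have hjc := Legs.conv_right (hc := hab) hja hjb
  have h1 : H.Rv j a * H.Rv j b * Ev a b (twist H) = Ev a b (twist H) * H.Rv j (conv a b hab) := by
    rw [H.Rv_conv_right hja hjb hab, ← val_tU H hab]
    have y : H.Ru hja * H.Ru hjb * H.Ru hab = H.Ru hab * H.Ru hjb * H.Ru hja :=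
      Units.ext (H.yang_baxter hja hjb hab)
    have c1 : Commute (kU H (conv a b hab)) (H.Ru hjb * H.Ru hja) := by
      refine Units.ext ?_
      have := kU_commute_Ev' H hjc (H.R : G ⊗[ℂ] G)
      change Commute _ (H.Rv j (conv a b hab)) at this
      rwa [H.Rv_conv_right hja hjb hab] at this
    have c2 : Commute (kU H a) (H.Ru hjb * H.Ru hja) := Units.ext
      ((H.Rv_commute (fun x => (hja _ _).symm) fun x => hab _ _).mul_right (kU_commute_Ev' H hja _))
    have c3 : Commute (kU H b) (H.Ru hjb * H.Ru hja) := Units.ext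
      ((kU_commute_Ev' H hjb _).mul_right
        (H.Rv_commute (fun x => (hjb _ _).symm) fun x => (hab _ _).symm))
    have : H.Ru hja * H.Ru hjb * tU H hab = tU H hab * (H.Ru hjb * H.Ru hja) := by
      have c := c1.mul_left (c2.inv_left.mul_left c3.inv_left)
      unfold tU
      rw [mul_assoc (H.Ru hab)]
      calc _ = H.Ru hja * H.Ru hjb * H.Ru hab * (kU H (conv a b hab)
            * ((kU H a)⁻¹ * (kU H b)⁻¹)) := by simp only [mul_assoc]
        _ = H.Ru hab * ((kU H (conv a b hab) * ((kU H a)⁻¹ * (kU H b)⁻¹))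
            * (H.Ru hjb * H.Ru hja)) := by rw [y, c.eq]; simp only [mul_assoc]
        _ = _ := by simp only [mul_assoc]
    exact congrArg Units.val this
  have h2 : H.Ri j (conv a b hab) = H.Ri j a * H.Ri j b := by
    have : H.Ru hjc = H.Ru hjb * H.Ru hja := Units.ext (H.Rv_conv_right hja hjb hab)
    have := congrArg (fun u : Aˣ => ((u⁻¹ : Aˣ) : A)) this
    rwa [mul_inv_rev] at this
  rw [RibbonHopfStar.dress, h2, ← mul_assoc, ← mul_assoc, h1]
  simp only [mul_assoc]

lemma dress_handle {a b j : G →ₐ[ℂ] A} {X Y : A} (hja : Legs j a) (hjb : Legs j b)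
    (hab : Legs a b) (hXj : ∀ x, Commute X (j x)) (hXb : ∀ x, Commute X (b x))
    (hYj : ∀ x, Commute Y (j x)) (hYa : ∀ x, Commute Y (a x))
    (h : H.Ri a b * X * H.Rv a b * Y = Y * H.Rv b a * X * H.Rv a b) :
    H.Ri a b * H.dress j a X * H.Rv a b * H.dress j b Y
      = H.dress j b Y * H.Rv b a * H.dress j a X * H.Rv a b := by
  have h1 := H.dress_Rv_dress hja hjb hab hXj hXb hYj hYa
  have h2 := H.dress_Rv_dress hjb hja hab.symm hYj hYa hXj hXb
  calc _ = H.Ri a b * (H.dress j a X * H.Rv a b * H.dress j b Y) := by simp only [mul_assoc]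
    _ = H.Ri a b * (H.Rv j a * H.Rv j b) * (X * H.Rv a b * Y) * (H.Ri j a * H.Ri j b) := by
      rw [h1]; simp only [mul_assoc]
    _ = H.Rv j b * H.Rv j a * (H.Ri a b * X * H.Rv a b * Y) * (H.Ri j a * H.Ri j b) := by
      rw [H.Ri_Rv_Rv' hja hjb hab]; simp only [mul_assoc]
    _ = H.Rv j b * H.Rv j a * (Y * H.Rv b a * X) * (H.Rv a b * (H.Ri j a * H.Ri j b)) := by
      rw [h]; simp only [mul_assoc]
    _ = _ := by rw [h2, ← H.Ri_Ri_Rv hja hjb hab]; simp only [mul_assoc]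

lemma hv_commute {a f : G →ₐ[ℂ] A} {z : A} (ha : ∀ x, Commute z (a x))
    (hf : ∀ x, Commute z (f x)) : Commute z (H.hv a f) := (ha _).mul_right (H.Qv_commute ha hf)

end SymmetryData

end

/-! ### The holonomies on a tensor product -/

/-- The tensor factor on which a holonomy lives. -/
def Hol.pos {g m : ℕ} : Hol g m → Fin m ⊕ Fin g
  | .M ν => .inl ν
  | .A i => .inr i
  | .B i => .inr i

lemma finRange_take_append (n : ℕ) (i : Fin n) :
    (finRange n).take i ++ i :: (finRange n).drop (i + 1) = finRange n := by
  have h := List.take_append_drop i (finRange n)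
  rw [List.drop_eq_getElem_cons (by simp)] at h
  simpa using h

lemma allFactors_eq {g m : ℕ} (k : Fin m ⊕ Fin g) :
    ∃ r, allFactors g m = preceding k ++ k :: r := by
  cases k with
  | inl ν =>
    refine ⟨((finRange m).drop (ν + 1)).map .inl ++ (finRange g).map .inr, ?_⟩
    rw [allFactors, preceding]
    conv_lhs => rw [← finRange_take_append m ν]
    simp
  | inr i =>
    refine ⟨((finRange g).drop (i + 1)).map .inr, ?_⟩
    rw [allFactors, preceding]
    conv_lhs => rw [← finRange_take_append g i]
    simp

lemma nodup_allFactors (g m : ℕ) : (allFactors g m).Nodup := by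
  rw [allFactors, nodup_append]
  refine ⟨(List.nodup_finRange m).map Sum.inl_injective,
    (List.nodup_finRange g).map Sum.inr_injective, ?_⟩
  simp

lemma mem_allFactors {g m : ℕ} (k : Fin m ⊕ Fin g) : k ∈ allFactors g m := by
  obtain ⟨r, hr⟩ := allFactors_eq k
  simp [hr]

lemma nodup_preceding {g m : ℕ} (k : Fin m ⊕ Fin g) : (preceding k).Nodup := by
  obtain ⟨r, hr⟩ := allFactors_eq k
  have := nodup_allFactors g m
  rw [hr] at this
  exact this.of_append_left

lemma notMem_preceding {g m : ℕ} (k : Fin m ⊕ Fin g) : k ∉ preceding k := by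
  obtain ⟨r, hr⟩ := allFactors_eq k
  have := nodup_allFactors g m
  rw [hr, nodup_append] at this
  intro h
  exact this.2.2 k h k mem_cons_self rfl

lemma preceding_eq_of_allFactors {g m : ℕ} {k : Fin m ⊕ Fin g} {l r : List (Fin m ⊕ Fin g)}
    (h : allFactors g m = l ++ k :: r) : preceding k = l := by
  obtain ⟨r', hr⟩ := allFactors_eq k
  have hn := nodup_allFactors g m
  rw [hr] at h hn
  rcases List.append_eq_append_iff.1 h with ⟨s, h1, h2⟩ | ⟨s, h1, h2⟩
  · cases s with
    | nil => simpa using h1.symm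
    | cons c s =>
      simp only [cons_append, List.cons.injEq] at h2
      rw [h2.2] at hn
      simp [nodup_append] at hn
  · cases s with
    | nil => simpa using h1
    | cons c s =>
      simp only [cons_append, List.cons.injEq] at h2
      rw [h1, ← h2.1] at hn
      simp [nodup_append] at hn

lemma Hol.Before.preceding {g m : ℕ} {h k : Hol g m} (hk : h.Before k) :
    ∃ r, GraphAlg.preceding k.pos = GraphAlg.preceding h.pos ++ h.pos :: r := by
  have key : ∀ p q : Fin m ⊕ Fin g, p ∈ GraphAlg.preceding q →
      ∃ r, GraphAlg.preceding q = GraphAlg.preceding p ++ p :: r := by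
    intro p q hp
    obtain ⟨s, t, hst⟩ := List.append_of_mem hp
    obtain ⟨r, hr⟩ := allFactors_eq q
    rw [hst, append_assoc, cons_append] at hr
    exact ⟨t, by rw [preceding_eq_of_allFactors hr, hst]⟩
  have take : ∀ {n : ℕ} {i j : Fin n}, i < j → i ∈ (finRange n).take j := by
    intro n i j hij
    rw [List.mem_take_iff_getElem]
    exact ⟨i, by simpa using hij, by simp⟩
  refine key _ _ ?_
  cases hk with
  | MM ν μ h => exact List.mem_map_of_mem (take h)
  | MA ν j => simp [Hol.pos, GraphAlg.preceding]
  | MB ν j => simp [Hol.pos, GraphAlg.preceding]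
  | AA i j h => exact List.mem_append_right _ (List.mem_map_of_mem (take h))
  | BB i j h => exact List.mem_append_right _ (List.mem_map_of_mem (take h))
  | AB i j h => exact List.mem_append_right _ (List.mem_map_of_mem (take h))
  | BA i j h => exact List.mem_append_right _ (List.mem_map_of_mem (take h))

lemma Hol.Before.pos_ne {g m : ℕ} {h k : Hol g m} (hk : h.Before k) : h.pos ≠ k.pos := by
  obtain ⟨r, hr⟩ := hk.preceding
  intro he
  have := notMem_preceding k.pos
  rw [hr, he] at this
  simp at this

section

lemma inFirst_dress (j φ : G →ₐ[ℂ] A) (I J : ι) :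
    inFirst (Fin (H.δ J)) (H.dress ((scal A _).comp j) (numHom A (H.τ I)) (H.holMat φ I))
      = H.dress ((scal A _).comp j) (H.lA A I J) (H.hv (H.lA A I J) ((scal A _).comp φ)) := by
  rw [← inFirstHom_apply, H.map_dress, inFirstHom_apply, H.inFirst_holMat]
  congr 1
  ext x : 1
  exact inFirstHom_scal _

lemma inSecond_dress (j φ : G →ₐ[ℂ] A) (I J : ι) :
    inSecond (Fin (H.δ I)) (H.dress ((scal A _).comp j) (numHom A (H.τ J)) (H.holMat φ J))
      = H.dress ((scal A _).comp j) (H.lB A I J) (H.hv (H.lB A I J) ((scal A _).comp φ)) := by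
  rw [← inSecondHom_apply, H.map_dress, inSecondHom_apply, H.inSecond_holMat]
  congr 1
  ext x : 1
  exact inSecondHom_scal _

lemma num_C_mul_dress (j φ : G →ₐ[ℂ] A) (I J K : ι) (a : Fin (H.N I J K)) :
    (num (H.C I J K a) : Matrix (Fin (H.δ K)) (Fin (H.δ I) × Fin (H.δ J)) A) *
        H.dress ((scal A _).comp j) (conv (H.lA A I J) (H.lB A I J) (H.legs_AB I J))
          (H.hv (conv (H.lA A I J) (H.lB A I J) (H.legs_AB I J)) ((scal A _).comp φ))
      = H.dress ((scal A _).comp j) (numHom A (H.τ K)) (H.holMat φ K) *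
        (num (H.C I J K a) : Matrix (Fin (H.δ K)) (Fin (H.δ I) × Fin (H.δ J)) A) := by
  have hc : Legs (conv (H.lA A I J) (H.lB A I J) (H.legs_AB I J)) ((scal A _).comp j) :=
    Legs.conv_left (legs_fst_scal _ _) (legs_snd_scal _ _)
  have hK := legs_numHom_scal (H.τ K) j
  have e1 : ∀ x : G ⊗[ℂ] G, (num (H.C I J K a) : Matrix (Fin (H.δ K)) (Fin (H.δ I) × Fin (H.δ J)) A)
        * Ev ((scal A _).comp j) (conv (H.lA A I J) (H.lB A I J) (H.legs_AB I J)) x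
      = Ev ((scal A _).comp j) (numHom A (H.τ K)) x
        * (num (H.C I J K a) : Matrix (Fin (H.δ K)) (Fin (H.δ I) × Fin (H.δ J)) A) := by
    intro x
    rw [← Ev_swap hc, H.num_C_mul_Ev, Ev_swap hK]
  rw [RibbonHopfStar.dress, RibbonHopfStar.dress, SymmetryData.holMat, SymmetryData.hv,
    SymmetryData.hv]
  rw [← Matrix.mul_assoc, ← Matrix.mul_assoc, RibbonHopfStar.Rv, e1]
  rw [Matrix.mul_assoc (Ev _ _ _), ← Matrix.mul_assoc (num _), H.num_C_mul_conv,
    Matrix.mul_assoc (numHom _ _ _), RibbonHopfStar.Qv, H.num_C_mul_Ev]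
  rw [Matrix.mul_assoc, Matrix.mul_assoc, Matrix.mul_assoc, RibbonHopfStar.Ri, e1]
  simp only [← Matrix.mul_assoc]
  rfl

lemma dress_functoriality (j φ : G →ₐ[ℂ] A) (hj : Legs j φ) (I J : ι) :
    productSide H (H.dress ((scal A _).comp j) (numHom A (H.τ I)) (H.holMat φ I))
        (H.dress ((scal A _).comp j) (numHom A (H.τ J)) (H.holMat φ J))
      = fusionSide H (fun K => H.dress ((scal A _).comp j) (numHom A (H.τ K)) (H.holMat φ K)) I J := by
  rw [productSide, inFirst_dress, inSecond_dress, H.RM_eq,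
    H.dress_fusion (legs_fst_scal _ _).symm (legs_snd_scal _ _).symm (H.legs_AB I J)
      (legs_fst_scal _ _) (legs_snd_scal _ _) (hj.map _), ← num_evalKron,
    H.evalKron_twist, fusionSide_eq]
  simp only [← num_C_mul_dress, ← Matrix.mul_assoc, ← num_mul]
  have h2 : ∀ Z : Matrix (Fin (H.δ I) × Fin (H.δ J)) (Fin (H.δ I) × Fin (H.δ J)) ℂ,
    (num Z : Matrix _ _ A) = numAlg A _ Z := fun _ => rfl
  simp only [h2, map_sum, sum_mul]

/-- Actions of the symmetry and holonomies on the factors of a tensor product. -/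
structure TensorFamily (H : SymmetryData G ι) (g m : ℕ) (A : Type*) [Ring A] [Algebra ℂ A] where
  /-- the action of the symmetry on a factor -/
  act : Fin m ⊕ Fin g → (G →ₐ[ℂ] A)
  /-- the homomorphism which describes a holonomy -/
  hom : Hol g m → (G →ₐ[ℂ] A)
  act_act : ∀ k l, k ≠ l → Legs (act k) (act l)
  act_hom : ∀ k h, k ≠ h.pos → Legs (act k) (hom h)
  hom_hom : ∀ h k, h.pos ≠ k.pos → Legs (hom h) (hom k)
  cross : ∀ h J ξ, Commute (muMat H J (act h.pos) ξ) (H.holMat (hom h) J)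
  handle : ∀ i I J, exchangeLeft H (H.holMat (hom (.A i)) I) (H.holMat (hom (.B i)) J)
    = handleRight H (H.holMat (hom (.A i)) I) (H.holMat (hom (.B i)) J)

namespace TensorFamily

variable {H} {g m : ℕ} (D : TensorFamily H g m A)

/-- The action on a list of factors. -/
def jay (l : List (Fin m ⊕ Fin g)) : G →ₐ[ℂ] A := listHom D.act l

/-- The holonomies on the tensor product. -/
def mat (h : Hol g m) (I : ι) : 𝕄[H, I, A] :=
  H.dress ((scal A _).comp (D.jay (preceding h.pos))) (numHom A (H.τ I)) (H.holMat (D.hom h) I)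

lemma legs_jay_hom {l : List (Fin m ⊕ Fin g)} {h : Hol g m} (hl : h.pos ∉ l) :
    Legs (D.jay l) (D.hom h) :=
  (legs_listHom fun k hk => (D.act_hom k h fun e => hl (e ▸ hk)).symm).symm

lemma legs_jay_act {l : List (Fin m ⊕ Fin g)} {k : Fin m ⊕ Fin g} (hl : k ∉ l) :
    Legs (D.jay l) (D.act k) :=
  (legs_listHom fun j hj => (D.act_act j k fun e => hl (e ▸ hj)).symm).symm

lemma jay_append_cons {l r : List (Fin m ⊕ Fin g)} {p : Fin m ⊕ Fin g}
    (hn : (l ++ p :: r).Nodup) (hpr : Legs (D.act p) (D.jay r)) (hlp : Legs (D.jay l) (D.act p))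
    (hlr : Legs (D.jay l) (D.jay r)) :
    D.jay (l ++ p :: r) = conv (D.jay l) (conv (D.act p) (D.jay r) hpr)
      (Legs.conv_right hlp hlr) := by
  have h1 := listHom_append (F := D.act) D.act_act hn
  rw [nodup_append, nodup_cons] at hn
  have h2 := listHom_cons (F := D.act) D.act_act hn.2.1.1
  unfold jay
  rw [h1]
  simp only [h2]

lemma commute_conv_hv {B : Type*} [Ring B] [Algebra ℂ B] (h : Hol g m) {a : G →ₐ[ℂ] B}
    {θ : A →ₐ[ℂ] B} (ha : ∀ x z, Commute (a x) (θ z)) (ξ : G) :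
    Commute (conv a (θ.comp (D.act h.pos)) (legs_comp ha _) ξ) (H.hv a (θ.comp (D.hom h))) :=
  GraphAlg.commute_conv_hv (D.cross h) ha ξ

lemma legs_list {l r : List (Fin m ⊕ Fin g)} {p : Fin m ⊕ Fin g}
    (hn : (l ++ p :: r).Nodup) : Legs (D.act p) (D.jay r) ∧ Legs (D.jay l) (D.act p) ∧
      Legs (D.jay l) (D.jay r) := by
  rw [nodup_append, nodup_cons] at hn
  refine ⟨(D.legs_jay_act hn.2.1.1).symm, D.legs_jay_act fun h => hn.2.2 _ h _ mem_cons_self rfl,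
    legs_listHom_listHom D.act_act fun x hx hx' => hn.2.2 _ hx _ (List.mem_cons_of_mem _ hx') rfl⟩

section

variable {B : Type*} [Ring B] [Algebra ℂ B] {a b : G →ₐ[ℂ] B} {θ : A →ₐ[ℂ] B}

lemma commute_hv_jay (ha : ∀ x z, Commute (a x) (θ z)) {h : Hol g m}
    {l : List (Fin m ⊕ Fin g)} (hl : h.pos ∉ l) (x : G) :
    Commute (H.hv a (θ.comp (D.hom h))) (θ.comp (D.jay l) x) :=
  (H.hv_commute (fun y => (ha y _).symm) fun y => (D.legs_jay_hom hl x y).map θ).symm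

lemma commute_hv_leg (hab : Legs a b) (hb : ∀ x z, Commute (b x) (θ z)) (h : Hol g m) (x : G) :
    Commute (H.hv a (θ.comp (D.hom h))) (b x) :=
  (H.hv_commute (fun y => (hab y x).symm) fun _ => hb x _).symm

lemma handle_dress (hab : Legs a b) (ha : ∀ x z, Commute (a x) (θ z))
    (hb : ∀ x z, Commute (b x) (θ z)) {h k : Hol g m} (hhk : h.pos = k.pos)
    (hX : H.Ri a b * H.hv a (θ.comp (D.hom h)) * H.Rv a b * H.hv b (θ.comp (D.hom k))
      = H.hv b (θ.comp (D.hom k)) * H.Rv b a * H.hv a (θ.comp (D.hom h)) * H.Rv a b) :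
    H.Ri a b * H.dress (θ.comp (D.jay (preceding h.pos))) a (H.hv a (θ.comp (D.hom h)))
        * H.Rv a b * H.dress (θ.comp (D.jay (preceding k.pos))) b (H.hv b (θ.comp (D.hom k)))
      = H.dress (θ.comp (D.jay (preceding k.pos))) b (H.hv b (θ.comp (D.hom k))) * H.Rv b a
        * H.dress (θ.comp (D.jay (preceding h.pos))) a (H.hv a (θ.comp (D.hom h))) * H.Rv a b := by
  have hn : h.pos ∉ preceding k.pos := hhk ▸ notMem_preceding h.pos
  rw [hhk]
  exact H.dress_handle (legs_comp ha _).symm (legs_comp hb _).symm hab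
    (D.commute_hv_jay ha hn) (D.commute_hv_leg hab hb h)
    (D.commute_hv_jay hb (notMem_preceding _)) (D.commute_hv_leg hab.symm ha k) hX

lemma exchange_dress (hab : Legs a b) (ha : ∀ x z, Commute (a x) (θ z))
    (hb : ∀ x z, Commute (b x) (θ z)) {h k : Hol g m} (hk : h.Before k) :
    Commute (H.Ri a b * H.dress (θ.comp (D.jay (preceding h.pos))) a (H.hv a (θ.comp (D.hom h)))
        * H.Rv a b)
      (H.dress (θ.comp (D.jay (preceding k.pos))) b (H.hv b (θ.comp (D.hom k)))) := by
  obtain ⟨r, hr⟩ := hk.preceding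
  have hn := nodup_preceding k.pos
  have hnk := notMem_preceding k.pos
  rw [hr] at hn hnk
  obtain ⟨hpr, hlp, hlr⟩ := D.legs_list hn
  have hrp : h.pos ∉ r := (nodup_cons.1 (nodup_append.1 hn).2.1).1
  rw [hr, D.jay_append_cons hn hpr hlp hlr]
  simp only [List.mem_append, mem_cons, not_or] at hnk
  have key := H.commute_dress (X := H.hv a (θ.comp (D.hom h))) (Y := H.hv b (θ.comp (D.hom k)))
    hab (legs_comp ha _).symm (legs_comp hb _).symm (hlp.map θ) (hlr.map θ)
    (legs_comp ha _) (legs_comp ha _) (legs_comp hb _) (legs_comp hb _) (hpr.map θ)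
    (D.commute_hv_jay ha (notMem_preceding _)) (D.commute_hv_leg hab hb h)
    (D.commute_hv_jay ha hrp) (fun x => (D.commute_conv_hv h ha x).symm)
    (H.hv_commute (D.commute_hv_leg hab hb h)
      fun x => (H.hv_commute (fun y => (ha y _).symm)
        fun y => (D.hom_hom k h hk.pos_ne.symm x y).map θ).symm)
    (D.commute_hv_jay hb hnk.1) (D.commute_hv_leg hab.symm ha k)
  simpa only [map_conv] using key

lemma commute_conv_list (ha : ∀ x z, Commute (a x) (θ z)) (h : Hol g m)
    {r : List (Fin m ⊕ Fin g)} (hn : (preceding h.pos ++ h.pos :: r).Nodup) (ξ : G) :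
    Commute (conv a (θ.comp (D.jay (preceding h.pos ++ h.pos :: r))) (legs_comp ha _) ξ)
      (H.dress (θ.comp (D.jay (preceding h.pos))) a (H.hv a (θ.comp (D.hom h)))) := by
  obtain ⟨hpr, hlp, hlr⟩ := D.legs_list hn
  have hrp : h.pos ∉ r := (nodup_cons.1 (nodup_append.1 hn).2.1).1
  have key := H.commute_conv_dress (a := a) (j := θ.comp (D.jay (preceding h.pos)))
    (r := θ.comp (conv (D.act h.pos) (D.jay r) hpr)) (X := H.hv a (θ.comp (D.hom h)))
    (legs_comp ha _).symm ((Legs.conv_right hlp hlr).map _) (legs_comp ha _)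
    (D.commute_hv_jay ha (notMem_preceding _)) ?_ ξ
  · simp only [D.jay_append_cons hn hpr hlp hlr, map_conv] at key ⊢
    exact key
  · intro x
    simp only [map_conv]
    rw [← conv_assoc (legs_comp ha _) (legs_comp ha _) (hpr.map _)]
    exact conv_commute (fun y => (D.commute_conv_hv h ha y).symm) (D.commute_hv_jay ha hrp) x

end

lemma mat_handle (i : Fin g) (I J : ι) :
    exchangeLeft H (D.mat (.A i) I) (D.mat (.B i) J)
      = handleRight H (D.mat (.A i) I) (D.mat (.B i) J) := by
  rw [exchangeLeft, handleRight, H.RinvM_eq, H.RM_eq, H.RpM_eq, mat, mat, inFirst_dress,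
    inSecond_dress]
  exact D.handle_dress (H.legs_AB I J) (lA_commute_scal H I J) (lB_commute_scal H I J)
    (h := .A i) (k := .B i) rfl ((H.handle_iff _ _ I J).1 (D.handle i I J))

lemma mat_exchange {h k : Hol g m} (hk : h.Before k) (I J : ι) :
    exchangeLeft H (D.mat h I) (D.mat k J) = exchangeRight H (D.mat h I) (D.mat k J) := by
  rw [exchangeLeft, exchangeRight, H.RinvM_eq, H.RM_eq, mat, mat, inFirst_dress, inSecond_dress]
  have key := D.exchange_dress (H.legs_AB I J) (lA_commute_scal H I J) (lB_commute_scal H I J) hk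
  rw [Commute, SemiconjBy] at key
  simpa only [mul_assoc] using key

lemma isHolFamily : IsHolFamily H g m D.mat where
  unit h := by
    rw [mat, H.numHom_zero, RibbonHopfStar.dress, H.Rv_triv_right, H.Ri_triv_right, one_mul, mul_one,
      H.holMat_unit]
  functoriality h I J :=
    dress_functoriality H _ _ (D.legs_jay_hom (notMem_preceding h.pos)) I J
  handle := D.mat_handle
  exchange h k hk := D.mat_exchange hk

/-- The graph algebra acts on the tensor product. -/
def lift : GraphAlgebra H g m →ₐ[ℂ] A := D.isHolFamily.lift

lemma hol_map_lift (h : Hol g m) (I : ι) : (hol H g m h I).map D.lift = D.mat h I :=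
  D.isHolFamily.hol_map_lift h I

lemma commute_muMat_mat (h : Hol g m) (J : ι) (ξ : G) :
    Commute (muMat H J (D.jay (allFactors g m)) ξ) (D.mat h J) := by
  obtain ⟨r, hr⟩ := allFactors_eq h.pos
  have hn := nodup_allFactors g m
  rw [hr] at hn ⊢
  exact D.commute_conv_list (fun _ _ => num_commute_scal _ _) h hn ξ

end TensorFamily

end

/-! ### The star operation on a tensor product -/

section

variable {σ : A → A}
variable {n : Type*} [Fintype n] [DecidableEq n]

/-- A map on the entries of the transposed matrix. -/
def hat (σ : A → A) (M : Matrix n n A) : Matrix n n A := Mᵀ.map σ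

lemma IsStarOp.hat (hσ : IsStarOp σ) : IsStarOp (hat (n := n) σ) := hσ.matrix

lemma hat_scal (hσ : IsStarOp σ) (x : A) : hat σ (scal A n x) = scal A n (σ x) := by
  ext a b
  by_cases h : a = b
  · subst h; simp [hat, scal_apply]
  · simp [hat, scal_apply, h, hσ.map_zero]

lemma IsStarHom.scal (hσ : IsStarOp σ) {f : G →ₐ[ℂ] A} (hf : IsStarHom σ f) :
    IsStarHom (hat (n := n) σ) ((GraphAlg.scal A n).comp f) := fun x => by
  rw [comp_apply, hat_scal hσ, hf]; rfl

lemma isStarHom_numHom (hσ : IsStarOp σ) (I : ι) :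
    IsStarHom (hat σ) (numHom A (H.τ I)) := fun x => by
  ext a b
  simp only [hat, numHom, comp_apply, numAlg_apply, num, Matrix.map_apply,
    Matrix.transpose_apply, hσ.algebraMap, H.τ_star, Matrix.conjTranspose_apply]

lemma hat_twisted (T : Aˣ) :
    hat (n := n) (fun x => ↑T⁻¹ * σ x * T) = fun M => scal A n ↑T⁻¹ * hat σ M * scal A n T := by
  funext M
  ext a b
  simp [hat, scal_apply, diagonal_mul, mul_diagonal]

lemma tU_map (θ : A →ₐ[ℂ] B) {f h : G →ₐ[ℂ] A} (hc : Legs f h) :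
    tU H (hc.map θ) = Units.map (θ : A →* B) (tU H hc) := by
  refine Units.ext ?_
  rw [val_tU, Units.coe_map, MonoidHom.coe_coe, val_tU, map_Ev]

lemma StarWord.congr {σ σ' : A → A} {a j : G →ₐ[ℂ] A} {X : A} (h : StarWord H σ a j X)
    (hX : σ X = σ' X) : StarWord H σ' a j X := by
  obtain ⟨Y, h1, h2, h3⟩ := h
  exact ⟨Y, h1, h2, hX ▸ h3⟩

lemma commute_of_inverse {X Y z : A} (hXY : X * Y = 1) (hYX : Y * X = 1) (hz : Commute X z) :
    Commute Y z := by
  calc Y * z = Y * (z * (X * Y)) := by rw [hXY, mul_one]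
    _ = Y * (z * X) * Y := by simp only [mul_assoc]
    _ = Y * X * z * Y := by rw [← hz.eq]; simp only [mul_assoc]
    _ = z * Y := by rw [hYX, one_mul]

/-- Elements that commute with everything in sight do not change the star operation. -/
lemma StarWord.twisted_of_commute {a j : G →ₐ[ℂ] A} {X : A} (h : StarWord H σ a j X) (T : Aˣ)
    (haT : ∀ x, Commute (T : A) (a x)) (hjT : ∀ x, Commute (T : A) (j x))
    (hXT : Commute (T : A) X) :
    StarWord H (fun x => ↑T⁻¹ * σ x * T) a j X := by
  obtain ⟨Y, h1, h2, h3⟩ := h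
  refine ⟨Y, h1, h2, ?_⟩
  have hY : Commute (T : A) Y := (commute_of_inverse h1 h2 hXT.symm).symm
  have hc : Commute (T : A) (σ X) := by
    rw [h3]
    exact ((hjT _).mul_right (((H.Rv_commute haT hjT).mul_right hY).mul_right
      (H.Ri_commute haT hjT))).mul_right (hjT _)
  change ↑T⁻¹ * σ X * T = _
  rw [mul_assoc, ← hc.eq, Units.inv_mul_cancel_left, h3]

lemma IsStarHom.twisted_of_commute {f : G →ₐ[ℂ] A} (hf : IsStarHom σ f) (T : Aˣ)
    (hT : ∀ x, Commute (T : A) (f x)) :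
    IsStarHom (fun x => ↑T⁻¹ * σ x * T) f := fun x => by
  change ↑T⁻¹ * σ (f x) * T = _
  rw [hf, mul_assoc, ← (hT _).eq, Units.inv_mul_cancel_left]

lemma counit_star (H : SymmetryData G ι) (x : G) :
    ε (star x) = star (ε x) := by
  refine H.smul_one_inj (I := H.zero) ?_
  rw [← H.τ_zero, H.τ_star, H.τ_zero, Matrix.conjTranspose_smul, conjTranspose_one]

namespace TensorFamily

variable {H} {g m : ℕ} (D : TensorFamily H g m A)

/-- The contribution of a factor to the scalar product. -/
def gramFactor (k : Fin m ⊕ Fin g) : Aˣ := tU H (D.legs_jay_act (notMem_preceding k))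

/-- The product of the contributions of the factors in a list. -/
def gram (l : List (Fin m ⊕ Fin g)) : Aˣ := (l.map D.gramFactor).prod

lemma gram_commute {l : List (Fin m ⊕ Fin g)} {z : A}
    (h : ∀ k ∈ l, Commute (D.gramFactor k : A) z) : Commute (D.gram l : A) z := by
  induction l with
  | nil => simp [gram]
  | cons k l ih =>
    rw [gram, map_cons, prod_cons, val_mul]
    exact (h k mem_cons_self).mul_left (ih fun j hj => h j (List.mem_cons_of_mem _ hj))

lemma gramFactor_commute {k : Fin m ⊕ Fin g} {z : A}
    (h1 : ∀ j ∈ preceding k, ∀ x, Commute z (D.act j x)) (h2 : ∀ x, Commute z (D.act k x)) :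
    Commute (D.gramFactor k : A) z := by
  rw [gramFactor, val_tU]
  exact (Ev_commute (fun x => listHom_commute h1 x) h2 _).symm

lemma gram_commute_of_prefix {l r : List (Fin m ⊕ Fin g)} (h : allFactors g m = l ++ r) {z : A}
    (hz : ∀ k ∈ l, ∀ x, Commute z (D.act k x)) : Commute (D.gram l : A) z := by
  refine D.gram_commute fun k hk => D.gramFactor_commute (fun j hj => hz j ?_) (hz k hk)
  obtain ⟨s, t, rfl⟩ := List.append_of_mem hk
  rw [append_assoc, cons_append] at h
  rw [preceding_eq_of_allFactors h] at hj
  exact List.mem_append_left _ hj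

section

variable {a : G →ₐ[ℂ] B} {θ : A →ₐ[ℂ] B} {σB : B → B} {l r : List (Fin m ⊕ Fin g)}
  {q : Fin m ⊕ Fin g}

lemma starWord_old (ha : ∀ x z, Commute (a x) (θ z)) (hl : allFactors g m = l ++ q :: r)
    (hc : Legs (D.jay l) (D.act q)) (hq : q ∉ l) {h : Hol g m} (hh : h.pos ∈ l)
    (hX : StarWord H σB a (θ.comp (D.jay l))
      (H.dress (θ.comp (D.jay (preceding h.pos))) a (H.hv a (θ.comp (D.hom h))))) :
    StarWord H (fun x => ↑(tU H (hc.map θ))⁻¹ * σB x * tU H (hc.map θ)) a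
      (θ.comp (conv (D.jay l) (D.act q) hc))
      (H.dress (θ.comp (D.jay (preceding h.pos))) a (H.hv a (θ.comp (D.hom h)))) := by
  obtain ⟨s, t, hst⟩ := List.append_of_mem hh
  have hl' := hl
  rw [hst, append_assoc, cons_append] at hl'
  have hs := preceding_eq_of_allFactors hl'
  have hln : l.Nodup := (hl ▸ nodup_allFactors g m : (l ++ q :: r).Nodup).of_append_left
  have hne : q ≠ h.pos := fun e => hq (e ▸ hh)
  have hqp : q ∉ preceding h.pos := fun h' => hq (hst ▸ hs ▸ List.mem_append_left _ h')
  rw [map_conv]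
  refine StarWord.first H (hc.map θ) (legs_comp ha _) (legs_comp ha _) hX (fun x => ?_) fun x => ?_
  · exact (H.dress_commute (fun y => (D.legs_jay_act hqp y x).symm.map θ)
      (fun y => (ha y _).symm) (H.hv_commute (fun y => (ha y _).symm)
        fun y => (D.act_hom q h hne x y).map θ)).symm
  · subst hs
    subst hst
    exact (D.commute_conv_list ha h hln x).symm

lemma starWord_new (hσ : IsStarOp σB) (hsa : IsStarHom σB a) (ha : ∀ x z, Commute (a x) (θ z))
    (hc : Legs (D.jay l) (D.act q)) (hj : IsStarHom σB (θ.comp (D.jay l))) {h : Hol g m}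
    (hp : preceding h.pos = l) (hh : h.pos = q)
    (hX : StarWord H σB a (θ.comp (D.act q)) (H.hv a (θ.comp (D.hom h)))) :
    StarWord H (fun x => ↑(tU H (hc.map θ))⁻¹ * σB x * tU H (hc.map θ)) a
      (θ.comp (conv (D.jay l) (D.act q) hc))
      (H.dress (θ.comp (D.jay (preceding h.pos))) a (H.hv a (θ.comp (D.hom h)))) := by
  subst hh
  subst hp
  rw [map_conv]
  exact StarWord.second H (hc.map θ) hσ hsa hj (legs_comp ha _) (legs_comp ha _) hX
    (D.commute_hv_jay ha (notMem_preceding _)) fun x => (D.commute_conv_hv h ha x).symm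

lemma starWord_hom_twisted (ha : ∀ x z, Commute (a x) (θ z))
    (hl : allFactors g m = l ++ q :: r) (hq : q ∉ l) {h : Hol g m} (hh : h.pos = q)
    (hX : StarWord H σB a (θ.comp (D.act q)) (H.hv a (θ.comp (D.hom h)))) :
    StarWord H (fun x => θ ↑(D.gram l)⁻¹ * σB x * θ (D.gram l)) a
      (θ.comp (D.act q)) (H.hv a (θ.comp (D.hom h))) := by
  have hg : ∀ z, (∀ k ∈ l, ∀ x, Commute z (D.act k x)) → Commute (θ (D.gram l)) (θ z) :=
    fun z hz => (D.gram_commute_of_prefix hl hz).map θ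
  exact hX.twisted_of_commute H (Units.map (θ : A →* B) (D.gram l)) (fun x => (ha x _).symm)
    (fun x => hg _ fun k hk y => (D.act_act k q (fun e => hq (e ▸ hk)) y x).symm)
    (H.hv_commute (fun x => (ha x _).symm)
      fun x => hg _ fun k hk y => (D.act_hom k h (fun e => hq (hh ▸ e ▸ hk)) y x).symm)

end

lemma star_prefix (hσ : IsStarOp σ) (hF : ∀ k, IsStarHom σ (D.act k))
    (hX : ∀ h I, StarWord H (hat σ) (numHom A (H.τ I)) ((scal A _).comp (D.act h.pos))
      (H.holMat (D.hom h) I)) {l r : List (Fin m ⊕ Fin g)} (hl : allFactors g m = l ++ r) :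
    IsStarOp (fun x => ↑(D.gram l)⁻¹ * σ x * D.gram l) ∧
    IsStarHom (fun x => ↑(D.gram l)⁻¹ * σ x * D.gram l) (D.jay l) ∧
    ∀ h : Hol g m, h.pos ∈ l → ∀ I, StarWord H (hat fun x => ↑(D.gram l)⁻¹ * σ x * D.gram l)
      (numHom A (H.τ I)) ((scal A _).comp (D.jay l)) (D.mat h I) := by
  induction l using List.reverseRecOn generalizing r with
  | nil =>
    have : (fun x => ↑(D.gram [])⁻¹ * σ x * D.gram []) = σ := by
      funext x; simp [gram]
    rw [this]
    refine ⟨hσ, fun x => ?_, by simp⟩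
    change σ (triv A x) = triv A (star x)
    rw [triv_apply, hσ.algebraMap, triv_apply, counit_star H]
  | append_singleton l q ih =>
    rw [append_assoc, List.singleton_append] at hl
    obtain ⟨i1, i2, i3⟩ := ih hl
    have hp := preceding_eq_of_allFactors hl
    have hn : (l ++ q :: r).Nodup := hl ▸ nodup_allFactors g m
    have hq : q ∉ l := hp ▸ notMem_preceding q
    have hc : Legs (D.jay l) (D.act q) := D.legs_jay_act hq
    have hgram : D.gram (l ++ [q]) = D.gram l * tU H hc := by
      rw [gram, List.map_append, List.prod_append]
      simp only [map_cons, List.map_nil, prod_cons, List.prod_nil, mul_one]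
      congr 1
      refine Units.ext ?_
      rw [gramFactor, val_tU, val_tU, hp]
    have hjay : D.jay (l ++ [q]) = conv (D.jay l) (D.act q) hc := by
      rw [jay, listHom_append D.act_act (hn.sublist (by simp))]
      simp only [listHom_singleton]; rfl
    have hF' : IsStarHom (fun x => ↑(D.gram l)⁻¹ * σ x * D.gram l) (D.act q) :=
      (hF q).twisted_of_commute _ fun x => D.gram_commute_of_prefix hl fun k hk y =>
        (D.act_act k q (fun e => hq (e ▸ hk)) y x).symm
    have hT := i2.ev_twist H i1 hF' hc
    rw [← val_tU H hc] at hT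
    have hσ' : (fun x => ↑(D.gram (l ++ [q]))⁻¹ * σ x * D.gram (l ++ [q]))
        = fun x => ↑(tU H hc)⁻¹ * (↑(D.gram l)⁻¹ * σ x * D.gram l) * tU H hc := by
      funext x
      rw [hgram]
      simp only [mul_inv_rev, val_mul, mul_assoc]
    rw [hσ', hjay]
    set σ₁ : A → A := fun x => ↑(D.gram l)⁻¹ * σ x * D.gram l with hσ₁
    refine ⟨i1.twisted _ hT, isStarHom_conv H hc i1 i2 hF', fun h hh I => ?_⟩
    have hhat : ∀ X : 𝕄[H, I, A],
        (((tU H (hc.map (scal A (Fin (H.δ I)))))⁻¹ : _ˣ) : Matrix _ _ A) * hat σ₁ X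
          * (tU H (hc.map (scal A (Fin (H.δ I)))) : 𝕄[H, I, A])
        = hat (fun x => ↑(tU H hc)⁻¹ * σ₁ x * tU H hc) X := by
      intro X
      rw [tU_map H (scal A (Fin (H.δ I))) hc, hat_twisted (σ := σ₁)]; rfl
    have ha : ∀ x z, Commute (numHom A (H.τ I) x) (scal A _ z) :=
      fun _ _ => num_commute_scal _ _
    rw [List.mem_append, List.mem_singleton] at hh
    rcases hh with hh | hh
    · exact (D.starWord_old ha hl hc hq hh (i3 h hh I)).congr H (hhat _)
    · have e1 := D.starWord_hom_twisted ha hl hq hh (hh ▸ hX h I)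
      have e2 : hat (n := Fin (H.δ I)) σ₁ = _ := hat_twisted (σ := σ) (D.gram l)
      rw [← e2] at e1
      exact (D.starWord_new i1.hat (isStarHom_numHom H i1 I) ha hc (i2.scal i1) (hh ▸ hp) hh
        e1).congr H (hhat _)

lemma star_all (hσ : IsStarOp σ) (hF : ∀ k, IsStarHom σ (D.act k))
    (hX : ∀ h I, StarWord H (hat σ) (numHom A (H.τ I)) ((scal A _).comp (D.act h.pos))
      (H.holMat (D.hom h) I)) :
    IsStarOp (fun x => ↑(D.gram (allFactors g m))⁻¹ * σ x * D.gram (allFactors g m)) ∧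
    IsStarHom (fun x => ↑(D.gram (allFactors g m))⁻¹ * σ x * D.gram (allFactors g m))
      (D.jay (allFactors g m)) ∧
    ∀ (h : Hol g m) I, StarWord H
      (hat fun x => ↑(D.gram (allFactors g m))⁻¹ * σ x * D.gram (allFactors g m))
      (numHom A (H.τ I)) ((scal A _).comp (D.jay (allFactors g m))) (D.mat h I) := by
  obtain ⟨h1, h2, h3⟩ := D.star_prefix hσ hF hX (l := allFactors g m) (r := []) (by simp)
  exact ⟨h1, h2, fun h I => h3 h (mem_allFactors _) I⟩

end TensorFamily

end

/-- The operators on `ℜ`. -/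
abbrev Op : Type := Matrix (RegIndex H) (RegIndex H) ℂ

/-! ### Operators on the tensor product of the factors -/

section

variable {κ : Type*} [Fintype κ] [DecidableEq κ] {n : κ → Type*} [∀ k, Fintype (n k)]
  [∀ k, DecidableEq (n k)]

/-- The tensor product of a family of matrices. -/
def prodMat (n : κ → Type*) [∀ k, Fintype (n k)] [∀ k, DecidableEq (n k)] :
    (∀ k, Matrix (n k) (n k) ℂ) →* Matrix (∀ k, n k) (∀ k, n k) ℂ where
  toFun X := Matrix.of fun x y => ∏ k, X k (x k) (y k)
  map_one' := by
    ext x y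
    by_cases h : x = y
    · subst h; simp
    · obtain ⟨k, hk⟩ := ne_iff.1 h
      rw [of_apply, Matrix.one_apply_ne h]
      exact prod_eq_zero (mem_univ k) (by simp [hk])
  map_mul' X Y := by
    ext x y
    simp only [of_apply, Pi.mul_apply, Matrix.mul_apply, Finset.prod_univ_sum,
      Fintype.piFinset_univ, Finset.prod_mul_distrib]

lemma prodMat_apply (X : ∀ k, Matrix (n k) (n k) ℂ) (x y : ∀ k, n k) :
    prodMat n X x y = ∏ k, X k (x k) (y k) := rfl

lemma prodMat_conjTranspose (X : ∀ k, Matrix (n k) (n k) ℂ) :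
    prodMat n (fun k => (X k)ᴴ) = (prodMat n X)ᴴ := by
  ext x y
  simp [prodMat_apply, Matrix.conjTranspose_apply, star_prod]

lemma prodMat_single (x y : ∀ k, n k) :
    prodMat n (fun k => Matrix.single (x k) (y k) 1) = Matrix.single x y 1 := by
  ext z w
  rw [prodMat_apply]
  by_cases h : x = z ∧ y = w
  · obtain ⟨rfl, rfl⟩ := h; simp
  · rw [single_apply, if_neg h]
    rcases not_and_or.1 h with h | h
    · obtain ⟨k, hk⟩ := ne_iff.1 h
      exact prod_eq_zero (mem_univ k) (by simp [hk])
    · obtain ⟨k, hk⟩ := ne_iff.1 h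
      exact prod_eq_zero (mem_univ k) (by simp [hk])

lemma prodMat_posDef {X : ∀ k, Matrix (n k) (n k) ℂ} (hX : ∀ k, (X k).PosDef) :
    (prodMat n X).PosDef := by
  have h : ∀ k, ∃ Y : Matrix (n k) (n k) ℂ, X k = Yᴴ * Y := fun k => by
    open scoped MatrixOrder Matrix.Norms.L2Operator in
    exact CStarAlgebra.nonneg_iff_eq_star_mul_self.1 (hX k).posSemidef.nonneg
  choose Y hY using h
  have h1 : prodMat n X = (prodMat n Y)ᴴ * prodMat n Y := by
    rw [← prodMat_conjTranspose, ← map_mul]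
    congr 1
    funext k
    exact hY k
  refine (Matrix.PosSemidef.posDef_iff_isUnit ?_).2
    ((Pi.isUnit_iff.2 fun k => (hX k).isUnit).map (prodMat n))
  rw [h1]
  exact Matrix.posSemidef_conjTranspose_mul_self _

end

section

variable {g m : ℕ} (lab : Fin m → ι)

lemma localOp_eq (k : Fin m ⊕ Fin g) (X : Matrix (Factor H lab k) (Factor H lab k) ℂ) :
    localOp H lab k X = prodMat (Factor H lab) (Pi.mulSingle k X) := by
  ext x y
  change (if ∀ l, l ≠ k → x l = y l then X (x k) (y k) else 0) = _
  rw [prodMat_apply]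
  split_ifs with h
  · rw [Finset.prod_eq_single k]
    · simp
    · intro l _ hl
      rw [Pi.mulSingle_eq_of_ne hl, h l hl, one_apply_eq]
    · simp
  · push Not at h
    obtain ⟨l, hl, hxy⟩ := h
    refine (prod_eq_zero (mem_univ l) ?_).symm
    rw [Pi.mulSingle_eq_of_ne hl, Matrix.one_apply_ne hxy]

/-- The operators on one tensor factor. -/
def locHom (k : Fin m ⊕ Fin g) :
    Matrix (Factor H lab k) (Factor H lab k) ℂ →ₐ[ℂ] SpaceMat H g lab :=
  ofLinearMap (localOp H lab k) (by rw [localOp_eq, Pi.mulSingle_one, map_one])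
    (fun X Y => by simp only [localOp_eq, Pi.mulSingle_mul, map_mul])

lemma locHom_apply (k : Fin m ⊕ Fin g) (X : Matrix (Factor H lab k) (Factor H lab k) ℂ) :
    locHom H lab k X = localOp H lab k X := rfl

lemma locHom_commute {k l : Fin m ⊕ Fin g} (h : k ≠ l)
    (X : Matrix (Factor H lab k) (Factor H lab k) ℂ)
    (Y : Matrix (Factor H lab l) (Factor H lab l) ℂ) :
    Commute (locHom H lab k X) (locHom H lab l Y) := by
  rw [locHom_apply, locHom_apply, localOp_eq, localOp_eq]
  exact (Pi.mulSingle_commute (f := fun k => Matrix (Factor H lab k) (Factor H lab k) ℂ) h X Y).map _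

/-- The operators on the single factors generate all operators. -/
lemma mem_of_locHom_mem (W : Subalgebra ℂ (SpaceMat H g lab))
    (hW : ∀ k X, locHom H lab k X ∈ W) (X : SpaceMat H g lab) : X ∈ W := by
  have h1 : ∀ f : ∀ k, Matrix (Factor H lab k) (Factor H lab k) ℂ, prodMat _ f ∈ W := by
    intro f
    refine Submonoid.pi_mem_of_mulSingle_mem (H := W.toSubmonoid.comap (prodMat (Factor H lab))) f
      fun k => ?_
    rw [Submonoid.mem_comap, ← localOp_eq]
    exact hW k (f k)
  rw [Matrix.matrix_eq_sum_single X]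
  refine sum_mem fun x _ => sum_mem fun y _ => ?_
  have : Matrix.single x y (X x y) = X x y • prodMat _ fun k => Matrix.single (x k) (y k) (1 : ℂ) := by
    rw [prodMat_single]; simp
  rw [this]
  exact W.smul_mem (h1 _) _

variable (π : SemiDirect H 1 0 →ₐ[ℂ] Op H)

/-- The representation of the symmetry on a factor. -/
def factorHom : ∀ k : Fin m ⊕ Fin g, G →ₐ[ℂ] Matrix (Factor H lab k) (Factor H lab k) ℂ
  | .inl ν => H.τ (lab ν)
  | .inr _ => π.comp (ofG H 1 0)

lemma factorHom_toLinearMap (k : Fin m ⊕ Fin g) :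
    (factorHom H lab π k).toLinearMap = factorRep H lab π k := by cases k <;> rfl

lemma exists_hol_eq_holMat (hm : H.IsModular) (g m : ℕ) (h : Hol g m) :
    ∃ φ : G →ₐ[ℂ] GraphAlgebra H g m, ∀ I, hol H g m h I = H.holMat φ I :=
  exists_holMat_eq H hm ((isHolFamily_hol H g m).unit h) ((isHolFamily_hol H g m).functoriality h)

/-- The homomorphism which describes a holonomy of the graph algebra. -/
def holHom (hm : H.IsModular) (g m : ℕ) (h : Hol g m) :
    G →ₐ[ℂ] GraphAlgebra H g m := (exists_hol_eq_holMat H hm g m h).choose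

lemma hol_eq_holMat (hm : H.IsModular) (g m : ℕ) (h : Hol g m) (I : ι) :
    hol H g m h I = H.holMat (holHom H hm g m h) I :=
  (exists_hol_eq_holMat H hm g m h).choose_spec I

variable (hm : H.IsModular)

/-- The homomorphism to the operators on a factor which describes a holonomy. -/
def holFactorHom : Hol g m → (G →ₐ[ℂ] SpaceMat H g lab)
  | .M ν => (locHom H lab (.inl ν)).comp (H.τ (lab ν))
  | .A i => ((locHom H lab (.inr i)).comp (π.comp (ofL H 1 0))).comp (holHom H hm 1 0 (.A 0))
  | .B i => ((locHom H lab (.inr i)).comp (π.comp (ofL H 1 0))).comp (holHom H hm 1 0 (.B 0))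

/-- The elements of `G ⊗ A` in the range of `(κ⁻¹ ⊗ 1) R'R` commute with the coproduct. -/
lemma commute_muMat_holMat (φ : G →ₐ[ℂ] A) (J : ι) (ξ : G) :
    Commute (muMat H J φ ξ) (H.holMat φ J) := by
  have hc := legs_numHom_scal (H.τ J) φ
  refine Commute.mul_right ?_ (H.Qv_commute_conv hc ξ).symm
  rw [muMat, conv_apply]
  exact (H.commute_kap_inv hc _).symm

lemma handle_cross (h : Hol 1 0) {A : Type*} [Ring A] [Algebra ℂ A]
    (θ : SemiDirect H 1 0 →ₐ[ℂ] A) (J : ι) (ξ : G) :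
    Commute (muMat H J (θ.comp (ofG H 1 0)) ξ)
      (H.holMat ((θ.comp (ofL H 1 0)).comp (holHom H hm 1 0 h)) J) := by
  have h1 : ∀ J ξ, Commute (muMat H J (ofG H 1 0) ξ)
      (H.holMat ((ofL H 1 0).comp (holHom H hm 1 0 h)) J) := fun J ξ => by
    rw [← H.holMat_map, ← hol_eq_holMat]
    exact muMat_commute_holS h J ξ
  exact commute_conv_hv h1 (a := numHom A (H.τ J)) (θ := (scal A _).comp θ)
    (fun _ _ => num_commute_scal _ _) ξ

/-- The actions and the holonomies on the tensor product. -/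
def spaceFamily : TensorFamily H g m (SpaceMat H g lab) where
  act k := (locHom H lab k).comp (factorHom H lab π k)
  hom := holFactorHom H lab π hm
  act_act k l h x y := locHom_commute H lab h _ _
  act_hom k h hk x y := by
    cases h <;> exact locHom_commute H lab hk _ _
  hom_hom h k hk x y := by
    cases h <;> cases k <;> exact locHom_commute H lab hk _ _
  cross h J ξ := by
    cases h with
    | M ν => exact commute_muMat_holMat H _ J ξ
    | A i => exact handle_cross H hm (.A 0) ((locHom H lab (.inr i)).comp π) J ξ
    | B i => exact handle_cross H hm (.B 0) ((locHom H lab (.inr i)).comp π) J ξ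
  handle i I J := by
    have h1 := ((isHolFamily_hol H 1 0).map
      ((locHom H lab (g := g) (m := m) (.inr i)).comp (π.comp (ofL H 1 0)))).handle 0 I J
    simp only [hol_eq_holMat H hm, H.holMat_map] at h1
    exact h1

lemma spaceFamily_jay (l : List (Fin m ⊕ Fin g)) (hl : l.Nodup) :
    ((spaceFamily H lab π hm).jay l).toLinearMap = listRep H lab π l := by
  induction l with
  | nil => rfl
  | cons k l ih =>
    rw [nodup_cons] at hl
    ext x : 1
    rw [toLinearMap_apply, TensorFamily.jay,
      listHom_cons (spaceFamily H lab π hm).act_act hl.1, conv_apply, listRep, ← ih hl.2,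
      ← factorHom_toLinearMap]
    rfl

lemma spaceFamily_mat (h : Hol g m) (J : ι) :
    (spaceFamily H lab π hm).mat h J = holOp H lab π J h := by
  have key : ∀ k (X : 𝕄[H, J, SpaceMat H g lab]), conjR H (precRep H lab π k) J X
        = H.dress ((scal _ _).comp ((spaceFamily H lab π hm).jay (preceding k)))
          (numHom _ (H.τ J)) X := by
    intro k X
    have hc := legs_numHom_scal (H.τ J) ((spaceFamily H lab π hm).jay (preceding k))
    rw [conjR, precRep, ← spaceFamily_jay H lab π hm _ (nodup_preceding k), evalMat_eq_Ev,
      evalMat_eq_Ev, H.Ev_swap_R hc, H.Ev_swap_Ri hc]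
    rfl
  cases h with
  | M ν =>
    rw [holOp, key]
    refine congrArg (H.dress _ _) ?_
    have : loopRep H (lab ν) J = H.holMat (H.τ (lab ν)) J := (H.holMat_eq _ J).symm
    rw [this]
    exact (H.holMat_map (locHom H lab (.inl ν)) (H.τ (lab ν)) J).symm
  | A i =>
    rw [holOp, key]
    refine congrArg (H.dress _ _) ?_
    have := H.holMat_map ((locHom H lab (g := g) (.inr i)).comp (π.comp (ofL H 1 0)))
      (holHom H hm 1 0 (.A 0)) J
    rw [← hol_eq_holMat] at this
    rw [holS, Matrix.map_map]
    exact this.symm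
  | B i =>
    rw [holOp, key]
    refine congrArg (H.dress _ _) ?_
    have := H.holMat_map ((locHom H lab (g := g) (.inr i)).comp (π.comp (ofL H 1 0)))
      (holHom H hm 1 0 (.B 0)) J
    rw [← hol_eq_holMat] at this
    rw [holS, Matrix.map_map]
    exact this.symm

end

section

variable {g m : ℕ}

lemma map_conj_eq_scal {n : Type*} [Fintype n] [DecidableEq n] (x y : A) (M : Matrix n n A) :
    M.map (fun F => x * F * y) = scal A n x * M * scal A n y := by
  ext a b
  simp [scal_apply, diagonal_mul, mul_diagonal]

lemma isGraphStar_iff (st : SemiDirect H g m → SemiDirect H g m) :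
    IsGraphStar H g m st ↔ IsStarOp st ∧ IsStarHom st (ofG H g m) ∧
      ∀ h I, StarWord H (hat st) (numHom _ (H.τ I)) ((scal _ _).comp (ofG H g m))
        (holS H g m h I) := by
  constructor
  · rintro ⟨h1, h2, h3, h4, h5, h6⟩
    refine ⟨⟨h1, h2, h3, h4⟩, h5, fun h I => ?_⟩
    obtain ⟨Y, y1, y2, y3⟩ := h6 h I
    rw [map_conj_eq_scal, evalMat_eq_Ev, evalMat_eq_Ev] at y3
    exact ⟨Y, y1, y2, y3⟩
  · rintro ⟨⟨h1, h2, h3, h4⟩, h5, h6⟩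
    refine ⟨h1, h2, h3, h4, h5, fun h I => ?_⟩
    obtain ⟨Y, y1, y2, y3⟩ := h6 h I
    refine ⟨Y, y1, y2, ?_⟩
    rw [map_conj_eq_scal, evalMat_eq_Ev, evalMat_eq_Ev]
    exact y3

lemma StarWord.map {σA : A → A} {σB : B → B} {a j : G →ₐ[ℂ] A} {X : A}
    (h : StarWord H σA a j X) (θ : A →ₐ[ℂ] B) (hθ : σB (θ X) = θ (σA X)) :
    StarWord H σB (θ.comp a) (θ.comp j) (θ X) := by
  obtain ⟨Y, y1, y2, y3⟩ := h
  refine ⟨θ Y, by rw [← map_mul, y1, map_one], by rw [← map_mul, y2, map_one], ?_⟩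
  rw [hθ, y3]
  simp only [map_mul, H.map_Rv, H.map_Ri]
  rfl

lemma StarWord.map_matrix {σA : A → A} {σB : B → B} {j : G →ₐ[ℂ] A} {I : ι}
    {X : 𝕄[H, I, A]}
    (h : StarWord H (hat σA) (numHom A (H.τ I)) ((scal A _).comp j) X) (θ : A →ₐ[ℂ] B)
    (hθ : ∀ a b, σB (θ (X a b)) = θ (σA (X a b))) :
    StarWord H (hat σB) (numHom B (H.τ I)) ((scal B _).comp (θ.comp j)) (X.map θ) := by
  have := h.map H (σB := hat σB) θ.mapMatrix (by ext a b; exact hθ b a)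
  rw [numHom_map, scal_map] at this
  exact this

lemma StarWord.unique {σ σ' : A → A} {a j : G →ₐ[ℂ] A} {X : A} (h : StarWord H σ a j X)
    (h' : StarWord H σ' a j X) : σ X = σ' X := by
  obtain ⟨Y, y1, y2, y3⟩ := h
  obtain ⟨Y', z1, z2, z3⟩ := h'
  have : Y = Y' := by rw [← mul_one Y, ← z1, ← mul_assoc, y2, one_mul]
  rw [y3, z3, this]

/-- A homomorphism respects the star operations if it does so on the generators. -/
lemma starHom_of_generators {st : SemiDirect H g m → SemiDirect H g m}
    (hst : IsGraphStar H g m st) {σ : A → A} (hσ : IsStarOp σ) (L : SemiDirect H g m →ₐ[ℂ] A)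
    (hG : IsStarHom σ (L.comp (ofG H g m)))
    (hX : ∀ h I, StarWord H (hat σ) (numHom _ (H.τ I)) ((scal _ _).comp (L.comp (ofG H g m)))
        ((holS H g m h I).map L)) (x : SemiDirect H g m) : σ (L x) = L (st x) := by
  obtain ⟨h1, h2, h3⟩ := (isGraphStar_iff H st).1 hst
  have hmul : ∀ x y, σ (L x) = L (st x) → σ (L y) = L (st y) → σ (L (x * y)) = L (st (x * y)) :=
    fun x y hx hy => by rw [map_mul, hσ.mul, hx, hy, h1.mul, map_mul]
  have hadd : ∀ x y, σ (L x) = L (st x) → σ (L y) = L (st y) → σ (L (x + y)) = L (st (x + y)) :=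
    fun x y hx hy => by rw [map_add, hσ.add, hx, hy, h1.add, map_add]
  have hsc : ∀ c : ℂ, σ (L (algebraMap ℂ _ c)) = L (st (algebraMap ℂ _ c)) := fun c => by
    rw [h1.algebraMap, commutes, commutes, hσ.algebraMap]
  have hL : ∀ y : GraphAlgebra H g m, σ (L (ofL H g m y)) = L (st (ofL H g m y)) := by
    intro y
    induction y using graphAlgebra_induction with
    | scalar c => rw [commutes]; exact hsc c
    | gen h I a b =>
      obtain ⟨Y, y1, y2, y3⟩ := h3 h I
      have e1 : StarWord H (fun _ => (hat st (holS H g m h I)).map L) (numHom A (H.τ I))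
          ((scal A _).comp (L.comp (ofG H g m))) ((holS H g m h I).map L) := by
        have := (h3 h I).map H (σB := fun _ => (hat st (holS H g m h I)).map L) L.mapMatrix rfl
        rw [numHom_map, scal_map] at this
        exact this
      have := congrFun (congrFun ((hX h I).unique H e1) b) a
      exact this
    | add x y hx hy => rw [map_add]; exact hadd _ _ hx hy
    | mul x y hx hy => rw [map_mul (ofL H g m) x y]; exact hmul _ _ hx hy
  induction x using semi_induction with
  | scalar c => exact hsc c
  | inl y => exact hL y
  | inr ξ =>
    have := hG ξ
    rw [comp_apply] at this
    rw [this, h2]; rfl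
  | add x y hx hy => exact hadd _ _ hx hy
  | mul x y hx hy => exact hmul _ _ hx hy

lemma isGraphStar_unique {st st' : SemiDirect H g m → SemiDirect H g m}
    (h : IsGraphStar H g m st) (h' : IsGraphStar H g m st') : st = st' := by
  obtain ⟨h1, h2, h3⟩ := (isGraphStar_iff H st).1 h
  funext x
  exact starHom_of_generators H h' h1 (AlgHom.id ℂ _) h2 (fun k I => by
    simpa using h3 k I) x

end

section

variable {g m : ℕ} {n : Type*} [Fintype n] [DecidableEq n]

/-- The adjoint with respect to the form with the Gram matrix `Q`. -/
def adj (Q X : Matrix n n ℂ) : Matrix n n ℂ := Q⁻¹ * Xᴴ * Q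

lemma isStarOp_adj {Q : Matrix n n ℂ} (hQ : Q.PosDef) : IsStarOp (adj Q) := by
  obtain ⟨U, hU⟩ := hQ.isUnit
  have : adj Q = fun x => ((U⁻¹ : (Matrix n n ℂ)ˣ) : Matrix n n ℂ) * star x * U := by
    funext x
    rw [adj, ← hU, Matrix.coe_units_inv]; rfl
  rw [this]
  refine isStarOp_star.twisted U ?_
  rw [hU]
  exact hQ.isHermitian

lemma mul_adj {Q : Matrix n n ℂ} (hQ : Q.PosDef) (X : Matrix n n ℂ) : Q * adj Q X = Xᴴ * Q := by
  rw [adj, ← Matrix.mul_assoc, ← Matrix.mul_assoc,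
    Matrix.mul_nonsing_inv _ ((Matrix.isUnit_iff_isUnit_det _).1 hQ.isUnit), Matrix.one_mul]

lemma eq_adj {Q : Matrix n n ℂ} (hQ : Q.PosDef) {X Y : Matrix n n ℂ} (h : Q * Y = Xᴴ * Q) :
    Y = adj Q X := by
  rw [adj, Matrix.mul_assoc, ← h, ← Matrix.mul_assoc,
    Matrix.nonsing_inv_mul _ ((Matrix.isUnit_iff_isUnit_det _).1 hQ.isUnit), Matrix.one_mul]

namespace TensorFamily

variable {H} (D : TensorFamily H g m (Matrix n n ℂ))

lemma posDef_prefix {Q : Matrix n n ℂ} (hQ : Q.PosDef) (hF : ∀ k, IsStarHom (adj Q) (D.act k))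
    (hX : ∀ h I, StarWord H (hat (adj Q)) (numHom _ (H.τ I)) ((scal _ _).comp (D.act h.pos))
      (H.holMat (D.hom h) I)) {l r : List (Fin m ⊕ Fin g)} (hl : allFactors g m = l ++ r) :
    (Q * (D.gram l : Matrix n n ℂ)).PosDef := by
  induction l using List.reverseRecOn generalizing r with
  | nil => simpa [gram] using hQ
  | append_singleton l q ih =>
    rw [append_assoc, List.singleton_append] at hl
    have ih := ih hl
    obtain ⟨i1, i2, i3⟩ := D.star_prefix (isStarOp_adj hQ) hF hX hl
    have hp := preceding_eq_of_allFactors hl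
    have hq : q ∉ l := hp ▸ notMem_preceding q
    have hc : Legs (D.jay l) (D.act q) := D.legs_jay_act hq
    have hF' := (hF q).twisted_of_commute (D.gram l) fun x => D.gram_commute_of_prefix hl
      fun k hk y => (D.act_act k q (fun e => hq (e ▸ hk)) y x).symm
    obtain ⟨x, hx, hT⟩ := H.exists_twist_eq
    have hgram : (D.gram (l ++ [q]) : Matrix n n ℂ)
        = D.gram l * (Ev (D.jay l) (D.act q) (star x) * Ev (D.jay l) (D.act q) x) := by
      rw [gram, List.map_append, List.prod_append]
      simp only [map_cons, List.map_nil, prod_cons, List.prod_nil, mul_one, val_mul]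
      rw [gramFactor, val_tU, hp, hT, Ev_mul hc]; rfl
    set Y := Ev (D.jay l) (D.act q) x with hY
    have h1 := i2.ev i1 hF' hc x
    have h2 : Q * (D.gram l : Matrix n n ℂ) * Ev (D.jay l) (D.act q) (star x)
        = Yᴴ * (Q * (D.gram l : Matrix n n ℂ)) := by
      rw [← h1, Matrix.mul_assoc Q, ← Matrix.mul_assoc (D.gram l : Matrix n n ℂ),
        ← Matrix.mul_assoc (D.gram l : Matrix n n ℂ), Units.mul_inv, Matrix.one_mul,
        ← Matrix.mul_assoc, mul_adj hQ, Matrix.mul_assoc]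
    have hYu : IsUnit Y := by
      obtain ⟨w, rfl⟩ := hx
      have h3 : Y * Ev (D.jay l) (D.act q) ↑w⁻¹ = 1 := by
        rw [hY, ← Ev_mul hc, Units.mul_inv, Ev_one]
      exact (Matrix.isUnit_iff_isUnit_det _).2 (Matrix.isUnit_det_of_right_inverse h3)
    rw [hgram, ← Matrix.mul_assoc, ← Matrix.mul_assoc, h2]
    exact ih.conjTranspose_mul_mul_same (Matrix.mulVec_injective_of_isUnit hYu)

end TensorFamily

/-- The form `Q` makes `π` a star representation. -/
structure IsGoodForm (π : SemiDirect H 1 0 →ₐ[ℂ] Op H) (Q : Op H) : Prop where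
  posDef : Q.PosDef
  onG : IsStarHom (adj Q) (π.comp (ofG H 1 0))
  onHol : ∀ h I, StarWord H (hat (adj Q)) (numHom _ (H.τ I))
    ((scal _ _).comp (π.comp (ofG H 1 0))) ((holS H 1 0 h I).map π)

variable (lab : Fin m → ι) {π : SemiDirect H 1 0 →ₐ[ℂ] Op H}
  {Q : Op H}

lemma factorGram_posDef (hQ : Fin g → Q.PosDef) (k : Fin m ⊕ Fin g) :
    (factorGram H lab Q k).PosDef := by
  cases k with
  | inl ν => exact PosDef.one
  | inr i => exact hQ i

lemma adj_locHom (hQ : Fin g → Q.PosDef) (k : Fin m ⊕ Fin g)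
    (X : Matrix (Factor H lab k) (Factor H lab k) ℂ) :
    adj (prodMat _ (factorGram H lab Q)) (locHom H lab k X)
      = locHom H lab k (adj (factorGram H lab Q k) X) := by
  refine (eq_adj (prodMat_posDef (factorGram_posDef H lab hQ)) ?_).symm
  rw [locHom_apply, locHom_apply, localOp_eq, localOp_eq, ← prodMat_conjTranspose, ← map_mul,
    ← map_mul]
  congr 1
  funext l
  by_cases h : l = k
  · subst h
    simp [mul_adj (factorGram_posDef H lab hQ l)]
  · simp [Pi.mulSingle_eq_of_ne h]

variable (hm : H.IsModular)

lemma spaceFamily_isStarHom (hQ : Fin g → IsGoodForm H π Q) (k : Fin m ⊕ Fin g) :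
    IsStarHom (adj (prodMat _ (factorGram H lab Q))) ((spaceFamily H lab π hm).act k) := by
  intro x
  change adj _ (locHom H lab k (factorHom H lab π k x)) = locHom H lab k (factorHom H lab π k _)
  rw [adj_locHom H lab fun i => (hQ i).posDef]
  congr 1
  cases k with
  | inl ν =>
    change adj 1 (H.τ (lab ν) x) = H.τ (lab ν) (star x)
    rw [H.τ_star, adj]; simp
  | inr i => exact (hQ i).onG x

lemma spaceFamily_starWord (hQ : Fin g → IsGoodForm H π Q) (h : Hol g m) (I : ι) :
    StarWord H (hat (adj (prodMat _ (factorGram H lab Q)))) (numHom _ (H.τ I))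
      ((scal _ _).comp ((spaceFamily H lab π hm).act h.pos))
      (H.holMat ((spaceFamily H lab π hm).hom h) I) := by
  have hσ := isStarOp_adj (prodMat_posDef (factorGram_posDef H lab fun i => (hQ i).posDef))
  cases h with
  | M ν =>
    exact starWord_hv H hσ.hat (isStarHom_numHom H hσ I)
      ((spaceFamily_isStarHom H lab hm hQ (.inl ν)).scal hσ) (legs_numHom_scal _ _)
  | A i =>
    have h1 := ((hQ i).onHol (.A 0) I).map_matrix H
      (σB := adj (prodMat _ (factorGram H lab Q))) (locHom H lab (.inr i))
      (fun a b => adj_locHom H lab (fun i => (hQ i).posDef) (.inr i) _)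
    have h2 : ((holS H 1 0 (.A 0) I).map π).map (locHom H lab (g := g) (.inr i))
        = H.holMat ((spaceFamily H lab π hm).hom (.A i)) I := by
      refine Eq.trans ?_ (H.holMat_map ((locHom H lab (.inr i)).comp (π.comp (ofL H 1 0)))
        (holHom H hm 1 0 (.A 0)) I)
      rw [← hol_eq_holMat]; rfl
    exact h2 ▸ h1
  | B i =>
    have h1 := ((hQ i).onHol (.B 0) I).map_matrix H
      (σB := adj (prodMat _ (factorGram H lab Q))) (locHom H lab (.inr i))
      (fun a b => adj_locHom H lab (fun i => (hQ i).posDef) (.inr i) _)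
    have h2 : ((holS H 1 0 (.B 0) I).map π).map (locHom H lab (g := g) (.inr i))
        = H.holMat ((spaceFamily H lab π hm).hom (.B i)) I := by
      refine Eq.trans ?_ (H.holMat_map ((locHom H lab (.inr i)).comp (π.comp (ofL H 1 0)))
        (holHom H hm 1 0 (.B 0)) I)
      rw [← hol_eq_holMat]; rfl
    exact h2 ▸ h1

lemma spaceGram_eq : spaceGram H (g := g) lab π Q = prodMat _ (factorGram H lab Q)
    * ((spaceFamily H lab π hm).gram (allFactors g m) : SpaceMat H g lab) := by
  rw [spaceGram, TensorFamily.gram, ← Units.coeHom_apply, map_list_prod, List.map_map]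
  refine congrArg₂ (· * ·) rfl (congrArg List.prod (List.map_congr_left fun k _ => ?_))
  rw [Function.comp_apply, Units.coeHom_apply, TensorFamily.gramFactor, val_tU, Ev,
    spaceFamily_jay H lab π hm _ (nodup_preceding k), precRep, ← factorHom_toLinearMap]
  rfl

lemma spaceGram_posDef (hm : H.IsModular) (hQ : Fin g → IsGoodForm H π Q) :
    (spaceGram H (g := g) lab π Q).PosDef := by
  rw [spaceGram_eq H lab hm]
  exact (spaceFamily H lab π hm).posDef_prefix
    (prodMat_posDef (factorGram_posDef H lab fun i => (hQ i).posDef))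
    (spaceFamily_isStarHom H lab hm hQ) (spaceFamily_starWord H lab hm hQ) (r := [])
    (by simp)

end

/-! ### The operators in the range of a representation -/

section

variable {g m : ℕ}

lemma map_mem_of_holMat_mem (hm : H.IsModular) (W : Subalgebra ℂ A)
    {φ : G →ₐ[ℂ] A} (h : ∀ I a b, H.holMat φ I a b ∈ W) (x : G) : φ x ∈ W := by
  have hx : x ∈ H.drinfeldRange := by rw [H.drinfeldRange_eq_top hm]; trivial
  have : H.drinfeldRange ≤ W.toSubmodule.comap φ.toLinearMap := by
    rw [SymmetryData.drinfeldRange, span_le]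
    rintro _ ⟨⟨I, a, b⟩, rfl⟩
    have h1 := W.smul_mem (h I a b) (H.κ I)
    rwa [SymmetryData.holMat_apply, smul_smul, mul_inv_cancel₀ (H.κ_ne_zero I), one_smul] at h1
  exact this hx

lemma ev_mem (W : Subalgebra ℂ A) {f h : G →ₐ[ℂ] A} (hf : ∀ x, f x ∈ W) (hh : ∀ x, h x ∈ W)
    (z : G ⊗[ℂ] G) : Ev f h z ∈ W := by
  induction z with
  | zero => rw [map_zero]; exact W.zero_mem
  | add x y hx hy => rw [map_add]; exact W.add_mem hx hy
  | tmul x y => rw [Ev_tmul]; exact W.mul_mem (hf x) (hh y)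

lemma listHom_mem {σ : Type*} {F : σ → (G →ₐ[ℂ] A)} (W : Subalgebra ℂ A) {l : List σ}
    (h : ∀ k ∈ l, ∀ x, F k x ∈ W) (x : G) : listHom F l x ∈ W := by
  induction l generalizing x with
  | nil => exact W.algebraMap_mem _
  | cons k l ih =>
    change cv (F k) (listHom F l) x ∈ W
    unfold cv
    split_ifs with hc
    · rw [conv_apply]
      exact ev_mem W (h k mem_cons_self)
        (fun x => ih (fun j hj => h j (List.mem_cons_of_mem _ hj)) x) _
    · exact W.algebraMap_mem _

lemma matrix_mul_mem (W : Subalgebra ℂ A) {n : Type*} [Fintype n] {X Y : Matrix n n A}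
    (hX : ∀ a b, X a b ∈ W) (hY : ∀ a b, Y a b ∈ W) (a b : n) : (X * Y) a b ∈ W := by
  rw [Matrix.mul_apply]
  exact sum_mem fun c _ => W.mul_mem (hX a c) (hY c b)

lemma ev_scal_num_mem (W : Subalgebra ℂ A) {n : Type*} [Fintype n] [DecidableEq n]
    {f : G →ₐ[ℂ] A} (hf : ∀ x, f x ∈ W) (ρ : G →ₐ[ℂ] Matrix n n ℂ) (z : G ⊗[ℂ] G) (a b : n) :
    Ev ((scal A n).comp f) (numHom A ρ) z a b ∈ W := by
  induction z with
  | zero => rw [map_zero]; exact W.zero_mem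
  | add x y hx hy => rw [map_add]; exact W.add_mem hx hy
  | tmul x y =>
    rw [Ev_tmul, comp_apply, scal_apply, diagonal_mul]
    exact W.mul_mem (hf x) (W.algebraMap_mem _)

namespace TensorFamily

variable {H} (D : TensorFamily H g m A)

lemma hom_mem (hm : H.IsModular) (W : Subalgebra ℂ A) (hW : ∀ h I a b, D.mat h I a b ∈ W)
    (hact : ∀ k, (∀ h : Hol g m, h.pos = k → ∀ x, D.hom h x ∈ W) → ∀ x, D.act k x ∈ W)
    (h : Hol g m) (x : G) : D.hom h x ∈ W := by
  have key : ∀ l r, allFactors g m = l ++ r →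
      ∀ h : Hol g m, h.pos ∈ l → ∀ x, D.hom h x ∈ W := by
    intro l
    induction l using List.reverseRecOn with
    | nil => simp
    | append_singleton l q ih =>
      intro r hl h hh
      rw [append_assoc, List.singleton_append] at hl
      have ih := ih _ hl
      rw [List.mem_append, List.mem_singleton] at hh
      rcases hh with hh | hh
      · exact ih h hh
      · have hp : preceding h.pos = l := hh ▸ preceding_eq_of_allFactors hl
        have hj : ∀ x, D.jay (preceding h.pos) x ∈ W := fun x =>
          listHom_mem W (fun k hk => hact k fun h' hh' => ih h' (hh' ▸ hp ▸ hk)) x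
        refine map_mem_of_holMat_mem H hm W fun I => ?_
        have hc := (legs_numHom_scal (H.τ I) (D.jay (preceding h.pos))).symm
        have h1 : H.holMat (D.hom h) I
            = H.Ri ((scal A _).comp (D.jay (preceding h.pos))) (numHom A (H.τ I)) * D.mat h I
              * H.Rv ((scal A _).comp (D.jay (preceding h.pos))) (numHom A (H.τ I)) := by
          rw [mat, RibbonHopfStar.dress]
          simp only [mul_assoc, H.Ri_mul_Rv hc, mul_one]
          rw [← mul_assoc, H.Ri_mul_Rv hc, one_mul]
        rw [h1]
        exact matrix_mul_mem W (matrix_mul_mem W (ev_scal_num_mem W hj _ _) (hW h I))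
          (ev_scal_num_mem W hj _ _)
  exact key _ [] (by simp) h (mem_allFactors _) x

lemma range_lift_mat (h : Hol g m) (I : ι) (a b) : D.mat h I a b ∈ D.lift.range := by
  rw [← D.hol_map_lift]
  exact ⟨_, rfl⟩

end TensorFamily

/-! ### Families of tensor families -/

section

variable {K : Type*} {B : K → Type*} [∀ p, Ring (B p)] [∀ p, Algebra ℂ (B p)]

lemma matrix_pi_ext {n : Type*} {X Y : Matrix n n (∀ p, B p)}
    (h : ∀ p, X.map (evalAlgHom ℂ B p) = Y.map (evalAlgHom ℂ B p)) : X = Y := by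
  ext a b p
  exact congrFun (congrFun (h p) a) b

lemma muMat_map {C : Type*} [Ring C] [Algebra ℂ C] (θ : A →ₐ[ℂ] C) (j : G →ₐ[ℂ] A) (J : ι)
    (ξ : G) : (muMat H J j ξ).map θ = muMat H J (θ.comp j) ξ := by
  have h1 : θ.mapMatrix.comp (muMat H J j) = muMat H J (θ.comp j) := by
    rw [muMat, map_conv]
    simp only [numHom_map, scal_map]
  exact DFunLike.congr_fun h1 ξ

variable {H}

/-- A family of tensor families. -/
def TensorFamily.pi (D : ∀ p, TensorFamily H g m (B p)) : TensorFamily H g m (∀ p, B p) where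
  act k := AlgHom.pi fun p => (D p).act k
  hom h := AlgHom.pi fun p => (D p).hom h
  act_act k l h x y := funext fun p => (D p).act_act k l h x y
  act_hom k h hk x y := funext fun p => (D p).act_hom k h hk x y
  hom_hom h k hk x y := funext fun p => (D p).hom_hom h k hk x y
  cross h J ξ := by
    refine matrix_pi_ext fun p => ?_
    rw [map_mul_alg, map_mul_alg, muMat_map, H.holMat_map]
    exact (D p).cross h J ξ
  handle i I J := by
    refine matrix_pi_ext fun p => ?_
    rw [exchangeLeft_map, handleRight_map, H.holMat_map, H.holMat_map]
    exact (D p).handle i I J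

variable (D : ∀ p, TensorFamily H g m (B p))

lemma TensorFamily.pi_jay (l : List (Fin m ⊕ Fin g)) (hl : l.Nodup) (p : K) :
    (evalAlgHom ℂ B p).comp ((TensorFamily.pi D).jay l) = (D p).jay l :=
  map_listHom _ (TensorFamily.pi D).act_act hl

lemma TensorFamily.pi_mat (h : Hol g m) (I : ι) (p : K) :
    ((TensorFamily.pi D).mat h I).map (evalAlgHom ℂ B p) = (D p).mat h I := by
  have h1 := H.map_dress (evalAlgHom ℂ B p).mapMatrix
    ((scal _ _).comp ((TensorFamily.pi D).jay (preceding h.pos))) (numHom _ (H.τ I))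
    (H.holMat ((TensorFamily.pi D).hom h) I)
  rw [scal_map, numHom_map, TensorFamily.pi_jay _ _ (nodup_preceding _)] at h1
  refine h1.trans (congrArg (H.dress _ _) ?_)
  exact H.holMat_map (evalAlgHom ℂ B p) ((TensorFamily.pi D).hom h) I

lemma TensorFamily.pi_lift (x : GraphAlgebra H g m) (p : K) :
    (TensorFamily.pi D).lift x p = (D p).lift x := by
  have : (evalAlgHom ℂ B p).comp (TensorFamily.pi D).lift = (D p).lift :=
    graphAlgebra_algHom_ext fun k I => by
      rw [TensorFamily.hol_map_lift, ← TensorFamily.pi_mat D, ← TensorFamily.hol_map_lift,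
        Matrix.map_map]; rfl
  exact DFunLike.congr_fun this x

lemma TensorFamily.hom_mem_of_pi {h : Hol g m} {x : G}
    (hx : (TensorFamily.pi D).hom h x ∈ (TensorFamily.pi D).lift.range) (p : K) :
    (D p).hom h x ∈ (D p).lift.range := by
  obtain ⟨y, hy⟩ := hx
  exact (mem_range _).2 ⟨y, (TensorFamily.pi_lift D y p).symm.trans (congrFun hy p)⟩

end

/-! ### Surjectivity -/

section

variable {π : SemiDirect H 1 0 →ₐ[ℂ] Op H}
variable (hm : H.IsModular)

lemma holHom_range (h : Hol g m) (W : Subalgebra ℂ A) (θ : GraphAlgebra H g m →ₐ[ℂ] A)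
    (hW : ∀ x, θ (holHom H hm g m h x) ∈ W) (I : ι) (a b) : θ (hol H g m h I a b) ∈ W := by
  rw [hol_eq_holMat H hm, H.holMat_apply, map_smul]
  exact W.smul_mem (hW _) _

lemma handle_range (W : Subalgebra ℂ A) (θ : GraphAlgebra H 1 0 →ₐ[ℂ] A)
    (hA : ∀ x, θ (holHom H hm 1 0 (.A 0) x) ∈ W)
    (hB : ∀ x, θ (holHom H hm 1 0 (.B 0) x) ∈ W) (y : GraphAlgebra H 1 0) : θ y ∈ W := by
  induction y using graphAlgebra_induction with
  | scalar c => rw [commutes]; exact W.algebraMap_mem c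
  | gen h I a b =>
    cases h with
    | M ν => exact ν.elim0
    | A i => exact Subsingleton.elim i 0 ▸ holHom_range H hm (.A 0) W θ hA I a b
    | B i => exact Subsingleton.elim i 0 ▸ holHom_range H hm (.B 0) W θ hB I a b
  | add x y hx hy => rw [map_add]; exact W.add_mem hx hy
  | mul x y hx hy => rw [map_mul θ x y]; exact W.mul_mem hx hy

variable (π) in
/-- The actions and holonomies for all labels. -/
abbrev allFamily (g m : ℕ) : TensorFamily H g m (∀ lab : Fin m → ι, SpaceMat H g lab) :=
  TensorFamily.pi fun lab => spaceFamily H lab π hm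

lemma allFamily_hom_mem (hπ : Surjective (π.comp (ofL H 1 0)))
    (h : Hol g m) (x : G) : (allFamily H π hm g m).hom h x ∈ (allFamily H π hm g m).lift.range := by
  refine (allFamily H π hm g m).hom_mem hm _ (TensorFamily.range_lift_mat _) ?_ h x
  rintro (ν | i) hk ξ
  · exact hk (.M ν) rfl ξ
  · obtain ⟨y, hy⟩ := hπ (π (ofG H 1 0 ξ))
    have := handle_range H hm (allFamily H π hm g m).lift.range (AlgHom.pi fun lab : Fin m → ι =>
        (locHom H lab (g := g) (.inr i)).comp (π.comp (ofL H 1 0)))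
      (hk (.A i) rfl) (hk (.B i) rfl) y
    convert this using 1
    funext lab
    exact congrArg (locHom H lab (.inr i)) hy.symm

lemma spaceFamily_lift_surjective (hπ : Surjective (π.comp (ofL H 1 0)))
    (lab : Fin m → ι) : Surjective (spaceFamily H (g := g) lab π hm).lift := by
  have hmem : ∀ (h : Hol g m) x, (spaceFamily H (g := g) lab π hm).hom h x
      ∈ (spaceFamily H (g := g) lab π hm).lift.range := fun h x =>
    TensorFamily.hom_mem_of_pi _ (allFamily_hom_mem H hm hπ h x) lab
  intro X
  refine (mem_range _).1 (mem_of_locHom_mem H lab (AlgHom.range _) ?_ X)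
  rintro (ν | i) Y
  · obtain ⟨x, rfl, -⟩ := H.exists_τ_eq (lab ν) Y
    exact hmem (.M ν) x
  · obtain ⟨y, hy⟩ := hπ Y
    rw [← hy]
    exact handle_range H hm (spaceFamily H (g := g) lab π hm).lift.range
      ((locHom H lab (g := g) (.inr i)).comp (π.comp (ofL H 1 0)))
      (hmem (.A i)) (hmem (.B i)) y

/-- A label is selected by the holonomies of the punctures. -/
lemma single_one_mem (hπ : Surjective (π.comp (ofL H 1 0))) (lab : Fin m → ι) :
    (Pi.single lab 1 : ∀ lab : Fin m → ι, SpaceMat H g lab) ∈ (allFamily H π hm g m).lift.range := by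
  have h1 : ∀ ν, ∃ e : G, ∀ J, H.τ J e = if J = lab ν then 1 else 0 := fun ν => by
    obtain ⟨e, he, he'⟩ := H.exists_τ_eq (lab ν) 1
    refine ⟨e, fun J => ?_⟩
    split_ifs with h
    · subst h; exact he
    · exact he' J h
  choose e he using h1
  have h2 : (Pi.single lab 1 : ∀ lab : Fin m → ι, SpaceMat H g lab)
      = ((finRange m).map fun ν => (allFamily H π hm g m).hom (.M ν) (e ν)).prod := by
    funext lab'
    have h3 : ∀ ν, (allFamily H π hm g m).hom (.M ν) (e ν) lab'
        = if lab' ν = lab ν then 1 else 0 := fun ν => by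
      change locHom H lab' (.inl ν) (H.τ (lab' ν) (e ν)) = _
      rw [he]
      split_ifs
      · exact map_one _
      · exact map_zero _
    have h4 := map_list_prod (evalAlgHom ℂ (fun lab : Fin m → ι => SpaceMat H g lab) lab')
      ((finRange m).map fun ν => (allFamily H π hm g m).hom (.M ν) (e ν))
    refine Eq.trans ?_ h4.symm
    rw [List.map_map]
    have h5 : ((finRange m).map (⇑(evalAlgHom ℂ (fun lab : Fin m → ι => SpaceMat H g lab) lab')
        ∘ fun ν => (allFamily H π hm g m).hom (.M ν) (e ν)))
        = (finRange m).map fun ν => (if lab' ν = lab ν then 1 else 0 : SpaceMat H g lab') :=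
      List.map_congr_left fun ν _ => h3 ν
    rw [h5]
    by_cases h : lab' = lab
    · subst h; simp
    · rw [single_eq_of_ne h]
      obtain ⟨ν, hν⟩ := ne_iff.1 h
      refine (List.prod_eq_zero ?_).symm
      exact List.mem_map.2 ⟨ν, List.mem_finRange ν, if_neg hν⟩
  rw [h2]
  refine Subalgebra.list_prod_mem _ fun y hy => ?_
  obtain ⟨ν, _, rfl⟩ := List.mem_map.1 hy
  exact allFamily_hom_mem H hm hπ _ _

lemma allFamily_lift_surjective (hπ : Surjective (π.comp (ofL H 1 0))) :
    Surjective (allFamily H π hm g m).lift := by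
  intro X
  change X ∈ (allFamily H π hm g m).lift.range
  have : X = ∑ lab, Pi.single lab (X lab) := (Finset.univ_sum_single X).symm
  rw [this]
  refine sum_mem fun lab _ => ?_
  obtain ⟨y, hy⟩ := spaceFamily_lift_surjective H hm hπ lab (X lab)
  have h1 : (Pi.single lab (X lab) : ∀ lab : Fin m → ι, SpaceMat H g lab)
      = Pi.single lab 1 * (allFamily H π hm g m).lift y := by
    funext lab'
    rw [Pi.mul_apply, TensorFamily.pi_lift]
    by_cases h : lab' = lab
    · subst h; rw [Pi.single_eq_same, Pi.single_eq_same, one_mul, hy]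
    · rw [single_eq_of_ne h, single_eq_of_ne h, zero_mul]
  rw [h1]
  exact Subalgebra.mul_mem _ (single_one_mem H hm hπ lab) ⟨y, rfl⟩

lemma card_spaceIndex (lab : Fin m → ι) : card (SpaceIndex H g lab)
    = (∏ ν, H.δ (lab ν)) * card (RegIndex H) ^ g := by
  rw [Fintype.card_pi, Fintype.prod_sum_type]
  congr 1
  · exact Finset.prod_congr rfl fun ν _ => card_fin _
  · refine (Finset.prod_congr rfl (g := fun _ => card (RegIndex H)) fun i _ => rfl).trans ?_
    rw [Finset.prod_const, Finset.card_univ, card_fin]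

lemma sum_card_spaceIndex :
    ∑ lab : Fin m → ι, card (SpaceIndex H g lab) * card (SpaceIndex H g lab)
      = card (RegIndex H) ^ (m + 2 * g) := by
  have h1 : card (RegIndex H) = ∑ I, H.δ I * H.δ I := by
    simp [RegIndex, Fintype.card_sigma]
  have h2 : ∑ lab : Fin m → ι, ∏ ν, (H.δ (lab ν) * H.δ (lab ν)) = (∑ I, H.δ I * H.δ I) ^ m := by
    rw [← Fin.prod_const, Finset.prod_univ_sum, Fintype.piFinset_univ]
  simp only [card_spaceIndex]
  calc ∑ lab : Fin m → ι, (∏ ν, H.δ (lab ν)) * card (RegIndex H) ^ g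
        * ((∏ ν, H.δ (lab ν)) * card (RegIndex H) ^ g)
      = ∑ lab : Fin m → ι, (∏ ν, (H.δ (lab ν) * H.δ (lab ν))) * card (RegIndex H) ^ (2 * g) := by
        refine sum_congr rfl fun lab _ => ?_
        rw [Finset.prod_mul_distrib]; ring
    _ = _ := by rw [← sum_mul, h2, ← h1, ← pow_add]

lemma allFamily_lift_injective (hπ : Surjective (π.comp (ofL H 1 0))) :
    Injective (allFamily H π hm g m).lift := by
  have hf := (spannedBy_graphAlgebra H g m).finite
  have h2 := (spannedBy_graphAlgebra H g m).finrank_le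
  have hr : LinearMap.range (allFamily H π hm g m).lift.toLinearMap = ⊤ :=
    range_eq_top.2 (allFamily_lift_surjective H hm hπ)
  have h3 := LinearMap.finrank_range_add_finrank_ker (allFamily H π hm g m).lift.toLinearMap
  rw [hr, finrank_top, Module.finrank_pi_fintype] at h3
  simp only [Module.finrank_matrix, Module.finrank_self, mul_one, sum_card_spaceIndex] at h3
  have h4 : finrank ℂ (ker (allFamily H π hm g m).lift.toLinearMap) = 0 := by
    omega
  exact ker_eq_bot.1 (finrank_eq_zero.1 h4)

lemma faithful (hπ : Surjective (π.comp (ofL H 1 0))) (x : GraphAlgebra H g m)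
    (hx : ∀ lab, (spaceFamily H lab π hm).lift x = 0) : x = 0 := by
  refine allFamily_lift_injective H hm hπ (a₂ := 0) ?_
  rw [map_zero]
  funext lab
  rw [TensorFamily.pi_lift, hx]; rfl

end

end

/-! ### The semi-direct product -/

section

variable {H}
variable {C : Type*} [Ring C] [Algebra ℂ C] {g m : ℕ}

namespace TensorFamily

variable (D : TensorFamily H g m A)

/-- The representation of the semi-direct product. -/
def semi : SemiDirect H g m →ₐ[ℂ] A :=
  semiLift D.lift (D.jay (allFactors g m)) fun h J ξ => by
    rw [D.hol_map_lift]; exact D.commute_muMat_mat h J ξ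

lemma semi_ofL (x : GraphAlgebra H g m) : D.semi (ofL H g m x) = D.lift x := semiLift_ofL _ _ _ x

lemma semi_ofG (x : G) : D.semi (ofG H g m x) = D.jay (allFactors g m) x := semiLift_ofG _ _ _ x

lemma holS_map_semi (h : Hol g m) (I : ι) : (holS H g m h I).map D.semi = D.mat h I := by
  rw [← D.hol_map_lift, holS, Matrix.map_map]
  ext a b
  exact D.semi_ofL _

variable {θ : A →ₐ[ℂ] C} {last : G →ₐ[ℂ] C}

lemma legs_last (hl : ∀ x z, Commute (last x) (θ z)) : Legs (θ.comp (D.jay (allFactors g m))) last := (legs_comp hl _).symm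

lemma mat_map_commute_last (hl : ∀ x z, Commute (last x) (θ z)) (h : Hol g m) (I : ι) (x : G) :
    Commute ((D.mat h I).map θ) (scal C _ (last x)) := by
  ext a b
  rw [scal_apply, mul_diagonal, diagonal_mul]
  exact (hl x _).eq.symm

lemma mat_map_commute_conv (h : Hol g m) (I : ι) (x : G) :
    Commute ((D.mat h I).map θ) (conv (numHom C (H.τ I))
      ((scal C _).comp (θ.comp (D.jay (allFactors g m)))) (legs_numHom_scal _ _) x) := by
  have h1 := ((D.commute_muMat_mat h I x).map θ.mapMatrix).symm
  have h2 : θ.mapMatrix (muMat H I (D.jay (allFactors g m)) x) = muMat H I (θ.comp _) x :=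
    muMat_map H θ _ I x
  rw [h2] at h1
  exact h1

/-- The representation of the semi-direct product on the tensor product with another
representation of the symmetry. -/
def semiLast (hl : ∀ x z, Commute (last x) (θ z)) : SemiDirect H g m →ₐ[ℂ] C :=
  semiLift (θ.comp D.lift) (conv (θ.comp (D.jay (allFactors g m))) last (D.legs_last hl))
    fun h J ξ => by
      have h1 : (hol H g m h J).map (θ.comp D.lift) = (D.mat h J).map θ := by
        rw [← D.hol_map_lift, Matrix.map_map]; rfl
      rw [h1, muMat]
      simp only [map_conv]
      rw [← conv_assoc (legs_numHom_scal _ _) (legs_numHom_scal _ _) ((D.legs_last hl).map _)]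
      exact (conv_commute (fun x => D.mat_map_commute_conv h J x)
        (fun x => D.mat_map_commute_last hl h J x) ξ).symm

lemma semiLast_ofL (hl : ∀ x z, Commute (last x) (θ z)) (x : GraphAlgebra H g m) : D.semiLast hl (ofL H g m x) = θ (D.lift x) :=
  semiLift_ofL _ _ _ x

lemma semiLast_ofG (hl : ∀ x z, Commute (last x) (θ z)) (x : G) : D.semiLast hl (ofG H g m x)
    = conv (θ.comp (D.jay (allFactors g m))) last (D.legs_last hl) x := semiLift_ofG _ _ _ x

lemma holS_map_semiLast (hl : ∀ x z, Commute (last x) (θ z)) (h : Hol g m) (I : ι) :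
    (holS H g m h I).map (D.semiLast hl) = (D.mat h I).map θ := by
  rw [← D.hol_map_lift, holS, Matrix.map_map, Matrix.map_map]
  ext a b
  exact D.semiLast_ofL hl _

lemma star_last (hl : ∀ x z, Commute (last x) (θ z)) {σA : A → A} {σC : C → C} (hC : IsStarOp σC)
    (hθ : ∀ x, σC (θ x) = θ (σA x)) (hlast : IsStarHom σC last)
    (hj : IsStarHom σA (D.jay (allFactors g m)))
    (hX : ∀ (h : Hol g m) I, StarWord H (hat σA) (numHom A (H.τ I))
      ((scal A _).comp (D.jay (allFactors g m))) (D.mat h I)) :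
    ∃ σ : C → C, IsStarOp σ ∧ IsStarHom σ ((D.semiLast hl).comp (ofG H g m)) ∧
      ∀ h I, StarWord H (hat σ) (numHom C (H.τ I))
        ((scal C _).comp ((D.semiLast hl).comp (ofG H g m)))
        ((holS H g m h I).map (D.semiLast hl)) := by
  have hc := D.legs_last hl
  have hG : (D.semiLast hl).comp (ofG H g m) = conv (θ.comp (D.jay (allFactors g m))) last hc :=
    AlgHom.ext (D.semiLast_ofG hl)
  have hj' : IsStarHom σC (θ.comp (D.jay (allFactors g m))) := fun x => by
    rw [comp_apply, hθ, hj]; rfl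
  have hT := hj'.ev_twist H hC hlast hc
  rw [← val_tU H hc] at hT
  refine ⟨fun x => ↑(tU H hc)⁻¹ * σC x * tU H hc, hC.twisted _ hT, ?_, fun h I => ?_⟩
  · rw [hG]
    exact isStarHom_conv H hc hC hj' hlast
  · rw [hG, D.holS_map_semiLast hl, map_conv]
    have h1 := (hX h I).map_matrix H θ (fun a b => hθ _)
    have h2 := StarWord.first H (hc.map (scal C (Fin (H.δ I)))) (legs_numHom_scal _ _)
      (legs_numHom_scal _ _) h1 (D.mat_map_commute_last hl h I) (D.mat_map_commute_conv h I)
    refine h2.congr H ?_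
    rw [tU_map H (scal C (Fin (H.δ I))) hc, hat_twisted (σ := σC)]; rfl

end TensorFamily

/-! ### Transport of star operations -/

lemma StarWord.pi {K : Type*} {B : K → Type*} [∀ p, Ring (B p)] [∀ p, Algebra ℂ (B p)]
    {σ : ∀ p, B p → B p} {j : G →ₐ[ℂ] ∀ p, B p} {I : ι}
    {X : 𝕄[H, I, ∀ p, B p]}
    (h : ∀ p, StarWord H (hat (σ p)) (numHom _ (H.τ I))
      ((scal _ _).comp ((evalAlgHom ℂ B p).comp j)) (X.map (evalAlgHom ℂ B p))) :
    StarWord H (hat fun f p => σ p (f p)) (numHom _ (H.τ I)) ((scal _ _).comp j) X := by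
  choose Y y1 y2 y3 using h
  have hY : ∀ p, (Matrix.of fun a b p => Y p a b : Matrix _ _ (∀ p, B p)).map
      (evalAlgHom ℂ B p) = Y p := fun p => rfl
  refine ⟨Matrix.of fun a b p => Y p a b, matrix_pi_ext fun p => ?_, matrix_pi_ext fun p => ?_,
    matrix_pi_ext fun p => ?_⟩
  · rw [map_mul_alg, hY, y1]; simp
  · rw [map_mul_alg, hY, y2]; simp
  · refine (y3 p).trans ?_
    set E := (evalAlgHom ℂ B p).mapMatrix (m := Fin (H.δ I)) with hE
    have e2 : ∀ x, ((scal _ (Fin (H.δ I))).comp ((evalAlgHom ℂ B p).comp j)) x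
        = E (((scal _ _).comp j) x) := fun x =>
        (DFunLike.congr_fun (scal_map (evalAlgHom ℂ B p) j) x).symm
    have e3 : Y p = E (Matrix.of fun a b p => Y p a b) := rfl
    have e4 : ∀ M : 𝕄[H, I, ∀ p, B p], M.map (evalAlgHom ℂ B p) = E M := fun M => rfl
    rw [e4, e2, e2, ← numHom_map (evalAlgHom ℂ B p), ← scal_map (evalAlgHom ℂ B p), e3]
    simp only [map_mul, H.map_Rv, H.map_Ri]
    rfl

lemma IsStarOp.pi {K : Type*} {B : K → Type*} [∀ p, Ring (B p)] [∀ p, Algebra ℂ (B p)]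
    {σ : ∀ p, B p → B p} (h : ∀ p, IsStarOp (σ p)) :
    IsStarOp fun (f : ∀ p, B p) p => σ p (f p) where
  add _ _ := funext fun p => (h p).add _ _
  smul _ _ := funext fun p => (h p).smul _ _
  mul _ _ := funext fun p => (h p).mul _ _
  invol _ := funext fun p => (h p).invol _

/-- A star operation on a faithful image of the semi-direct product. -/
lemma exists_isGraphStar_of_equiv (e : SemiDirect H g m ≃ₐ[ℂ] C) {σ : C → C} (hσ : IsStarOp σ)
    (hG : IsStarHom σ (e.toAlgHom.comp (ofG H g m)))
    (hX : ∀ h I, StarWord H (hat σ) (numHom _ (H.τ I))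
      ((scal _ _).comp (e.toAlgHom.comp (ofG H g m))) ((holS H g m h I).map e)) :
    ∃ st, IsGraphStar H g m st := by
  refine ⟨fun x => e.symm (σ (e x)), (isGraphStar_iff H _).2 ⟨⟨?_, ?_, ?_, ?_⟩, ?_, ?_⟩⟩
  · intro x y; simp [hσ.add]
  · intro c x; simp [hσ.smul]
  · intro x y; rw [map_mul e, hσ.mul, map_mul e.symm]
  · intro x; simp [hσ.invol]
  · intro ξ
    have := hG ξ
    change σ (e (ofG H g m ξ)) = e (ofG H g m (star ξ)) at this
    change e.symm (σ (e (ofG H g m ξ))) = _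
    rw [this, e.symm_apply_apply]
  · intro h I
    have h1 := (hX h I).map_matrix H (σB := fun x => e.symm (σ (e x))) e.symm.toAlgHom
      (fun a b => by
        change e.symm (σ (e (e.symm _))) = e.symm _
        rw [e.apply_symm_apply])
    have e1 : ((holS H g m h I).map e).map e.symm.toAlgHom = holS H g m h I := by
      ext a b
      exact e.symm_apply_apply _
    have e2 : e.symm.toAlgHom.comp (e.toAlgHom.comp (ofG H g m)) = ofG H g m := by
      ext x
      exact e.symm_apply_apply _
    rw [e1, e2] at h1
    exact h1

end

section

variable {g m : ℕ}
variable {π : SemiDirect H 1 0 →ₐ[ℂ] Op H}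
  {Q : Op H}

lemma adj_spaceGram (hm : H.IsModular) (lab : Fin m → ι) : adj (spaceGram H (g := g) lab π Q)
    = fun x => ((((spaceFamily H lab π hm).gram (allFactors g m))⁻¹ : (SpaceMat H g lab)ˣ)
        : SpaceMat H g lab) * adj (prodMat _ (factorGram H lab Q)) x
      * (((spaceFamily H lab π hm).gram (allFactors g m) : (SpaceMat H g lab)ˣ) :
        SpaceMat H g lab) := by
  funext x
  rw [adj, adj, spaceGram_eq H lab hm, Matrix.mul_inv_rev, Matrix.coe_units_inv]
  simp only [Matrix.mul_assoc]

lemma spaceFamily_star (hm : H.IsModular) (hQ : Fin g → IsGoodForm H π Q) (lab : Fin m → ι) :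
    IsStarOp (adj (spaceGram H (g := g) lab π Q)) ∧
    IsStarHom (adj (spaceGram H (g := g) lab π Q)) ((spaceFamily H lab π hm).jay (allFactors g m)) ∧
    ∀ (h : Hol g m) I, StarWord H (hat (adj (spaceGram H (g := g) lab π Q)))
      (numHom _ (H.τ I)) ((scal _ _).comp ((spaceFamily H lab π hm).jay (allFactors g m)))
      ((spaceFamily H lab π hm).mat h I) := by
  rw [adj_spaceGram H hm]
  exact (spaceFamily H lab π hm).star_all
    (isStarOp_adj (prodMat_posDef (factorGram_posDef H lab fun i => (hQ i).posDef)))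
    (spaceFamily_isStarHom H lab hm hQ) (spaceFamily_starWord H lab hm hQ)

/-- The representations of the semi-direct product are star representations. -/
lemma spaceFamily_semi_star (hm : H.IsModular) (hQ : Fin g → IsGoodForm H π Q) (lab : Fin m → ι)
    {st : SemiDirect H g m → SemiDirect H g m} (hst : IsGraphStar H g m st)
    (x : SemiDirect H g m) :
    spaceGram H lab π Q * (spaceFamily H lab π hm).semi (st x)
      = ((spaceFamily H lab π hm).semi x)ᴴ * spaceGram H lab π Q := by
  obtain ⟨h1, h2, h3⟩ := spaceFamily_star H hm hQ lab
  have hG : (spaceFamily H (g := g) lab π hm).semi.comp (ofG H g m)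
      = (spaceFamily H lab π hm).jay (allFactors g m) :=
    AlgHom.ext (TensorFamily.semi_ofG _)
  rw [← starHom_of_generators H hst h1 (spaceFamily H lab π hm).semi (hG ▸ h2)
    (fun h I => by rw [hG, TensorFamily.holS_map_semi]; exact h3 h I),
    mul_adj (spaceGram_posDef H lab hm hQ)]

/-- The matrices on the tensor product of the factors and one more representation. -/
abbrev ExtMat (g m : ℕ) (p : (Fin m → ι) × ι) : Type :=
  Matrix (SpaceIndex H g p.1 × Fin (H.δ p.2)) (SpaceIndex H g p.1 × Fin (H.δ p.2)) ℂ

lemma last_commute (p : (Fin m → ι) × ι) (x : G) (z : SpaceMat H g p.1) :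
    Commute (legSnd ℂ (SpaceIndex H g p.1) (H.τ p.2) x)
      (inFirstHom ℂ (SpaceIndex H g p.1) (Fin (H.δ p.2)) z) :=
  (inFirst_commute_inSecond_num _ _).symm

variable (π) in
/-- The representations of the semi-direct product on `V^{I_1} ⊗ ⋯ ⊗ ℜ ⊗ V^I`. -/
def extHom (hm : H.IsModular) (g m : ℕ) : SemiDirect H g m →ₐ[ℂ] ∀ p, ExtMat H g m p :=
  AlgHom.pi fun p => (spaceFamily H p.1 π hm).semiLast (last_commute H p)

lemma extHom_range_inFirst (hm : H.IsModular) (hπ : Surjective (π.comp (ofL H 1 0)))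
    (X : ∀ lab : Fin m → ι, SpaceMat H g lab) :
    (fun p : (Fin m → ι) × ι => inFirstHom ℂ _ (Fin (H.δ p.2)) (X p.1))
      ∈ (extHom H π hm g m).range := by
  obtain ⟨y, rfl⟩ := allFamily_lift_surjective H hm hπ X
  refine (mem_range _).2 ⟨ofL H g m y, funext fun p => ?_⟩
  refine ((spaceFamily H p.1 π hm).semiLast_ofL (last_commute H p) y).trans ?_
  rw [TensorFamily.pi_lift]

lemma extHom_range_last (hm : H.IsModular) (hπ : Surjective (π.comp (ofL H 1 0))) (ξ : G) :
    (fun p : (Fin m → ι) × ι => legSnd ℂ (SpaceIndex H g p.1) (H.τ p.2) ξ)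
      ∈ (extHom H π hm g m).range := by
  have h1 : ∀ z : G ⊗[ℂ] G, (fun p : (Fin m → ι) × ι =>
      mul' ℂ (ExtMat H g m p) (map (((inFirstHom ℂ _ (Fin (H.δ p.2))).comp
          ((spaceFamily H p.1 π hm).jay (allFactors g m))).toLinearMap ∘ₗ
            𝒮)
        (conv _ (legSnd ℂ (SpaceIndex H g p.1) (H.τ p.2))
          ((spaceFamily H p.1 π hm).legs_last (last_commute H p))).toLinearMap z))
      ∈ (extHom H π hm g m).range := by
    intro z
    induction z with
    | zero => simp only [map_zero]; exact Subalgebra.zero_mem _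
    | add x y hx hy => simp only [map_add]; exact Subalgebra.add_mem _ hx hy
    | tmul x y =>
      have h2 := Subalgebra.mul_mem _ (extHom_range_inFirst H hm hπ (g := g) (m := m)
        fun lab => (spaceFamily H lab π hm).jay (allFactors g m) (𝒮 x))
        ((mem_range (extHom H π hm g m)).2 ⟨ofG H g m y, rfl⟩)
      convert h2 using 1
      funext p
      rw [map_tmul, mul'_apply, Pi.mul_apply]
      refine congrArg₂ (· * ·) rfl ?_
      exact ((spaceFamily H p.1 π hm).semiLast_ofG (last_commute H p) y).symm
  convert h1 (Δ ξ) using 1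
  funext p
  exact (sum_antipode_mul_conv ((spaceFamily H p.1 π hm).legs_last (last_commute H p)) ξ).symm

lemma extHom_surjective (hm : H.IsModular) (hπ : Surjective (π.comp (ofL H 1 0))) :
    Surjective (extHom H π hm g m) := by
  classical
  have h1 : ∀ (p : (Fin m → ι) × ι) X Y, (Pi.single p (X ⊗ₖ Y) : ∀ p, ExtMat H g m p)
      ∈ (extHom H π hm g m).range := by
    intro p X Y
    obtain ⟨y, hy, hy'⟩ := H.exists_τ_eq p.2 Y
    have h2 := Subalgebra.mul_mem _ (extHom_range_inFirst H hm hπ (Pi.single p.1 X))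
      (extHom_range_last H hm hπ y)
    convert h2 using 1
    funext q
    rw [Pi.mul_apply]
    by_cases hq : q = p
    · subst hq
      rw [Pi.single_eq_same, Pi.single_eq_same]
      change _ = inFirst _ X * inSecond _ (num (H.τ q.2 y))
      have : (num (H.τ q.2 y) : Matrix _ _ ℂ) = Y := by rw [hy]; ext; simp [num]
      rw [this, inFirst, inSecond, ← Matrix.mul_kronecker_mul, Matrix.mul_one, Matrix.one_mul]
    · rw [single_eq_of_ne hq]
      by_cases h1 : q.1 = p.1
      · have h2 : q.2 ≠ p.2 := fun h => hq (Prod.ext h1 h)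
        have h3 : legSnd ℂ (SpaceIndex H g q.1) (H.τ q.2) y = 0 := by
          rw [legSnd, comp_apply, numHom, comp_apply, hy' _ h2, map_zero, map_zero]
        rw [h3, mul_zero]
      · rw [single_eq_of_ne h1, map_zero, zero_mul]
  intro Z
  have hZ : Z = ∑ p, Pi.single p (Z p) := (Finset.univ_sum_single Z).symm
  refine (mem_range _).1 ?_
  rw [hZ]
  refine sum_mem fun p _ => ?_
  have h2 : (Pi.single p (Z p) : ∀ p, ExtMat H g m p) = ∑ x, ∑ y, Z p x y • Pi.single p
        (Matrix.single x.1 y.1 (1 : ℂ) ⊗ₖ Matrix.single x.2 y.2 (1 : ℂ)) := by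
    simp only [← Pi.single_smul, Matrix.single_kronecker_single, mul_one]
    conv_lhs => rw [Matrix.matrix_eq_sum_single (Z p)]
    refine (map_sum (AddMonoidHom.single (fun p : (Fin m → ι) × ι => ExtMat H g m p) p) _ _).trans
      (sum_congr rfl fun x _ => ?_)
    refine (map_sum (AddMonoidHom.single (fun p : (Fin m → ι) × ι => ExtMat H g m p) p) _ _).trans
      (sum_congr rfl fun y _ => ?_)
    exact congrArg (Pi.single p) (by rw [Matrix.smul_single, smul_eq_mul, mul_one])
  rw [h2]
  exact sum_mem fun x _ => sum_mem fun y _ => Subalgebra.smul_mem _ (h1 p _ _) _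

lemma extHom_injective (hm : H.IsModular) (hπ : Surjective (π.comp (ofL H 1 0))) :
    Injective (extHom H π hm g m) := by
  have hf := (spannedBy_semiDirect H g m).finite
  have h2 := (spannedBy_semiDirect H g m).finrank_le
  have hr : LinearMap.range (extHom H π hm g m).toLinearMap = ⊤ :=
    range_eq_top.2 (extHom_surjective H hm hπ)
  have h3 := LinearMap.finrank_range_add_finrank_ker (extHom H π hm g m).toLinearMap
  rw [hr, finrank_top, Module.finrank_pi_fintype] at h3
  have h4 : ∑ p : (Fin m → ι) × ι, finrank ℂ (ExtMat H g m p)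
      = card (RegIndex H) ^ (m + 2 * g) * card (RegIndex H) := by
    have h5 : card (RegIndex H) = ∑ I, H.δ I * H.δ I := by
      simp [RegIndex, Fintype.card_sigma]
    conv_rhs => rw [← sum_card_spaceIndex]
    rw [h5, sum_prod_type, sum_mul_sum]
    refine sum_congr rfl fun lab _ => sum_congr rfl fun I _ => ?_
    rw [Module.finrank_matrix, Module.finrank_self, Fintype.card_prod, card_fin]
    ring
  rw [h4] at h3
  have h5 : finrank ℂ (ker (extHom H π hm g m).toLinearMap) = 0 := by
    omega
  exact ker_eq_bot.1 (finrank_eq_zero.1 h5)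

lemma exists_isGraphStar (hm : H.IsModular) (hπ : Surjective (π.comp (ofL H 1 0)))
    (hQ : Fin g → IsGoodForm H π Q) : ∃ st, IsGraphStar H g m st := by
  have h1 : ∀ p : (Fin m → ι) × ι, ∃ σ : ExtMat H g m p → ExtMat H g m p, IsStarOp σ ∧
      IsStarHom σ (((spaceFamily H p.1 π hm).semiLast (last_commute H p)).comp (ofG H g m)) ∧
      ∀ h I, StarWord H (hat σ) (numHom _ (H.τ I)) ((scal _ _).comp
        (((spaceFamily H p.1 π hm).semiLast (last_commute H p)).comp (ofG H g m)))
        ((holS H g m h I).map ((spaceFamily H p.1 π hm).semiLast (last_commute H p))) := by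
    intro p
    obtain ⟨s1, s2, s3⟩ := spaceFamily_star H hm hQ p.1
    have hP := spaceGram_posDef H p.1 hm hQ
    have hP' : (spaceGram H p.1 π Q ⊗ₖ (1 : Matrix (Fin (H.δ p.2)) (Fin (H.δ p.2)) ℂ)).PosDef :=
      hP.kronecker PosDef.one
    have hk : ∀ X Y, adj (spaceGram H p.1 π Q ⊗ₖ (1 : Matrix (Fin (H.δ p.2)) (Fin (H.δ p.2)) ℂ))
        (X ⊗ₖ Y) = adj (spaceGram H p.1 π Q) X ⊗ₖ Yᴴ := fun X Y => by
      refine (eq_adj hP' ?_).symm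
      rw [← Matrix.mul_kronecker_mul, mul_adj hP, Matrix.one_mul, Matrix.conjTranspose_kronecker,
        ← Matrix.mul_kronecker_mul, Matrix.mul_one]
    refine (spaceFamily H p.1 π hm).star_last (last_commute H p) (isStarOp_adj hP')
      (fun X => ?_) (fun ξ => ?_) s2 s3
    · change adj _ (X ⊗ₖ 1) = _
      rw [hk, conjTranspose_one]; rfl
    · have e : ∀ ξ, legSnd ℂ (SpaceIndex H g p.1) (H.τ p.2) ξ
          = (1 : SpaceMat H g p.1) ⊗ₖ H.τ p.2 ξ := fun ξ => by
        change inSecond _ (num (H.τ p.2 ξ)) = _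
        have : (num (H.τ p.2 ξ) : Matrix _ _ ℂ) = H.τ p.2 ξ := by ext; simp [num]
        rw [this]; rfl
      rw [e, hk, e, H.τ_star]
      congr 1
      have := s1.map_one
      exact this
  choose σ a1 a2 a3 using h1
  let e : SemiDirect H g m ≃ₐ[ℂ] ∀ p, ExtMat H g m p :=
    AlgEquiv.ofBijective (extHom H π hm g m) ⟨extHom_injective H hm hπ, extHom_surjective H hm hπ⟩
  refine exists_isGraphStar_of_equiv e (IsStarOp.pi a1) (fun ξ => funext fun p => a2 p ξ) ?_
  intro h I
  refine StarWord.pi fun p => ?_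
  exact a3 p h I

end

/-! ### The handle relation -/

section

variable (H : RibbonHopfStar G)

namespace RibbonHopfStar

lemma Qv_mul_Rv_mul_Qv {a c l : G →ₐ[ℂ] A} (hac : Legs a c) (hal : Legs a l) (hcl : Legs c l) :
    H.Qv a l * H.Rv a c * H.Qv c l = H.Rv a c * H.Qv (conv a c hac) l := by
  have hf := Legs.conv_left hal hcl (hc := hac)
  rw [H.Qv_eq hal, H.Qv_eq hcl, H.Qv_eq hf, H.Rv_conv_left hac hal hcl,
    H.Rv_conv_right hal.symm hcl.symm hac]
  have y1 := H.yang_baxter hac hal hcl.symm.symm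
  have y2 := H.yang_baxter hal hac hcl.symm
  have y3 := H.yang_baxter hal.symm hcl.symm hac
  calc _ = H.Rv l a * (H.Rv a l * H.Rv a c * H.Rv l c) * H.Rv c l := by noncomm_ring
    _ = (H.Rv l a * H.Rv l c * H.Rv a c) * H.Rv a l * H.Rv c l := by rw [y2]; noncomm_ring
    _ = _ := by rw [y3]; noncomm_ring

lemma Rv_mul_of_invariant {b k : G →ₐ[ℂ] A} {X : A} (hk : ∀ x, k x * X = ε x • X) :
    H.Rv b k * X = X := by
  have h1 : ∀ z : G ⊗[ℂ] G, Ev b k z * X = Ev b (triv A) z * X := by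
    intro z
    induction z with
    | tmul x y =>
      rw [Ev_tmul, Ev_tmul, mul_assoc, hk, triv_apply, mul_assoc, smul_def]
    | _ => simp_all [add_mul]
  have h2 := h1 H.R
  have h3 := H.Rv_triv_right b
  rw [Rv] at h3 ⊢
  rw [h2, h3, one_mul]

/-- If `λ` acts on `X` by the dual of the leg `f`, so do the elements `(R'R)(b, λ)`. -/
lemma Qv_mul_Rv_mul {b f lam : G →ₐ[ℂ] A} (hbf : Legs b f) (hbl : Legs b lam)
    (hfl : Legs f lam) {X : A} (hb : ∀ x, Commute X (b x))
    (hX : ∀ x, lam x * X = f (𝒮 x) * X) :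
    H.Qv b lam * H.Rv b f * X = H.Ri f b * X := by
  have h1 : ∀ x, conv f lam hfl x * X = ε x • X := fun x => by
    have h2 : ∀ z : G ⊗[ℂ] G, Ev f lam z * X = f (pairEval LinearMap.id 𝒮 z) * X := by
      intro z
      induction z with
      | tmul x y => rw [Ev_tmul, pairEval_tmul, mul_assoc, hX, map_mul, mul_assoc]; rfl
      | _ => simp_all [add_mul]
    rw [conv_apply, h2, pairEval_comul_antipode, commutes, ← smul_def]
  rw [H.Qv_eq hbl, mul_assoc (H.Rv lam b), ← H.Rv_conv_right hbf hbl hfl, mul_assoc,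
    H.Rv_mul_of_invariant h1, H.Rv_eq_sum, H.Ri_eq_sum, sum_mul, sum_mul]
  refine sum_congr rfl fun i _ => ?_
  rw [mul_assoc, ← (hb _).eq, ← mul_assoc, hX, mul_assoc, (hb _).eq, mul_assoc]

/-- The handle relation, tested on the vectors in the third leg. -/
lemma handle_test {a b c l lam : G →ₐ[ℂ] A} (hab : Legs a b) (hac : Legs a c) (hbc : Legs b c)
    (hal : Legs a l) (hbl : Legs b l) (hcl : Legs c l) (ham : Legs a lam) (hbm : Legs b lam)
    (hcm : Legs c lam) {E : A} (haE : ∀ x, Commute E (a x)) (hbE : ∀ x, Commute E (b x))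
    (hcE : ∀ x, Commute E (c x))
    (hc : ∀ x, lam x * (H.Qv c l * E) = c (𝒮 x) * (H.Qv c l * E))
    (hf : ∀ x, lam x * (H.Qv (conv a c hac) l * E)
      = conv a c hac (𝒮 x) * (H.Qv (conv a c hac) l * E)) :
    H.Ri a b * H.Qv a l * H.Rv a b * H.Qv b lam * (H.Qv c l * E)
      = H.Qv b lam * H.Rv b a * H.Qv a l * H.Rv a b * (H.Qv c l * E) := by
  have haX : ∀ x, Commute (H.Qv c l * E) (a x) := fun x =>
    ((H.Qv_commute (fun y => hac _ _) (fun y => hal _ _)).symm).mul_left (haE x)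
  have hbX : ∀ x, Commute (H.Qv c l * E) (b x) := fun x =>
    ((H.Qv_commute (fun y => hbc _ _) (fun y => hbl _ _)).symm).mul_left (hbE x)
  have hfl := Legs.conv_left hal hcl (hc := hac)
  have hfm := Legs.conv_left ham hcm (hc := hac)
  have hbf := Legs.conv_right hab.symm hbc (hc := hac)
  have hbF : ∀ x, Commute (H.Qv (conv a c hac) l * E) (b x) := fun x =>
    ((H.Qv_commute (fun y => hbf _ _) (fun y => hbl _ _)).symm).mul_left (hbE x)
  have haf : ∀ x, Commute E (conv a c hac x) := fun x => conv_commute haE hcE x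
  set X := H.Qv c l * E with hX
  set F := H.Qv (conv a c hac) l * E with hF
  have cX : Commute X (H.Rv a b) := H.Rv_commute haX hbX
  have fus : H.Qv a l * H.Rv a c * X = H.Rv a c * F := by
    rw [hX, hF, ← mul_assoc, ← mul_assoc, H.Qv_mul_Rv_mul_Qv hac hal hcl]
  have s1 : H.Qv b lam * H.Rv b c * X = H.Ri c b * X := H.Qv_mul_Rv_mul hbc hbm hcm hbX hc
  have s2 : H.Qv b lam * (H.Rv b c * H.Rv b a) * F = H.Ri (conv a c hac) b * F := by
    rw [← H.Rv_conv_right hab.symm hbc hac]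
    exact H.Qv_mul_Rv_mul hbf hbm hfm hbF hf
  have i1 : H.Ri (conv a c hac) b = H.Ri c b * H.Ri a b := by
    have h1 := H.Rv_mul_Ri hbf.symm
    rw [H.Rv_conv_left hac hab hbc.symm] at h1
    have := congrArg (fun z => H.Ri c b * (H.Ri a b * z)) h1
    simp only [mul_one] at this
    rw [← this, mul_assoc (H.Rv a b), ← mul_assoc (H.Ri a b), H.Ri_mul_Rv hab, one_mul,
      ← mul_assoc, H.Ri_mul_Rv hbc.symm, one_mul]
  have y1 : H.Rv a b * H.Rv a c * H.Ri c b = H.Ri c b * H.Rv a c * H.Rv a b := by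
    have h1 := H.yang_baxter hac hab hbc.symm
    have h2 := congrArg (fun z => H.Ri c b * z * H.Ri c b) h1
    simp only [mul_assoc, H.Rv_mul_Ri hbc.symm, mul_one] at h2
    rw [← mul_assoc (H.Ri c b) (H.Rv c b), H.Ri_mul_Rv hbc.symm, one_mul] at h2
    rw [mul_assoc, mul_assoc, ← h2]
  have y2 : H.Rv b a * H.Rv b c * H.Rv a c = H.Rv a c * H.Rv b c * H.Rv b a :=
    H.yang_baxter hab.symm hbc hac
  have y3 : H.Rv a c * H.Ri c b * H.Ri a b = H.Ri a b * H.Ri c b * H.Rv a c := by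
    have h2 := congrArg (fun z => H.Ri a b * z * H.Ri a b) y1
    simp only [mul_assoc, H.Rv_mul_Ri hab, mul_one] at h2
    rw [← mul_assoc (H.Ri a b) (H.Rv a b), H.Ri_mul_Rv hab, one_mul] at h2
    rw [mul_assoc, mul_assoc, ← h2]
  have cac : Commute (H.Qv b lam) (H.Rv a c) :=
    (H.Qv_commute (fun x => (H.Rv_commute (fun y => hab.symm _ _) (fun y => hbc _ _)).symm)
      (fun x => (H.Rv_commute (fun y => ham.symm _ _) (fun y => hcm.symm _ _)).symm)).symm
  have cbc : Commute (H.Qv a l) (H.Rv b c) :=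
    H.Rv_commute (fun y => (H.Qv_commute (fun x => hab.symm _ _) (fun x => hbl _ _)).symm)
      (fun y => (H.Qv_commute (fun x => hac.symm _ _) (fun x => hcl _ _)).symm)
  have ccb : Commute (H.Qv a l) (H.Ri c b) :=
    H.Ri_commute (fun y => (H.Qv_commute (fun x => hac.symm _ _) (fun x => hcl _ _)).symm)
      (fun y => (H.Qv_commute (fun x => hab.symm _ _) (fun x => hbl _ _)).symm)
  have yb := H.yang_baxter hab hac hbc
  -- both sides agree after insertion of `R(a * b, c)`
  have key : (H.Ri a b * H.Qv a l * H.Rv a b * H.Qv b lam) * H.Rv (conv a b hab) c * X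
      = (H.Qv b lam * H.Rv b a * H.Qv a l * H.Rv a b) * H.Rv (conv a b hab) c * X := by
    rw [H.Rv_conv_left hab hac hbc]
    calc _ = H.Ri a b * H.Qv a l * H.Rv a b * (H.Qv b lam * H.Rv a c) * H.Rv b c * X := by
          noncomm_ring
      _ = H.Ri a b * H.Qv a l * H.Rv a b * H.Rv a c * (H.Qv b lam * H.Rv b c * X) := by
          rw [cac.eq]; noncomm_ring
      _ = H.Ri a b * H.Qv a l * (H.Rv a b * H.Rv a c * H.Ri c b) * X := by
          rw [s1]; noncomm_ring
      _ = H.Ri a b * (H.Qv a l * H.Ri c b) * H.Rv a c * (H.Rv a b * X) := by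
          rw [y1]; noncomm_ring
      _ = H.Ri a b * H.Ri c b * (H.Qv a l * H.Rv a c * X) * H.Rv a b := by
          rw [ccb.eq, ← cX.eq]; noncomm_ring
      _ = (H.Ri a b * H.Ri c b * H.Rv a c) * F * H.Rv a b := by rw [fus]; noncomm_ring
      _ = H.Rv a c * (H.Ri (conv a c hac) b * F) * H.Rv a b := by
          rw [← y3, i1]; noncomm_ring
      _ = (H.Rv a c * H.Qv b lam) * (H.Rv b c * H.Rv b a) * F * H.Rv a b := by
          rw [← s2]; noncomm_ring
      _ = H.Qv b lam * (H.Rv a c * H.Rv b c * H.Rv b a) * F * H.Rv a b := by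
          rw [← cac.eq]; noncomm_ring
      _ = H.Qv b lam * H.Rv b a * H.Rv b c * (H.Rv a c * F) * H.Rv a b := by
          rw [← y2]; noncomm_ring
      _ = H.Qv b lam * H.Rv b a * (H.Rv b c * H.Qv a l) * H.Rv a c * (X * H.Rv a b) := by
          rw [← fus]; noncomm_ring
      _ = H.Qv b lam * H.Rv b a * H.Qv a l * (H.Rv b c * H.Rv a c * H.Rv a b) * X := by
          rw [← cbc.eq, cX.eq]; noncomm_ring
      _ = _ := by rw [← yb]; noncomm_ring
  have hQ : ∀ x, Commute X (conv a b hab x) := fun x => conv_commute haX hbX x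
  have hfc := Legs.conv_left hac hbc (hc := hab)
  have hP1 : ∀ x, Commute (H.Ri a b * H.Qv a l * H.Rv a b * H.Qv b lam) (c x) := fun x =>
    (((H.Ri_commute (fun y => hac.symm _ _) fun y => hbc.symm _ _).symm.mul_left
      (H.Qv_commute (fun y => hac.symm _ _) fun y => hcl _ _).symm).mul_left
      (H.Rv_commute (fun y => hac.symm _ _) fun y => hbc.symm _ _).symm).mul_left
      (H.Qv_commute (fun y => hbc.symm _ _) fun y => hcm _ _).symm
  have hP2 : ∀ x, Commute (H.Qv b lam * H.Rv b a * H.Qv a l * H.Rv a b) (c x) := fun x =>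
    (((H.Qv_commute (fun y => hbc.symm _ _) fun y => hcm _ _).symm.mul_left
      (H.Rv_commute (fun y => hbc.symm _ _) fun y => hac.symm _ _).symm).mul_left
      (H.Qv_commute (fun y => hac.symm _ _) fun y => hcl _ _).symm).mul_left
      (H.Rv_commute (fun y => hac.symm _ _) fun y => hbc.symm _ _).symm
  rw [← H.cancel_Rv hfc hP1 hQ, ← H.cancel_Rv hfc hP2 hQ, key]

end RibbonHopfStar

end

/-! ### The representation of the handle algebra -/

section

lemma legL_map {M N : Type*} [AddCommGroup M] [Module ℂ M] [AddCommGroup N] [Module ℂ N]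
    (f : G →ₗ[ℂ] ℂ) (ψ : G →ₗ[ℂ] G) (T : M →ₗ[ℂ] N) (z : G ⊗[ℂ] M) :
    legL f (map ψ T z) = T (legL (f ∘ₗ ψ) z) := by
  induction z with
  | tmul x y => simp
  | _ => simp_all

lemma ext_legL (H : SymmetryData G ι) {M : Type*} [AddCommGroup M] [Module ℂ M] {z w : G ⊗[ℂ] M}
    (h : ∀ f : G →ₗ[ℂ] ℂ, legL f z = legL f w) : z = w := H.ext_coef fun _ _ _ => h _

/-- The Drinfeld map. -/
def drinfeldMap : Dual ℂ G →ₗ[ℂ] G where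
  toFun f := legL f H.RR
  map_add' f f' := by
    induction H.RR with
    | zero => simp
    | add x y hx hy => simp only [map_add, hx, hy]; abel
    | tmul x y => simp [add_smul]
  map_smul' c f := by
    induction H.RR with
    | tmul x y => simp [mul_smul]
    | _ => simp_all [smul_add]

lemma drinfeldMap_bijective (hm : H.IsModular) :
    Function.Bijective (drinfeldMap H) := by
  have := H.finiteDimensional
  have h1 : Surjective (drinfeldMap H) := by
    rw [← range_eq_top, eq_top_iff, ← H.drinfeldRange_eq_top hm,
      SymmetryData.drinfeldRange, span_le]
    rintro _ ⟨p, rfl⟩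
    exact ⟨entry (A := ℂ) (H.τ p.1) p.2.1 p.2.2, rfl⟩
  exact ⟨(LinearMap.injective_iff_surjective_of_finrank_eq_finrank
    Subspace.dual_finrank_eq).2 h1, h1⟩

variable (hm : H.IsModular)

/-- The Drinfeld map as an isomorphism. -/
def drinfeldEquiv : Dual ℂ G ≃ₗ[ℂ] G :=
  LinearEquiv.ofBijective (drinfeldMap H) (drinfeldMap_bijective H hm)

lemma drinfeldEquiv_apply (f : Dual ℂ G) : drinfeldEquiv H hm f = legL f H.RR := rfl

lemma drinfeldEquiv_counit : drinfeldEquiv H hm Coalgebra.counit = 1 := by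
  have h1 : ∀ z : G ⊗[ℂ] G, legL Coalgebra.counit z = Ev (triv G) (AlgHom.id ℂ G) z := by
    intro z
    induction z with
    | tmul x y => simp [smul_def]
    | _ => simp_all
  have h2 := H.Qv_eq (Legs.triv_left (AlgHom.id ℂ G))
  rw [H.Rv_triv_left, H.Rv_triv_right, one_mul] at h2
  rw [drinfeldEquiv_apply, h1]
  exact h2

/-- The representation on `G` which corresponds to an antirepresentation by the transposed maps on
the dual space. -/
def dualAction (ψ : G →ₗ[ℂ] End ℂ G) (h1 : ψ 1 = 1) (hψ : ∀ x y, ψ (x * y) = ψ y * ψ x) :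
    G →ₐ[ℂ] End ℂ G :=
  ofLinearMap
    { toFun := fun ξ => (drinfeldEquiv H hm).toLinearMap ∘ₗ (ψ ξ).dualMap ∘ₗ
        (drinfeldEquiv H hm).symm.toLinearMap
      map_add' := fun x y => by ext z; simp [LinearMap.dualMap_apply', LinearMap.comp_add]
      map_smul' := fun c x => by ext z; simp [LinearMap.dualMap_apply', LinearMap.comp_smul] }
    (by
      ext z
      simp only [LinearMap.coe_mk, AddHom.coe_mk, h1, LinearMap.comp_apply, LinearEquiv.coe_coe]
      exact (drinfeldEquiv H hm).apply_symm_apply z)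
    (fun x y => by
      ext z
      simp only [LinearMap.coe_mk, AddHom.coe_mk, hψ, LinearMap.comp_apply, LinearEquiv.coe_coe,
        End.mul_apply, LinearEquiv.symm_apply_apply]
      rfl)

variable {ψ : G →ₗ[ℂ] End ℂ G} {h1 : ψ 1 = 1} {hψ : ∀ x y, ψ (x * y) = ψ y * ψ x}

lemma dualAction_drinfeld (ξ : G) (f : Dual ℂ G) :
    dualAction H hm ψ h1 hψ ξ (drinfeldEquiv H hm f) = drinfeldEquiv H hm (f ∘ₗ ψ ξ) := by
  change drinfeldEquiv H hm ((ψ ξ).dualMap ((drinfeldEquiv H hm).symm _)) = _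
  rw [LinearEquiv.symm_apply_apply]; rfl

lemma dualAction_RR (ξ : G) :
    map LinearMap.id (dualAction H hm ψ h1 hψ ξ) H.RR = map (ψ ξ) LinearMap.id H.RR := by
  refine ext_legL H fun f => ?_
  rw [legL_map, legL_map, comp_id, ← drinfeldEquiv_apply H hm, dualAction_drinfeld,
    drinfeldEquiv_apply, id_apply]

/-- The action of `G` on itself by which `B` acts. -/
def dualLeft : G →ₐ[ℂ] End ℂ G :=
  dualAction H hm (LinearMap.mul ℂ G ∘ₗ 𝒮) (by ext; simp)
    (fun x y => by ext; simp [antipode_mul_antidistrib, mul_assoc])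

/-- The action of `G` on itself by transposed right multiplications. -/
def dualRight : G →ₐ[ℂ] End ℂ G :=
  dualAction H hm (LinearMap.mul ℂ G).flip (by ext; simp) (fun x y => by ext; simp [mul_assoc])

lemma legs_dualLeft_dualRight : Legs (dualLeft H hm) (dualRight H hm) := fun x y => by
  ext z
  obtain ⟨f, rfl⟩ := (drinfeldEquiv H hm).surjective z
  simp only [dualLeft, dualRight, End.mul_apply, dualAction_drinfeld]
  congr 1
  ext w
  simp [mul_assoc]

lemma dualLeft_one (ξ : G) : dualLeft H hm ξ 1 = ε ξ • 1 := by
  rw [← drinfeldEquiv_counit H hm, dualLeft, dualAction_drinfeld, ← map_smul]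
  congr 1
  ext x
  simp

/-- Left multiplications. -/
def leftMul (G : Type uG) [Ring G] [HopfAlgebra ℂ G] : G →ₐ[ℂ] End ℂ G := Algebra.lmul ℂ G

/-- Right multiplications with the antipode. -/
def rightMul (G : Type uG) [Ring G] [HopfAlgebra ℂ G] : G →ₐ[ℂ] End ℂ G :=
  ofLinearMap ((LinearMap.mul ℂ G).flip ∘ₗ 𝒮) (by ext; simp)
    (fun x y => by ext; simp [antipode_mul_antidistrib, mul_assoc])

lemma leftMul_apply (x y : G) : leftMul G x y = x * y := rfl

lemma rightMul_apply (x y : G) : rightMul G x y = y * 𝒮 x := rfl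

lemma legs_leftMul_rightMul : Legs (leftMul G) (rightMul G) := fun x y => by
  ext z; simp [leftMul_apply, rightMul_apply, mul_assoc]

/-- The product of two linear maps on the two legs of the coproduct. -/
def convLin (f h : G →ₗ[ℂ] A) : G →ₗ[ℂ] A :=
  pairEval f h ∘ₗ Coalgebra.comul

lemma convLin_assoc (f h k : G →ₗ[ℂ] A) :
    convLin (convLin f h) k = convLin f (convLin h k) := by
  ext x
  let Ψ : G ⊗[ℂ] (G ⊗[ℂ] G) →ₗ[ℂ] A :=
    mul' ℂ A ∘ₗ map f (pairEval h k)
  have e1 : ∀ z : G ⊗[ℂ] G, pairEval (convLin f h) k z = Ψ (comulLeft G z) := by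
    intro z
    induction z with
    | tmul x y =>
      rw [pairEval_tmul]
      change pairEval f h (Coalgebra.comul x) * k y = Ψ (assoc ℂ G G G (Coalgebra.comul x ⊗ₜ y))
      generalize (Δ x : G ⊗[ℂ] G) = w
      induction w with
      | tmul p q => simp [Ψ, mul_assoc]
      | _ => simp_all [add_mul, add_tmul]
    | _ => simp_all
  have e2 : ∀ z : G ⊗[ℂ] G, pairEval f (convLin h k) z = Ψ (comulRight G z) := by
    intro z
    induction z with
    | tmul x y => simp [Ψ, comulRight, convLin]
    | _ => simp_all
  change pairEval (convLin f h) k _ = pairEval f (convLin h k) _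
  rw [e1, e2]
  exact congrArg Ψ (coassoc_apply x)

lemma sum_conv_mul_antipode {f h : G →ₐ[ℂ] A} (hc : Legs f h) :
    convLin (conv f h hc).toLinearMap (h.toLinearMap ∘ₗ 𝒮) = f.toLinearMap := by
  have h0 : (conv f h hc).toLinearMap = convLin f.toLinearMap h.toLinearMap := by
    ext x; exact conv_apply hc x
  rw [h0, convLin_assoc]
  have h2 : convLin h.toLinearMap (h.toLinearMap ∘ₗ 𝒮) = (triv A : G →ₐ[ℂ] A).toLinearMap := by
    ext x
    have h3 : ∀ z : G ⊗[ℂ] G, pairEval h.toLinearMap (h.toLinearMap ∘ₗ 𝒮) z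
        = h (pairEval LinearMap.id 𝒮 z) := by
      intro z
      induction z with
      | tmul x y => simp
      | _ => simp_all
    change pairEval _ _ _ = _
    rw [h3, pairEval_comul_antipode, commutes]; rfl
  rw [h2]
  ext x
  have := congrArg (fun φ : G →ₐ[ℂ] A => φ x) (conv_triv_right f)
  exact (conv_apply _ _).symm.trans this

lemma convLin_adjoint {f h : G →ₐ[ℂ] A} (hc : Legs f h)
    {Z : A} (hZ : ∀ x, Commute Z (conv f h hc x)) :
    convLin (f.toLinearMap ∘ₗ 𝒮) (mulLeft ℂ Z ∘ₗ f.toLinearMap) = convLin h.toLinearMap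
        (mulLeft ℂ Z ∘ₗ h.toLinearMap ∘ₗ 𝒮) := by
  have e1 : h.toLinearMap = convLin (f.toLinearMap ∘ₗ 𝒮) (conv f h hc).toLinearMap := by
    ext x; exact (sum_antipode_mul_conv hc x).symm
  have e2 : ∀ k l : G →ₗ[ℂ] A, convLin k (mulLeft ℂ Z ∘ₗ l)
      = convLin (mulRight ℂ Z ∘ₗ k) l := fun k l => by
    ext x
    change pairEval _ _ _ = pairEval _ _ _
    generalize (Δ x : G ⊗[ℂ] G) = z
    induction z with
    | tmul x y => simp [mul_assoc]
    | _ => simp_all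
  have e3 : ∀ k l : G →ₗ[ℂ] A, mulLeft ℂ Z ∘ₗ convLin k l
      = convLin (mulLeft ℂ Z ∘ₗ k) l := fun k l => by
    ext x
    change Z * pairEval _ _ _ = pairEval _ _ _
    generalize (Δ x : G ⊗[ℂ] G) = z
    induction z with
    | tmul x y => simp [mul_assoc]
    | _ => simp_all [mul_add]
  have e4 : mulLeft ℂ Z ∘ₗ (conv f h hc).toLinearMap
      = mulRight ℂ Z ∘ₗ (conv f h hc).toLinearMap := by
    ext x; exact (hZ x).eq
  have e5 : mulLeft ℂ Z ∘ₗ f.toLinearMap = convLin (mulLeft ℂ Z ∘ₗ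
      (conv f h hc).toLinearMap) (h.toLinearMap ∘ₗ 𝒮) := by
    rw [← e3, sum_conv_mul_antipode hc]
  rw [e5, e4, ← e2, ← convLin_assoc, ← e1]

end

section

lemma legL_mul_tmul_one_right {B : Type*} [Ring B] [Algebra ℂ B] (k : G →ₗ[ℂ] ℂ) (x : G)
    (z : G ⊗[ℂ] B) :
    legL k (z * (x ⊗ₜ 1)) = legL (k ∘ₗ mulRight ℂ x) z := by
  induction z with
  | tmul a b => simp
  | _ => simp_all [add_mul]

lemma legL_mul_Ev {B : Type*} [Ring B] [Algebra ℂ B] (k : G →ₗ[ℂ] ℂ) (φ : G →ₐ[ℂ] B)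
    (Z W : B) (z : G ⊗[ℂ] G) :
    legL k ((includeRight : B →ₐ[ℂ] G ⊗[ℂ] B) Z * (Ev includeLeft (includeRight.comp φ) z
        * (includeRight : B →ₐ[ℂ] G ⊗[ℂ] B) W))
      = Z * (φ (legL k z) * W) := by
  induction z with
  | tmul a b => simp
  | _ => simp_all [add_mul, mul_add]

lemma include_commute (B : Type*) [Ring B] [Algebra ℂ B] (x : G) (z : B) :
    Commute ((includeLeft : G →ₐ[ℂ] G ⊗[ℂ] B) x) ((includeRight : B →ₐ[ℂ] G ⊗[ℂ] B) z) := by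
  simp [Commute, SemiconjBy]

variable (hm : H.IsModular)

lemma conv_leftMul_rightMul : conv (leftMul G) (rightMul G) legs_leftMul_rightMul
    = conv (dualLeft H hm) (dualRight H hm) (legs_dualLeft_dualRight H hm) := by
  ext ξ y
  obtain ⟨f, rfl⟩ := (drinfeldEquiv H hm).surjective y
  rw [conv_apply, conv_apply]
  have e1 : ∀ z, Ev (leftMul G) (rightMul G) z (drinfeldEquiv H hm f)
      = legL f (pairEval (includeRight : G →ₐ[ℂ] G ⊗[ℂ] G).toLinearMap
        (mulLeft ℂ H.RR ∘ₗ (includeRight :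
          G →ₐ[ℂ] G ⊗[ℂ] G).toLinearMap ∘ₗ 𝒮) z) := by
    intro z
    induction z with
    | tmul x y =>
      rw [Ev_tmul, End.mul_apply, leftMul_apply, rightMul_apply, drinfeldEquiv_apply, pairEval_tmul]
      change _ = legL f ((1 ⊗ₜ x) * (H.RR * (1 ⊗ₜ 𝒮 y)))
      rw [SymmetryData.legL_mul_left, SymmetryData.legL_mul_right]
    | _ => simp_all [LinearMap.add_apply]
  have e2 : ∀ z, Ev (dualLeft H hm) (dualRight H hm) z (drinfeldEquiv H hm f)
      = legL f (pairEval ((includeLeft : G →ₐ[ℂ] G ⊗[ℂ] G).toLinearMap ∘ₗ 𝒮) (mulLeft ℂ H.RR ∘ₗ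
          (includeLeft : G →ₐ[ℂ] G ⊗[ℂ] G).toLinearMap) z) := by
    intro z
    induction z with
    | tmul x y =>
      rw [Ev_tmul, End.mul_apply, dualRight, dualAction_drinfeld, dualLeft,
        dualAction_drinfeld, pairEval_tmul, drinfeldEquiv_apply]
      change _ = legL f ((𝒮 x ⊗ₜ 1) * (H.RR * (y ⊗ₜ 1)))
      rw [SymmetryData.legL_mul_tmul_one, legL_mul_tmul_one_right]
      congr 2
      ext w
      simp [mul_assoc]
    | _ => simp_all [LinearMap.add_apply]
  rw [e1, e2]
  exact congrArg (legL f) (LinearMap.congr_fun (convLin_adjoint legs_include H.RR_commute) ξ).symm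

/-- The projection `y ↦ ε(y) 1`. -/
def vac (G : Type uG) [Ring G] [HopfAlgebra ℂ G] : End ℂ G :=
  (LinearMap.toSpanSingleton ℂ G 1) ∘ₗ Coalgebra.counit

lemma vac_apply (y : G) : vac G y = ε y • 1 := rfl

lemma vac_one : vac G 1 = 1 := by simp [vac_apply]

lemma mul_leftMul_vac (T : End ℂ G) (y : G) :
    T * (leftMul G y * vac G) = leftMul G (T y) * vac G := by
  ext z
  simp [vac_apply, leftMul_apply]

lemma dualLeft_mul_Qv {c : G →ₐ[ℂ] A} {θ : End ℂ G →ₐ[ℂ] A}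
    (hc : ∀ x z, Commute (c x) (θ z)) (ξ : G) :
    θ (dualLeft H hm ξ) * (H.Qv c (θ.comp (leftMul G)) * θ (vac G))
      = c (𝒮 ξ) * (H.Qv c (θ.comp (leftMul G)) * θ (vac G)) := by
  have e1 : ∀ z : G ⊗[ℂ] G, θ (dualLeft H hm ξ) * (Ev c (θ.comp (leftMul G)) z * θ (vac G))
      = Ev c (θ.comp (leftMul G)) (map LinearMap.id (dualLeft H hm ξ) z) * θ (vac G) := by
    intro z
    induction z with
    | tmul x y =>
      rw [map_tmul, Ev_tmul, Ev_tmul, mul_assoc, ← mul_assoc, ← (hc _ _).eq, mul_assoc, mul_assoc]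
      change c x * _ = c x * _
      congr 1
      rw [comp_apply, comp_apply, ← map_mul, ← map_mul, ← map_mul, mul_leftMul_vac]
    | _ => simp_all [mul_add, add_mul]
  have e2 : ∀ z : G ⊗[ℂ] G, Ev c (θ.comp (leftMul G)) (map
        ((LinearMap.mul ℂ G ∘ₗ 𝒮) ξ) LinearMap.id z) * θ (vac G)
      = c (𝒮 ξ) * (Ev c (θ.comp (leftMul G)) z * θ (vac G)) := by
    intro z
    induction z with
    | tmul x y => simp [mul_assoc]
    | _ => simp_all [mul_add, add_mul]
  change θ (dualLeft H hm ξ) * (Ev c (θ.comp (leftMul G)) H.RR * _)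
    = c _ * (Ev c (θ.comp (leftMul G)) H.RR * _)
  rw [e1, ← e2, dualLeft, dualAction_RR]

lemma handle_of_separating {B : Type*} [Ring B] [Algebra ℂ B] {a b : G →ₐ[ℂ] B}
    {sc : End ℂ G →ₐ[ℂ] B} (hab : Legs a b) (ha : ∀ x z, Commute (a x) (sc z))
    (hb : ∀ x z, Commute (b x) (sc z)) (hsep : ∀ Z1 Z2 : B, (∀ x : G,
      Z1 * (sc (leftMul G x) * sc (vac G)) = Z2 * (sc (leftMul G x) * sc (vac G))) → Z1 = Z2) :
    H.Ri a b * H.hv a (sc.comp (leftMul G)) * H.Rv a b * H.hv b (sc.comp (dualLeft H hm))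
      = H.hv b (sc.comp (dualLeft H hm)) * H.Rv b a * H.hv a (sc.comp (leftMul G)) * H.Rv a b := by
  let inc : B →ₐ[ℂ] G ⊗[ℂ] B := includeRight
  let c : G →ₐ[ℂ] G ⊗[ℂ] B := includeLeft
  have hc : ∀ x z, Commute (c x) (inc z) := include_commute B
  have hac : Legs (inc.comp a) c := by intro x y; exact (hc y (a x)).symm
  have hbc : Legs (inc.comp b) c := by intro x y; exact (hc y (b x)).symm
  have h1 := H.handle_test (a := inc.comp a) (b := inc.comp b) (c := c)
    (l := (inc.comp sc).comp (leftMul G)) (lam := (inc.comp sc).comp (dualLeft H hm))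
    (E := (inc.comp sc) (vac G)) (hab.map inc) hac hbc
    (fun x y => (ha x _).map inc) (fun x y => (hb x _).map inc) (fun x y => hc x _)
    (fun x y => (ha x _).map inc) (fun x y => (hb x _).map inc) (fun x y => hc x _)
    (fun x => (ha x _).symm.map inc) (fun x => (hb x _).symm.map inc) (fun x => (hc x _).symm)
    (fun x => dualLeft_mul_Qv H hm (θ := inc.comp sc) (fun x z => hc x _) x)
    (fun x => dualLeft_mul_Qv H hm (θ := inc.comp sc)
      (fun x z => (conv_commute (fun y => ((ha y _).symm.map inc)) (fun y => (hc y _).symm) x).symm)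
      x)
  have h2 : ∀ φ : G →ₐ[ℂ] End ℂ G,
      H.Qv (inc.comp a) ((inc.comp sc).comp φ) = inc (H.Qv a (sc.comp φ)) := fun φ =>
    (H.map_Qv inc a (sc.comp φ)).symm
  have h3 : ∀ φ : G →ₐ[ℂ] End ℂ G,
      H.Qv (inc.comp b) ((inc.comp sc).comp φ) = inc (H.Qv b (sc.comp φ)) := fun φ =>
    (H.map_Qv inc b (sc.comp φ)).symm
  rw [h2, h3, ← H.map_Ri, ← H.map_Rv, ← H.map_Rv, ← map_mul, ← map_mul, ← map_mul, ← map_mul,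
    ← map_mul, ← map_mul] at h1
  have h4 : H.Ri a b * H.Qv a (sc.comp (leftMul G)) * H.Rv a b * H.Qv b (sc.comp (dualLeft H hm))
      = H.Qv b (sc.comp (dualLeft H hm)) * H.Rv b a * H.Qv a (sc.comp (leftMul G)) * H.Rv a b := by
    generalize H.Ri a b * H.Qv a (sc.comp (leftMul G)) * H.Rv a b
        * H.Qv b (sc.comp (dualLeft H hm)) = Z1 at h1 ⊢
    generalize H.Qv b (sc.comp (dualLeft H hm)) * H.Rv b a * H.Qv a (sc.comp (leftMul G))
        * H.Rv a b = Z2 at h1 ⊢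
    refine hsep Z1 Z2 fun x => ?_
    obtain ⟨f, rfl⟩ := (drinfeldEquiv H hm).surjective x
    have h5 := congrArg (legL f) h1
    have h6 : ∀ Z : B, legL f (inc Z * (H.Qv c ((inc.comp sc).comp (leftMul G))
        * (inc.comp sc) (vac G))) = Z * (sc (leftMul G (legL f H.RR)) * sc (vac G)) :=
      fun Z => legL_mul_Ev f (sc.comp (leftMul G)) Z (sc (vac G)) H.RR
    rw [h6, h6] at h5
    exact h5
  have k1 : Commute (a ↑H.kap⁻¹) (H.Ri a b) := H.commute_kap_inv hab _
  have k2 : Commute (b ↑H.kap⁻¹) (H.Rv b a) := H.commute_kap_inv hab.symm _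
  have k3 : Commute (b ↑H.kap⁻¹) (H.Ri a b * H.Qv a (sc.comp (leftMul G)) * H.Rv a b) := by
    have q1 : Commute (b ↑H.kap⁻¹) (H.Rv a b) := by
      have := H.commute_kap_inv hab.symm (swapLegs G H.R)
      rwa [Ev_swap hab.symm] at this
    have q2 : Commute (b ↑H.kap⁻¹) (H.Ri a b) := by
      have := H.commute_kap_inv hab.symm (swapLegs G ↑H.R⁻¹)
      rwa [Ev_swap hab.symm] at this
    exact (q2.mul_right (H.Qv_commute (fun x => hab.symm _ _) fun x => hb _ _)).mul_right q1
  have k4 : Commute (a ↑H.kap⁻¹) (H.Qv b (sc.comp (dualLeft H hm)) * H.Rv b a) := by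
    have q1 : Commute (a ↑H.kap⁻¹) (H.Rv b a) := by
      have := H.commute_kap_inv hab (swapLegs G H.R)
      rwa [Ev_swap hab] at this
    exact (H.Qv_commute (fun x => hab _ _) fun x => ha _ _).mul_right q1
  change H.Ri a b * (a _ * H.Qv a _) * H.Rv a b * (b _ * H.Qv b _)
    = (b _ * H.Qv b _) * H.Rv b a * (a _ * H.Qv a _) * H.Rv a b
  rw [← mul_assoc (H.Ri a b), ← k1.eq, mul_assoc (a _), mul_assoc (a _),
    mul_assoc (a _), ← mul_assoc _ (b _), ← k3.eq, mul_assoc (b _), h4, mul_assoc (b _) (H.Qv b _),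
    ← mul_assoc (_ * _) (a _), mul_assoc (b _) _ (a _), ← k4.eq]
  have hk := hab ↑H.kap⁻¹ ↑H.kap⁻¹
  rw [← mul_assoc (b _) (a _), ← hk.eq]
  simp only [mul_assoc]

lemma handle_leftMul_dualLeft (I J : ι) :
    exchangeLeft H (H.holMat (leftMul G) I) (H.holMat (dualLeft H hm) J)
      = handleRight H (H.holMat (leftMul G) I) (H.holMat (dualLeft H hm) J) := by
  rw [H.handle_iff]
  refine handle_of_separating H hm (H.legs_AB I J) (lA_commute_scal H I J)
    (lB_commute_scal H I J) fun Z1 Z2 h => ?_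
  ext i j x
  have h5 := h x
  rw [← map_mul] at h5
  have h7 := congrArg (fun N : End ℂ G => N 1) (congrFun (congrFun h5 i) j)
  simpa only [scal_apply, mul_diagonal, End.mul_apply, vac_one, leftMul_apply, mul_one] using h7

end

section

variable (hm : H.IsModular)

/-- The holonomies of a handle. -/
def handleFamily : Hol 1 0 → ∀ I : ι, 𝕄[H, I, End ℂ G]
  | .M ν => ν.elim0
  | .A _ => H.holMat (leftMul G)
  | .B _ => H.holMat (dualLeft H hm)

lemma isHolFamily_handleFamily : IsHolFamily H 1 0 (handleFamily H hm) where
  unit h := by cases h with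
    | M ν => exact ν.elim0
    | A i => exact H.holMat_unit _
    | B i => exact H.holMat_unit _
  functoriality h := by cases h with
    | M ν => exact ν.elim0
    | A i => exact H.holMat_functoriality _
    | B i => exact H.holMat_functoriality _
  handle _ := handle_leftMul_dualLeft H hm
  exchange h k hk := by
    cases hk with
    | MM ν => exact ν.elim0
    | MA ν => exact ν.elim0
    | MB ν => exact ν.elim0
    | AA i j hij => exact absurd hij (by omega)
    | BB i j hij => exact absurd hij (by omega)
    | AB i j hij => exact absurd hij (by omega)
    | BA i j hij => exact absurd hij (by omega)

/-- The action of the graph algebra of a handle on `G`. -/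
def handleHom : GraphAlgebra H 1 0 →ₐ[ℂ] End ℂ G := (isHolFamily_handleFamily H hm).lift

lemma hol_map_handleHom (h : Hol 1 0) (I : ι) :
    (hol H 1 0 h I).map (handleHom H hm) = handleFamily H hm h I :=
  IsHolFamily.hol_map_lift _ _ _

lemma commute_muMat_conv {φ r : G →ₐ[ℂ] A} (hc : Legs φ r) (J : ι) (ξ : G) :
    Commute (muMat H J (conv φ r hc) ξ) (H.holMat φ J) := by
  rw [muMat]
  simp only [map_conv]
  rw [← conv_assoc (legs_numHom_scal _ _) (legs_numHom_scal _ _) (hc.map _)]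
  refine (conv_commute (fun x => (commute_muMat_holMat H φ J x).symm) (fun x => ?_) ξ).symm
  refine Commute.mul_left (legs_numHom_scal _ _ _ _) (H.Qv_commute (fun y => ?_) fun y => ?_).symm
  · exact (legs_numHom_scal _ _ _ _).symm
  · exact ((hc y x).map (scal A _)).symm

/-- The action of the semi-direct product of a handle on `G`. -/
def handleSemi : SemiDirect H 1 0 →ₐ[ℂ] End ℂ G :=
  semiLift (handleHom H hm) (conv (leftMul G) (rightMul G) legs_leftMul_rightMul)
    fun h J ξ => by
      rw [hol_map_handleHom]
      cases h with
      | M ν => exact ν.elim0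
      | A i => exact commute_muMat_conv H _ J ξ
      | B i =>
        rw [conv_leftMul_rightMul H hm]
        exact commute_muMat_conv H _ J ξ

lemma Ev_mul_vac {c : G →ₐ[ℂ] A} {θ : End ℂ G →ₐ[ℂ] A} (hc : ∀ x z, Commute (c x) (θ z)) (x y : G) :
    θ (leftMul G y * dualLeft H hm x) * (H.Qv c (θ.comp (leftMul G)) * θ (vac G))
      = Ev c (θ.comp (leftMul G)) ((𝒮 x ⊗ₜ y) * H.RR) * θ (vac G) := by
  rw [map_mul, mul_assoc, dualLeft_mul_Qv H hm hc, Ev_mul (fun x y => hc x _), Ev_tmul,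
    ← mul_assoc, ← mul_assoc, ← (hc _ _).eq]
  rfl

lemma lTensor_Ev_mul {B : Type*} [Ring B] [Algebra ℂ B] {φ : G →ₐ[ℂ] B} {W : B}
    {ev : B →ₗ[ℂ] G} (h : ∀ y, ev (φ y * W) = y) (w : G ⊗[ℂ] G) :
    lTensor G ev (Ev includeLeft (includeRight.comp φ) w
        * (includeRight : B →ₐ[ℂ] G ⊗[ℂ] B) W) = w := by
  induction w with
  | tmul x y => simp [h]
  | _ => simp_all [add_mul]

lemma isUnit_RR : IsUnit H.RR := by
  have h5 := (H.Ru (legs_include (G := G)).symm * H.Ru (legs_include (G := G))).isUnit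
  rw [val_mul, H.val_Ru, H.val_Ru, ← H.Qv_eq legs_include] at h5
  rwa [RibbonHopfStar.Qv, Ev_include] at h5

/-- `x ⊗ y ↦ l(y) λ(x)`. -/
def heisenberg : G ⊗[ℂ] G →ₗ[ℂ] End ℂ G := mul' ℂ _ ∘ₗ (TensorProduct.comm ℂ _ _).toLinearMap ∘ₗ
    map (dualLeft H hm).toLinearMap (leftMul G).toLinearMap

lemma heisenberg_injective : Injective (heisenberg H hm) := by
  have := H.finiteDimensional
  rw [← ker_eq_bot, LinearMap.ker_eq_bot']
  intro z hz
  have e1 : ∀ z : G ⊗[ℂ] G, (includeRight : _ →ₐ[ℂ] G ⊗[ℂ] End ℂ G) (heisenberg H hm z)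
        * (H.Qv includeLeft (includeRight.comp (leftMul G))
        * (includeRight : _ →ₐ[ℂ] G ⊗[ℂ] End ℂ G) (vac G))
      = Ev includeLeft (includeRight.comp (leftMul G)) (map 𝒮 LinearMap.id z * H.RR)
        * (includeRight : _ →ₐ[ℂ] G ⊗[ℂ] End ℂ G) (vac G) := by
    intro z
    induction z with
    | tmul x y => exact Ev_mul_vac H hm (include_commute _) x y
    | _ => simp_all [map_add, add_mul]
  have e3 := lTensor_Ev_mul (φ := leftMul G) (W := vac G)
    (ev := LinearMap.applyₗ (R := ℂ) (1 : G)) (fun y => by simp [vac_one, leftMul_apply])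
    (map 𝒮 LinearMap.id z * H.RR)
  rw [← e1, hz, map_zero, zero_mul, map_zero] at e3
  have e5 : map 𝒮 LinearMap.id z = 0 :=
    (isUnit_RR H).mul_left_eq_zero.1 e3.symm
  obtain ⟨T, hT⟩ := LinearMap.exists_leftInverse_of_injective (𝒮 : G →ₗ[ℂ] G) (ker_eq_bot.2
      (LinearMap.injective_iff_surjective.2 H.antipode_surjective))
  have e6 := congrArg (map T LinearMap.id) e5
  rw [← LinearMap.comp_apply, ← TensorProduct.map_comp, hT, comp_id,
    TensorProduct.map_id, map_zero] at e6
  exact e6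

lemma handleHom_surjective : Surjective (handleHom H hm) := by
  have := H.finiteDimensional
  have hmem : ∀ x y : G, leftMul G y * dualLeft H hm x ∈ (handleHom H hm).range := by
    intro x y
    refine Subalgebra.mul_mem _ (map_mem_of_holMat_mem H hm _ (fun I a b => ?_) y)
      (map_mem_of_holMat_mem H hm _ (fun I a b => ?_) x)
    · exact ⟨hol H 1 0 (.A 0) I a b, congrFun (congrFun (hol_map_handleHom H hm (.A 0) I) a) b⟩
    · exact ⟨hol H 1 0 (.B 0) I a b, congrFun (congrFun (hol_map_handleHom H hm (.B 0) I) a) b⟩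
  have h2 : Surjective (heisenberg H hm) := (LinearMap.injective_iff_surjective_of_finrank_eq_finrank
    (by rw [Module.finrank_tensorProduct, Module.finrank_linearMap])).1
    (heisenberg_injective H hm)
  intro T
  obtain ⟨z, rfl⟩ := h2 T
  induction z with
  | zero => exact ⟨0, by simp⟩
  | add x y hx hy =>
    obtain ⟨a, ha⟩ := hx
    obtain ⟨b, hb⟩ := hy
    exact ⟨a + b, by rw [map_add, map_add, ha, hb]⟩
  | tmul x y => exact hmem x y

/-- Operators on `G` as matrices. -/
def regMatrix : End ℂ G ≃ₐ[ℂ] Op H :=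
  LinearMap.toMatrixAlgEquiv H.muBasis

lemma regMatrix_mulVec (T : End ℂ G) (x : G) :
    regMatrix H T *ᵥ H.muBasis.repr x = H.muBasis.repr (T x) :=
  LinearMap.toMatrix_mulVec_repr H.muBasis H.muBasis T x

lemma holMat_triv (I : ι) : H.holMat (triv A) I = (H.κ I)⁻¹ • 1 := by
  have h0 := legs_numHom_scal (H.τ I) (triv A : G →ₐ[ℂ] A)
  rw [SymmetryData.holMat, SymmetryData.hv, H.Qv_eq h0, SymmetryData.comp_triv, H.Rv_triv_left,
    H.Rv_triv_right, mul_one, mul_one, numHom, comp_apply, H.τ_kap_inv, map_smul, map_one]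

lemma exists_isHandleRep (hm : H.IsModular) : ∃ π Ω, IsHandleRep H π Ω := by
  refine ⟨(regMatrix H).toAlgHom.comp (handleSemi H hm), H.muBasis.repr 1, ⟨?_, ?_, ?_⟩⟩
  · intro w
    obtain ⟨x, hx⟩ := handleHom_surjective H hm (leftMul G (H.muBasis.equivFun.symm w))
    refine ⟨x, ?_⟩
    change regMatrix H (handleSemi H hm (ofL H 1 0 x)) *ᵥ _ = w
    rw [handleSemi, semiLift_ofL, regMatrix_mulVec, hx, leftMul_apply, mul_one]
    exact H.muBasis.equivFun.apply_symm_apply w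
  · intro I a b
    change regMatrix H (handleSemi H hm (ofL H 1 0 (hol H 1 0 (.B 0) I a b))) *ᵥ _ = _
    have h1 : handleHom H hm (hol H 1 0 (.B 0) I a b) = H.holMat (dualLeft H hm) I a b :=
      congrFun (congrFun (hol_map_handleHom H hm (.B 0) I) a) b
    have h2 := congrFun (congrFun (holMat_triv H (A := ℂ) I) a) b
    rw [H.holMat_apply, triv_apply, Matrix.smul_apply, smul_right_inj (inv_ne_zero (H.κ_ne_zero I)),
      Algebra.algebraMap_self, RingHom.id_apply, Matrix.one_apply] at h2
    rw [handleSemi, semiLift_ofL, regMatrix_mulVec, h1, H.holMat_apply, LinearMap.smul_apply,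
      dualLeft_one, h2, map_smul, map_smul]
    ext p
    split_ifs <;> simp
  · intro ξ
    change regMatrix H (handleSemi H hm (ofG H 1 0 ξ)) *ᵥ _ = _
    rw [handleSemi, semiLift_ofG, regMatrix_mulVec, conv_apply]
    have h1 : ∀ z : G ⊗[ℂ] G, Ev (leftMul G) (rightMul G) z 1 = pairEval LinearMap.id 𝒮 z := by
      intro z
      induction z with
      | tmul x y => simp [leftMul_apply, rightMul_apply]
      | _ => simp_all [LinearMap.add_apply]
    rw [h1, pairEval_comul_antipode, algebraMap_eq_smul_one, map_smul]
    rfl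

/-- Every representation of the handle algebra on a space of this dimension is surjective. -/
lemma handle_surjective (hm : H.IsModular) (θ : GraphAlgebra H 1 0 →ₐ[ℂ] Op H) :
    Surjective θ := by
  have := H.finiteDimensional
  have hf := (spannedBy_graphAlgebra H 1 0).finite
  have h2 := (spannedBy_graphAlgebra H 1 0).finrank_le
  let e0 : GraphAlgebra H 1 0 →ₐ[ℂ] Op H :=
    (regMatrix H).toAlgHom.comp (handleHom H hm)
  have hs0 : Surjective e0 :=
    (regMatrix H).surjective.comp (handleHom_surjective H hm)
  have hM : finrank ℂ (Op H) = card (RegIndex H) ^ (0 + 2 * 1) := by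
    rw [Module.finrank_matrix, Module.finrank_self]; ring
  have h3 : finrank ℂ (GraphAlgebra H 1 0) = finrank ℂ (Op H) :=
    le_antisymm (h2.trans hM.ge) (LinearMap.finrank_le_finrank_of_surjective
      (f := e0.toLinearMap) hs0)
  have hi0 : Injective e0 :=
    (LinearMap.injective_iff_surjective_of_finrank_eq_finrank (f := e0.toLinearMap) h3).2 hs0
  let e : GraphAlgebra H 1 0 ≃ₐ[ℂ] Op H :=
    AlgEquiv.ofBijective e0 ⟨hi0, hs0⟩
  have hne : Nonempty (RegIndex H) := ⟨⟨H.zero, ⟨0, H.δ_pos _⟩, ⟨0, H.δ_pos _⟩⟩⟩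
  have hi : Injective (θ.comp e.symm.toAlgHom) :=
    (θ.comp e.symm.toAlgHom).toRingHom.injective
  have h4 := LinearMap.injective_iff_surjective.1
    (show Injective (θ.comp e.symm.toAlgHom).toLinearMap from hi)
  intro x
  obtain ⟨y, hy⟩ := h4 x
  exact ⟨e.symm y, hy⟩

end

/-! ### The antipode and the star operation -/

section

lemma convLin_triv_right (f : G →ₗ[ℂ] A) :
    convLin f (triv A : G →ₐ[ℂ] A).toLinearMap = f := by
  ext x
  have h1 : ∀ z : G ⊗[ℂ] G, pairEval f (triv A : G →ₐ[ℂ] A).toLinearMap z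
      = f (Ev (AlgHom.id ℂ G) (triv G) z) := by
    intro z
    induction z with
    | tmul x y =>
      rw [pairEval_tmul, Ev_tmul, triv_apply, ← Algebra.commutes, ← smul_def, map_smul,
        toLinearMap_apply, triv_apply, ← Algebra.commutes, ← smul_def]
      rfl
    | _ => simp_all
  have h2 := DFunLike.congr_fun (conv_triv_right (AlgHom.id ℂ G)) x
  rw [conv_apply] at h2
  exact (h1 _).trans (congrArg f h2)

lemma convLin_triv_left (f : G →ₗ[ℂ] A) :
    convLin (triv A : G →ₐ[ℂ] A).toLinearMap f = f := by
  ext x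
  have h1 : ∀ z : G ⊗[ℂ] G, pairEval (triv A : G →ₐ[ℂ] A).toLinearMap f z
      = f (Ev (triv G) (AlgHom.id ℂ G) z) := by
    intro z
    induction z with
    | tmul x y =>
      rw [pairEval_tmul, Ev_tmul, triv_apply, ← smul_def, map_smul,
        toLinearMap_apply, triv_apply, ← smul_def]
      rfl
    | _ => simp_all
  have h2 := DFunLike.congr_fun (conv_triv_left (AlgHom.id ℂ G)) x
  rw [conv_apply] at h2
  exact (h1 _).trans (congrArg f h2)

namespace RibbonHopfStar

variable (H : RibbonHopfStar G)

/-- A right invariant under `a * λ` turns `λ` into the inverse antipode of `a`. -/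
lemma mul_eq_of_invariant {a lam : G →ₐ[ℂ] A} (hal : Legs a lam) {N : A}
    (hN : ∀ x, N * conv a lam hal x = ε x • N) (T : G →ₗ[ℂ] G)
    (hT : ∀ x, 𝒮 (T x) = x) (hT' : ∀ x, T (𝒮 x) = x)
    (x : G) : N * lam x = N * a (T x) := by
  have hm : ∀ x y, T (x * y) = T y * T x := fun x y => by
    conv_lhs => rw [← hT x, ← hT y, ← antipode_mul_antidistrib, hT']
  let Ψ : G ⊗[ℂ] (G ⊗[ℂ] G) →ₗ[ℂ] A := mul' ℂ A ∘ₗ (TensorProduct.comm ℂ A A).toLinearMap ∘ₗ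
      map (a.toLinearMap ∘ₗ T) (mulLeft ℂ N ∘ₗ Ev a lam)
  have e1 : ∀ z : G ⊗[ℂ] G, Ψ (comulRight G z) = N * a (T (Ev (AlgHom.id ℂ G) (triv G) z)) := by
    intro z
    induction z with
    | tmul x y =>
      have h1 := hN y
      rw [conv_apply] at h1
      simp only [Ψ, comulRight, map_tmul, LinearMap.comp_apply, id_apply,
        LinearEquiv.coe_coe, comm_tmul, mul'_apply,
        LinearMap.mulLeft_apply, h1, Ev_tmul, triv_apply, toLinearMap_apply, AlgHom.id_apply]
      rw [← Algebra.commutes, ← smul_def, map_smul, map_smul, smul_mul_assoc, mul_smul_comm]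
    | _ => simp_all [mul_add]
  have e2 : ∀ z : G ⊗[ℂ] G, Ψ (comulLeft G z) = N * lam (Ev (triv G) (AlgHom.id ℂ G) z) := by
    intro z
    induction z with
    | tmul x y =>
      have h1 : ∀ w : G ⊗[ℂ] G, Ψ (assoc ℂ G G G (w ⊗ₜ y))
          = N * lam y * a (T (pairEval LinearMap.id 𝒮 w)) := by
        intro w
        induction w with
        | tmul p q =>
          simp only [Ψ, TensorProduct.assoc_tmul, map_tmul, LinearMap.comp_apply,
            LinearEquiv.coe_coe, comm_tmul, mul'_apply,
            LinearMap.mulLeft_apply, Ev_tmul, toLinearMap_apply, pairEval_tmul,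
            id_apply, hm, hT', map_mul]
          rw [(hal q y).eq]
          simp only [mul_assoc]
        | _ => simp_all [add_tmul, mul_add]
      change Ψ (assoc ℂ G G G (Δ x ⊗ₜ y)) = _
      have hT1 : T 1 = 1 := by rw [← antipode_one (R := ℂ) (A := G), hT']; simp
      rw [h1, pairEval_comul_antipode, Ev_tmul, triv_apply, AlgHom.id_apply, ← smul_def,
        algebraMap_eq_smul_one, map_smul, hT1, map_smul, map_smul, map_one,
        mul_smul_comm, mul_one, mul_smul_comm]
    | _ => simp_all [mul_add]
  have e3 : Ψ (comulLeft G (Δ x)) = Ψ (comulRight G (Δ x)) := congrArg Ψ (coassoc_apply x)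
  rw [e1, e2, ← conv_apply (Legs.triv_right _), ← conv_apply (Legs.triv_left _), conv_triv_right,
    conv_triv_left] at e3
  exact e3

variable [FiniteDimensional ℂ G]

/-- The inverse of the antipode. -/
def antipodeInv : G →ₗ[ℂ] G :=
  𝒮 ∘ₗ mulLeft ℂ ↑H.uU⁻¹ ∘ₗ mulRight ℂ (H.uU : G)

lemma antipode_antipodeInv (x : G) : 𝒮 (H.antipodeInv x) = x := by
  change 𝒮 (𝒮 (↑H.uU⁻¹ * (x * H.uU))) = x
  rw [H.antipode_antipode]
  simp [mul_assoc]

lemma antipode_injective (H : RibbonHopfStar G) : Injective (𝒮 : G →ₗ[ℂ] G) :=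
  LinearMap.injective_iff_surjective.2 H.antipode_surjective

lemma antipodeInv_antipode (x : G) : H.antipodeInv (𝒮 x) = x :=
  H.antipode_injective (H.antipode_antipodeInv _)

lemma antipodeInv_mul_g (x : G) : H.antipodeInv x * H.gU = H.gU * 𝒮 x := by
  rw [H.mul_g, H.antipode_antipodeInv]

lemma antipode_antipode_g (x : G) :
    𝒮 (𝒮 x) = ↑H.gU⁻¹ * x * H.gU := by
  rw [mul_assoc, H.mul_g, Units.inv_mul_cancel_left]

/-- `∑ S⁻¹(r²) S(r¹) = v⁻¹ g`. -/
lemma sum_antipodeInv_mul_antipode :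
    ∑ i, H.antipodeInv (H.rr i) * 𝒮 (H.rl i) = ↑H.v⁻¹ * H.gU := by
  have h1 := congrArg (mul' ℂ G ∘ₗ (TensorProduct.comm ℂ G G).toLinearMap ∘ₗ
    map 𝒮 H.antipodeInv) H.antipode_antipode_R
  rw [H.R_eq] at h1
  simp only [map_sum, LinearMap.comp_apply, map_tmul, LinearEquiv.coe_coe,
    comm_tmul, mul'_apply, H.antipodeInv_antipode] at h1
  rw [← h1, ← H.sum_rr_g_inv_rl, sum_mul]
  refine sum_congr rfl fun i _ => ?_
  rw [H.antipode_antipode_g]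
  simp only [mul_assoc]

/-- `∑ r² g S(r¹) = v`. -/
lemma sum_rr_g_antipode_rl :
    ∑ i, H.rr i * H.gU * 𝒮 (H.rl i) = (H.v : G) := by
  have h1 := congrArg (mul' ℂ G ∘ₗ map LinearMap.id
    𝒮) H.antipode_antipode_R
  rw [H.R_eq] at h1
  simp only [map_sum, LinearMap.comp_apply, map_tmul, mul'_apply, id_apply] at h1
  have h2 : ∑ i, H.rr i * H.antipodeInv (H.rl i) = H.u := by
    refine H.antipode_injective ?_
    rw [H.u_eq_sum, map_sum, map_sum]
    simp only [antipode_mul_antidistrib, H.antipode_antipodeInv]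
    exact h1.symm
  have h3 : H.u * H.gU = H.v := by
    rw [← H.val_uU, gU, val_mul, Units.mul_inv_cancel_left]
  rw [← h3, ← h2, sum_mul]
  refine sum_congr rfl fun i _ => ?_
  rw [mul_assoc, mul_assoc, H.antipodeInv_mul_g]

/-- `∑ x² g S(x¹) = ε(x) g`. -/
lemma pairEval_g_antipode (x : G) :
    pairEval (mulRight ℂ (H.gU : G)) 𝒮 (swapLegs G (Δ x)) = ε x • (H.gU : G) := by
  have h1 : ∀ z : G ⊗[ℂ] G, pairEval (mulRight ℂ (H.gU : G)) 𝒮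
      (swapLegs G z) = H.antipodeInv (pairEval LinearMap.id 𝒮 z) * H.gU := by
    intro z
    induction z with
    | tmul x y =>
      have h2 : y * H.antipodeInv x = H.antipodeInv (x * 𝒮 y) :=
        H.antipode_injective (by
          rw [antipode_mul_antidistrib, H.antipode_antipodeInv, H.antipode_antipodeInv])
      rw [swapLegs_tmul, pairEval_tmul, pairEval_tmul, mulRight_apply,
        id_apply, ← h2, mul_assoc, mul_assoc, H.antipodeInv_mul_g]
    | _ => simp_all [add_mul]
  have h3 : H.antipodeInv 1 = 1 := H.antipode_injective (by rw [H.antipode_antipodeInv]; simp)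
  rw [h1, pairEval_comul_antipode, algebraMap_eq_smul_one, map_smul, h3, smul_mul_assoc, one_mul]

end RibbonHopfStar

namespace SymmetryData

/-- `S(x*) = S(x)*`. -/
lemma antipode_star (H : SymmetryData G ι) (x : G) :
    𝒮 (star x) = star (𝒮 x) := by
  let S' : G →ₗ[ℂ] G :=
    { toFun := fun x => star (𝒮 (star x))
      map_add' := fun x y => by simp
      map_smul' := fun c x => by simp }
  have h1 : convLin S' LinearMap.id = (triv G : G →ₐ[ℂ] G).toLinearMap := by
    ext x
    have h2 : ∀ z : G ⊗[ℂ] G, pairEval S' LinearMap.id z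
        = star (pairEval LinearMap.id 𝒮 (swapLegs G (star z))) := by
      intro z
      induction z with
      | tmul x y => simp [S', star_tmul]
      | _ => simp_all [star_add]
    change pairEval S' LinearMap.id _ = _
    rw [h2, ← H.comul_star, pairEval_comul_antipode, toLinearMap_apply, triv_apply,
      GraphAlg.counit_star H, algebraMap_eq_smul_one, star_smul, star_one, star_star,
      ← algebraMap_eq_smul_one]
  have h2 : convLin LinearMap.id 𝒮 = (triv G : G →ₐ[ℂ] G).toLinearMap := by
    ext x; exact pairEval_comul_antipode x
  have h3 : S' = 𝒮 := by
    rw [← convLin_triv_right S', ← h2, ← convLin_assoc, h1, convLin_triv_left]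
  have h4 := LinearMap.congr_fun h3 (star x)
  change star (𝒮 (star (star x))) = _ at h4
  rw [← h4, star_star]

lemma antipode_e0 : 𝒮 H.e0 = H.e0 := by
  have := H.finiteDimensional
  have h1 : ∀ x, 𝒮 H.e0 * x = ε x • 𝒮 H.e0 := fun x => by
    obtain ⟨y, rfl⟩ := H.antipode_surjective x
    rw [← antipode_mul_antidistrib, H.mul_e0, map_smul, HopfAlgebra.counit_antipode]
  have h2 := h1 H.e0
  rw [H.mul_e0, HopfAlgebra.counit_antipode, H.counit_e0, one_smul, one_smul] at h2
  exact h2.symm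

lemma star_u [FiniteDimensional ℂ G] : star H.u = ((H.uU⁻¹ : Gˣ) : G) := by
  have h1 := congrArg (pairEval LinearMap.id 𝒮) H.star_R
  rw [H.inv_R_eq, H.R_eq] at h1
  simp only [star_sum, map_sum, star_tmul, swapLegs_tmul, pairEval_tmul, id_apply] at h1
  rw [H.u_eq_sum, star_sum]
  simp only [star_mul, ← H.antipode_star]
  rw [h1]
  have h2 := congrArg (· * ((H.uU⁻¹ : Gˣ) : G)) H.sum_rr_u_rl
  simp only [sum_mul, one_mul] at h2
  rw [← h2]
  refine sum_congr rfl fun i _ => ?_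
  rw [H.antipode_antipode, H.val_uU]
  simp only [mul_assoc]

lemma star_gU [FiniteDimensional ℂ G] : star (H.gU : G) = ↑H.gU⁻¹ := by
  have h1 : star ↑H.uU⁻¹ = H.u := by
    rw [← H.star_u, star_star]
  rw [H.gU_inv, RibbonHopfStar.gU, val_mul, val_mul, star_mul, h1, H.star_v, H.val_uU]

end SymmetryData

end

/-! ### The ground state and the two monodromies of a handle -/

section

lemma Ev_mul_of_invariant {b k : G →ₐ[ℂ] A} {X : A} (hk : ∀ x, k x * X = ε x • X) (z : G ⊗[ℂ] G) :
    Ev b k z * X = Ev b (triv A) z * X := by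
  induction z with
  | tmul x y => rw [Ev_tmul, Ev_tmul, mul_assoc, hk, triv_apply, mul_assoc, smul_def]
  | _ => simp_all [add_mul]

lemma mul_Ev_of_invariant {b k : G →ₐ[ℂ] A} {X : A} (hk : ∀ x, X * k x = ε x • X) (z : G ⊗[ℂ] G) :
    X * Ev k b z = X * Ev (triv A) b z := by
  induction z with
  | tmul x y =>
    rw [Ev_tmul, Ev_tmul, ← mul_assoc, hk, triv_apply, ← mul_assoc, ← Algebra.commutes, smul_def]
  | _ => simp_all [mul_add]

lemma Qv_triv_right (b : G →ₐ[ℂ] A) : H.Qv b (triv A) = 1 := by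
  rw [H.Qv_eq (Legs.triv_right b), H.Rv_triv_left, H.Rv_triv_right, one_mul]

lemma Qv_conv_right {a b lam : G →ₐ[ℂ] A} (hab : Legs a b) (ham : Legs a lam) (hbm : Legs b lam) :
    H.Qv b (conv a lam ham) = H.Rv a b * (H.Qv b lam * H.Rv b a) := by
  rw [H.Qv_eq (Legs.conv_right hab.symm hbm), H.Rv_conv_left ham hab hbm.symm,
    H.Rv_conv_right hab.symm hbm ham, H.Qv_eq hbm]
  simp only [mul_assoc]

section

variable {a b lam : G →ₐ[ℂ] A} (hab : Legs a b) (ham : Legs a lam) (hbm : Legs b lam) {X E : A}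
  (hXb : ∀ y, Commute X (b y))
  (h : H.Ri a b * X * H.Rv a b * H.hv b lam = H.hv b lam * H.Rv b a * X * H.Rv a b)

lemma handle_Qv (hab : Legs a b) (hXb : ∀ y, Commute X (b y))
    (h : H.Ri a b * X * H.Rv a b * H.hv b lam = H.hv b lam * H.Rv b a * X * H.Rv a b) :
    H.Ri a b * X * H.Rv a b * H.Qv b lam = H.Qv b lam * H.Rv b a * X * H.Rv a b := by
  have c : Commute ↑(kU H b)⁻¹ (H.Ri a b * X * H.Rv a b) :=
    ((kU_commute_Ev' H hab _).units_inv_left.mul_right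
      (hXb _).symm).mul_right (kU_commute_Ev' H hab _).units_inv_left
  have h1 : H.hv b lam = ↑(kU H b)⁻¹ * H.Qv b lam := rfl
  rw [h1, ← mul_assoc, ← c.eq] at h
  refine (Units.mul_right_inj (kU H b)⁻¹).1 ?_
  simpa only [mul_assoc] using h

lemma Qv_conv_mul_of_handle (hab : Legs a b) (ham : Legs a lam) (hbm : Legs b lam)
    (hXb : ∀ y, Commute X (b y))
    (h : H.Ri a b * X * H.Rv a b * H.hv b lam = H.hv b lam * H.Rv b a * X * H.Rv a b)
    (haE : ∀ y, Commute E (a y)) (hbE : ∀ y, Commute E (b y))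
    (hE : ∀ x, lam x * E = ε x • E) :
    H.Qv b (conv a lam ham) * (X * E) = X * E := by
  have h1 := congrArg (· * E) (handle_Qv H hab hXb h)
  have h2 : H.Qv b lam * E = E := by
    rw [RibbonHopfStar.Qv, Ev_mul_of_invariant hE]; exact (congrArg (· * E) (Qv_triv_right H b)).trans (one_mul E)
  have c := (H.Rv_commute haE hbE).eq
  simp only [mul_assoc] at h1
  rw [h2, ← c] at h1
  simp only [← mul_assoc] at h1
  have h3 := (Units.mul_left_inj (H.Ru hab)).1 h1
  rw [Qv_conv_right H hab ham hbm]
  have h4 := congrArg (H.Rv a b * ·) h3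
  simp only [← mul_assoc, H.Rv_mul_Ri hab, one_mul] at h4 ⊢
  exact h4.symm

lemma mul_Qv_conv_of_handle (hab : Legs a b) (ham : Legs a lam) (hbm : Legs b lam)
    (hXb : ∀ y, Commute X (b y))
    (h : H.Ri a b * X * H.Rv a b * H.hv b lam = H.hv b lam * H.Rv b a * X * H.Rv a b)
    (haE : ∀ y, Commute E (a y)) (hbE : ∀ y, Commute E (b y))
    (hE : ∀ x, E * lam x = ε x • E) {Y : A} (hXY : X * Y = 1)
    (hYX : Y * X = 1) : E * Y * H.Qv b (conv a lam ham) = E * Y := by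
  have h1 := handle_Qv H hab hXb h
  have h2 : E * H.Qv b lam = E := by
    have := mul_Ev_of_invariant (b := b) hE (swapLegs G (swapLegs G H.R * (H.R : G ⊗[ℂ] G)))
    rw [Ev_swap hbm.symm, Ev_swap (Legs.triv_left b)] at this
    exact this.trans ((congrArg (E * ·) (Qv_triv_right H b)).trans (mul_one E))
  have c := (H.Rv_commute haE hbE).eq
  rw [Qv_conv_right H hab ham hbm]
  have h3 : Y * H.Rv a b * (H.Qv b lam * H.Rv b a) * X * H.Rv a b = H.Rv a b * H.Qv b lam := by
    have := congrArg (Y * H.Rv a b * ·) h1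
    simp only [mul_assoc] at this ⊢
    rw [← this, ← mul_assoc (H.Rv a b) (H.Ri a b), H.Rv_mul_Ri hab, one_mul, ← mul_assoc Y, hYX,
      one_mul]
  have h4 : E * (Y * H.Rv a b * (H.Qv b lam * H.Rv b a) * X) * H.Rv a b = E * H.Rv a b := by
    rw [mul_assoc, h3, ← mul_assoc, c, mul_assoc, h2]
  have h5 := congrArg (· * Y) ((Units.mul_left_inj (H.Ru hab)).1 h4)
  simpa [mul_assoc, hXY] using h5

end

variable (hm : H.IsModular)

lemma counit_drinfeldEquiv (k : Dual ℂ G) :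
    ε (drinfeldEquiv H hm k) = k 1 := by
  have h1 : ∀ z : G ⊗[ℂ] G, ε (legL k z) = k (Ev (AlgHom.id ℂ G) (triv G) z) := by
    intro z
    induction z with
    | tmul x y => simp [← Algebra.commutes, ← smul_def, mul_comm]
    | _ => simp_all
  rw [drinfeldEquiv_apply, h1]
  exact congrArg k (Qv_triv_right H (AlgHom.id ℂ G))

/-- Relations of the elements `(R'R)(b, f)` with an independent leg `b` are relations of `f`. -/
lemma invariant_of_Qv (hm : H.IsModular) {f : G →ₐ[ℂ] A} {Z W V : A}
    (h : (includeRight : A →ₐ[ℂ] G ⊗[ℂ] A) Z * (H.Qv includeLeft (includeRight.comp f)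
        * (includeRight : A →ₐ[ℂ] G ⊗[ℂ] A) W)
      = (includeRight : A →ₐ[ℂ] G ⊗[ℂ] A) V) (x : G) :
    Z * (f x * W) = ε x • V := by
  obtain ⟨k, rfl⟩ := (drinfeldEquiv H hm).surjective x
  have h1 := congrArg (legL k) h
  rw [RibbonHopfStar.Qv, legL_mul_Ev] at h1
  rw [counit_drinfeldEquiv, drinfeldEquiv_apply]
  refine Eq.trans h1 ?_
  simp

variable {C : Type*} [Ring C] [Algebra ℂ C] {φ ψ : G →ₐ[ℂ] C} {E : C}
  {a : G →ₐ[ℂ] A} {θ : C →ₐ[ℂ] A} (ha : ∀ x z, Commute (a x) (θ z))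

lemma conv_mul_of_handle (hm : H.IsModular) (h : ∀ I J, exchangeLeft H (H.holMat φ I) (H.holMat ψ J)
      = handleRight H (H.holMat φ I) (H.holMat ψ J))
    (hE : ∀ x, ψ x * E = ε x • E) (x : G) :
    conv a (θ.comp ψ) (legs_comp ha ψ) x * (H.hv a (θ.comp φ) * θ E)
      = ε x • (H.hv a (θ.comp φ) * θ E) := by
  let inc : A →ₐ[ℂ] G ⊗[ℂ] A := includeRight
  let c : G →ₐ[ℂ] G ⊗[ℂ] A := includeLeft
  have hc : ∀ x z, Commute (c x) (inc z) := include_commute A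
  have hac : Legs (inc.comp a) c := fun x y => (hc y (a x)).symm
  have h1 := handle_universal h (a := inc.comp a) (b := c) (θ := inc.comp θ) hac
    (fun x z => (ha x z).map inc) (fun x z => hc x _)
  have h2 := Qv_conv_mul_of_handle H (E := inc (θ E)) hac ((legs_comp ha ψ).map inc)
    (fun x y => hc x _)
    (fun y => by
      have := (hc y (H.hv a (θ.comp φ))).symm
      rw [H.map_hv] at this
      exact this) h1 (fun y => ((ha y E).map inc).symm) (fun y => (hc y _).symm)
    (fun x => by
      change inc (θ (ψ x)) * inc (θ E) = _
      rw [← map_mul, ← map_mul, hE, map_smul, map_smul])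
  refine (one_mul _).symm.trans (invariant_of_Qv H hm ?_ x)
  rw [map_one, one_mul, map_mul, H.map_hv, map_conv]
  exact h2

lemma mul_conv_of_handle (hm : H.IsModular) (h : ∀ I J, exchangeLeft H (H.holMat φ I) (H.holMat ψ J)
      = handleRight H (H.holMat φ I) (H.holMat ψ J))
    (hE : ∀ x, E * ψ x = ε x • E) {Y : A}
    (hXY : H.hv a (θ.comp φ) * Y = 1) (hYX : Y * H.hv a (θ.comp φ) = 1) (x : G) :
    θ E * Y * conv a (θ.comp ψ) (legs_comp ha ψ) x = ε x • (θ E * Y) := by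
  let inc : A →ₐ[ℂ] G ⊗[ℂ] A := includeRight
  let c : G →ₐ[ℂ] G ⊗[ℂ] A := includeLeft
  have hc : ∀ x z, Commute (c x) (inc z) := include_commute A
  have hac : Legs (inc.comp a) c := fun x y => (hc y (a x)).symm
  have h1 := handle_universal h (a := inc.comp a) (b := c) (θ := inc.comp θ) hac
    (fun x z => (ha x z).map inc) (fun x z => hc x _)
  have h2 := mul_Qv_conv_of_handle H (E := inc (θ E)) (Y := inc Y) hac
    ((legs_comp ha ψ).map inc) (fun x y => hc x _)
    (fun y => by
      have := (hc y (H.hv a (θ.comp φ))).symm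
      rw [H.map_hv] at this
      exact this) h1 (fun y => ((ha y E).map inc).symm) (fun y => (hc y _).symm)
    (fun x => by
      change inc (θ E) * inc (θ (ψ x)) = _
      rw [← map_mul, ← map_mul, hE, map_smul, map_smul])
    (by rw [← map_one inc, ← hXY, map_mul, H.map_hv]; rfl)
    (by rw [← map_one inc, ← hYX, map_mul, H.map_hv]; rfl)
  refine (congrArg (θ E * Y * ·) (mul_one _).symm).trans (invariant_of_Qv H hm ?_ x)
  rw [map_one, mul_one, map_mul, map_conv]
  exact h2

end

/-! ### The regular representations and the twisted trace form -/

section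

/-- The coordinates `τ^I(x)_{ba}` of an element. -/
def zeta : G →ₗ[ℂ] (RegIndex H → ℂ) where
  toFun x p := H.τ p.1 x p.2.2 p.2.1
  map_add' x y := by ext; simp
  map_smul' c x := by ext; simp

lemma zeta_apply (x : G) (p : RegIndex H) : zeta H x p = H.τ p.1 x p.2.2 p.2.1 := rfl

lemma zeta_mu (I : ι) (a b : Fin (H.δ I)) : zeta H (H.mu I b a) = Pi.single ⟨I, (a, b)⟩ 1 := by
  ext ⟨J, c, d⟩
  rw [zeta_apply]
  by_cases h : J = I
  · subst h
    rw [H.τ_mu_self, single_apply]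
    by_cases h1 : b = d <;> by_cases h2 : a = c <;> simp [h1, h2, Ne.symm]
  · rw [H.τ_mu_of_ne h, single_eq_of_ne (fun e => h (congrArg Sigma.fst e))]
    rfl

lemma zeta_injective : Injective (zeta H) := fun x y h =>
  H.ext_τ fun I => by ext b a; exact congrFun h ⟨I, (a, b)⟩

/-- The coordinates as a linear equivalence. -/
def zetaEquiv : G ≃ₗ[ℂ] (RegIndex H → ℂ) :=
  have := H.finiteDimensional
  LinearEquiv.ofInjectiveOfFinrankEq (zeta H) (zeta_injective H) (by
    rw [Module.finrank_pi, H.finrank_eq_card])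

lemma zetaEquiv_apply (x : G) : zetaEquiv H x = zeta H x := rfl

lemma zeta_surjective (w : RegIndex H → ℂ) : ∃ x, zeta H x = w :=
  (zetaEquiv H).surjective w

/-- Operators on `G` as matrices, in the coordinates `τ^I(x)_{ba}`. -/
def zetaMatrix : End ℂ G ≃ₐ[ℂ] Op H :=
  (zetaEquiv H).conjAlgEquiv ℂ |>.trans LinearMap.toMatrixAlgEquiv'

lemma zetaMatrix_mulVec (T : End ℂ G) (x : G) :
    zetaMatrix H T *ᵥ zeta H x = zeta H (T x) := by
  change toMatrix' ((zetaEquiv H).conj T) *ᵥ zetaEquiv H x = _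
  rw [LinearMap.toMatrix'_mulVec]
  rw [LinearEquiv.conj_apply_apply, LinearEquiv.symm_apply_apply, zetaEquiv_apply]

lemma ext_zeta {X Y : Op H} (h : ∀ x, X *ᵥ zeta H x = Y *ᵥ zeta H x) : X = Y :=
  ext_iff_mulVec.2 fun w => by
    obtain ⟨x, rfl⟩ := zeta_surjective H w
    exact h x

lemma dot_zeta (x y : G) : star (zeta H x) ⬝ᵥ zeta H y = ∑ I, (H.τ I (star x * y)).trace := by
  rw [dotProduct, Fintype.sum_sigma]
  refine sum_congr rfl fun I _ => ?_
  rw [sum_prod_type, map_mul, H.τ_star, Matrix.trace]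
  refine sum_congr rfl fun a _ => ?_
  rw [Matrix.diag_apply, Matrix.mul_apply]
  rfl

lemma eq_conjTranspose {X Y : Op H}
    (h : ∀ x y, star (zeta H x) ⬝ᵥ (X *ᵥ zeta H y) = star (Y *ᵥ zeta H x) ⬝ᵥ zeta H y) :
    X = Yᴴ := by
  refine ext_zeta H fun y => ?_
  have h1 : ∀ v : RegIndex H → ℂ, star v ⬝ᵥ (X *ᵥ zeta H y - Yᴴ *ᵥ zeta H y) = 0 := fun v => by
    obtain ⟨x, rfl⟩ := zeta_surjective H v
    rw [dotProduct_sub, h, Matrix.star_mulVec, Matrix.dotProduct_mulVec, sub_self]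
  exact sub_eq_zero.1 (dotProduct_star_self_eq_zero.1 (by
    have := congrArg star (h1 (X *ᵥ zeta H y - Yᴴ *ᵥ zeta H y))
    rwa [Matrix.star_dotProduct, star_star, star_zero] at this))

/-- Right multiplications with the antipode, as matrices. -/
def regRight : G →ₐ[ℂ] Op H :=
  (zetaMatrix H).toAlgHom.comp (rightMul G)

/-- Left multiplications, as matrices. -/
def regLeft : G →ₐ[ℂ] Op H :=
  (zetaMatrix H).toAlgHom.comp (leftMul G)

lemma regRight_mulVec (x y : G) :
    regRight H x *ᵥ zeta H y = zeta H (y * 𝒮 x) := zetaMatrix_mulVec H _ _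

lemma regLeft_mulVec (x y : G) : regLeft H x *ᵥ zeta H y = zeta H (x * y) :=
  zetaMatrix_mulVec H _ _

lemma legs_reg : Legs (regRight H) (regLeft H) := fun x y =>
  (legs_leftMul_rightMul.symm x y).map (zetaMatrix H).toAlgHom

lemma conjTranspose_regLeft (x : G) : (regLeft H x)ᴴ = regLeft H (star x) :=
  (eq_conjTranspose H fun y z => by
    rw [regLeft_mulVec, regLeft_mulVec, dot_zeta, dot_zeta, star_mul, mul_assoc]).symm

lemma conjTranspose_regRight (x : G) : (regRight H x)ᴴ = regRight H (star x) :=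
  (eq_conjTranspose H fun y z => by
    rw [regRight_mulVec, regRight_mulVec, dot_zeta, dot_zeta, star_mul, H.antipode_star]
    refine sum_congr rfl fun I _ => ?_
    rw [← mul_assoc, map_mul, Matrix.trace_mul_comm, ← map_mul, mul_assoc]).symm

lemma Ev_reg_mulVec (z : G ⊗[ℂ] G) (y : G) : Ev (regRight H) (regLeft H) z *ᵥ zeta H y
    = zeta H (pairEval (mulRight ℂ y) 𝒮 (swapLegs G z)) := by
  induction z with
  | tmul a b =>
    rw [Ev_tmul, ← mulVec_mulVec, regLeft_mulVec, regRight_mulVec]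
    simp
  | _ => simp_all [add_mulVec]

lemma conjTranspose_Ev_reg (z : G ⊗[ℂ] G) :
    (Ev (regRight H) (regLeft H) z)ᴴ = Ev (regRight H) (regLeft H) (star z) := by
  induction z with
  | tmul a b =>
    rw [star_tmul, Ev_tmul, Ev_tmul, conjTranspose_mul,
      conjTranspose_regLeft, conjTranspose_regRight]
    exact (legs_reg H _ _).symm
  | _ => simp_all [Matrix.conjTranspose_add, star_add]

/-- The form `twist` in the regular representation. -/
def regTwist : Op H := Ev (regRight H) (regLeft H) (twist H)

lemma exists_regTwist_eq : ∃ z : G ⊗[ℂ] G, IsUnit (Ev (regRight H) (regLeft H) z) ∧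
    regTwist H = (Ev (regRight H) (regLeft H) z)ᴴ * Ev (regRight H) (regLeft H) z := by
  obtain ⟨x, ⟨w, rfl⟩, hT⟩ := H.exists_twist_eq
  refine ⟨w, (Matrix.isUnit_iff_isUnit_det _).2 (Matrix.isUnit_det_of_right_inverse
    (B := Ev (regRight H) (regLeft H) ↑w⁻¹) ?_), ?_⟩
  · rw [← Ev_mul (legs_reg H), Units.mul_inv, Ev_one]
  · rw [regTwist, hT, Ev_mul (legs_reg H), conjTranspose_Ev_reg]

/-- A positive form which commutes with the regular representations stays positive. -/
lemma posDef_mul_regTwist {D : Op H} (hD : D.PosDef)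
    (hr : ∀ x, Commute D (regRight H x)) (hl : ∀ x, Commute D (regLeft H x)) :
    (D * regTwist H).PosDef := by
  obtain ⟨z, hz, hT⟩ := exists_regTwist_eq H
  rw [hT, ← Matrix.mul_assoc, conjTranspose_Ev_reg, (Ev_commute hr hl _).eq, ← conjTranspose_Ev_reg]
  exact hD.conjTranspose_mul_mul_same (Matrix.mulVec_injective_of_isUnit hz)

/-- The antipode of `κ` acts by scalars. -/
lemma exists_τ_antipode_kap (I : ι) :
    ∃ c : ℂ, c ≠ 0 ∧ H.τ I (𝒮 (H.kap : G)) = c • 1 ∧ H.τ I (𝒮 ↑H.kap⁻¹) = c⁻¹ • 1 := by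
  have := H.finiteDimensional
  have hc : ∀ x, H.τ I x * H.τ I (𝒮 (H.kap : G)) = H.τ I (𝒮 (H.kap : G)) * H.τ I x := fun x => by
    obtain ⟨y, rfl⟩ := H.antipode_surjective x
    rw [← map_mul (H.τ I), ← map_mul (H.τ I), ← antipode_mul_antidistrib,
      H.kap_central, antipode_mul_antidistrib]
  obtain ⟨c, h⟩ := H.schur_self hc
  have h1 : H.τ I (𝒮 (H.kap : G)) * H.τ I (𝒮 ↑H.kap⁻¹) = 1 := by
    rw [← map_mul, ← antipode_mul_antidistrib, inv_mul, antipode_one, map_one]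
  rw [h, smul_mul_assoc, Matrix.one_mul] at h1
  have hc : c ≠ 0 := by
    rintro rfl
    have := H.δ_pos I
    rw [zero_smul] at h1
    exact zero_ne_one (congrFun (congrFun h1 ⟨0, this⟩) ⟨0, this⟩ |>.trans (by simp))
  exact ⟨c, hc, h, by rw [← h1, smul_smul, inv_mul_cancel₀ hc, one_smul]⟩

/-- The scalar by which the antipode of `κ` acts. -/
def kapS (I : ι) : ℂ := (exists_τ_antipode_kap H I).choose

lemma τ_antipode_kap (I : ι) : H.τ I (𝒮 (H.kap : G)) = kapS H I • 1 :=
  (exists_τ_antipode_kap H I).choose_spec.2.1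

lemma τ_antipode_kap_inv (I : ι) :
    H.τ I (𝒮 ↑H.kap⁻¹) = (kapS H I)⁻¹ • 1 :=
  (exists_τ_antipode_kap H I).choose_spec.2.2

lemma regTwist_mulVec_g [FiniteDimensional ℂ G] {w : G} (hw : ∀ x, w * x = x * w) :
    regTwist H *ᵥ zeta H (H.gU * w) = zeta H (H.v * w * ↑H.kap⁻¹ * 𝒮 ↑H.kap⁻¹) := by
  set k : G := ↑H.kap⁻¹ with hk
  have hSk : ∀ x, 𝒮 k * x = x * 𝒮 k := fun x => by
    obtain ⟨y, rfl⟩ := H.antipode_surjective x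
    rw [← antipode_mul_antidistrib, ← antipode_mul_antidistrib, hk, H.kap_inv_central]
  have hp : ∀ (y : G), (∀ x, y * x = x * y) → ∀ z : G ⊗[ℂ] G,
      pairEval (mulRight ℂ ((H.gU : G) * y)) 𝒮 z = pairEval (mulRight ℂ (H.gU : G)) 𝒮 z * y := by
    intro y hy z
    induction z with
    | tmul a b => simp only [pairEval_tmul, mulRight_apply, mul_assoc, hy]
    | _ => simp_all [add_mul]
  have hy : ∀ x, w * k * 𝒮 k * x = x * (w * k * 𝒮 k) :=
    fun x => by
      rw [mul_assoc, hSk, ← mul_assoc, mul_assoc w, hk, H.kap_inv_central, ← mul_assoc, hw]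
      simp only [mul_assoc]
  have e1 : regRight H k *ᵥ (regLeft H k *ᵥ zeta H (H.gU * w)) = zeta H (H.gU * (w * k * 𝒮 k)) := by
    rw [regLeft_mulVec, regRight_mulVec, hk, H.kap_inv_central]
    simp only [mul_assoc]
  rw [regTwist, twist, Ev_mul (legs_reg H), Ev_mul (legs_reg H), Ev_tmul, ← mulVec_mulVec,
    ← mulVec_mulVec, ← mulVec_mulVec, e1, Ev_reg_mulVec, hp _ hy,
    H.pairEval_g_antipode, H.counit_kap, H.κ_zero, one_smul, Ev_reg_mulVec, hp _ hy, H.R_eq]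
  simp only [map_sum, swapLegs_tmul, pairEval_tmul, mulRight_apply]
  rw [H.sum_rr_g_antipode_rl]
  simp only [mul_assoc]

/-- The scalars of the scalar product on the loop algebra are positive. -/
lemma kapS_div_pos (hm : H.IsModular) (I : ι) :
    0 < kapS H I * (H.κ I)⁻¹ * (H.qdim I)⁻¹ := by
  have := H.finiteDimensional
  obtain ⟨w, hw, hw'⟩ := H.exists_τ_eq I 1
  have hwc : ∀ x, w * x = x * w := fun x => H.ext_τ fun J => by
    by_cases h : J = I
    · subst h; simp [hw]
    · simp [hw' J h]
  have hT := posDef_mul_regTwist H (D := 1) PosDef.one (fun _ => Commute.one_left _)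
    (fun _ => Commute.one_left _)
  rw [Matrix.one_mul] at hT
  have hne : zeta H (H.gU * w) ≠ 0 := fun h => by
    have h1 : (H.gU : G) * w = 0 := zeta_injective H (h.trans (map_zero _).symm)
    have h2 := congrArg (fun x => H.τ I (↑H.gU⁻¹ * x)) h1
    simp only [Units.inv_mul_cancel_left, mul_zero, map_zero, hw] at h2
    exact one_ne_zero (congrFun (congrFun h2 ⟨0, H.δ_pos I⟩) ⟨0, H.δ_pos I⟩ |>.symm.trans
      (by simp) |>.symm)
  have h1 := hT.dotProduct_mulVec_pos hne
  rw [regTwist_mulVec_g H hwc, dot_zeta, sum_eq_single I (fun J _ h => by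
    simp [hw' J h]) (by simp)] at h1
  have h2 : H.τ I (star ((H.gU : G) * w) * (H.v * w * ↑H.kap⁻¹ * 𝒮 ↑H.kap⁻¹))
      = (H.κ I * (kapS H I)⁻¹) • (H.τ I H.grp)ᴴ := by
    simp only [map_mul, star_mul, H.τ_star, hw, H.κ_sq, H.τ_kap_inv, τ_antipode_kap_inv, H.val_gU]
    simp only [conjTranspose_one, Matrix.one_mul, Matrix.mul_one, Matrix.mul_smul, smul_smul]
    congr 1
    field_simp [H.κ_ne_zero I]
  rw [h2, Matrix.trace_smul, Matrix.trace_conjTranspose, smul_eq_mul] at h1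
  change 0 < _ * star (H.qdim I) at h1
  have hq : star (H.qdim I) = H.qdim I := (IsSelfAdjoint.of_nonneg (hm.1 I).le)
  rw [hq] at h1
  obtain ⟨r, hr, h3⟩ := RCLike.pos_iff_exists_ofReal.1 h1
  refine RCLike.pos_iff_exists_ofReal.2 ⟨r⁻¹, inv_pos.2 hr, ?_⟩
  rw [RCLike.ofReal_inv, h3]
  simp only [mul_inv, inv_inv]
  ring

end

/-! ### The representation of the handle algebra in the basis of the `A`-monodromies -/

section

variable (hm : H.IsModular)

/-- A representation of the handle algebra in which the vectors `A^I_{ab}|0⟩` are the standard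
basis. -/
structure IsStandardHandle (π : SemiDirect H 1 0 →ₐ[ℂ] Op H) (Ω : RegIndex H → ℂ) : Prop where
  basis : ∀ (I : ι) (a b : Fin (H.δ I)), π (holS H 1 0 (.A 0) I a b) *ᵥ Ω = zeta H (H.mu I b a)
  vacuum : ∀ (I : ι) (a b : Fin (H.δ I)),
    π (holS H 1 0 (.B 0) I a b) *ᵥ Ω = (if a = b then (H.κ I)⁻¹ else 0) • Ω
  invariant : ∀ ξ : G, π (ofG H 1 0 ξ) *ᵥ Ω = ε ξ • Ω

/-- The homomorphism which describes a holonomy of the handle. -/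
def opHom (π : SemiDirect H 1 0 →ₐ[ℂ] Op H) (h : Hol 1 0) :
    G →ₐ[ℂ] Op H :=
  (π.comp (ofL H 1 0)).comp (holHom H hm 1 0 h)

variable {π : SemiDirect H 1 0 →ₐ[ℂ] Op H} {Ω : RegIndex H → ℂ}

lemma holS_map_eq (h : Hol 1 0) (I : ι) : (holS H 1 0 h I).map π = H.holMat (opHom H hm π h) I := by
  rw [opHom, ← H.holMat_map, ← hol_eq_holMat]; rfl

lemma handle_holHom (I J : ι) :
    exchangeLeft H (H.holMat (holHom H hm 1 0 (.A 0)) I) (H.holMat (holHom H hm 1 0 (.B 0)) J)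
      = handleRight H (H.holMat (holHom H hm 1 0 (.A 0)) I)
        (H.holMat (holHom H hm 1 0 (.B 0)) J) := by
  rw [← hol_eq_holMat, ← hol_eq_holMat]
  exact (isHolFamily_hol H 1 0).handle 0 I J

/-- The matrices of operators on `ℜ`, as an algebra over the graph algebra. -/
def graphScal (π : SemiDirect H 1 0 →ₐ[ℂ] Op H) (I : ι) :
    GraphAlgebra H 1 0 →ₐ[ℂ] Matrix (Fin (H.δ I)) (Fin (H.δ I)) (Op H) :=
  (scal _ _).comp (π.comp (ofL H 1 0))

lemma commute_graphScal (I : ι) (x : G) (z : GraphAlgebra H 1 0) :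
    Commute (numHom (Op H) (H.τ I) x) (graphScal H π I z) :=
  num_commute_scal _ _

lemma scal_mul_apply {n : Type*} [Fintype n] [DecidableEq n]
    (z : A) (Z : Matrix n n A) (a b : n) : (scal A n z * Z) a b = z * Z a b := by
  simp [scal_apply, diagonal_mul]

lemma mul_scal_apply {n : Type*} [Fintype n] [DecidableEq n]
    (z : A) (Z : Matrix n n A) (a b : n) : (Z * scal A n z) a b = Z a b * z := by
  simp [scal_apply, mul_diagonal]

lemma numHom_mul_apply {n : Type*} [Fintype n] [DecidableEq n]
    (ρ : G →ₐ[ℂ] Matrix n n ℂ) (x : G) (Z : Matrix n n A) (a b : n) :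
    (numHom A ρ x * Z) a b = ∑ c, ρ x a c • Z c b := by
  simp [numHom, numAlg_apply, num, Matrix.mul_apply, smul_def]

lemma mul_numHom_apply {n : Type*} [Fintype n] [DecidableEq n]
    (ρ : G →ₐ[ℂ] Matrix n n ℂ) (x : G) (Z : Matrix n n A) (a b : n) :
    (Z * numHom A ρ x) a b = ∑ c, ρ x c b • Z a c := by
  simp [numHom, numAlg_apply, num, Matrix.mul_apply, smul_def, Algebra.commutes]

/-- The projection on the ground state. -/
def ground (π : SemiDirect H 1 0 →ₐ[ℂ] Op H) :
    Op H := opHom H hm π (.B 0) H.e0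

lemma ext_zeta_mu {X Y : Op H}
    (h : ∀ I a b, X *ᵥ zeta H (H.mu I b a) = Y *ᵥ zeta H (H.mu I b a)) : X = Y :=
  Matrix.ext_col fun p => by
    have := h p.1 p.2.1 p.2.2
    rwa [zeta_mu, mulVec_single_one, mulVec_single_one] at this

namespace IsStandardHandle

variable {H} (hπ : IsStandardHandle H π Ω)

lemma vacuum_eq (hπ : IsStandardHandle H π Ω) : Ω = zeta H H.e0 := by
  rw [SymmetryData.e0, ← hπ.basis, holS, Matrix.map_apply, (isHolFamily_hol H 1 0).unit,
    one_apply_eq, map_one, map_one, Matrix.one_mulVec]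

lemma opHom_B_mulVec (hπ : IsStandardHandle H π Ω) (x : G) :
    opHom H hm π (.B 0) x *ᵥ Ω = ε x • Ω := by
  obtain ⟨k, rfl⟩ := (drinfeldEquiv H hm).surjective x
  have h0 : ∀ I a b, opHom H hm π (.B 0) (H.coef I a b H.RR) *ᵥ Ω
      = ε (H.coef I a b H.RR) • Ω := fun I a b => by
    have h1 := hπ.vacuum I a b
    have h2 := congrFun (congrFun (holS_map_eq H hm (π := π) (.B 0) I) a) b
    rw [Matrix.map_apply] at h2
    have h3 := congrFun (congrFun (holMat_triv H (A := ℂ) I) a) b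
    rw [H.holMat_apply, triv_apply, Matrix.smul_apply,
      smul_right_inj (inv_ne_zero (H.κ_ne_zero I)), Algebra.algebraMap_self, RingHom.id_apply,
      Matrix.one_apply] at h3
    rw [h2, H.holMat_apply, smul_mulVec] at h1
    refine (smul_right_inj (inv_ne_zero (H.κ_ne_zero I))).1 (h1.trans ?_)
    rw [h3, smul_smul]
    split_ifs <;> simp
  rw [drinfeldEquiv_apply, H.eq_sum_coef H.RR]
  simp only [map_sum, sum_mulVec, sum_smul]
  refine sum_congr rfl fun I _ => sum_congr rfl fun a _ =>
    sum_congr rfl fun b _ => ?_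
  simp only [legL_tmul, map_smul, smul_mulVec, h0, smul_assoc]

lemma ground_mulVec (hπ : IsStandardHandle H π Ω) : ground H hm π *ᵥ Ω = Ω := by
  rw [ground, hπ.opHom_B_mulVec hm, H.counit_e0, one_smul]

lemma basis_holMat (hπ : IsStandardHandle H π Ω) (I : ι) (a b : Fin (H.δ I)) :
    H.holMat (opHom H hm π (.A 0)) I a b *ᵥ Ω = zeta H (H.mu I b a) := by
  rw [← holS_map_eq, ← hπ.basis]; rfl

lemma opHom_B_eq (hπ : IsStandardHandle H π Ω) : opHom H hm π (.B 0) = regRight H := by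
  refine AlgHom.ext fun x => ext_zeta_mu H fun I a b => ?_
  have h1 := conv_mul_of_handle H (commute_graphScal H (π := π) I) hm
    (handle_holHom H hm) (E := holHom H hm 1 0 (.B 0) H.e0) (fun x => by
      rw [← map_mul, H.mul_e0, map_smul])
  have h2 := congrFun (congrFun (mul_of_invariant _ h1 x) a) b
  have h3 := congrArg (· *ᵥ Ω) h2
  rw [numHom_mul_apply] at h3
  have e1 : ∀ c, (H.hv (numHom (Op H) (H.τ I)) ((graphScal H π I).comp (holHom H hm 1 0 (.A 0)))
      * graphScal H π I (holHom H hm 1 0 (.B 0) H.e0)) c b *ᵥ Ω = zeta H (H.mu I b c) :=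
    fun c => by
      rw [← hπ.basis_holMat hm]
      refine (congrArg (· *ᵥ Ω) (mul_scal_apply _ _ c b)).trans ?_
      rw [← mulVec_mulVec]
      congr 1
      exact hπ.ground_mulVec hm
  have e2 := (congrArg (· *ᵥ Ω) (scal_mul_apply (opHom H hm π (.B 0) x) _ a b)).symm.trans h3
  simp only [← mulVec_mulVec, sum_mulVec, smul_mulVec, e1] at e2
  rw [regRight_mulVec]
  refine e2.trans ?_
  rw [SymmetryData.mu_mul]
  simp

lemma ground_mulVec_zeta (hπ : IsStandardHandle H π Ω) (y : G) :
    ground H hm π *ᵥ zeta H y = ε y • Ω := by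
  rw [ground, hπ.opHom_B_eq hm, regRight_mulVec, H.antipode_e0, H.mul_e0, map_smul, ← hπ.vacuum_eq]

lemma symmetry_mul_ground (hπ : IsStandardHandle H π Ω) (x : G) :
    π (ofG H 1 0 x) * ground H hm π = ε x • ground H hm π := by
  refine ext_zeta H fun y => ?_
  rw [← mulVec_mulVec, smul_mulVec, hπ.ground_mulVec_zeta hm, mulVec_smul, hπ.invariant, smul_comm]

/-- The symmetry acts by the product of the left and right regular representations. -/
lemma symmetry_eq (hm : H.IsModular) (hπ : IsStandardHandle H π Ω) :
    π.comp (ofG H 1 0) = conv (regRight H) (regLeft H) (legs_reg H) := by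
  refine AlgHom.ext fun x => ext_zeta_mu H fun I a b => ?_
  set a' := numHom (Op H) (H.τ I) with ha'
  set j' := (scal (Op H) (Fin (H.δ I))).comp (π.comp (ofG H 1 0))
    with hj'
  set X := H.holMat (opHom H hm π (.A 0)) I with hX
  set E := scal (Op H) (Fin (H.δ I)) (ground H hm π) with hE
  have haj : Legs a' j' := legs_numHom_scal _ _
  have h1 : ∀ y, conv a' j' haj y * (X * E) = X * (a' y * E) := fun y => by
    have c : conv a' j' haj y * X = X * conv a' j' haj y :=
      handle_cross H hm (.A 0) π I y
    rw [← mul_assoc, c, mul_assoc, conv_apply, Ev_mul_of_invariant (fun x => ?_),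
      ← conv_apply (Legs.triv_right a'), conv_triv_right]
    rw [hj', hE, comp_apply, ← map_mul, ← map_smul]
    exact congrArg _ (hπ.symmetry_mul_ground hm x)
  have hv : ∀ c d, X c d *ᵥ Ω = zeta H (H.mu I d c) := hπ.basis_holMat hm I
  have h2 : ∀ z : G ⊗[ℂ] G, (mul' ℂ _ (map (a'.toLinearMap ∘ₗ
      𝒮) (conv a' j' haj).toLinearMap z) * (X * E)) a b *ᵥ Ω
      = Ev (regRight H) (regLeft H) z *ᵥ zeta H (H.mu I b a) := by
    intro z
    induction z with
    | tmul p q =>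
      rw [map_tmul, mul'_apply, toLinearMap_apply, mul_assoc, h1,
        Ev_tmul, ← mulVec_mulVec, regLeft_mulVec, regRight_mulVec, H.mul_mu,
        sum_mul]
      refine (congrArg (· *ᵥ Ω) (numHom_mul_apply (H.τ I) (𝒮 p) _ a b)).trans ?_
      refine (sum_mulVec _ _ _).trans ?_
      have e1 : ∀ c, (X * (a' q * E)) c b *ᵥ Ω = ∑ d, H.τ I q d b • zeta H (H.mu I d c) :=
        fun c => by
          rw [← mul_assoc, hE, mul_scal_apply, ← mulVec_mulVec, hπ.ground_mulVec,
            ha', mul_numHom_apply, sum_mulVec]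
          simp only [smul_mulVec, hv]
      simp only [smul_mulVec, e1, smul_mul_assoc, H.mu_mul, map_sum, map_smul, smul_sum]
      rw [sum_comm]
      exact sum_congr rfl fun _ _ => sum_congr rfl fun _ _ => smul_comm _ _ _
    | _ => simp_all [add_mul, Matrix.add_apply, add_mulVec]
  have h3 := h2 (Δ x)
  rw [sum_antipode_mul_conv, hj', comp_apply, scal_mul_apply, hE, mul_scal_apply,
    ← mulVec_mulVec, ← mulVec_mulVec, hπ.ground_mulVec, hv] at h3
  rw [conv_apply]
  exact h3

lemma regLeft_mul_ground (hπ : IsStandardHandle H π Ω) (x : G) :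
    regLeft H x * ground H hm π = ε x • ground H hm π := by
  refine ext_zeta H fun y => ?_
  rw [← mulVec_mulVec, smul_mulVec, hπ.ground_mulVec_zeta hm, mulVec_smul,
    hπ.vacuum_eq, regLeft_mulVec, H.mul_e0, map_smul, smul_comm]

lemma ground_mul_symmetry (hm : H.IsModular) (hπ : IsStandardHandle H π Ω) (x : G) :
    ground H hm π * π (ofG H 1 0 x) = ε x • ground H hm π := by
  have h0 : ground H hm π = regRight H H.e0 := by rw [ground, hπ.opHom_B_eq hm]
  have h1 : ∀ y, ground H hm π * regRight H y = ε y • ground H hm π := fun y => by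
    rw [h0, ← map_mul, H.e0_mul, map_smul]
  have h2 : ground H hm π * regLeft H x = regLeft H x * ground H hm π := by
    rw [h0]; exact legs_reg H _ _
  change _ * (π.comp (ofG H 1 0)) x = _
  rw [hπ.symmetry_eq hm, conv_apply, mul_Ev_of_invariant h1, ← conv_apply (Legs.triv_left _),
    conv_triv_left, h2, hπ.regLeft_mul_ground hm]

end IsStandardHandle

end

/-! ### Matrix elements with the ground state -/

section

section

variable {a lam rho : G →ₐ[ℂ] A} {N : A}

lemma mul_eq_antipodeInv [FiniteDimensional ℂ G] (hal : Legs a lam)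
    (hN : ∀ x, N * conv a lam hal x = ε x • N) (x : G) :
    N * lam x = N * a (H.antipodeInv x) :=
  RibbonHopfStar.mul_eq_of_invariant hal hN H.antipodeInv H.antipode_antipodeInv
    H.antipodeInv_antipode x

lemma mul_Ri_of_invariant [FiniteDimensional ℂ G] (hal : Legs a lam)
    (hN : ∀ x, N * conv a lam hal x = ε x • N) :
    N * H.Ri a lam = N * a (↑H.v⁻¹ * H.gU) := by
  rw [H.Ri_eq_sum, ← H.sum_antipodeInv_mul_antipode, map_sum, mul_sum, mul_sum]
  refine sum_congr rfl fun i _ => ?_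
  rw [(hal _ _).eq, ← mul_assoc, mul_eq_antipodeInv H hal hN, map_mul, mul_assoc]

/-- The action of the conjugated holonomy on the ground state. -/
lemma mul_Ri_conv_kap [FiniteDimensional ℂ G] (hal : Legs a lam) (har : Legs a rho)
    (hlr : Legs lam rho)
    (hN : ∀ x, N * conv a lam hal x = ε x • N) :
    N * H.Ri a (conv lam rho hlr) * conv lam rho hlr (H.kap : G)
      = N * a (↑H.v⁻¹ * H.gU) * (Ev lam rho (twist H) * (lam H.kap * rho H.kap)) := by
  have hac := Legs.conv_right hal har (hc := hlr)
  have hcr := Legs.conv_left har hlr (hc := hal)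
  have h1 : H.Ru hlr * H.Ru hac = H.Ru hal * H.Ru hcr := by
    refine Units.ext ?_
    simp only [val_mul, RibbonHopfStar.val_Ru]
    rw [H.Rv_conv_right hal har hlr, H.Rv_conv_left hal har hlr, ← mul_assoc, ← mul_assoc,
      H.yang_baxter hal har hlr]
  have h2 : (H.Ru hac)⁻¹ = (H.Ru hcr)⁻¹ * ((H.Ru hal)⁻¹ * H.Ru hlr) := by
    rw [eq_comm, ← mul_eq_one_iff_eq_inv, mul_assoc, mul_assoc, h1, inv_mul_cancel_left,
      inv_mul_cancel]
  have h3 : N * H.Ri (conv a lam hal) rho = N := by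
    rw [RibbonHopfStar.Ri, mul_Ev_of_invariant hN]
    exact (congrArg (N * ·) (H.Ri_triv_left rho)).trans (mul_one N)
  have h4 : N * H.Ri a (conv lam rho hlr) = N * H.Ri a lam * H.Rv lam rho := by
    have := congrArg (fun u : Aˣ => N * (u : A)) h2
    simp only [val_mul, RibbonHopfStar.val_inv_Ru, RibbonHopfStar.val_Ru] at this
    rw [this, ← mul_assoc, h3, mul_assoc]
  have h5 : H.Rv lam rho * conv lam rho hlr H.kap
      = Ev lam rho (twist H) * (lam H.kap * rho H.kap) := by
    rw [← val_tU H hlr, tU, ← val_kU, ← val_kU, ← val_kU, ← RibbonHopfStar.val_Ru _ hlr,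
      ← val_mul, ← val_mul, ← val_mul]
    have c : kU H lam * kU H rho = kU H rho * kU H lam := Units.ext (hlr _ _)
    rw [c]
    congr 1
    group
  rw [h4, mul_Ri_of_invariant H hal hN, mul_assoc, h5]

end

variable (hm : H.IsModular)
variable {π : SemiDirect H 1 0 →ₐ[ℂ] Op H} {Ω : RegIndex H → ℂ}

lemma trace_g_inv (hm : H.IsModular) [FiniteDimensional ℂ G] (I : ι) :
    (H.τ I ↑H.gU⁻¹).trace = H.qdim I := by
  rw [← H.star_gU, H.τ_star, Matrix.trace_conjTranspose, H.val_gU]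
  exact IsSelfAdjoint.of_nonneg (hm.1 I).le


namespace IsStandardHandle

variable {H}

section

variable {I : ι} {Y : 𝕄[H, I, Op H]}

lemma ground_inverse_conv (hm : H.IsModular)
    (hπ : IsStandardHandle H π Ω) (hXY : H.holMat (opHom H hm π (.A 0)) I * Y = 1)
    (hYX : Y * H.holMat (opHom H hm π (.A 0)) I = 1) (x : G) :
    scal (Op H) (Fin (H.δ I)) (ground H hm π) * Y
        * conv (numHom (Op H) (H.τ I)) ((scal (Op H) (Fin (H.δ I))).comp (regRight H)) (legs_numHom_scal _ _) x
      = ε x • (scal (Op H) (Fin (H.δ I)) (ground H hm π) * Y) := by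
  have h1 := mul_conv_of_handle H (a := numHom (Op H) (H.τ I)) (θ := graphScal H π I)
    (φ := holHom H hm 1 0 (.A 0)) (ψ := holHom H hm 1 0 (.B 0))
    (commute_graphScal H (π := π) I) hm
    (handle_holHom H hm) (E := holHom H hm 1 0 (.B 0) H.e0) (fun x => by
      rw [← map_mul, H.e0_mul, map_smul]) hXY hYX x
  have h2 : (scal (Op H) (Fin (H.δ I))).comp (regRight H)
      = (graphScal H π I).comp (holHom H hm 1 0 (.B 0)) := by
    rw [← hπ.opHom_B_eq hm]; rfl
  simp only [h2]
  exact h1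

lemma ground_inverse_mulVec [FiniteDimensional ℂ G] (hm : H.IsModular)
    (hπ : IsStandardHandle H π Ω) (hXY : H.holMat (opHom H hm π (.A 0)) I * Y = 1)
    (hYX : Y * H.holMat (opHom H hm π (.A 0)) I = 1) (a b : Fin (H.δ I)) (q : RegIndex H) :
    (scal (Op H) (Fin (H.δ I)) (ground H hm π) * Y * numHom (Op H) (H.τ I) H.gU) b a *ᵥ Pi.single q 1
      = (if (⟨I, (a, b)⟩ : RegIndex H) = q then (H.qdim I)⁻¹ else 0) • Ω := by
  obtain ⟨J, c, d⟩ := q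
  set N := scal (Op H) (Fin (H.δ I)) (ground H hm π) * Y with hN
  set N' := N * numHom (Op H) (H.τ I) (H.gU : G) with hN'
  have hinv := mul_eq_antipodeInv H _ (hπ.ground_inverse_conv hm hXY hYX)
  have h1 : ∀ x, N' * scal (Op H) (Fin (H.δ I)) (regRight H x)
      = N' * numHom (Op H) (H.τ I) (𝒮 x) := fun x => by
    have c := (num_commute_scal (H.τ I (H.gU : G)) (regRight H x)).eq
    change numHom (Op H) (H.τ I) (H.gU : G) * _ = _ * numHom (Op H) (H.τ I) (H.gU : G) at c
    rw [hN', mul_assoc, c, ← mul_assoc]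
    refine (congrArg (· * _) (hinv x)).trans ?_
    rw [mul_assoc, ← map_mul, H.antipodeInv_mul_g, map_mul, ← mul_assoc]
  have h2 : ∀ (J : ι) (b d : Fin _) (r : RegIndex H) (y : G),
      H.τ J y * Matrix.of (fun c a => (N' b a *ᵥ zeta H (H.mu J d c)) r)
        = Matrix.of (fun c a => (N' b a *ᵥ zeta H (H.mu J d c)) r) * H.τ I y := by
    intro J b d r y
    obtain ⟨x, rfl⟩ := H.antipode_surjective y
    ext c a
    have h3 := congrArg (· *ᵥ zeta H (H.mu J d c)) (congrFun (congrFun (h1 x) b) a)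
    simp only [mul_scal_apply, mul_numHom_apply, ← mulVec_mulVec, regRight_mulVec, H.mu_mul,
      map_sum, map_smul, mulVec_sum, mulVec_smul, sum_mulVec,
      smul_mulVec] at h3
    have h4 := congrFun h3 r
    simp only [Finset.sum_apply, Pi.smul_apply, smul_eq_mul] at h4
    rw [Matrix.mul_apply, Matrix.mul_apply]
    simp only [of_apply]
    rw [h4]
    exact sum_congr rfl fun _ _ => mul_comm _ _
  rw [← zeta_mu]
  by_cases hJ : I = J
  · subst hJ
    choose f hf using fun b d r => H.schur_self (h2 I b d r)
    have hf' : ∀ b a d c r, (N' b a *ᵥ zeta H (H.mu I d c)) r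
        = f b d r * (1 : 𝕄[H, I, ℂ]) c a := fun b a d c r =>
      congrFun (congrFun (hf b d r) c) a
    have h5 : N' * (numHom (Op H) (H.τ I) ↑H.gU⁻¹ * H.holMat (opHom H hm π (.A 0)) I)
        = scal (Op H) (Fin (H.δ I)) (ground H hm π) := by
      rw [hN', ← mul_assoc, mul_assoc N, ← map_mul, Units.mul_inv, map_one, mul_one, hN, mul_assoc,
        hYX, mul_one]
    have h6 : ∀ r, f b d r = (if b = d then (H.qdim I)⁻¹ else 0) * Ω r := fun r => by
      have h7 := congrFun (congrArg (· *ᵥ Ω) (congrFun (congrFun h5 b) d)) r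
      simp only [Matrix.mul_apply (M := N'), numHom_mul_apply, sum_mulVec, ← mulVec_mulVec,
        smul_mulVec, hπ.basis_holMat, mulVec_sum, mulVec_smul,
        Finset.sum_apply, Pi.smul_apply, hf', smul_eq_mul] at h7
      have h8 : ∑ x, ∑ y, H.τ I ↑H.gU⁻¹ x y * (f b d r * (1 : 𝕄[H, I, ℂ]) y x)
          = H.qdim I * f b d r := by
        rw [← trace_g_inv H hm, Matrix.trace, sum_mul]
        refine sum_congr rfl fun x _ => ?_
        rw [sum_eq_single x (fun y _ h => by rw [Matrix.one_apply_ne h]; ring) (by simp),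
          one_apply_eq, mul_one, Matrix.diag_apply]
      rw [h8] at h7
      have hq := (hm.1 I).ne'
      have h9 : (scal (Op H) (Fin (H.δ I)) (ground H hm π) b d
          *ᵥ Ω) r = (if b = d then 1 else 0) * Ω r := by
        rw [scal_apply, diagonal_apply]
        split_ifs
        · rw [hπ.ground_mulVec, one_mul]
        · simp
      rw [h9] at h7
      split_ifs at h7 ⊢
      · field_simp; rw [mul_comm, h7, one_mul]
      · rw [zero_mul] at h7 ⊢
        exact (mul_eq_zero.1 h7).resolve_left hq
    ext r
    rw [hf', h6, Pi.smul_apply, smul_eq_mul, Matrix.one_apply]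
    by_cases e1 : b = d <;> by_cases e2 : c = a <;>
      simp [e1, e2, Ne.symm, eq_comm]
  · rw [if_neg (fun e => hJ (congrArg Sigma.fst e)), zero_smul]
    ext r
    exact congrFun (congrFun (H.schur_ne (Ne.symm hJ) (h2 J b d r)) c) a

end

end IsStandardHandle

end

/-! ### The loop algebra and its integral -/

section

lemma isHolFamily_loop (φ : G →ₐ[ℂ] A) :
    IsHolFamily H 0 1 fun _ => H.holMat φ where
  unit _ := H.holMat_unit φ
  functoriality _ := H.holMat_functoriality φ
  handle i := i.elim0
  exchange h k hk := by
    cases hk with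
    | MM ν μ h => exact absurd h (by simp [Subsingleton.elim ν μ])
    | MA _ j => exact j.elim0
    | MB _ j => exact j.elim0
    | AA i => exact i.elim0
    | BB i => exact i.elim0
    | AB i => exact i.elim0
    | BA i => exact i.elim0

variable {H}

lemma loop_induction {p : SemiDirect H 0 1 → Prop} (add : ∀ x y, p x → p y → p (x + y))
    (mul : ∀ I a b ξ, p (holS H 0 1 (.M 0) I a b * ofG H 0 1 ξ)) (x : SemiDirect H 0 1) : p x := by
  have h1 : x ∈ LinearMap.range (ofL H 0 1).toLinearMap * LinearMap.range (ofG H 0 1).toLinearMap :=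
    range_ofL_mul_range_ofG (H := H) ▸ mem_top
  refine mul_induction_on h1 ?_ add
  rintro _ ⟨y, rfl⟩ _ ⟨ξ, rfl⟩
  have h2 : y ∈ entrySpan H (hol H 0 1 (.M 0)) := by
    have h3 := list_prod_entrySpan_hol H 0 1
    have h4 : holList 0 1 = [.M 0] := by simp [holList, List.finRange_succ]
    rw [h4, List.map_singleton, List.prod_singleton] at h3
    exact h3 ▸ mem_top
  induction h2 using span_induction generalizing ξ with
  | mem y hy =>
    obtain ⟨q, rfl⟩ := hy
    exact mul _ _ _ _
  | zero =>
    have h5 := mul H.zero ⟨0, H.δ_pos _⟩ ⟨0, H.δ_pos _⟩ 0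
    rw [map_zero, mul_zero] at h5
    rw [map_zero, zero_mul]
    exact h5
  | add y z _ _ hy hz =>
    rw [map_add, add_mul]
    exact add _ _ (hy ξ) (hz ξ)
  | smul c y _ hy =>
    have := hy (c • ξ)
    rwa [map_smul, mul_smul_comm, ← smul_mul_assoc, ← map_smul] at this

/-- The homomorphism from the loop algebra with symmetry to the operators on `ℜ`, which takes the
loop to the `A`-monodromy. -/
def loopSemi (hm : H.IsModular) (π : SemiDirect H 1 0 →ₐ[ℂ] Op H) : SemiDirect H 0 1 →ₐ[ℂ] Op H :=
  semiLift (isHolFamily_loop H (opHom H hm π (.A 0))).lift (π.comp (ofG H 1 0)) fun h J ξ => by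
    rw [IsHolFamily.hol_map_lift]
    exact handle_cross H hm (.A 0) π J ξ

variable (hm : H.IsModular)
variable {π : SemiDirect H 1 0 →ₐ[ℂ] Op H} {Ω : RegIndex H → ℂ}

lemma loopSemi_ofG (ξ : G) : loopSemi hm π (ofG H 0 1 ξ) = π (ofG H 1 0 ξ) :=
  semiLift_ofG _ _ _ _

lemma holS_map_loopSemi (h : Hol 0 1) (I : ι) : (holS H 0 1 h I).map (loopSemi hm π)
    = H.holMat (opHom H hm π (.A 0)) I := by
  rw [← IsHolFamily.hol_map_lift (isHolFamily_loop H (opHom H hm π (.A 0))) h I]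
  ext1 a b
  exact semiLift_ofL _ _ _ _

lemma counit_mu (I : ι) (a b : Fin (H.δ I)) :
    ε (H.mu I b a) = if I = H.zero then 1 else 0 := by
  refine H.smul_one_inj (I := H.zero) ?_
  rw [← H.τ_zero]
  by_cases h : I = H.zero
  · subst h
    have : ∀ c : Fin (H.δ H.zero), c = a := fun c =>
      Fin.ext (by have := c.2; have := a.2; have := H.δ_zero; omega)
    rw [H.τ_mu_self, if_pos rfl, one_smul]
    ext c d
    rw [this b, this c, this d]; simp
  · rw [H.τ_mu_of_ne (Ne.symm h), if_neg h, zero_smul]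

namespace IsStandardHandle

variable (hπ : IsStandardHandle H π Ω) {st : SemiDirect H 0 1 → SemiDirect H 0 1}
  {ω : SemiDirect H 0 1 →ₗ[ℂ] ℂ}

lemma loop_mulVec (hπ : IsStandardHandle H π Ω) (h : Hol 0 1) (I : ι) (a b : Fin (H.δ I)) :
    loopSemi hm π (holS H 0 1 h I a b) *ᵥ Ω = zeta H (H.mu I b a) := by
  rw [← hπ.basis_holMat hm, ← holS_map_loopSemi hm h]; rfl

lemma loop_mul_mulVec (hπ : IsStandardHandle H π Ω) (x : SemiDirect H 0 1) (ξ : G) :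
    loopSemi hm π (x * ofG H 0 1 ξ) *ᵥ Ω = ε ξ • (loopSemi hm π x *ᵥ Ω) := by
  rw [map_mul, ← mulVec_mulVec, loopSemi_ofG, hπ.invariant, mulVec_smul]

lemma ground_mulVec_loop (hπ : IsStandardHandle H π Ω) (I : ι) (a b : Fin (H.δ I)) (ξ : G) :
    ground H hm π *ᵥ (loopSemi hm π (holS H 0 1 (.M 0) I a b * ofG H 0 1 ξ) *ᵥ Ω)
      = (if I = H.zero then ε ξ else 0) • Ω := by
  rw [hπ.loop_mul_mulVec, hπ.loop_mulVec, mulVec_smul, hπ.ground_mulVec_zeta, counit_mu, smul_smul]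
  split_ifs <;> simp

lemma integral_smul (hπ : IsStandardHandle H π Ω) (hω : IsLoopIntegral H ω) (x : SemiDirect H 0 1) :
    ω x • Ω = ground H hm π *ᵥ (loopSemi hm π x *ᵥ Ω) := by
  induction x using loop_induction with
  | add x y hx hy =>
    rw [map_add, map_add, add_smul, add_mulVec, Matrix.mulVec_add, hx, hy]
  | mul I a b ξ => rw [hω, hπ.ground_mulVec_loop]

lemma vacuum_ne_zero (hπ : IsStandardHandle H π Ω) : Ω ≠ 0 := fun h => by
  have h1 := congrArg ε
    (zeta_injective H ((hπ.vacuum_eq.symm.trans h).trans (map_zero (zeta H)).symm))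
  rw [H.counit_e0, map_zero] at h1
  exact one_ne_zero h1

lemma exists_isLoopIntegral (hm : H.IsModular)
    (hπ : IsStandardHandle H π Ω) : ∃ ω, IsLoopIntegral H ω := by
  obtain ⟨p, hp⟩ := ne_iff.1 hπ.vacuum_ne_zero
  refine ⟨(Ω p)⁻¹ • proj p ∘ₗ (ground H hm π).mulVecLin
    ∘ₗ (Matrix.mulVecBilin ℂ ℂ).flip Ω ∘ₗ (loopSemi hm π).toLinearMap, fun I a b ξ => ?_⟩
  change (Ω p)⁻¹ • (ground H hm π *ᵥ (loopSemi hm π _ *ᵥ Ω)) p = _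
  rw [hπ.ground_mulVec_loop, Pi.smul_apply, smul_eq_mul, smul_eq_mul, mul_comm,
    mul_inv_cancel_right₀ hp]

lemma integral_mul (hm : H.IsModular) (hπ : IsStandardHandle H π Ω) (hω : IsLoopIntegral H ω)
    (x : SemiDirect H 0 1) (ξ : G) :
    ω (x * ofG H 0 1 ξ) = ε ξ * ω x := by
  refine smul_left_injective ℂ hπ.vacuum_ne_zero ?_
  change _ • Ω = _ • Ω
  rw [hπ.integral_smul hm hω, hπ.loop_mul_mulVec, mulVec_smul, mul_smul, hπ.integral_smul hm hω]

lemma mul_integral (hm : H.IsModular) (hπ : IsStandardHandle H π Ω) (hω : IsLoopIntegral H ω)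
    (x : SemiDirect H 0 1) (ξ : G) :
    ω (ofG H 0 1 ξ * x) = ε ξ * ω x := by
  refine smul_left_injective ℂ hπ.vacuum_ne_zero ?_
  change _ • Ω = _ • Ω
  rw [hπ.integral_smul hm hω, map_mul, ← mulVec_mulVec, loopSemi_ofG, mulVec_mulVec,
    hπ.ground_mul_symmetry hm, smul_mulVec, mul_smul, hπ.integral_smul hm hω]

/-- The scalars of the scalar product. -/
def _root_.GraphAlg.gramScalar (H : SymmetryData G ι) : Op H :=
  Matrix.diagonal fun p : RegIndex H => kapS H p.1 * (H.κ p.1)⁻¹ * (H.qdim p.1)⁻¹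

lemma kap_mulVec (q : RegIndex H) : (regRight H (H.kap : G) * regLeft H (H.kap : G))
    *ᵥ Pi.single q 1 = (kapS H q.1 * H.κ q.1) • Pi.single q 1 := by
  obtain ⟨I, a, b⟩ := q
  rw [← zeta_mu, ← mulVec_mulVec, regLeft_mulVec, regRight_mulVec, ← map_smul]
  refine congrArg (zeta H) (H.ext_τ fun J => ?_)
  simp only [map_mul, map_smul, H.τ_kap, τ_antipode_kap]
  by_cases h : J = I
  · subst h; simp
  · simp [H.τ_mu_of_ne h]

lemma gram_apply (hm : H.IsModular) (hπ : IsStandardHandle H π Ω) (hst : IsGraphStar H 0 1 st)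
    (hω : IsLoopIntegral H ω) (p q : RegIndex H) :
    ω (st (holS H 0 1 (.M 0) p.1 p.2.1 p.2.2) * holS H 0 1 (.M 0) q.1 q.2.1 q.2.2)
      = (gramScalar H * regTwist H) p q := by
  have := H.finiteDimensional
  obtain ⟨I, a, b⟩ := p
  refine smul_left_injective ℂ hπ.vacuum_ne_zero ?_
  change _ • Ω = _ • Ω
  rw [hπ.integral_smul hm hω, map_mul, ← mulVec_mulVec, hπ.loop_mulVec, zeta_mu, mulVec_mulVec]
  obtain ⟨-, -, h1⟩ := (isGraphStar_iff H st).1 hst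
  have h2 := (h1 (.M 0) I).map H (σB := fun _ => ((hat st (holS H 0 1 (.M 0) I)).map
    (loopSemi hm π))) (loopSemi hm π).mapMatrix rfl
  rw [numHom_map, scal_map] at h2
  obtain ⟨Y, hXY, hYX, h3⟩ := h2
  have hX : (loopSemi hm π).mapMatrix (holS H 0 1 (.M 0) I)
      = H.holMat (opHom H hm π (.A 0)) I := holS_map_loopSemi hm (.M 0) I
  rw [hX] at hXY hYX
  have hj : (loopSemi hm π).comp (ofG H 0 1) = conv (regRight H) (regLeft H) (legs_reg H) :=
    (AlgHom.ext fun x => loopSemi_ofG hm x).trans (hπ.symmetry_eq hm)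
  set E := scal (Op H) (Fin (H.δ I)) (ground H hm π) with hE
  set a' := numHom (Op H) (H.τ I) with ha'
  have hEj : ∀ x, E * (scal (Op H) (Fin (H.δ I))).comp ((loopSemi hm π).comp (ofG H 0 1)) x
      = ε x • E := fun x => by
    rw [comp_apply, hE, ← map_mul, ← map_smul]
    refine congrArg _ ?_
    rw [comp_apply, loopSemi_ofG]
    exact hπ.ground_mul_symmetry hm x
  have h4 := congrArg (E * ·) h3
  have hkinv : ε ((H.kap⁻¹ : Gˣ) : G) = 1 := by
    refine H.smul_one_inj (I := H.zero) ?_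
    rw [← H.τ_zero, H.τ_kap_inv, H.κ_zero, inv_one]
  have hER : E * H.Rv a' ((scal (Op H) (Fin (H.δ I))).comp ((loopSemi hm π).comp (ofG H 0 1)))
      = E := by
    have := mul_Ev_of_invariant (b := a') hEj (swapLegs G H.R)
    rw [Ev_swap (legs_numHom_scal _ _).symm, Ev_swap (Legs.triv_left _)] at this
    exact this.trans ((congrArg (E * ·) (H.Rv_triv_right a')).trans (mul_one E))
  simp only [← mul_assoc] at h4
  rw [hEj, hkinv, one_smul, hER, hj, map_conv, mul_Ri_conv_kap H
    (legs_numHom_scal _ _) (legs_numHom_scal _ _) _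
    (hπ.ground_inverse_conv hm hXY hYX)] at h4
  have hv : a' (((H.v⁻¹ : Gˣ) : G) * H.gU) = ((H.κ I)⁻¹ * (H.κ I)⁻¹) • a' (H.gU : G) := by
    have : (H.v⁻¹ : Gˣ) = H.kap⁻¹ * H.kap⁻¹ := by
      rw [← mul_inv_rev, inv_inj]
      exact Units.ext (by rw [val_mul, ← sq, H.kap_sq])
    rw [this, ha', numHom, comp_apply, comp_apply, val_mul, map_mul, map_mul,
      map_mul (H.τ I), H.τ_kap_inv, smul_mul_smul_comm, one_mul, map_smul, map_one, smul_mul_assoc,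
      one_mul]
  have hW : Ev ((scal (Op H) (Fin (H.δ I))).comp (regRight H))
      ((scal (Op H) (Fin (H.δ I))).comp (regLeft H)) (twist H)
        * ((scal (Op H) (Fin (H.δ I))).comp (regRight H) H.kap
          * (scal (Op H) (Fin (H.δ I))).comp (regLeft H) H.kap)
      = scal (Op H) (Fin (H.δ I)) (regRight H H.kap * regLeft H H.kap * regTwist H) := by
    have c : Commute (regRight H H.kap * regLeft H H.kap) (regTwist H) :=
      (kU_commute_Ev H (legs_reg H) _).mul_left (kU_commute_Ev' H (legs_reg H) _)
    rw [c.eq, map_mul, map_mul, regTwist, map_Ev]; rfl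
  rw [hv, hW, mul_smul_comm, smul_mul_assoc] at h4
  have h5 := congrArg (· *ᵥ (Pi.single q 1 : RegIndex H → ℂ)) (congrFun (congrFun h4 b) a)
  simp only [Matrix.smul_apply, mul_scal_apply, hE, scal_mul_apply] at h5
  refine h5.trans ?_
  rw [smul_mulVec, ← mulVec_mulVec, ← mulVec_mulVec, mulVec_single_one]
  have h6 : ∀ w : RegIndex H → ℂ, (scal (Op H) (Fin (H.δ I)) (ground H hm π) * Y
      * a' (H.gU : G)) b a *ᵥ ((regRight H (H.kap : G) * regLeft H (H.kap : G)) *ᵥ w)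
      = (kapS H I * H.κ I * (H.qdim I)⁻¹ * w ⟨I, (a, b)⟩) • Ω := fun w => by
    have hw : w = ∑ r, w r • (Pi.single r 1 : RegIndex H → ℂ) := by
      ext r; simp [Finset.sum_apply, Pi.single_apply]
    conv_lhs => rw [hw]
    simp only [mulVec_sum, mulVec_smul, kap_mulVec, hπ.ground_inverse_mulVec hm hXY hYX, ha']
    rw [sum_eq_single (⟨I, (a, b)⟩ : RegIndex H)]
    · rw [if_pos rfl, smul_smul, smul_smul]
      congr 1
      ring
    · intro r _ hr
      rw [if_neg (Ne.symm hr)]; simp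
    · simp
  rw [h6, gramScalar, diagonal_mul, smul_smul, Matrix.col_apply]
  congr 1
  field_simp [H.κ_ne_zero I]

end IsStandardHandle

end

/-! ### The scalar product on `ℜ` -/

section

lemma gramScalar_posDef (hm : H.IsModular) : (gramScalar H).PosDef :=
  PosDef.diagonal fun p => kapS_div_pos H hm p.1

lemma gramScalar_mulVec (I : ι) (a b : Fin (H.δ I)) : gramScalar H *ᵥ zeta H (H.mu I b a)
    = (kapS H I * (H.κ I)⁻¹ * (H.qdim I)⁻¹) • zeta H (H.mu I b a) := by
  rw [zeta_mu, gramScalar, Matrix.diagonal_mulVec_single, mul_one, ← Pi.single_smul, smul_eq_mul,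
    mul_one]

lemma gramScalar_commute_regRight (x : G) : Commute (gramScalar H) (regRight H x) := by
  refine ext_zeta_mu H fun I a b => ?_
  rw [← mulVec_mulVec, ← mulVec_mulVec, gramScalar_mulVec, mulVec_smul, regRight_mulVec, H.mu_mul]
  simp only [map_sum, map_smul, mulVec_sum, mulVec_smul, gramScalar_mulVec, smul_sum]
  exact sum_congr rfl fun _ _ => smul_comm _ _ _

lemma gramScalar_commute_regLeft (x : G) : Commute (gramScalar H) (regLeft H x) := by
  refine ext_zeta_mu H fun I a b => ?_
  rw [← mulVec_mulVec, ← mulVec_mulVec, gramScalar_mulVec, mulVec_smul, regLeft_mulVec, H.mul_mu]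
  simp only [map_sum, map_smul, mulVec_sum, mulVec_smul, gramScalar_mulVec, smul_sum]
  exact sum_congr rfl fun _ _ => smul_comm _ _ _

/-- The Gram matrix of the vectors `A^I_{ab}|0⟩`. -/
def gram : Op H := gramScalar H * regTwist H

lemma gram_posDef (hm : H.IsModular) : (gram H).PosDef :=
  posDef_mul_regTwist H (gramScalar_posDef H hm) (gramScalar_commute_regRight H)
    (gramScalar_commute_regLeft H)

lemma adj_gram : adj (gram H) = fun x => (((tU H (legs_reg H))⁻¹ : (Op H)ˣ) : Op H)
    * adj (gramScalar H) x * tU H (legs_reg H) := by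
  funext x
  rw [adj, adj, gram, regTwist, ← val_tU H (legs_reg H), Matrix.mul_inv_rev, Matrix.coe_units_inv]
  simp only [Matrix.mul_assoc]

lemma isStarHom_regRight (hm : H.IsModular) :
    IsStarHom (adj (gramScalar H)) (regRight H) := fun x => by
  refine (eq_adj (gramScalar_posDef H hm) ?_).symm
  rw [conjTranspose_regRight]
  exact gramScalar_commute_regRight H _

lemma isStarHom_regLeft (hm : H.IsModular) :
    IsStarHom (adj (gramScalar H)) (regLeft H) := fun x => by
  refine (eq_adj (gramScalar_posDef H hm) ?_).symm
  rw [conjTranspose_regLeft]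
  exact gramScalar_commute_regLeft H _

lemma isStarHom_gram (hm : H.IsModular) :
    IsStarHom (adj (gram H)) (conv (regRight H) (regLeft H) (legs_reg H)) := by
  rw [adj_gram]
  exact isStarHom_conv H (legs_reg H) (isStarOp_adj (gramScalar_posDef H hm))
    (isStarHom_regRight H hm) (isStarHom_regLeft H hm)

lemma starWord_conv_holMat {σ : A → A} (hσ : IsStarOp σ)
    {f h : G →ₐ[ℂ] A} (hc : Legs f h) (hf : IsStarHom σ f) (I : ι) :
    StarWord H (hat fun x => ↑(tU H hc)⁻¹ * σ x * tU H hc) (numHom A (H.τ I))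
      ((scal A (Fin (H.δ I))).comp (conv f h hc)) (H.holMat f I) := by
  have hA : Legs (numHom A (H.τ I)) ((scal A (Fin (H.δ I))).comp h) := legs_numHom_scal _ _
  have hF : Legs (numHom A (H.τ I)) ((scal A (Fin (H.δ I))).comp f) := legs_numHom_scal _ _
  have hS : Legs ((scal A (Fin (H.δ I))).comp f) ((scal A (Fin (H.δ I))).comp h) :=
    hc.map (scal A (Fin (H.δ I)))
  have h1 : StarWord H (hat σ) (numHom A (H.τ I)) ((scal A (Fin (H.δ I))).comp f) (H.holMat f I) :=
    starWord_hv H hσ.hat (isStarHom_numHom H hσ I) (hf.scal hσ) hF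
  have c1 : ∀ x, Commute (H.holMat f I) ((scal A (Fin (H.δ I))).comp h x) := fun x =>
    (H.hv_commute (fun y => (hA y x).symm) fun y => (hS y x).symm).symm
  have c2 : ∀ x, Commute (H.holMat f I) (conv (numHom A (H.τ I))
      ((scal A (Fin (H.δ I))).comp f) hF x) := fun x => (commute_muMat_holMat H f I x).symm
  have h2 := StarWord.first H hS hF hA h1 c1 c2
  rw [tU_map] at h2
  rw [hat_twisted, map_conv]
  exact h2

lemma starWord_gram (hm : H.IsModular) (I : ι) :
    StarWord H (hat (adj (gram H))) (numHom (Op H) (H.τ I))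
      ((scal (Op H) (Fin (H.δ I))).comp (conv (regRight H) (regLeft H) (legs_reg H)))
      (H.holMat (regRight H) I) := by
  rw [adj_gram]
  exact starWord_conv_holMat H (isStarOp_adj (gramScalar_posDef H hm)) (legs_reg H)
    (isStarHom_regRight H hm) I

variable {H}
variable {π : SemiDirect H 1 0 →ₐ[ℂ] Op H} {Ω : RegIndex H → ℂ}
  {st : SemiDirect H 0 1 → SemiDirect H 0 1} {ω : SemiDirect H 0 1 →ₗ[ℂ] ℂ}

namespace IsStandardHandle

lemma form_eq (hm : H.IsModular) (hπ : IsStandardHandle H π Ω)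
    (hst : IsGraphStar H 0 1 st) (hω : IsLoopIntegral H ω) (x y : SemiDirect H 0 1) :
    star (loopSemi hm π x *ᵥ Ω) ⬝ᵥ (gram H *ᵥ (loopSemi hm π y *ᵥ Ω)) = ω (st x * y) := by
  induction x using loop_induction with
  | add x x' hx hx' =>
    rw [hst.add, add_mul, map_add, map_add, add_mulVec, star_add, add_dotProduct, hx, hx']
  | mul I a b ξ =>
    induction y using loop_induction with
    | add y y' hy hy' =>
      rw [mul_add, map_add, map_add, add_mulVec, Matrix.mulVec_add, dotProduct_add, hy, hy']
    | mul J c d η =>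
      rw [hπ.loop_mul_mulVec, hπ.loop_mul_mulVec, hst.mul, hst.onG, ← mul_assoc,
        hπ.integral_mul hm hω, mul_assoc, hπ.mul_integral hm hω, counit_star H,
        mulVec_smul, star_smul, smul_dotProduct, dotProduct_smul, hπ.loop_mulVec,
        hπ.loop_mulVec, zeta_mu, zeta_mu]
      have h1 := hπ.gram_apply hm hst hω ⟨I, (a, b)⟩ ⟨J, (c, d)⟩
      rw [h1, ← Pi.single_star, star_one, single_one_dotProduct, mulVec_single_one,
        smul_eq_mul, smul_eq_mul, mul_left_comm]
      rfl

lemma adj_loop (hm : H.IsModular) (hπ : IsStandardHandle H π Ω)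
    (hst : IsGraphStar H 0 1 st) (hω : IsLoopIntegral H ω) (x : SemiDirect H 0 1) :
    adj (gram H) (loopSemi hm π x) = loopSemi hm π (st x) := by
  refine (eq_adj (gram_posDef H hm) ?_).symm
  have h1 : ∀ y z : SemiDirect H 0 1, star (loopSemi hm π y *ᵥ Ω) ⬝ᵥ
        ((gram H * loopSemi hm π (st x)) *ᵥ (loopSemi hm π z *ᵥ Ω))
      = star (loopSemi hm π y *ᵥ Ω) ⬝ᵥ
        (((loopSemi hm π x)ᴴ * gram H) *ᵥ (loopSemi hm π z *ᵥ Ω)) := fun y z => by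
    have e : ∀ u w : SemiDirect H 0 1, loopSemi hm π u *ᵥ (loopSemi hm π w *ᵥ Ω)
        = loopSemi hm π (u * w) *ᵥ Ω := fun u w => by rw [map_mul, mulVec_mulVec]
    rw [← mulVec_mulVec, ← mulVec_mulVec, Matrix.dotProduct_mulVec _ (_)ᴴ,
      ← Matrix.star_mulVec, e, e, hπ.form_eq hm hst hω, hπ.form_eq hm hst hω, hst.mul,
      mul_assoc]
  ext p q
  have h2 := h1 (holS H 0 1 (.M 0) p.1 p.2.1 p.2.2) (holS H 0 1 (.M 0) q.1 q.2.1 q.2.2)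
  simp only [hπ.loop_mulVec, zeta_mu] at h2
  rw [← Pi.single_star, star_one, single_one_dotProduct, single_one_dotProduct,
    mulVec_single_one, mulVec_single_one] at h2
  exact h2

lemma isGoodForm (hm : H.IsModular) (hπ : IsStandardHandle H π Ω)
    (hst : IsGraphStar H 0 1 st) (hω : IsLoopIntegral H ω) : IsGoodForm H π (gram H) where
  posDef := gram_posDef H hm
  onG := hπ.symmetry_eq hm ▸ isStarHom_gram H hm
  onHol h I := by
    have h0 := holS_map_eq H hm (π := π) h I
    cases h with
    | M ν => exact ν.elim0
    | A i =>
      obtain rfl : i = 0 := Subsingleton.elim _ _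
      have h1 := (((isGraphStar_iff H st).1 hst).2.2 (.M 0) I).map_matrix H
        (σB := adj (gram H)) (loopSemi hm π) fun a b => hπ.adj_loop hm hst hω _
      rw [holS_map_loopSemi] at h1
      rw [h0]
      have h2 : (loopSemi hm π).comp (ofG H 0 1) = π.comp (ofG H 1 0) :=
        AlgHom.ext fun x => loopSemi_ofG hm x
      exact h2 ▸ h1
    | B i =>
      obtain rfl : i = 0 := Subsingleton.elim _ _
      rw [h0, hπ.opHom_B_eq hm, hπ.symmetry_eq hm]
      exact starWord_gram H hm I

end IsStandardHandle

end

/-! ### Change of basis in the handle representation -/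

section

/-- Conjugation with a unit. -/
def conjAlg (U : Aˣ) : A →ₐ[ℂ] A :=
  ofLinearMap (mulRight ℂ ↑U⁻¹ ∘ₗ mulLeft ℂ (U : A)) (by simp)
    fun x y => by simp [mul_assoc]

lemma conjAlg_apply (U : Aˣ) (x : A) :
    conjAlg U x = U * x * ↑U⁻¹ := rfl

variable {π : SemiDirect H 1 0 →ₐ[ℂ] Op H} {Ω : RegIndex H → ℂ}

lemma conjAlg_inv_comp (U : (Op H)ˣ) : (conjAlg U).comp ((conjAlg U⁻¹).comp π) = π := by
  refine AlgHom.ext fun x => ?_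
  rw [comp_apply, comp_apply, conjAlg_apply, conjAlg_apply]
  simp [mul_assoc]

lemma IsGoodForm.conj {Γ : Op H} (h : IsGoodForm H π Γ) (U : (Op H)ˣ) :
    IsGoodForm H ((conjAlg U).comp π)
      ((((U⁻¹ : (Op H)ˣ) : Op H))ᴴ * Γ * ((U⁻¹ : (Op H)ˣ) : Op H)) := by
  have hP : ((((U⁻¹ : (Op H)ˣ) : Op H))ᴴ * Γ * ((U⁻¹ : (Op H)ˣ) : Op H)).PosDef :=
    (Matrix.IsUnit.posDef_star_left_conjugate_iff (U⁻¹).isUnit).2 h.posDef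
  have hadj : ∀ Y, adj ((((U⁻¹ : (Op H)ˣ) : Op H))ᴴ * Γ * ((U⁻¹ : (Op H)ˣ) : Op H)) (conjAlg U Y)
      = conjAlg U (adj Γ Y) := fun Y => by
    refine (eq_adj hP ?_).symm
    have h1 : ((U : Op H))ᴴ * (((U⁻¹ : (Op H)ˣ) : Op H))ᴴ = 1 := by
      rw [← conjTranspose_mul, inv_mul, conjTranspose_one]
    rw [conjAlg_apply, conjAlg_apply, conjTranspose_mul, conjTranspose_mul]
    calc _ = (((U⁻¹ : (Op H)ˣ) : Op H))ᴴ * Γ * (((U⁻¹ : (Op H)ˣ) : Op H) * U) * adj Γ Y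
            * ((U⁻¹ : (Op H)ˣ) : Op H) := by simp only [mul_assoc]
      _ = (((U⁻¹ : (Op H)ˣ) : Op H))ᴴ * (Γ * adj Γ Y) * ((U⁻¹ : (Op H)ˣ) : Op H) := by
        rw [inv_mul, mul_one, mul_assoc _ Γ]
      _ = (((U⁻¹ : (Op H)ˣ) : Op H))ᴴ * Yᴴ * 1 * Γ * ((U⁻¹ : (Op H)ˣ) : Op H) := by
        rw [mul_adj h.posDef, mul_one, mul_assoc _ Yᴴ]
      _ = _ := by rw [← h1]; simp only [mul_assoc]
  refine ⟨hP, fun x => ?_, fun k I => ?_⟩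
  · rw [comp_apply, comp_apply, hadj]
    exact congrArg _ (h.onG x)
  · have := (h.onHol k I).map_matrix H (σB := adj ((((U⁻¹ : (Op H)ˣ) : Op H))ᴴ * Γ
      * ((U⁻¹ : (Op H)ˣ) : Op H))) (conjAlg U) fun a b => hadj _
    rw [Matrix.map_map] at this
    exact this

variable {H}

namespace IsHandleRep

lemma mem_span (hπ : IsHandleRep H π Ω) (w : RegIndex H → ℂ) :
    w ∈ Submodule.span ℂ (Set.range fun p : RegIndex H =>
      π (holS H 1 0 (.A 0) p.1 p.2.1 p.2.2) *ᵥ Ω) := by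
  obtain ⟨x, rfl⟩ := hπ.cyclic w
  have hx : x ∈ entrySpan H (hol H 1 0 (.A 0)) * entrySpan H (hol H 1 0 (.B 0)) := by
    have h3 := list_prod_entrySpan_hol H 1 0
    have h4 : holList 1 0 = [.A 0, .B 0] := by simp [holList, List.finRange_succ]
    rw [h4, map_cons, List.map_singleton, prod_cons, List.prod_singleton] at h3
    exact h3 ▸ mem_top
  refine mul_induction_on hx (fun y hy z hz => ?_) fun y z hy hz => ?_
  · have hz' : ∃ c : ℂ, π (ofL H 1 0 z) *ᵥ Ω = c • Ω := by
      induction hz using span_induction with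
      | mem z hz =>
        obtain ⟨q, rfl⟩ := hz
        exact ⟨_, hπ.vacuum q.1 q.2.1 q.2.2⟩
      | zero => exact ⟨0, by simp⟩
      | add z z' _ _ h h' =>
        obtain ⟨c, hc⟩ := h
        obtain ⟨c', hc'⟩ := h'
        exact ⟨c + c', by rw [map_add, map_add, add_mulVec, hc, hc', add_smul]⟩
      | smul a z _ h =>
        obtain ⟨c, hc⟩ := h
        exact ⟨a * c, by rw [map_smul, map_smul, smul_mulVec, hc, smul_smul]⟩
    obtain ⟨c, hc⟩ := hz'
    rw [map_mul, map_mul, ← mulVec_mulVec, hc, mulVec_smul]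
    refine smul_mem _ c ?_
    clear hx
    induction hy using span_induction with
    | mem y hy =>
      obtain ⟨q, rfl⟩ := hy
      exact subset_span ⟨q, rfl⟩
    | zero => simp
    | add y y' _ _ h h' =>
      rw [map_add, map_add, add_mulVec]
      exact Submodule.add_mem _ h h'
    | smul a y _ h =>
      rw [map_smul, map_smul, smul_mulVec]
      exact smul_mem _ a h
  · rw [map_add, map_add, add_mulVec]
    exact Submodule.add_mem _ hy hz

/-- Every representation of the handle algebra with a ground state has the vectors
`A^I_{ab}|0⟩` as a basis. -/
lemma exists_standard (hπ : IsHandleRep H π Ω) : ∃ U : (Op H)ˣ,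
    (∀ p : RegIndex H, (U : Op H) *ᵥ Pi.single p 1 = π (holS H 1 0 (.A 0) p.1 p.2.1 p.2.2) *ᵥ Ω) ∧
    IsStandardHandle H ((conjAlg U⁻¹).comp π) (↑U⁻¹ *ᵥ Ω) := by
  let P : Op H := Matrix.of fun r p => (π (holS H 1 0 (.A 0) p.1 p.2.1 p.2.2) *ᵥ Ω) r
  have hP : ∀ p : RegIndex H, P *ᵥ Pi.single p 1
      = π (holS H 1 0 (.A 0) p.1 p.2.1 p.2.2) *ᵥ Ω := fun p => by
    rw [mulVec_single_one]; rfl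
  have hs : Surjective P.mulVec := fun w => by
    have := hπ.mem_span w
    have hle : Submodule.span ℂ (Set.range fun p : RegIndex H =>
        π (holS H 1 0 (.A 0) p.1 p.2.1 p.2.2) *ᵥ Ω) ≤ LinearMap.range P.mulVecLin :=
      span_le.2 (by rintro _ ⟨p, rfl⟩; exact ⟨_, hP p⟩)
    exact hle this
  obtain ⟨U, hU⟩ := Matrix.mulVec_surjective_iff_isUnit.1 hs
  have hv : ∀ x, ((conjAlg U⁻¹).comp π) x *ᵥ (↑U⁻¹ *ᵥ Ω) = ↑U⁻¹ *ᵥ (π x *ᵥ Ω) := fun x => by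
    rw [comp_apply, conjAlg_apply, inv_inv, mulVec_mulVec, mul_assoc, mul_assoc,
      Units.mul_inv, mul_one, mulVec_mulVec]
  refine ⟨U, fun p => hU ▸ hP p, ⟨fun I a b => ?_, fun I a b => ?_, fun x => ?_⟩⟩
  · have h1 := hP ⟨I, (a, b)⟩
    rw [← hU] at h1
    rw [hv, ← h1, mulVec_mulVec, inv_mul, Matrix.one_mulVec, zeta_mu]
  · rw [hv, hπ.vacuum, mulVec_smul]
  · rw [hv, hπ.invariant, mulVec_smul]

lemma exists_form (hm : H.IsModular) (hπ : IsHandleRep H π Ω)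
    {st : SemiDirect H 0 1 → SemiDirect H 0 1} (hst : IsGraphStar H 0 1 st)
    {ω : SemiDirect H 0 1 →ₗ[ℂ] ℂ} (hω : IsLoopIntegral H ω) :
    ∃ Q, IsHandleForm H st ω π Ω Q ∧ (∀ Q', IsHandleForm H st ω π Ω Q' → Q' = Q)
      ∧ IsGoodForm H π Q := by
  obtain ⟨U, hU, hS⟩ := hπ.exists_standard
  have key : ∀ Q, IsHandleForm H st ω π Ω Q ↔ (U : Op H)ᴴ * Q * U = gram H := fun Q => by
    have h1 : ∀ p q : RegIndex H, star (π (holS H 1 0 (.A 0) p.1 p.2.1 p.2.2) *ᵥ Ω) ⬝ᵥ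
        (Q *ᵥ (π (holS H 1 0 (.A 0) q.1 q.2.1 q.2.2) *ᵥ Ω)) = ((U : Op H)ᴴ * Q * U) p q :=
      fun p q => by
        rw [← hU, ← hU, Matrix.star_mulVec, ← Matrix.dotProduct_mulVec, mulVec_mulVec,
          mulVec_mulVec, ← Pi.single_star, star_one, single_one_dotProduct,
          mulVec_single_one, Matrix.col_apply, mul_assoc]
    constructor
    · intro h
      ext p q
      rw [← h1, gram, ← hS.gram_apply hm hst hω]
      exact h p.1 q.1 p.2.1 p.2.2 q.2.1 q.2.2
    · intro h I J a b c d
      refine (h1 ⟨I, (a, b)⟩ ⟨J, (c, d)⟩).trans ?_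
      rw [h, gram, ← hS.gram_apply hm hst hω]
  have hc1 : ((U : Op H))ᴴ * (((U⁻¹ : (Op H)ˣ) : Op H))ᴴ = 1 := by
    rw [← conjTranspose_mul, inv_mul, conjTranspose_one]
  have hc2 : (((U⁻¹ : (Op H)ˣ) : Op H))ᴴ * ((U : Op H))ᴴ = 1 := by
    rw [← conjTranspose_mul, Units.mul_inv, conjTranspose_one]
  refine ⟨(((U⁻¹ : (Op H)ˣ) : Op H))ᴴ * gram H * ((U⁻¹ : (Op H)ˣ) : Op H), (key _).2 ?_,
    fun Q' hQ' => ?_, ?_⟩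
  · rw [← mul_assoc, ← mul_assoc, hc1, one_mul, mul_assoc, inv_mul, mul_one]
  · rw [← (key Q').1 hQ', ← mul_assoc, ← mul_assoc, hc2, one_mul, mul_assoc, Units.mul_inv, mul_one]
  · have := (hS.isGoodForm hm hst hω).conj H U
    rwa [conjAlg_inv_comp] at this

end IsHandleRep

lemma IsLoopIntegral.unique {ω ω' : SemiDirect H 0 1 →ₗ[ℂ] ℂ} (h : IsLoopIntegral H ω)
    (h' : IsLoopIntegral H ω') : ω = ω' := by
  ext x
  induction x using loop_induction with
  | add x y hx hy => rw [map_add, map_add, hx, hy]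
  | mul I a b ξ => rw [h, h']

lemma exists_isLoopIntegral (hm : H.IsModular) :
    ∃ ω, IsLoopIntegral H ω := by
  obtain ⟨π, Ω, hπ⟩ := exists_isHandleRep H hm
  obtain ⟨U, -, hS⟩ := hπ.exists_standard
  exact hS.exists_isLoopIntegral hm

end

end GraphAlg

theorem mainTheorem12 {G : Type*} [Ring G] [HopfAlgebra ℂ G] [StarRing G] [StarModule ℂ G]
    {ι : Type} [Fintype ι] [DecidableEq ι] (H : GraphAlg.SymmetryData G ι)
    (hd : ∀ I, 0 < H.qdim I) (hs : IsUnit H.s) :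
    (∀ g m, ∃! st, GraphAlg.IsGraphStar H g m st) ∧
    (∃! ω, GraphAlg.IsLoopIntegral H ω) ∧
    (∃ π Ω, GraphAlg.IsHandleRep H π Ω) ∧
    ∀ (st : ∀ g m, GraphAlg.SemiDirect H g m → GraphAlg.SemiDirect H g m)
      (_ : ∀ g m, GraphAlg.IsGraphStar H g m (st g m))
      (ω : GraphAlg.SemiDirect H 0 1 →ₗ[ℂ] ℂ) (_ : GraphAlg.IsLoopIntegral H ω)
      (π : GraphAlg.SemiDirect H 1 0 →ₐ[ℂ]
        Matrix (GraphAlg.RegIndex H) (GraphAlg.RegIndex H) ℂ)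
      (Ω : GraphAlg.RegIndex H → ℂ) (_ : GraphAlg.IsHandleRep H π Ω),
      ∃ Q : Matrix (GraphAlg.RegIndex H) (GraphAlg.RegIndex H) ℂ,
        GraphAlg.IsHandleForm H (st 0 1) ω π Ω Q ∧
        (∀ Q', GraphAlg.IsHandleForm H (st 0 1) ω π Ω Q' → Q' = Q) ∧
        Q.PosDef ∧
        ∀ g m : ℕ,
          ∃ Λ : ∀ lab : Fin m → ι,
              GraphAlg.GraphAlgebra H g m →ₐ[ℂ] GraphAlg.SpaceMat H g lab,
            (∀ lab h J,
              (GraphAlg.hol H g m h J).map (Λ lab) = GraphAlg.holOp H lab π J h) ∧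
            (∀ lab, (GraphAlg.spaceGram H (g := g) lab π Q).PosDef ∧
              ∃ Λ' : GraphAlg.SemiDirect H g m →ₐ[ℂ] GraphAlg.SpaceMat H g lab,
                (∀ x, Λ' (GraphAlg.ofL H g m x) = Λ lab x) ∧
                (∀ ξ, Λ' (GraphAlg.ofG H g m ξ) = GraphAlg.totalRep H lab π ξ) ∧
                ∀ X, GraphAlg.spaceGram H lab π Q * Λ' (st g m X)
                  = (Λ' X)ᴴ * GraphAlg.spaceGram H lab π Q) ∧
            (∀ x, (∀ lab, Λ lab x = 0) → x = 0) ∧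
            ∀ lab, GraphAlg.IsIrreducibleRep (Λ lab) := by
  have hm : H.IsModular := ⟨hd, hs⟩
  have hsurj : ∀ π : GraphAlg.SemiDirect H 1 0 →ₐ[ℂ] GraphAlg.Op H,
      Function.Surjective (π.comp (GraphAlg.ofL H 1 0)) := fun π =>
    GraphAlg.handle_surjective H hm _
  have hrep := GraphAlg.exists_isHandleRep H hm
  have hint := GraphAlg.exists_isLoopIntegral (H := H) hm
  refine ⟨fun g m => ?_, ?_, hrep, ?_⟩
  · obtain ⟨π, Ω, hπ⟩ := hrep
    obtain ⟨ω, hω⟩ := hint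
    obtain ⟨st₀, hst₀⟩ := GraphAlg.exists_isGraphStar (g := 0) (m := 1) (Q := 0) H hm (hsurj π)
      fun i => i.elim0
    obtain ⟨Q, -, -, hQ⟩ := hπ.exists_form hm hst₀ hω
    obtain ⟨st, hst⟩ := GraphAlg.exists_isGraphStar (g := g) (m := m) H hm (hsurj π)
      fun _ => hQ
    exact ⟨st, hst, fun st' hst' => GraphAlg.isGraphStar_unique H hst' hst⟩
  · obtain ⟨ω, hω⟩ := hint
    exact ⟨ω, hω, fun ω' hω' => hω'.unique hω⟩
  · intro st hst ω hω π Ω hπ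
    obtain ⟨Q, hQ, huniq, hgood⟩ := hπ.exists_form hm (hst 0 1) hω
    refine ⟨Q, hQ, huniq, hgood.posDef, fun g m =>
      ⟨fun lab => (GraphAlg.spaceFamily H lab π hm).lift, fun lab h J => ?_, fun lab =>
        ⟨GraphAlg.spaceGram_posDef H lab hm fun _ => hgood,
          (GraphAlg.spaceFamily H lab π hm).semi, fun x => ?_, fun ξ => ?_, fun X => ?_⟩,
        GraphAlg.faithful H hm (hsurj π), fun lab => ?_⟩⟩
    · rw [GraphAlg.TensorFamily.hol_map_lift, GraphAlg.spaceFamily_mat]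
    · exact GraphAlg.TensorFamily.semi_ofL _ x
    · rw [GraphAlg.TensorFamily.semi_ofG, GraphAlg.totalRep,
        ← GraphAlg.spaceFamily_jay H lab π hm _ (GraphAlg.nodup_allFactors g m)]
      rfl
    · exact GraphAlg.spaceFamily_semi_star H hm (fun _ => hgood) lab (hst g m) X
    · have : Nonempty (GraphAlg.SpaceIndex H g lab) := ⟨fun k => match k with
        | .inl ν => (⟨0, H.δ_pos (lab ν)⟩ : Fin (H.δ (lab ν)))
        | .inr _ => (⟨H.zero, ⟨0, H.δ_pos _⟩, ⟨0, H.δ_pos _⟩⟩ : GraphAlg.RegIndex H)⟩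
      exact GraphAlg.isIrreducibleRep_of_surjective
        (GraphAlg.spaceFamily_lift_surjective H hm (hsurj π) lab)
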